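/- Fix a Littlewood–Paley couple $(\chi,\varphi)$ on $\mathbb R^3$: smooth, $[0,1]$-valued, $\operatorname{supp}\chi\subset\{|\xi|\le 4/3\}$, $\operatorname{supp}\varphi\subset\{3/4\le|\xi|\le 8/3\}$, $\chi(\xi)+\sum_{j\ge0}\varphi(2^{-j}\xi)=1$. Put $\Delta_{-1}=\chi(D)$, $\Delta_j=\varphi(2^{-j}D)$ for $j\ge 0$, $S_j=\chi(2^{-j}D)$, with $D=-i\nabla$, and $$\|w\|_{H^s}=\Big(\sum_{j\ge-1}2^{2js}\|\Delta_jw\|_{L^2}^2\Big)^{1/2},\qquad \|w\|_{LL}=\sup_{q\in\mathbb N,\;q\ge2}\frac{\|\nabla S_qw\|_{L^\infty}}{q+1}.$$ Let $s_1\in[-\tfrac12,1)$ and $s\in(s_1,1)$. There is a constant $C>0$, depending only on $s_1$, $s$ and $(\chi,\varphi)$, such that the following holds for all $T>0$ and $\lambda>C$. Let $u\in L^1([0,T];\mathcal S'(\mathbb R^3))$ be a real vector field, and let $v\in L^\infty([0,T];H^{-1/2}(\mathbb R^3))$ be, with some pressure $p\in L^1([0,T];\mathcal S'(\mathbb R^3))$,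 a weak solution on $[0,T]\times\mathbb R^3$ of $$\partial_tv+u\cdot\nabla v-\Delta_hv+\nabla p=f+g\,e_3,\qquad \operatorname{div}v=\operatorname{div}u=0,\qquad v(0)=v_0,$$ where $\Delta_h=\partial_1^2+\partial_2^2$, the data satisfy $v_0\in H^s$, $f\in L^1([0,T];H^s)$, $g\in L^2([0,T];H^{s-1})$, and the equation is understood integrated in time and tested against Schwartz functions, with $u\cdot\nabla v=\lim_{j\to\infty}S_ju\cdot\nabla S_jv$ in $\mathcal S'$ for a.e. time and $u\cdot\nabla v\in L^1([0,T];\mathcal S')$. (Here $w\in L^1([0,T];\mathcal S')$ means that $\langle w(\cdot),\psi\rangle\in L^1([0,T])$ for every Schwartz function $\psi$.) Assume that $\|u(t)\|_{LL}\le h(t)$ for a.e. $t\in[0,T]$, for some nonnegative $h\in L^1([0,T])$, and let $s_t=s-\lambda\int_0^th(\tau)\,d\tau$. Then for every $t\in[0,T]$ with $s_t\ge s_1$, with $\nabla_h=(\partial_1,\partial_2)$, $$\|v(t)\|_{H^{s_t}}+\Big(\int_0^t\|\nabla_hv(\tau)\|_{H^{s_\tau}}^2d\tau\Big)^{1/2}\le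 C(1+\sqrt t)\exp\Big(\frac C\lambda\int_0^th(\tau)\,d\tau\Big)\Big(\|v_0\|_{H^s}+\|f\|_{L^1([0,t];H^s)}+\|g\|_{L^2([0,t];H^{s-1})}\Big).$$ -/

import Mathlib

open MeasureTheory Filter Topology
open scoped SchwartzMap FourierTransform LineDeriv ENNReal ContDiff

noncomputable section

namespace LosingEstimate

/-- The physical space `ℝ³`; the indices `0, 1` are the horizontal directions and `2` is the
vertical one. -/
abbrev Space := EuclideanSpace ℝ (Fin 3)

/-- The `k`-th vector of the canonical basis of `ℝ³`. -/
def e (k : Fin 3) : Space := EuclideanSpace.single k 1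

/-! ### Littlewood-Paley decomposition -/

/-- A couple `(χ, φ)` of smooth functions with values in `[0,1]`, with `χ` supported in the ball
`|ξ| ≤ 4/3`, `φ` supported in the shell `3/4 ≤ |ξ| ≤ 8/3`, and
`χ(ξ) + ∑_{j ≥ 0} φ(2⁻ʲ ξ) = 1` for all `ξ`. -/
structure LittlewoodPaley where
  /-- the low-frequency profile -/
  chi : Space → ℝ
  /-- the profile of the dyadic shells -/
  phi : Space → ℝ
  chi_smooth : ContDiff ℝ ∞ chi
  phi_smooth : ContDiff ℝ ∞ phi
  chi_mem : ∀ ξ, chi ξ ∈ Set.Icc (0 : ℝ) 1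
  phi_mem : ∀ ξ, phi ξ ∈ Set.Icc (0 : ℝ) 1
  chi_supp : ∀ ξ, chi ξ ≠ 0 → ‖ξ‖ ≤ 4 / 3
  phi_supp : ∀ ξ, phi ξ ≠ 0 → 3 / 4 ≤ ‖ξ‖ ∧ ‖ξ‖ ≤ 8 / 3
  sum_eq_one : ∀ ξ, HasSum (fun j : ℕ => phi (((2 : ℝ) ^ j)⁻¹ • ξ)) (1 - chi ξ)

/-- A continuous function on `ℝ³` vanishing for `|ξ| > R` has compact support. -/
theorem hasCompactSupport_of_bound {m : Space → ℝ} {R : ℝ} (h : ∀ ξ, m ξ ≠ 0 → ‖ξ‖ ≤ R) :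
    HasCompactSupport m := by
  refine HasCompactSupport.intro (isCompact_closedBall (0 : Space) R) ?_
  intro x hx
  by_contra hne
  exact hx (by simpa using h x hne)

/-- The function `ξ ↦ m(2⁻ʲ · 2πξ) e^{2πi⟨x,ξ⟩}`. The factor `2π` accounts for the
normalization `e^{-2πi⟨x,ξ⟩}` of the Fourier transform in Mathlib, so that `m(2⁻ʲ D)`, with
`D = -i∇`, has symbol `m(2⁻ʲ · 2πξ)`. -/
def modulated (m : Space → ℝ) (j : ℕ) (x ξ : Space) : ℂ :=
  (m ((2 * Real.pi / (2 : ℝ) ^ j) • ξ) : ℂ) *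
    Complex.exp (((2 * Real.pi * inner ℝ x ξ : ℝ) : ℂ) * Complex.I)

theorem modulated_smooth {m : Space → ℝ} (hm : ContDiff ℝ ∞ m) (j : ℕ) (x : Space) :
    ContDiff ℝ ∞ (modulated m j x) := by
  have h1 : ContDiff ℝ ∞ fun ξ : Space => (m ((2 * Real.pi / (2 : ℝ) ^ j) • ξ) : ℂ) :=
    Complex.ofRealCLM.contDiff.comp (hm.comp (contDiff_const_smul _))
  have h2 : ContDiff ℝ ∞ fun ξ : Space => ((2 * Real.pi * inner ℝ x ξ : ℝ) : ℂ) :=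
    Complex.ofRealCLM.contDiff.comp (contDiff_const.mul (contDiff_const.inner ℝ contDiff_id))
  exact h1.mul ((h2.mul contDiff_const).cexp)

theorem modulated_hasCompactSupport {m : Space → ℝ} {R : ℝ} (h : ∀ ξ, m ξ ≠ 0 → ‖ξ‖ ≤ R)
    (j : ℕ) (x : Space) : HasCompactSupport (modulated m j x) := by
  have hc : (2 * Real.pi / (2 : ℝ) ^ j) ≠ 0 := by positivity
  have h1 : HasCompactSupport fun ξ : Space => m ((2 * Real.pi / (2 : ℝ) ^ j) • ξ) :=
    (hasCompactSupport_of_bound h).comp_smul hc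
  have h2 : HasCompactSupport fun ξ : Space => (m ((2 * Real.pi / (2 : ℝ) ^ j) • ξ) : ℂ) :=
    h1.comp_left (g := fun r : ℝ => (r : ℂ)) (by simp)
  exact h2.mul_right

/-- The low-frequency cut-off `S_j T = χ(2⁻ʲ D) T` of a tempered distribution, as the function
`x ↦ ⟨𝓕 T, χ(2⁻ʲ · 2πξ) e^{2πi⟨x,ξ⟩}⟩`. -/
def lowPass (P : LittlewoodPaley) (j : ℕ) (T : 𝓢'(Space, ℂ)) (x : Space) : ℂ :=
  (𝓕 T) ((modulated_hasCompactSupport P.chi_supp j x).toSchwartzMap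
    (modulated_smooth P.chi_smooth j x))

/-- The block `φ(2⁻ʲ D) T` of a tempered distribution, as a function, for `j ≥ 0`. -/
def shell (P : LittlewoodPaley) (j : ℕ) (T : 𝓢'(Space, ℂ)) (x : Space) : ℂ :=
  (𝓕 T) ((modulated_hasCompactSupport (fun ξ hξ => (P.phi_supp ξ hξ).2) j x).toSchwartzMap
    (modulated_smooth P.phi_smooth j x))

/-- The dyadic blocks, with the index shifted by one: `block P n T` is `Δ_{n-1} T`, that is
`Δ_{-1} T = χ(D) T` for `n = 0`, and `Δ_j T = φ(2⁻ʲ D) T` for `n = j + 1`. -/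
def block (P : LittlewoodPaley) : ℕ → 𝓢'(Space, ℂ) → Space → ℂ
  | 0, T => lowPass P 0 T
  | j + 1, T => shell P j T

/-- The norm of `H^s = B^s_{2,2}` of a family `w` of tempered distributions (a scalar, a vector
field, a matrix field): `(∑_{j ≥ -1} 2^{2js} ‖Δ_j w‖²_{L²})^{1/2}`, with `j = n - 1`. -/
def sobolevNorm (P : LittlewoodPaley) (s : ℝ) {ι : Type*} [Fintype ι]
    (w : ι → 𝓢'(Space, ℂ)) : ℝ≥0∞ :=
  (∑' n : ℕ, ENNReal.ofReal ((2 : ℝ) ^ (2 * s * ((n : ℝ) - 1))) *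
    ∑ i, eLpNorm (block P n (w i)) 2 volume ^ 2) ^ (1 / 2 : ℝ)

/-- The LogLip quantity `‖w‖_{LL} = sup_{q ≥ 2} ‖∇ S_q w‖_{L^∞} / (q + 1)` of a vector field. -/
def llNorm (P : LittlewoodPaley) (w : Fin 3 → 𝓢'(Space, ℂ)) : ℝ≥0∞ :=
  ⨆ (q : ℕ) (_ : 2 ≤ q), (⨆ (k : Fin 3) (i : Fin 3),
    eLpNorm (lowPass P q (∂_{e k} (w i))) ⊤ volume) / ((q : ℝ≥0∞) + 1)

/-! ### Operators on distributions -/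

/-- The divergence of a vector field. -/
def divergence (w : Fin 3 → 𝓢'(Space, ℂ)) : 𝓢'(Space, ℂ) := ∑ k, ∂_{e k} (w k)

/-- The horizontal Laplacian `Δ_h = ∂₁² + ∂₂²`. -/
def horizontalLaplacian (w : 𝓢'(Space, ℂ)) : 𝓢'(Space, ℂ) :=
  ∂_{e 0} (∂_{e 0} w) + ∂_{e 1} (∂_{e 1} w)

/-- The horizontal gradient `∇_h w = (∂₁ w, ∂₂ w)` of a vector field, as a matrix field. -/
def horizontalGradient (w : Fin 3 → 𝓢'(Space, ℂ)) : Fin 2 × Fin 3 → 𝓢'(Space, ℂ) :=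
  fun ki => ∂_{e (Fin.castLE (by decide) ki.1)} (w ki.2)

/-- A tempered distribution is real if it takes real values on real test functions. -/
def IsRealDistribution (T : 𝓢'(Space, ℂ)) : Prop :=
  ∀ ψ : 𝓢(Space, ℂ), (∀ x, (ψ x).im = 0) → (T ψ).im = 0

/-- `N = w · ∇ a`, where the products `w_k ∂_k a` of distributions are understood, as usual, as
limits in the sense of tempered distributions of the products `S_j w_k S_j ∂_k a` of smooth
functions. -/
def IsConvection (P : LittlewoodPaley) (w : Fin 3 → 𝓢'(Space, ℂ)) (a N : 𝓢'(Space, ℂ)) : Prop :=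
  ∀ ψ : 𝓢(Space, ℂ), Tendsto
    (fun j : ℕ => ∫ x, (∑ k, lowPass P j (w k) x * lowPass P j (∂_{e k} a) x) * ψ x)
    atTop (𝓝 (N ψ))

/-- `τ ↦ w τ` is integrable on `[0,T]` with values in tempered distributions. -/
def WeaklyIntegrable (T : ℝ) (w : ℝ → 𝓢'(Space, ℂ)) : Prop :=
  ∀ ψ : 𝓢(Space, ℂ), IntegrableOn (fun τ => w τ ψ) (Set.Icc 0 T) volume

/-! ### The system -/

/-- `v`, with pressure `p`, is a weak solution on `[0,T]` of
`∂_t v + u · ∇v - Δ_h v + ∇p = f + g e₃`, `div v = div u = 0`, `v(0) = v₀`.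
The momentum equation is integrated in time and tested against Schwartz functions, `N` being the
convection term `u · ∇v`. The transporting field `u` is real. -/
structure IsSolution (P : LittlewoodPaley) (T : ℝ) (u v f : ℝ → Fin 3 → 𝓢'(Space, ℂ))
    (p g : ℝ → 𝓢'(Space, ℂ)) (v₀ : Fin 3 → 𝓢'(Space, ℂ)) : Prop where
  u_integrable : ∀ i, WeaklyIntegrable T fun τ => u τ i
  v_integrable : ∀ i, WeaklyIntegrable T fun τ => v τ i
  p_integrable : WeaklyIntegrable T p
  f_integrable : ∀ i, WeaklyIntegrable T fun τ => f τ i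
  g_integrable : WeaklyIntegrable T g
  u_real : ∀ᵐ τ ∂volume.restrict (Set.Icc 0 T), ∀ i, IsRealDistribution (u τ i)
  div_u : ∀ᵐ τ ∂volume.restrict (Set.Icc 0 T), divergence (u τ) = 0
  div_v : ∀ᵐ τ ∂volume.restrict (Set.Icc 0 T), divergence (v τ) = 0
  momentum : ∃ N : ℝ → Fin 3 → 𝓢'(Space, ℂ),
    (∀ i, WeaklyIntegrable T fun τ => N τ i) ∧
    (∀ᵐ τ ∂volume.restrict (Set.Icc 0 T), ∀ i, IsConvection P (u τ) (v τ i) (N τ i)) ∧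
    ∀ t ∈ Set.Icc 0 T, ∀ (i : Fin 3) (ψ : 𝓢(Space, ℂ)),
      v t i ψ = v₀ i ψ + ∫ τ in (0 : ℝ)..t,
        (f τ i + (if i = 2 then g τ else 0) - N τ i + horizontalLaplacian (v τ i)
          - ∂_{e i} (p τ)) ψ

/-- The losing regularity index `s_t = s - λ ∫₀ᵗ h`. -/
def losingIndex (s lam : ℝ) (h : ℝ → ℝ) (t : ℝ) : ℝ := s - lam * ∫ τ in (0 : ℝ)..t, h τ

end LosingEstimate

end

open LosingEstimate

/-!
The proof is an energy estimate on dyadic blocks, with weights whose exponent decreases in time.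

Multipliers. For a symbol `m` in the Schwartz class, `op m T x` is the pairing of `𝓕 T` with
`m e^{2πi⟨x,·⟩}`. Frequencies are cut into homogeneous shells `q ∈ ℤ`, and the blocks of the equation
are projected by the symbols `leray q i l` of the Leray projector cut to the shell `q`, which removes
the pressure. Shells and Sobolev norms are compared in `dyadicSum_le` and `sobolevNorm_sq_le`.

Commutator. The block `q` of the projected convection term is the transport of the block of `v` by the
frequencies of `u` below `2^{q⁺ + 2}`, plus a remainder. `LittlewoodPaley.exists_remainder_bound`
bounds this remainder in `L²` by `h ∑ⱼ 2^{-|q-j|} (max(q,j)⁺ + 5) ‖vⱼ‖`: the factor `max(q,j)⁺ + 5`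
is the logarithmic loss allowed by the log-Lipschitz norm. Since `χ` need not be even, the low
frequencies of a real field can be complex; the transport uses the even part `chiE` of the symbol,
that is, the real part of the low frequencies, and the difference is bounded like high frequencies
(`LittlewoodPaley.exists_im_bound`).

Energy identity. The low frequencies of `u` are Lipschitz and may grow linearly at infinity. The
identity for one block, `Flow.hasPrim_energy`, is proved with a cut-off at infinity; transport by a
divergence free field only contributes the derivative of the cut-off (`abs_integral_transport_le`),
which disappears in the limit (`hasPrim_energy`).

Vertical force. The Laplacian only gives horizontal dissipation, but the symbol of the Leray
projection of `e₃` is bounded by `|ξ_h| / |ξ|`. The force `g e₃` is therefore controlled in `H^{s-1}`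
by half of the dissipation (`LittlewoodPaley.ofReal_integral_inner_leray_le`,
`LittlewoodPaley.ofReal_work_le`).

Loss of regularity. Let `H(t) = ∫₀ᵗ h`. The time derivative of the weight `2^{2 q⁺ (s - λ H(t))}`
produces `-2 λ log 2 q⁺ h(t)` times the weighted energy. By the Schur test
`tsum_lossWeight_decaySum_le`, which needs exponents in `[-1/2, 1)`, the remainders cost at most a
constant times `(q⁺ + 5) h(t)` times the weighted energy; for large `λ` the part with `q⁺` is
absorbed. The part without logarithmic loss is absorbed as well, because `λ H(t) ≤ s - s₁` makes
`H(t)` small. For this reason no Gronwall lemma is needed and the exponential factor of the statement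
is only used through being at least `1`.

A priori summability. The velocity is only known to be in `H^{-1/2}`, so the weighted energies need
not be finite to start with. The weights are therefore bent down beyond an index `N`
(`lossWeight`), which makes all sums finite; the estimate `EnergyFamily.truncated_sum_le` does not
depend on `N`, and `N → ∞` gives `EnergyFamily.exists_losing_estimate`.
-/

noncomputable section

namespace LosingEstimate

/-! ### Multipliers of tempered distributions as functions -/

/-- The character `ξ ↦ e^{2πi⟨x,ξ⟩}`. -/
def chr (x ξ : Space) : ℂ := Complex.exp (((2 * Real.pi * inner ℝ x ξ : ℝ) : ℂ) * Complex.I)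

theorem norm_chr (x ξ : Space) : ‖chr x ξ‖ = 1 := Complex.norm_exp_ofReal_mul_I _

theorem chr_add (x y ξ : Space) : chr (x + y) ξ = chr x ξ * chr y ξ := by
  simp only [chr, ← Complex.exp_add, inner_add_left]
  congr 1; push_cast; ring

theorem chr_comm (x ξ : Space) : chr x ξ = chr ξ x := by
  simp only [chr, real_inner_comm]

theorem chr_neg (x ξ : Space) : chr (-x) ξ = starRingEnd ℂ (chr x ξ) := by
  simp only [chr, ← Complex.exp_conj, inner_neg_left, map_mul, Complex.conj_ofReal, Complex.conj_I]
  congr 1; push_cast; ring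

theorem chr_neg_right (x ξ : Space) : chr x (-ξ) = starRingEnd ℂ (chr x ξ) := by
  rw [chr_comm, chr_neg, chr_comm]

theorem continuous_chr (x : Space) : Continuous (chr x) := by
  unfold chr; fun_prop

theorem continuous_chr_uncurry : Continuous fun z : Space × Space => chr z.1 z.2 := by
  unfold chr; fun_prop

theorem hasTemperateGrowth_cexp_mul_I :
    Function.HasTemperateGrowth fun t : ℝ => Complex.exp ((t : ℂ) * Complex.I) := by
  have hsmooth : ContDiff ℝ ∞ fun t : ℝ => Complex.exp ((t : ℂ) * Complex.I) :=
    ((Complex.ofRealCLM.contDiff).mul contDiff_const).cexp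
  refine ⟨hsmooth, fun n => ⟨0, 1, fun t => ?_⟩⟩
  rw [norm_iteratedFDeriv_eq_norm_iteratedDeriv]
  have h : ∀ n : ℕ, iteratedDeriv n (fun t : ℝ => Complex.exp ((t : ℂ) * Complex.I)) =
      fun t : ℝ => Complex.I ^ n * Complex.exp ((t : ℂ) * Complex.I) := by
    intro n
    induction n with
    | zero => simp
    | succ n ih =>
      rw [iteratedDeriv_succ, ih]
      funext t
      have h1 : HasDerivAt (fun t : ℝ => ((t : ℂ) * Complex.I)) Complex.I t := by
        simpa using (Complex.ofRealCLM.hasDerivAt (x := t)).mul_const Complex.I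
      rw [(h1.cexp.const_mul (Complex.I ^ n)).deriv]
      ring
  rw [h]
  simp [Complex.norm_exp_ofReal_mul_I]

theorem chr_hasTemperateGrowth (x : Space) : (chr x).HasTemperateGrowth := by
  have h : (fun ξ : Space => 2 * Real.pi * inner ℝ x ξ).HasTemperateGrowth := by fun_prop
  exact hasTemperateGrowth_cexp_mul_I.comp h

/-- Multiplication by the character `e^{2πi⟨x,·⟩}` on the Schwartz space. -/
def modS (x : Space) : 𝓢(Space, ℂ) →L[ℂ] 𝓢(Space, ℂ) := SchwartzMap.smulLeftCLM ℂ (chr x)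

@[simp] theorem modS_apply (x : Space) (m : 𝓢(Space, ℂ)) (ξ : Space) :
    modS x m ξ = chr x ξ * m ξ := by
  rw [modS, SchwartzMap.smulLeftCLM_apply_apply (chr_hasTemperateGrowth x), smul_eq_mul]

theorem hasTemperateGrowth_coord (k : Fin 3) :
    (fun ξ : Space => 2 * Real.pi * Complex.I * ((ξ k : ℝ) : ℂ)).HasTemperateGrowth := by
  have h : (fun ξ : Space => ξ k).HasTemperateGrowth :=
    (EuclideanSpace.proj (𝕜 := ℝ) k).hasTemperateGrowth
  have h2 : (fun ξ : Space => ((ξ k : ℝ) : ℂ)).HasTemperateGrowth :=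
    Function.Complex.hasTemperateGrowth_ofReal.comp h
  exact (Function.HasTemperateGrowth.const _).mul h2

/-- Multiplication by `2πi ξ_k`, the symbol of `∂_k`, on the Schwartz space. -/
def mulI (k : Fin 3) : 𝓢(Space, ℂ) →L[ℂ] 𝓢(Space, ℂ) :=
  SchwartzMap.smulLeftCLM ℂ fun ξ : Space => 2 * Real.pi * Complex.I * ((ξ k : ℝ) : ℂ)

@[simp] theorem mulI_apply (k : Fin 3) (m : 𝓢(Space, ℂ)) (ξ : Space) :
    mulI k m ξ = 2 * Real.pi * Complex.I * ((ξ k : ℝ) : ℂ) * m ξ := by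
  rw [mulI, SchwartzMap.smulLeftCLM_apply_apply (hasTemperateGrowth_coord k), smul_eq_mul]

/-- Pointwise product of Schwartz functions. -/
def mulS (a b : 𝓢(Space, ℂ)) : 𝓢(Space, ℂ) := SchwartzMap.smulLeftCLM ℂ a b

@[simp] theorem mulS_apply (a b : 𝓢(Space, ℂ)) (ξ : Space) : mulS a b ξ = a ξ * b ξ := by
  rw [mulS, SchwartzMap.smulLeftCLM_apply_apply a.hasTemperateGrowth, smul_eq_mul]

/-- The function `x ↦ ⟨𝓕 T, m e^{2πi⟨x,·⟩}⟩`, which is the tempered distribution of Fourier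
transform `m · 𝓕 T`. -/
def op (m : 𝓢(Space, ℂ)) (T : 𝓢'(Space, ℂ)) (x : Space) : ℂ := (𝓕 T) (modS x m)

variable {B : Type*} [NormedAddCommGroup B] [NormedSpace ℂ B]

/-- A continuous function of polynomial growth times a Schwartz function is integrable. -/
theorem integrable_schwartz_smul {f : Space → B} (hf : Continuous f) {C : ℝ} {N : ℕ}
    (hb : ∀ x, ‖f x‖ ≤ C * (1 + ‖x‖) ^ N) (ψ : 𝓢(Space, ℂ)) :
    Integrable fun x => ψ x • f x := by
  have h0 := ψ.integrable_pow_mul (volume : Measure Space) 0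
  have hN := ψ.integrable_pow_mul (volume : Measure Space) N
  have hg : Integrable fun x : Space =>
      |C| * 2 ^ N * (‖x‖ ^ 0 * ‖ψ x‖ + ‖x‖ ^ N * ‖ψ x‖) := (h0.add hN).const_mul _
  refine hg.mono' (ψ.continuous.smul hf).aestronglyMeasurable (.of_forall fun x => ?_)
  rw [norm_smul]
  have h1 : (1 + ‖x‖) ^ N ≤ 2 ^ N * (1 + ‖x‖ ^ N) := by
    have := add_pow_le (zero_le_one (α := ℝ)) (norm_nonneg x) N
    refine this.trans ?_
    rw [one_pow]
    gcongr
    · norm_num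
    · omega
  calc ‖ψ x‖ * ‖f x‖ ≤ ‖ψ x‖ * (|C| * (2 ^ N * (1 + ‖x‖ ^ N))) := by
        gcongr
        exact (hb x).trans (mul_le_mul (le_abs_self C) h1 (by positivity) (abs_nonneg C))
    _ = _ := by ring

/-- The property of a continuous linear map `J` on the Schwartz space that
`x ↦ J (m e^{2πi⟨x,·⟩})` is differentiable with the expected derivative, grows at most
polynomially, and integrates against `ψ` to `J (m 𝓕⁻ψ)`. It holds for all `J` with values in
`ℂ`; the vector-valued version is what allows for an induction. -/
structure Adm (J : 𝓢(Space, ℂ) →L[ℂ] B) : Prop where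
  deriv : ∀ m x, HasFDerivAt (fun y => J (modS y m))
    (∑ k : Fin 3, (EuclideanSpace.proj (𝕜 := ℝ) k : Space →L[ℝ] ℝ).smulRight
      (J (modS x (mulI k m)))) x
  growth : ∀ m, ∃ (C : ℝ) (N : ℕ), ∀ x, ‖J (modS x m)‖ ≤ C * (1 + ‖x‖) ^ N
  pair : ∀ m ψ : 𝓢(Space, ℂ), ∫ y, ψ y • J (modS y m) = J (mulS (𝓕⁻ ψ) m)

namespace Adm

variable {J : 𝓢(Space, ℂ) →L[ℂ] B}

theorem continuous (h : Adm J) (m : 𝓢(Space, ℂ)) : Continuous fun y => J (modS y m) :=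
  continuous_iff_continuousAt.2 fun x => (h.deriv m x).continuousAt

theorem integrable (h : Adm J) (m ψ : 𝓢(Space, ℂ)) : Integrable fun y => ψ y • J (modS y m) := by
  obtain ⟨C, N, hC⟩ := h.growth m
  exact integrable_schwartz_smul (h.continuous m) hC ψ

theorem postcomp [CompleteSpace B] {B' : Type*} [NormedAddCommGroup B'] [NormedSpace ℂ B']
    [CompleteSpace B'] (h : Adm J) (L : B →L[ℂ] B') : Adm (L ∘L J) where
  deriv m x := by
    have := (L.restrictScalars ℝ).hasFDerivAt.comp x (h.deriv m x)
    refine this.congr_fderiv ?_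
    ext v
    simp
  growth m := by
    obtain ⟨C, N, hC⟩ := h.growth m
    refine ⟨‖L‖ * C, N, fun x => ?_⟩
    calc ‖L (J (modS x m))‖ ≤ ‖L‖ * ‖J (modS x m)‖ := L.le_opNorm _
      _ ≤ ‖L‖ * (C * (1 + ‖x‖) ^ N) := by gcongr; exact hC x
      _ = _ := by ring
  pair m ψ := by
    have := L.integral_comp_comm (h.integrable m ψ)
    simp only [map_smul] at this
    simp only [ContinuousLinearMap.comp_apply, this, h.pair]

theorem smulLeft (h : Adm J) {w : Space → ℂ} (hw : w.HasTemperateGrowth) :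
    Adm (J ∘L SchwartzMap.smulLeftCLM ℂ w) := by
  have h1 : ∀ x m, SchwartzMap.smulLeftCLM ℂ w (modS x m) =
      modS x (SchwartzMap.smulLeftCLM ℂ w m) := by
    intro x m; ext ξ
    simp only [modS_apply, SchwartzMap.smulLeftCLM_apply_apply hw, smul_eq_mul]; ring
  have h2 : ∀ k m, SchwartzMap.smulLeftCLM ℂ w (mulI k m) =
      mulI k (SchwartzMap.smulLeftCLM ℂ w m) := by
    intro x m; ext ξ
    simp only [mulI_apply, SchwartzMap.smulLeftCLM_apply_apply hw, smul_eq_mul]; ring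
  have h3 : ∀ a m, SchwartzMap.smulLeftCLM ℂ w (mulS a m) =
      mulS a (SchwartzMap.smulLeftCLM ℂ w m) := by
    intro x m; ext ξ
    simp only [mulS_apply, SchwartzMap.smulLeftCLM_apply_apply hw, smul_eq_mul]; ring
  refine ⟨fun m x => ?_, fun m => ?_, fun m ψ => ?_⟩
  · simpa only [ContinuousLinearMap.comp_apply, h1, h2] using
      h.deriv (SchwartzMap.smulLeftCLM ℂ w m) x
  · simpa only [ContinuousLinearMap.comp_apply, h1] using h.growth (SchwartzMap.smulLeftCLM ℂ w m)
  · simpa only [ContinuousLinearMap.comp_apply, h1, h3] using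
      h.pair (SchwartzMap.smulLeftCLM ℂ w m) ψ

end Adm

theorem hasFDerivAt_chr (x ξ : Space) : HasFDerivAt (fun ξ => chr x ξ)
    (((2 * Real.pi * Complex.I) * chr x ξ) •
      (Complex.ofRealCLM ∘L (innerSL ℝ x : Space →L[ℝ] ℝ))) ξ := by
  have h0 : HasFDerivAt (fun ξ : Space => (inner ℝ x ξ : ℝ)) (innerSL ℝ x : Space →L[ℝ] ℝ) ξ :=
    (innerSL ℝ x : Space →L[ℝ] ℝ).hasFDerivAt
  have h1 := ((Complex.ofRealCLM.hasFDerivAt.comp ξ (h0.const_mul (2 * Real.pi))).mul_const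
    Complex.I).cexp
  refine h1.congr_fderiv ?_
  ext v
  simp [chr]
  ring

theorem inner_e (x : Space) (k : Fin 3) : inner ℝ x (e k) = x k := by
  simp [e, EuclideanSpace.inner_single_right]

theorem e_apply (j k : Fin 3) : e k j = if j = k then 1 else 0 := by
  simp [e]

theorem lineDeriv_modS (k : Fin 3) (x : Space) (m : 𝓢(Space, ℂ)) :
    ∂_{e k} (modS x m) = modS x (∂_{e k} m) + (2 * Real.pi * Complex.I * (x k : ℂ)) • modS x m := by
  ext ξ
  simp only [SchwartzMap.lineDerivOp_apply_eq_fderiv, add_apply, modS_apply,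
    smul_apply, smul_eq_mul]
  have h : ⇑(modS x m) = (fun η => chr x η) * ⇑m := funext (modS_apply x m)
  rw [h, ((hasFDerivAt_chr x ξ).mul (m.hasFDerivAt ξ)).fderiv]
  simp [inner_e]
  ring

theorem lineDeriv_mulI (k j : Fin 3) (m : 𝓢(Space, ℂ)) :
    ∂_{e k} (mulI j m) = mulI j (∂_{e k} m) +
      (if j = k then 2 * Real.pi * Complex.I else 0 : ℂ) • m := by
  ext ξ
  simp only [SchwartzMap.lineDerivOp_apply_eq_fderiv, add_apply, mulI_apply,
    smul_apply, smul_eq_mul]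
  have h0 : HasFDerivAt (fun ξ : Space => 2 * Real.pi * Complex.I * ((ξ j : ℝ) : ℂ))
      ((2 * Real.pi * Complex.I) • (Complex.ofRealCLM ∘L EuclideanSpace.proj (𝕜 := ℝ) j)) ξ :=
    ((Complex.ofRealCLM ∘L (EuclideanSpace.proj (𝕜 := ℝ) j : Space →L[ℝ] ℝ)).hasFDerivAt).const_mul
      (2 * Real.pi * Complex.I)
  have h : ⇑(mulI j m) = (fun η => 2 * Real.pi * Complex.I * ((η j : ℝ) : ℂ)) * ⇑m :=
    funext (mulI_apply j m)
  rw [h, (h0.mul (m.hasFDerivAt ξ)).fderiv]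
  by_cases hjk : j = k
  · simp [e_apply, hjk]; ring
  · simp [e_apply, hjk]

theorem lineDeriv_mulS (k : Fin 3) (a m : 𝓢(Space, ℂ)) :
    ∂_{e k} (mulS a m) = mulS (∂_{e k} a) m + mulS a (∂_{e k} m) := by
  ext ξ
  simp only [SchwartzMap.lineDerivOp_apply_eq_fderiv, add_apply, mulS_apply]
  have h : ⇑(mulS a m) = ⇑a * ⇑m := funext (mulS_apply a m)
  rw [h, ((a.hasFDerivAt ξ).mul (m.hasFDerivAt ξ)).fderiv]
  simp
  ring

theorem lineDeriv_fourierInv (k : Fin 3) (ψ : 𝓢(Space, ℂ)) :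
    ∂_{e k} (𝓕⁻ ψ) = 𝓕⁻ (mulI k ψ) := by
  rw [SchwartzMap.lineDerivOp_fourierInv_eq]
  congr 1
  ext ξ
  have : (fun x : Space => inner ℝ x (e k)).HasTemperateGrowth := by fun_prop
  rw [smul_apply, SchwartzMap.smulLeftCLM_apply_apply this, mulI_apply, inner_e, Complex.real_smul,
    smul_eq_mul]
  ring

theorem Adm.lineDeriv {J : 𝓢(Space, ℂ) →L[ℂ] B} (h : Adm J) (k : Fin 3) :
    Adm (J ∘L LineDeriv.lineDerivOpCLM ℂ 𝓢(Space, ℂ) (e k)) := by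
  -- The derivative of `e^{2πi⟨y,·⟩} m` is `e^{2πi⟨y,·⟩} (∂ₖ m + 2πi yₖ m)`: it costs one power of
  -- `y`.
  have key : ∀ y m, (J ∘L LineDeriv.lineDerivOpCLM ℂ 𝓢(Space, ℂ) (e k)) (modS y m) =
      J (modS y (∂_{e k} m)) + (2 * Real.pi * Complex.I * (y k : ℂ)) • J (modS y m) := by
    intro y m
    simp [lineDeriv_modS]
  refine ⟨fun m x => ?_, fun m => ?_, fun m ψ => ?_⟩
  · simp only [key]
    have h0 : HasFDerivAt (fun ξ : Space => 2 * Real.pi * Complex.I * ((ξ k : ℝ) : ℂ))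
        ((2 * Real.pi * Complex.I) • (Complex.ofRealCLM ∘L EuclideanSpace.proj (𝕜 := ℝ) k)) x :=
      ((Complex.ofRealCLM ∘L
        (EuclideanSpace.proj (𝕜 := ℝ) k : Space →L[ℝ] ℝ)).hasFDerivAt).const_mul
        (2 * Real.pi * Complex.I)
    refine ((h.deriv (∂_{e k} m) x).add (h0.smul (h.deriv m x))).congr_fderiv ?_
    ext v
    simp only [lineDeriv_mulI]
    fin_cases k <;> simp [Fin.sum_univ_three] <;> module
  · obtain ⟨C, N, hC⟩ := h.growth m
    obtain ⟨C', N', hC'⟩ := h.growth (∂_{e k} m)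
    refine ⟨|C'| + 2 * Real.pi * |C|, N' + (N + 1), fun x => ?_⟩
    rw [key]
    have h1 : (1 : ℝ) ≤ 1 + ‖x‖ := by linarith [norm_nonneg x]
    have hx : |x k| ≤ 1 + ‖x‖ := by
      have := PiLp.norm_apply_le x k
      rw [Real.norm_eq_abs] at this
      linarith
    calc _ ≤ ‖J (modS x (∂_{e k} m))‖ + ‖(2 * Real.pi * Complex.I * (x k : ℂ)) • J (modS x m)‖ :=
          norm_add_le _ _
      _ = ‖J (modS x (∂_{e k} m))‖ + 2 * Real.pi * |x k| * ‖J (modS x m)‖ := by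
          rw [norm_smul]; simp [abs_of_pos Real.pi_pos]
      _ ≤ |C'| * (1 + ‖x‖) ^ N' + 2 * Real.pi * (1 + ‖x‖) * (|C| * (1 + ‖x‖) ^ N) := by
          gcongr
          · exact (hC' x).trans (by gcongr; exact le_abs_self _)
          · exact (hC x).trans (by gcongr; exact le_abs_self _)
      _ = |C'| * (1 + ‖x‖) ^ N' + 2 * Real.pi * |C| * (1 + ‖x‖) ^ (N + 1) := by ring
      _ ≤ |C'| * (1 + ‖x‖) ^ (N' + (N + 1)) + 2 * Real.pi * |C| * (1 + ‖x‖) ^ (N' + (N + 1)) := by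
          have h2 := pow_le_pow_right₀ h1 (Nat.le_add_right N' (N + 1))
          have h3 := pow_le_pow_right₀ h1 (Nat.le_add_left (N + 1) N')
          gcongr
      _ = _ := by ring
  -- In the pairing with `ψ` the factor `2πi yₖ` is moved to `ψ`.
  · have h1 := h.integrable (∂_{e k} m) ψ
    have h2 := h.integrable m (mulI k ψ)
    have h3 : ∀ y, ψ y • (J ∘L LineDeriv.lineDerivOpCLM ℂ 𝓢(Space, ℂ) (e k)) (modS y m) =
        ψ y • J (modS y (∂_{e k} m)) + mulI k ψ y • J (modS y m) := by
      intro y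
      rw [key, smul_add, smul_smul, mulI_apply, mul_comm]
    simp only [h3]
    rw [integral_add h1 h2, h.pair, h.pair]
    simp [lineDeriv_mulS, lineDeriv_fourierInv, add_comm]

theorem norm_exp_I_sub_le (a : ℝ) :
    ‖Complex.exp (a * Complex.I) - 1 - a * Complex.I‖ ≤ 3 * a ^ 2 := by
  by_cases h : |a| ≤ 1
  · have := Complex.norm_exp_sub_one_sub_id_le (x := a * Complex.I) (by simpa using h)
    refine this.trans ?_
    simp only [norm_mul, Complex.norm_real, Real.norm_eq_abs, Complex.norm_I, mul_one, sq_abs]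
    nlinarith [sq_nonneg a]
  · push Not at h
    have h1 : 1 ≤ a ^ 2 := by rw [← sq_abs]; nlinarith
    have h2 : |a| ≤ a ^ 2 := by rw [← sq_abs]; nlinarith
    calc _ ≤ ‖Complex.exp (a * Complex.I)‖ + ‖(1 : ℂ)‖ + ‖(a : ℂ) * Complex.I‖ := by
          refine (norm_sub_le _ _).trans ?_
          gcongr
          exact norm_sub_le _ _
      _ = 1 + 1 + |a| := by simp [Complex.norm_exp_ofReal_mul_I]
      _ ≤ _ := by linarith

/-- Evaluation in the sup norm is the base case of the induction. -/
theorem adm_toBoundedContinuousFunction :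
    Adm (SchwartzMap.toBoundedContinuousFunctionCLM ℂ Space ℂ) := by
  have hsub : ∀ m x,
      ‖SchwartzMap.toBoundedContinuousFunctionCLM ℂ Space ℂ (modS x m)‖ ≤
        SchwartzMap.seminorm ℂ 0 0 m * (1 + ‖x‖) ^ 0 := by
    intro m x
    rw [pow_zero, mul_one]
    refine (BoundedContinuousFunction.norm_le (by positivity)).2 fun ξ => ?_
    simp only [SchwartzMap.toBoundedContinuousFunctionCLM_apply, modS_apply, norm_mul, norm_chr,
      one_mul]
    exact m.norm_le_seminorm ℂ ξ
  -- The second order remainder of `y ↦ e^{2πi⟨y,ξ⟩}` is at most quadratic in `|ξ|`, uniformly in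
  -- `y`, and the decay of `m` absorbs `|ξ|²`.
  have hder : ∀ m x, HasFDerivAt
      (fun y => SchwartzMap.toBoundedContinuousFunctionCLM ℂ Space ℂ (modS y m))
      (∑ k : Fin 3, (EuclideanSpace.proj (𝕜 := ℝ) k : Space →L[ℝ] ℝ).smulRight
      (SchwartzMap.toBoundedContinuousFunctionCLM ℂ Space ℂ (modS x (mulI k m)))) x := by
    intro m x
    rw [hasFDerivAt_iff_isLittleO_nhds_zero]
    have hO : (fun v : Space => ‖v‖ ^ 2) =o[𝓝 0] fun v : Space => v := by
      have := Asymptotics.isLittleO_norm_pow_id (E' := Space) (n := 2) (by norm_num)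
      exact this
    refine Asymptotics.IsBigO.trans_isLittleO ?_ hO
    refine Asymptotics.IsBigO.of_bound (3 * (2 * Real.pi) ^ 2 * SchwartzMap.seminorm ℂ 2 0 m)
      (.of_forall fun v => ?_)
    refine (BoundedContinuousFunction.norm_le (by positivity)).2 fun ξ => ?_
    have h1 : (SchwartzMap.toBoundedContinuousFunctionCLM ℂ Space ℂ (modS (x + v) m) -
        SchwartzMap.toBoundedContinuousFunctionCLM ℂ Space ℂ (modS x m) -
        (∑ k : Fin 3, (EuclideanSpace.proj (𝕜 := ℝ) k : Space →L[ℝ] ℝ).smulRight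
        (SchwartzMap.toBoundedContinuousFunctionCLM ℂ Space ℂ (modS x (mulI k m)))) v) ξ =
        chr x ξ * m ξ * (Complex.exp ((2 * Real.pi * inner ℝ v ξ : ℝ) * Complex.I) - 1 -
          (2 * Real.pi * inner ℝ v ξ : ℝ) * Complex.I) := by
      simp [Fin.sum_univ_three, chr_add, PiLp.inner_apply]
      simp only [chr, PiLp.inner_apply, Fin.sum_univ_three]
      simp
      ring
    rw [h1, norm_mul, norm_mul, norm_chr, one_mul]
    have h2 := norm_exp_I_sub_le (2 * Real.pi * inner ℝ v ξ)
    have h3 : |inner ℝ v ξ| ≤ ‖v‖ * ‖ξ‖ := abs_real_inner_le_norm v ξ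
    have h4 : (inner ℝ v ξ) ^ 2 ≤ (‖v‖ * ‖ξ‖) ^ 2 := by
      rw [← sq_abs]; gcongr
    calc _ ≤ ‖m ξ‖ * (3 * (2 * Real.pi * inner ℝ v ξ) ^ 2) := by gcongr
      _ = ‖m ξ‖ * (3 * (2 * Real.pi) ^ 2 * (inner ℝ v ξ) ^ 2) := by ring
      _ ≤ ‖m ξ‖ * (3 * (2 * Real.pi) ^ 2 * (‖v‖ * ‖ξ‖) ^ 2) := by gcongr
      _ = 3 * (2 * Real.pi) ^ 2 * (‖ξ‖ ^ 2 * ‖m ξ‖) * ‖v‖ ^ 2 := by ring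
      _ ≤ 3 * (2 * Real.pi) ^ 2 * SchwartzMap.seminorm ℂ 2 0 m * ‖v‖ ^ 2 := by
          gcongr
          exact m.norm_pow_mul_le_seminorm ℂ 2 ξ
      _ = _ := by simp
  refine ⟨hder, fun m => ⟨_, 0, hsub m⟩, fun m ψ => ?_⟩
  have hc : Continuous fun y => SchwartzMap.toBoundedContinuousFunctionCLM ℂ Space ℂ (modS y m) :=
    continuous_iff_continuousAt.2 fun x => (hder m x).continuousAt
  have hi := integrable_schwartz_smul hc (hsub m) ψ
  -- After evaluation at `ξ`, the pairing is the formula for the inverse Fourier transform.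
  ext ξ
  have h1 := (BoundedContinuousFunction.evalCLM ℂ ξ :
    BoundedContinuousFunction Space ℂ →L[ℂ] ℂ).integral_comp_comm hi
  simp only [BoundedContinuousFunction.evalCLM_apply] at h1
  rw [← h1]
  simp only [SchwartzMap.toBoundedContinuousFunctionCLM_apply, mulS_apply,
    BoundedContinuousFunction.coe_smul, modS_apply, smul_eq_mul]
  rw [SchwartzMap.fourierInv_coe, Real.fourierInv_eq, ← integral_mul_const]
  congr 1
  funext y
  simp only [chr, Circle.smul_def, Real.fourierChar_apply, smul_eq_mul]
  push_cast
  ring_nf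

theorem Adm.pi {ι : Type*} [Fintype ι] {J : ι → 𝓢(Space, ℂ) →L[ℂ] B} [CompleteSpace B]
    (h : ∀ i, Adm (J i)) : Adm (ContinuousLinearMap.pi J) := by
  have hd : ∀ m x, HasFDerivAt (fun y => ContinuousLinearMap.pi J (modS y m))
      (∑ k : Fin 3, (EuclideanSpace.proj (𝕜 := ℝ) k : Space →L[ℝ] ℝ).smulRight
      (ContinuousLinearMap.pi J (modS x (mulI k m)))) x := by
    intro m x
    rw [hasFDerivAt_pi']
    intro i
    refine ((h i).deriv m x).congr_fderiv ?_
    ext v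
    simp
  have hg : ∀ m, ∃ (C : ℝ) (N : ℕ), ∀ x, ‖ContinuousLinearMap.pi J (modS x m)‖ ≤
      C * (1 + ‖x‖) ^ N := by
    intro m
    choose C N hC using fun i => (h i).growth m
    refine ⟨∑ i, |C i|, ∑ i, N i, fun x => (pi_norm_le_iff_of_nonneg (by positivity)).2 fun i => ?_⟩
    have h1 : (1 : ℝ) ≤ 1 + ‖x‖ := by linarith [norm_nonneg x]
    refine (hC i x).trans ?_
    calc C i * (1 + ‖x‖) ^ N i ≤ |C i| * (1 + ‖x‖) ^ N i := by gcongr; exact le_abs_self _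
      _ ≤ _ := by
        have h2 := pow_le_pow_right₀ h1
          (Finset.single_le_sum (f := N) (fun _ _ => Nat.zero_le _) (Finset.mem_univ i))
        have h3 := Finset.single_le_sum (f := fun i => |C i|) (fun _ _ => abs_nonneg _)
          (Finset.mem_univ i)
        gcongr
  refine ⟨hd, hg, fun m ψ => ?_⟩
  have hc : Continuous fun y => ContinuousLinearMap.pi J (modS y m) :=
    continuous_iff_continuousAt.2 fun x => (hd m x).continuousAt
  obtain ⟨C, N, hC⟩ := hg m
  have hi := integrable_schwartz_smul hc hC ψ
  funext i
  have h1 := (ContinuousLinearMap.proj (R := ℂ) (φ := fun _ : ι => B) i).integral_comp_comm hi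
  simp only [ContinuousLinearMap.proj_apply] at h1
  rw [← h1]
  exact (h i).pair m ψ

theorem Adm.iteratedLineDeriv {J : 𝓢(Space, ℂ) →L[ℂ] B} (h : Adm J) (n : ℕ) (α : Fin n → Fin 3) :
    Adm (J ∘L LineDeriv.iteratedLineDerivOpCLM ℂ 𝓢(Space, ℂ) fun i => e (α i)) := by
  induction n generalizing J with
  | zero => exact h
  | succ n ih =>
    have := ih (h.lineDeriv (α 0)) (fun i => α i.succ)
    exact this

/-- The derivatives of order `n` in the coordinate directions control the full derivative. -/
theorem norm_iteratedFDeriv_le_sum (φ : 𝓢(Space, ℂ)) (n : ℕ) (x : Space) :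
    ‖iteratedFDeriv ℝ n φ x‖ ≤ ∑ α : Fin n → Fin 3, ‖(∂^{fun i => e (α i)} φ) x‖ := by
  refine ContinuousMultilinearMap.opNorm_le_bound (by positivity) fun v => ?_
  have hv : v = fun i => ∑ k : Fin 3, (v i k) • e k := by
    funext i
    ext j
    simp [e_apply, Fin.sum_univ_three]
    fin_cases j <;> simp
  conv_lhs => rw [hv]
  rw [ContinuousMultilinearMap.map_sum]
  refine (norm_sum_le _ _).trans ?_
  rw [Finset.sum_mul]
  refine Finset.sum_le_sum fun α _ => ?_
  rw [ContinuousMultilinearMap.map_smul_univ, norm_smul,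
    SchwartzMap.iteratedLineDerivOp_eq_iteratedFDeriv, mul_comm, norm_prod]
  gcongr
  exact PiLp.norm_apply_le _ _

/-- Every continuous linear functional on the Schwartz space is continuous for the sup norms of
finitely many weighted derivatives; by Hahn-Banach it factors through a product of spaces of bounded
functions. -/
theorem adm_functional (T : 𝓢(Space, ℂ) →L[ℂ] ℂ) : Adm T := by
  obtain ⟨s, C, -, hC⟩ := Seminorm.bound_of_continuous (schwartz_withSeminorms ℂ Space ℂ)
    (normSeminorm ℂ ℂ |>.comp T.toLinearMap) (continuous_norm.comp T.continuous)
  let w : ℕ → Space → ℂ := fun k x => (((1 + ‖x‖ ^ 2) ^ (k : ℝ) : ℝ) : ℂ)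
  have hw : ∀ k, (w k).HasTemperateGrowth := fun k =>
    Function.Complex.hasTemperateGrowth_ofReal.comp
      (Function.hasTemperateGrowth_one_add_norm_sq_rpow Space k)
  -- `J` runs over the weighted derivatives which dominate the finitely many seminorms in `s`.
  let I := Σ p : s, (Fin p.1.2 → Fin 3)
  let J : I → 𝓢(Space, ℂ) →L[ℂ] BoundedContinuousFunction Space ℂ := fun i =>
    ((SchwartzMap.toBoundedContinuousFunctionCLM ℂ Space ℂ) ∘L
      SchwartzMap.smulLeftCLM ℂ (w i.1.1.1)) ∘L
      LineDeriv.iteratedLineDerivOpCLM ℂ 𝓢(Space, ℂ) fun l => e (i.2 l)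
  have hJ : ∀ i, Adm (J i) := fun i =>
    (adm_toBoundedContinuousFunction.smulLeft (hw i.1.1.1)).iteratedLineDeriv _ i.2
  let JJ := ContinuousLinearMap.pi J
  have hJJ : Adm JJ := Adm.pi hJ
  have hseminorm : ∀ p ∈ s, ∀ φ, SchwartzMap.seminorm ℂ p.1 p.2 φ ≤
      (Fintype.card (Fin p.2 → Fin 3)) * ‖JJ φ‖ := by
    intro p hp φ
    refine SchwartzMap.seminorm_le_bound ℂ p.1 p.2 φ (by positivity) fun x => ?_
    have h1 := norm_iteratedFDeriv_le_sum φ p.2 x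
    calc ‖x‖ ^ p.1 * ‖iteratedFDeriv ℝ p.2 φ x‖
        ≤ ‖x‖ ^ p.1 * ∑ α : Fin p.2 → Fin 3, ‖(∂^{fun i => e (α i)} φ) x‖ := by gcongr
      _ = ∑ α : Fin p.2 → Fin 3, ‖x‖ ^ p.1 * ‖(∂^{fun i => e (α i)} φ) x‖ := Finset.mul_sum ..
      _ ≤ ∑ α : Fin p.2 → Fin 3, ‖JJ φ‖ := by
          refine Finset.sum_le_sum fun α _ => ?_
          have h2 : ‖x‖ ^ p.1 ≤ ‖w p.1 x‖ := by
            have h3 : ‖x‖ ≤ 1 + ‖x‖ ^ 2 := by nlinarith [sq_nonneg (‖x‖ - 1), sq_nonneg ‖x‖]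
            simp only [w, Complex.norm_real, Real.norm_eq_abs, Real.rpow_natCast]
            rw [abs_of_nonneg (by positivity)]
            gcongr
          calc _ ≤ ‖w p.1 x‖ * ‖(∂^{fun i => e (α i)} φ) x‖ := by gcongr
            _ = ‖J ⟨⟨p, hp⟩, α⟩ φ x‖ := by
                simp only [J, ContinuousLinearMap.comp_apply,
                  SchwartzMap.toBoundedContinuousFunctionCLM_apply,
                  SchwartzMap.smulLeftCLM_apply_apply (hw p.1), smul_eq_mul, norm_mul]
                rfl
            _ ≤ ‖J ⟨⟨p, hp⟩, α⟩ φ‖ := BoundedContinuousFunction.norm_coe_le_norm _ x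
            _ ≤ ‖JJ φ‖ := norm_le_pi_norm (JJ φ) ⟨⟨p, hp⟩, α⟩
      _ = _ := by simp
  obtain ⟨K, hK⟩ : ∃ K : ℝ, ∀ φ, ‖T φ‖ ≤ K * ‖JJ φ‖ := by
    refine ⟨C * ∑ p ∈ s, (Fintype.card (Fin p.2 → Fin 3) : ℝ), fun φ => ?_⟩
    have h1 : ‖T φ‖ ≤ C * (s.sup (schwartzSeminormFamily ℂ Space ℂ)) φ := by
      exact hC φ
    refine h1.trans ?_
    rw [mul_assoc]
    gcongr
    refine Seminorm.finset_sup_apply_le (by positivity) fun p hp => ?_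
    refine (hseminorm p hp φ).trans ?_
    gcongr
    exact Finset.single_le_sum (f := fun p : ℕ × ℕ => (Fintype.card (Fin p.2 → Fin 3) : ℝ))
      (fun _ _ => by positivity) hp
  have hker : ∀ φ, JJ φ = 0 → T φ = 0 := by
    intro φ h
    have := hK φ
    rw [h, norm_zero, mul_zero] at this
    exact norm_le_zero_iff.1 this
  let R := LinearMap.range JJ.toLinearMap
  -- `T` descends to the range of `JJ`.
  obtain ⟨g, hg⟩ : ∃ g : R →ₗ[ℂ] ℂ, ∀ φ, g ⟨JJ φ, φ, rfl⟩ = T φ := by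
    have hsurj : Function.Surjective JJ.toLinearMap.rangeRestrict :=
      LinearMap.surjective_rangeRestrict _
    obtain ⟨σ, hσ⟩ := JJ.toLinearMap.rangeRestrict.exists_rightInverse_of_surjective
      (LinearMap.range_eq_top.2 hsurj)
    refine ⟨T.toLinearMap ∘ₗ σ, fun φ => ?_⟩
    have h1 : JJ.toLinearMap.rangeRestrict (σ ⟨JJ φ, φ, rfl⟩) = ⟨JJ φ, φ, rfl⟩ :=
      LinearMap.congr_fun hσ _
    have h2 : JJ (σ ⟨JJ φ, φ, rfl⟩) = JJ φ := congrArg Subtype.val h1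
    have h3 := hker (σ ⟨JJ φ, φ, rfl⟩ - φ) (by rw [map_sub, h2, sub_self])
    rw [map_sub, sub_eq_zero] at h3
    exact h3
  have hgb : ∀ r : R, ‖g r‖ ≤ K * ‖r‖ := by
    rintro ⟨r, φ, rfl⟩
    exact (congrArg norm (hg φ)).trans_le (hK φ)
  obtain ⟨L, hL, -⟩ := exists_extension_norm_eq R (g.mkContinuous K hgb)
  have : T = L ∘L JJ := by
    ext φ
    have := hL ⟨JJ φ, φ, rfl⟩
    simp only [LinearMap.mkContinuous_apply, hg] at this
    exact this.symm
  rw [this]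
  exact hJJ.postcomp L

/-! ### Calculus of `op` -/

section OpCalculus

variable (m : 𝓢(Space, ℂ)) (T : 𝓢'(Space, ℂ))

theorem adm_fourier : Adm ((𝓕 T : 𝓢'(Space, ℂ)) : 𝓢(Space, ℂ) →L[ℂ] ℂ) := adm_functional _

theorem hasFDerivAt_op (x : Space) : HasFDerivAt (op m T)
    (∑ k : Fin 3, (EuclideanSpace.proj (𝕜 := ℝ) k : Space →L[ℝ] ℝ).smulRight
      (op (mulI k m) T x)) x := (adm_fourier T).deriv m x

theorem differentiable_op : Differentiable ℝ (op m T) := fun x =>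
  (hasFDerivAt_op m T x).differentiableAt

theorem continuous_op : Continuous (op m T) := (differentiable_op m T).continuous

theorem fderiv_op (x : Space) (k : Fin 3) : fderiv ℝ (op m T) x (e k) = op (mulI k m) T x := by
  rw [(hasFDerivAt_op m T x).fderiv]
  fin_cases k <;> simp [Fin.sum_univ_three, e_apply]

theorem fderiv_op_apply (x v : Space) :
    fderiv ℝ (op m T) x v = ∑ k, v k • op (mulI k m) T x := by
  rw [(hasFDerivAt_op m T x).fderiv]
  simp [Fin.sum_univ_three]

theorem growth_op : ∃ (C : ℝ) (N : ℕ), ∀ x, ‖op m T x‖ ≤ C * (1 + ‖x‖) ^ N :=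
  (adm_fourier T).growth m

theorem integral_mul_op (ψ : 𝓢(Space, ℂ)) :
    ∫ y, ψ y * op m T y = (𝓕 T) (mulS (𝓕⁻ ψ) m) := (adm_fourier T).pair m ψ

theorem integrable_mul_op (ψ : 𝓢(Space, ℂ)) : Integrable fun y => ψ y * op m T y :=
  (adm_fourier T).integrable m ψ

end OpCalculus

theorem modS_mulI (x : Space) (k : Fin 3) (m : 𝓢(Space, ℂ)) :
    modS x (mulI k m) = mulI k (modS x m) := by
  ext ξ; simp; ring

theorem fourier_lineDeriv_apply (k : Fin 3) (T : 𝓢'(Space, ℂ)) (m : 𝓢(Space, ℂ)) :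
    (𝓕 (∂_{e k} T)) m = (𝓕 T) (mulI k m) := by
  rw [TemperedDistribution.fourier_apply, TemperedDistribution.lineDerivOp_apply_apply,
    SchwartzMap.lineDerivOp_fourier_eq, TemperedDistribution.fourier_apply]
  congr 1
  rw [← FourierTransform.fourier_neg]
  congr 1
  ext ξ
  have : (fun x : Space => inner ℝ x (e k)).HasTemperateGrowth := by fun_prop
  rw [neg_apply, smul_apply, SchwartzMap.smulLeftCLM_apply_apply this, mulI_apply, inner_e,
    Complex.real_smul, smul_eq_mul]
  ring

theorem op_lineDeriv (k : Fin 3) (m : 𝓢(Space, ℂ)) (T : 𝓢'(Space, ℂ)) (x : Space) :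
    op m (∂_{e k} T) x = op (mulI k m) T x := by
  rw [op, fourier_lineDeriv_apply, op, modS_mulI]

theorem op_add_left (m m' : 𝓢(Space, ℂ)) (T : 𝓢'(Space, ℂ)) (x : Space) :
    op (m + m') T x = op m T x + op m' T x := by simp [op]

theorem op_sub_left (m m' : 𝓢(Space, ℂ)) (T : 𝓢'(Space, ℂ)) (x : Space) :
    op (m - m') T x = op m T x - op m' T x := by
  simp only [op, map_sub]

theorem op_smul_left (c : ℂ) (m : 𝓢(Space, ℂ)) (T : 𝓢'(Space, ℂ)) (x : Space) :
    op (c • m) T x = c * op m T x := by simp [op]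

theorem op_zero_left (T : 𝓢'(Space, ℂ)) (x : Space) : op 0 T x = 0 := by simp [op]

theorem op_sum_left {ι : Type*} (s : Finset ι) (m : ι → 𝓢(Space, ℂ)) (T : 𝓢'(Space, ℂ))
    (x : Space) : op (∑ i ∈ s, m i) T x = ∑ i ∈ s, op (m i) T x := by simp [op]

theorem fourierInv_schwartz_apply (a : 𝓢(Space, ℂ)) (x : Space) :
    (𝓕⁻ a) x = ∫ ξ, chr x ξ * a ξ := by
  rw [SchwartzMap.fourierInv_coe, Real.fourierInv_eq]
  congr 1
  funext ξ
  simp only [chr, Circle.smul_def, Real.fourierChar_apply, smul_eq_mul, real_inner_comm]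

theorem fourier_schwartz_apply (a : 𝓢(Space, ℂ)) (x : Space) :
    (𝓕 a) x = ∫ ξ, chr (-x) ξ * a ξ := by
  rw [SchwartzMap.fourier_coe, Real.fourier_eq]
  congr 1
  funext ξ
  simp only [chr, Circle.smul_def, Real.fourierChar_apply, smul_eq_mul, real_inner_comm,
    inner_neg_right]

theorem fourier_modS (x : Space) (a : 𝓢(Space, ℂ)) (y : Space) :
    (𝓕 (modS x a)) y = (𝓕⁻ a) (x - y) := by
  rw [fourier_schwartz_apply, fourierInv_schwartz_apply]
  congr 1
  funext ξ
  rw [modS_apply, sub_eq_add_neg, chr_add]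
  ring

theorem op_eq_apply_fourier (m : 𝓢(Space, ℂ)) (T : 𝓢'(Space, ℂ)) (x : Space) :
    op m T x = T (𝓕 (modS x m)) := rfl

theorem mulS_modS (x : Space) (a m : 𝓢(Space, ℂ)) :
    mulS (modS x a) m = modS x (mulS a m) := by
  ext ξ; simp; ring

/-- A product of symbols acts as a convolution with the kernel of the first factor. -/
theorem op_mulS (a m : 𝓢(Space, ℂ)) (T : 𝓢'(Space, ℂ)) (x : Space) :
    op (mulS a m) T x = ∫ y, (𝓕⁻ a) (x - y) * op m T y := by
  have h := integral_mul_op m T (𝓕 (modS x a))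
  simp only [fourier_modS] at h
  rw [h, FourierTransform.fourierInv_fourier_eq, mulS_modS, op]

theorem integrable_kernel_mul_op (a m : 𝓢(Space, ℂ)) (T : 𝓢'(Space, ℂ)) (x : Space) :
    Integrable fun y => (𝓕⁻ a) (x - y) * op m T y := by
  have h := integrable_mul_op m T (𝓕 (modS x a))
  simpa only [fourier_modS] using h

/-- For a family of distributions that is measurable in the time variable when tested, the functions
`op m (w τ) x` are jointly measurable, up to a null set of times. -/
theorem exists_measurable_op {μ : Measure ℝ} {w : ℝ → 𝓢'(Space, ℂ)}
    (hw : ∀ ψ, AEMeasurable (fun τ => w τ ψ) μ) (m : 𝓢(Space, ℂ)) :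
    ∃ F : ℝ × Space → ℂ, Measurable F ∧ (∀ τ, Continuous fun x => F (τ, x)) ∧
      ∀ᵐ τ ∂μ, ∀ x, op m (w τ) x = F (τ, x) := by
  have hx : ∀ x, AEMeasurable (fun τ => op m (w τ) x) μ := fun x => hw _
  -- Measurable representatives are chosen at the points of a dense sequence, which removes a null
  -- set `Z` of times; continuity in `x` then gives all the other points.
  let d := TopologicalSpace.denseSeq Space
  have hd : DenseRange d := TopologicalSpace.denseRange_denseSeq Space
  have hall : ∀ᵐ τ ∂μ, ∀ n, op m (w τ) (d n) = (hx (d n)).mk _ τ :=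
    ae_all_iff.2 fun n => (hx (d n)).ae_eq_mk
  obtain ⟨Z, hZ, hZm, hZ0⟩ := (exists_measurable_superset_of_null (ae_iff.1 hall))
  classical
  let G : Space → ℝ → ℂ := fun x τ => if τ ∈ Z then 0 else op m (w τ) x
  have hGc : ∀ τ, Continuous fun x => G x τ := by
    intro τ
    by_cases h : τ ∈ Z
    · simp only [G, h, if_true]; exact continuous_const
    · simp only [G, h, if_false]; exact continuous_op m (w τ)
  have hGd : ∀ n, Measurable (G (d n)) := by
    intro n
    have : G (d n) = fun τ => if τ ∈ Z then 0 else (hx (d n)).mk _ τ := by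
      funext τ
      by_cases h : τ ∈ Z
      · simp [G, h]
      · have : τ ∉ {τ | ¬ ∀ n, op m (w τ) (d n) = (hx (d n)).mk _ τ} := fun h' => h (hZ h')
        simp only [Set.mem_ofPred_eq, not_not] at this
        simp only [G, h, if_false]
        exact this n
    rw [this]
    exact Measurable.ite hZm measurable_const (hx (d n)).measurable_mk
  have hGm : ∀ x, Measurable (G x) := by
    intro x
    obtain ⟨u, hu, hux⟩ := mem_closure_iff_seq_limit.1 (hd x)
    choose n hn using hu
    refine measurable_of_tendsto_metrizable (f := fun k => G (u k)) (fun k => ?_) ?_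
    · rw [← hn k]; exact hGd (n k)
    · exact tendsto_pi_nhds.2 fun τ => ((hGc τ).tendsto x).comp hux
  have hG : Measurable (Function.uncurry G) :=
    measurable_uncurry_of_continuous_of_measurable hGc hGm
  refine ⟨fun z => G z.2 z.1, hG.comp measurable_swap, hGc, ?_⟩
  have : ∀ᵐ τ ∂μ, τ ∉ Z := by
    rw [ae_iff]; simpa using hZ0
  filter_upwards [this] with τ hτ x
  simp [G, hτ]

/-! ### Symbols and their dilations -/

/-- Dilation `m ↦ m(2⁻^q ·)` of a symbol. -/
def dil (q : ℤ) (m : 𝓢(Space, ℂ)) : 𝓢(Space, ℂ) :=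
  SchwartzMap.compCLMOfContinuousLinearEquiv ℂ
    (ContinuousLinearEquiv.smulLeft (R₁ := ℝ) (M₁ := Space)
      (Units.mk0 ((2 : ℝ) ^ (-q)) (by positivity))) m

@[simp] theorem dil_apply (q : ℤ) (m : 𝓢(Space, ℂ)) (ξ : Space) :
    dil q m ξ = m ((2 : ℝ) ^ (-q) • ξ) := rfl

theorem mulI_dil (k : Fin 3) (q : ℤ) (m : 𝓢(Space, ℂ)) :
    mulI k (dil q m) = ((2 : ℂ) ^ q) • dil q (mulI k m) := by
  ext ξ
  simp only [mulI_apply, dil_apply, smul_apply, smul_eq_mul, PiLp.smul_apply]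
  have : (2 : ℂ) ^ q * (2 : ℂ) ^ (-q) = 1 := by
    rw [← zpow_add₀ two_ne_zero]; simp
  push_cast
  linear_combination (-(2 * Real.pi * Complex.I * (ξ k : ℂ) *
    m ((2 : ℝ) ^ (-q) • ξ))) * this

theorem fourierInv_dil (q : ℤ) (m : 𝓢(Space, ℂ)) (x : Space) :
    (𝓕⁻ (dil q m)) x = (((2 : ℝ) ^ q) ^ 3 : ℝ) • (𝓕⁻ m) ((2 : ℝ) ^ q • x) := by
  rw [fourierInv_schwartz_apply, fourierInv_schwartz_apply]
  have h := Measure.integral_comp_smul (volume : Measure Space)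
    (fun ξ => chr ((2 : ℝ) ^ q • x) ξ * m ξ) ((2 : ℝ) ^ (-q))
  have h2 : ∀ ξ : Space, chr ((2 : ℝ) ^ q • x) ((2 : ℝ) ^ (-q) • ξ) = chr x ξ := by
    intro ξ
    have : (2 : ℝ) ^ q * (2 : ℝ) ^ (-q) = 1 := by
      rw [← zpow_add₀ two_ne_zero]; simp
    simp only [chr, inner_smul_left, inner_smul_right]
    congr 3
    simp only [conj_trivial]
    linear_combination (2 * Real.pi * inner ℝ x ξ) * this
  simp only [h2] at h
  simp only [dil_apply]
  rw [h]
  simp only [finrank_euclideanSpace, Fintype.card_fin]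
  congr 1
  rw [abs_of_pos (by positivity), ← inv_pow, ← zpow_neg, neg_neg]

/-- The `L¹` norm of the kernel of a symbol. -/
def kerNorm (m : 𝓢(Space, ℂ)) : ℝ := ∫ x, ‖(𝓕⁻ m) x‖

/-- The first moment of the kernel of a symbol. -/
def kerMoment (m : 𝓢(Space, ℂ)) : ℝ := ∫ x, ‖x‖ * ‖(𝓕⁻ m) x‖

theorem kerNorm_nonneg (m : 𝓢(Space, ℂ)) : 0 ≤ kerNorm m := integral_nonneg fun _ => norm_nonneg _

theorem kerMoment_nonneg (m : 𝓢(Space, ℂ)) : 0 ≤ kerMoment m :=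
  integral_nonneg fun _ => by positivity

theorem kerNorm_dil (q : ℤ) (m : 𝓢(Space, ℂ)) : kerNorm (dil q m) = kerNorm m := by
  have h := Measure.integral_comp_smul (volume : Measure Space) (fun x => ‖(𝓕⁻ m) x‖) ((2 : ℝ) ^ q)
  simp only [finrank_euclideanSpace, Fintype.card_fin] at h
  simp only [kerNorm, fourierInv_dil, norm_smul, Real.norm_eq_abs]
  rw [integral_const_mul, h, smul_eq_mul, ← mul_assoc, ← abs_mul, mul_inv_cancel₀ (by positivity)]
  simp

theorem kerMoment_dil (q : ℤ) (m : 𝓢(Space, ℂ)) :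
    kerMoment (dil q m) = (2 : ℝ) ^ (-q) * kerMoment m := by
  have h := Measure.integral_comp_smul (volume : Measure Space)
    (fun x => ‖x‖ * ‖(𝓕⁻ m) x‖) ((2 : ℝ) ^ q)
  simp only [finrank_euclideanSpace, Fintype.card_fin] at h
  have h2 : ∀ x : Space, ‖x‖ * ‖(𝓕⁻ (dil q m)) x‖ = ((2 : ℝ) ^ (-q) * |((2 : ℝ) ^ q) ^ 3|) *
      (‖(2 : ℝ) ^ q • x‖ * ‖(𝓕⁻ m) ((2 : ℝ) ^ q • x)‖) := by
    intro x
    rw [fourierInv_dil, norm_smul, norm_smul, Real.norm_eq_abs, Real.norm_eq_abs,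
      abs_of_pos (a := (2 : ℝ) ^ q) (by positivity), zpow_neg]
    field_simp
  simp only [kerMoment, h2]
  rw [integral_const_mul, h, smul_eq_mul, mul_assoc, ← mul_assoc |_|, ← abs_mul,
    mul_inv_cancel₀ (by positivity)]
  simp

theorem kerNorm_smul (c : ℂ) (m : 𝓢(Space, ℂ)) : kerNorm (c • m) = ‖c‖ * kerNorm m := by
  simp only [kerNorm, FourierTransform.fourierInv_smul, smul_apply, norm_smul]
  rw [integral_const_mul]

theorem kerMoment_smul (c : ℂ) (m : 𝓢(Space, ℂ)) : kerMoment (c • m) = ‖c‖ * kerMoment m := by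
  simp only [kerMoment, FourierTransform.fourierInv_smul, smul_apply, norm_smul]
  rw [← integral_const_mul]
  congr 1; funext x; ring

theorem kerNorm_mulI_dil (k : Fin 3) (q : ℤ) (m : 𝓢(Space, ℂ)) :
    kerNorm (mulI k (dil q m)) = (2 : ℝ) ^ q * kerNorm (mulI k m) := by
  rw [mulI_dil, kerNorm_smul, kerNorm_dil]; simp

theorem kerMoment_mulI_dil (k : Fin 3) (q : ℤ) (m : 𝓢(Space, ℂ)) :
    kerMoment (mulI k (dil q m)) = kerMoment (mulI k m) := by
  rw [mulI_dil, kerMoment_smul, kerMoment_dil, ← mul_assoc, norm_zpow, Complex.norm_ofNat,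
    ← zpow_add₀ two_ne_zero, add_neg_cancel, zpow_zero, one_mul]

/-! ### Plancherel identity and Fourier densities -/

section Plancherel

/-- The inverse Fourier transform of a function, as an integral. -/
def invFourier (g : Space → ℂ) (x : Space) : ℂ := ∫ ξ, chr x ξ * g ξ

theorem norm_invFourier_le (g : Space → ℂ) (x : Space) : ‖invFourier g x‖ ≤ ∫ ξ, ‖g ξ‖ := by
  refine (norm_integral_le_integral_norm _).trans_eq ?_
  simp [norm_chr]

theorem integrable_chr_mul {g : Space → ℂ} (hg : Integrable g) (x : Space) :
    Integrable fun ξ => chr x ξ * g ξ :=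
  hg.bdd_mul (c := 1) (continuous_chr x).aestronglyMeasurable
    (.of_forall fun ξ => (norm_chr x ξ).le)

theorem continuous_invFourier {g : Space → ℂ} (hg : Integrable g) : Continuous (invFourier g) := by
  refine continuous_of_dominated (bound := fun ξ => ‖g ξ‖) (fun x => ?_) (fun x => ?_) hg.norm ?_
  · exact (integrable_chr_mul hg x).aestronglyMeasurable
  · exact .of_forall fun ξ => by simp [norm_chr]
  · refine .of_forall fun ξ => ?_
    simp only [chr_comm _ ξ]
    exact (continuous_chr ξ).mul continuous_const

theorem integral_mul_invFourier {g : Space → ℂ} (hg : Integrable g) (ψ : 𝓢(Space, ℂ)) :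
    ∫ x, ψ x * invFourier g x = ∫ ξ, (𝓕⁻ ψ) ξ * g ξ := by
  have hi : Integrable (Function.uncurry fun x ξ => chr x ξ * (ψ x * g ξ))
      ((volume : Measure Space).prod volume) := by
    refine (ψ.integrable.mul_prod hg).bdd_mul (c := 1)
      continuous_chr_uncurry.aestronglyMeasurable (.of_forall fun z => (norm_chr _ _).le)
  have h := integral_integral_swap hi
  calc ∫ x, ψ x * invFourier g x = ∫ x, ∫ ξ, chr x ξ * (ψ x * g ξ) := by
        congr 1; funext x
        rw [invFourier, ← integral_const_mul]
        congr 1; funext ξ; ring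
    _ = ∫ ξ, ∫ x, chr x ξ * (ψ x * g ξ) := h
    _ = _ := by
        congr 1; funext ξ
        rw [fourierInv_schwartz_apply, ← integral_mul_const]
        congr 1; funext x
        rw [chr_comm]; ring

theorem ae_eq_zero_of_schwartz {f : Space → ℂ} (hf : LocallyIntegrable f)
    (h : ∀ ψ : 𝓢(Space, ℂ), ∫ x, ψ x * f x = 0) : f =ᵐ[volume] 0 := by
  refine ae_eq_zero_of_integral_contDiff_smul_eq_zero hf fun g hg hgc => ?_
  have h1 : HasCompactSupport fun x => (g x : ℂ) := hgc.comp_left (g := fun r : ℝ => (r : ℂ)) rfl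
  have h2 : ContDiff ℝ ∞ fun x => (g x : ℂ) := Complex.ofRealCLM.contDiff.comp hg
  simpa [HasCompactSupport.toSchwartzMap_toFun] using h (h1.toSchwartzMap h2)

theorem integrable_schwartz_mul (ψ : 𝓢(Space, ℂ)) {f : Space → ℂ} (hf : MemLp f 2) :
    Integrable fun x => ψ x * f x :=
  MemLp.integrable_mul (p := 2) (q := 2) (ψ.memLp 2 volume) hf

theorem invFourier_ae_eq {g : Space → ℂ} (hg : Integrable g) (hg2 : MemLp g 2) :
    invFourier g =ᵐ[volume] (𝓕⁻ (hg2.toLp g) : Lp ℂ 2 (volume : Measure Space)) := by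
  have h1 : LocallyIntegrable (invFourier g) := (continuous_invFourier hg).locallyIntegrable
  have h2 : LocallyIntegrable (𝓕⁻ (hg2.toLp g) : Lp ℂ 2 (volume : Measure Space)) :=
    (Lp.memLp _).locallyIntegrable (by norm_num)
  have h3 := ae_eq_zero_of_schwartz (h1.sub h2) fun ψ => ?_
  · filter_upwards [h3] with x hx
    simpa [sub_eq_zero] using hx
  · have e1 := congrArg (fun S : 𝓢'(Space, ℂ) => S ψ)
      (Lp.fourierInv_toTemperedDistribution_eq (hg2.toLp g))
    simp only [TemperedDistribution.fourierInv_apply, Lp.toTemperedDistribution_apply,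
      smul_eq_mul] at e1
    have e2 : ∫ ξ, (𝓕⁻ ψ) ξ * (hg2.toLp g) ξ = ∫ ξ, (𝓕⁻ ψ) ξ * g ξ := by
      refine integral_congr_ae ?_
      filter_upwards [hg2.coeFn_toLp] with ξ hξ
      rw [hξ]
    rw [e2, ← integral_mul_invFourier hg] at e1
    have i1 : Integrable fun x => ψ x * invFourier g x :=
      ψ.integrable.mul_bdd (c := ∫ ξ, ‖g ξ‖) (continuous_invFourier hg).aestronglyMeasurable
        (.of_forall fun x => norm_invFourier_le g x)
    have i2 : Integrable fun x => ψ x * (𝓕⁻ (hg2.toLp g) : Lp ℂ 2 (volume : Measure Space)) x :=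
      integrable_schwartz_mul ψ (Lp.memLp _)
    simp only [Pi.sub_apply, mul_sub]
    rw [integral_sub i1 i2, e1, sub_self]

theorem eLpNorm_eq_of_norm_eq {f g : Lp ℂ 2 (volume : Measure Space)} (h : ‖f‖ = ‖g‖) :
    eLpNorm f 2 volume = eLpNorm g 2 volume := by
  rw [Lp.norm_def, Lp.norm_def] at h
  exact (ENNReal.toReal_eq_toReal_iff' (Lp.eLpNorm_ne_top _) (Lp.eLpNorm_ne_top _)).1 h

theorem eLpNorm_invFourier {g : Space → ℂ} (hg : Integrable g) (hg2 : MemLp g 2) :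
    eLpNorm (invFourier g) 2 volume = eLpNorm g 2 volume := by
  rw [eLpNorm_congr_ae (invFourier_ae_eq hg hg2), ← eLpNorm_congr_ae hg2.coeFn_toLp]
  exact eLpNorm_eq_of_norm_eq ((Lp.fourierTransformₗᵢ Space ℂ).symm.norm_map _)

theorem integral_conj_invFourier {g g' : Space → ℂ} (hg : Integrable g) (hg2 : MemLp g 2)
    (hg' : Integrable g') (hg2' : MemLp g' 2) :
    ∫ x, starRingEnd ℂ (invFourier g x) * invFourier g' x = ∫ ξ, starRingEnd ℂ (g ξ) * g' ξ := by
  have h : inner ℂ (𝓕⁻ (hg2.toLp g) : Lp ℂ 2 (volume : Measure Space)) (𝓕⁻ (hg2'.toLp g')) =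
      inner ℂ (hg2.toLp g) (hg2'.toLp g') := by
    rw [← Lp.inner_fourier_eq, FourierTransform.fourier_fourierInv_eq,
      FourierTransform.fourier_fourierInv_eq]
  rw [L2.inner_def, L2.inner_def] at h
  calc _ = ∫ x, inner ℂ ((𝓕⁻ (hg2.toLp g) : Lp ℂ 2 (volume : Measure Space)) x)
        ((𝓕⁻ (hg2'.toLp g') : Lp ℂ 2 (volume : Measure Space)) x) := by
        refine integral_congr_ae ?_
        filter_upwards [invFourier_ae_eq hg hg2, invFourier_ae_eq hg' hg2'] with x h1 h2
        rw [h1, h2, RCLike.inner_apply, mul_comm]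
    _ = _ := h
    _ = _ := by
        refine integral_congr_ae ?_
        filter_upwards [hg2.coeFn_toLp, hg2'.coeFn_toLp] with x h1 h2
        rw [h1, h2, RCLike.inner_apply, mul_comm]

end Plancherel

/-- `a` is a function, square integrable on balls, which is the Fourier transform of `T` when
tested against compactly supported functions. -/
structure HasDensity (T : 𝓢'(Space, ℂ)) (a : Space → ℂ) : Prop where
  measurable : Measurable a
  memLp : ∀ R : ℝ, MemLp ((Metric.ball 0 R).indicator a) 2 volume
  apply_eq : ∀ m : 𝓢(Space, ℂ), HasCompactSupport m → (𝓕 T) m = ∫ ξ, a ξ * m ξ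

namespace HasDensity

variable {T : 𝓢'(Space, ℂ)} {a : Space → ℂ}

theorem memLp_mul (h : HasDensity T a) {m : Space → ℂ} (hm : Continuous m)
    (hc : HasCompactSupport m) : MemLp (fun ξ => a ξ * m ξ) 2 := by
  obtain ⟨R, hR⟩ := hc.isCompact.isBounded.subset_ball 0
  obtain ⟨C, hC⟩ := hm.bounded_above_of_compact_support hc
  refine (h.memLp R).of_le_mul (c := C) (h.measurable.mul hm.measurable).aestronglyMeasurable
    (.of_forall fun ξ => ?_)
  by_cases hξ : ξ ∈ Metric.ball (0 : Space) R
  · simp only [Set.indicator_of_mem hξ, norm_mul]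
    rw [mul_comm]
    gcongr
    exact hC ξ
  · have : m ξ = 0 := image_eq_zero_of_notMem_tsupport fun h' => hξ (hR h')
    simp [this, hξ]

theorem integrable_mul (h : HasDensity T a) {m : Space → ℂ} (hm : Continuous m)
    (hc : HasCompactSupport m) : Integrable fun ξ => a ξ * m ξ := by
  obtain ⟨R, hR⟩ := hc.isCompact.isBounded.subset_ball 0
  have h1 : MemLp ((Metric.ball (0 : Space) R).indicator fun _ => (1 : ℂ)) 2 volume :=
    memLp_indicator_const 2 measurableSet_ball 1 (Or.inr measure_ball_lt_top.ne)
  have h2 := (h.memLp_mul hm hc).integrable_mul h1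
  refine h2.congr (.of_forall fun ξ => ?_)
  by_cases hξ : ξ ∈ Metric.ball (0 : Space) R
  · simp [hξ]
  · have : m ξ = 0 := image_eq_zero_of_notMem_tsupport fun h' => hξ (hR h')
    simp [this]

theorem hasCompactSupport_modS {m : 𝓢(Space, ℂ)} (hc : HasCompactSupport m) (x : Space) :
    HasCompactSupport (modS x m) := by
  have : ⇑(modS x m) = fun ξ => chr x ξ * m ξ := funext (modS_apply x m)
  rw [this]
  exact hc.mul_left

theorem op_eq (h : HasDensity T a) {m : 𝓢(Space, ℂ)} (hc : HasCompactSupport m) (x : Space) :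
    op m T x = invFourier (fun ξ => a ξ * m ξ) x := by
  rw [op, h.apply_eq _ (hasCompactSupport_modS hc x), invFourier]
  congr 1; funext ξ; rw [modS_apply]; ring

theorem eLpNorm_op (h : HasDensity T a) {m : 𝓢(Space, ℂ)} (hc : HasCompactSupport m) :
    eLpNorm (op m T) 2 volume = eLpNorm (fun ξ => a ξ * m ξ) 2 volume := by
  rw [funext (h.op_eq hc), eLpNorm_invFourier (h.integrable_mul m.continuous hc)
    (h.memLp_mul m.continuous hc)]

theorem memLp_op (h : HasDensity T a) {m : 𝓢(Space, ℂ)} (hc : HasCompactSupport m) :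
    MemLp (op m T) 2 :=
  ⟨(continuous_op m T).aestronglyMeasurable,
    (h.eLpNorm_op hc).trans_lt (h.memLp_mul m.continuous hc).2⟩

theorem integral_conj_op {T' : 𝓢'(Space, ℂ)} {a' : Space → ℂ} (h : HasDensity T a)
    (h' : HasDensity T' a') {m m' : 𝓢(Space, ℂ)} (hc : HasCompactSupport m)
    (hc' : HasCompactSupport m') :
    ∫ x, starRingEnd ℂ (op m T x) * op m' T' x =
      ∫ ξ, starRingEnd ℂ (a ξ * m ξ) * (a' ξ * m' ξ) := by
  rw [funext (h.op_eq hc), funext (h'.op_eq hc')]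
  exact integral_conj_invFourier (h.integrable_mul m.continuous hc) (h.memLp_mul m.continuous hc)
    (h'.integrable_mul m'.continuous hc') (h'.memLp_mul m'.continuous hc')

theorem hasCompactSupport_mulI {m : 𝓢(Space, ℂ)} (hc : HasCompactSupport m) (k : Fin 3) :
    HasCompactSupport (mulI k m) := by
  have : ⇑(mulI k m) = fun ξ => 2 * Real.pi * Complex.I * ((ξ k : ℝ) : ℂ) * m ξ :=
    funext (mulI_apply k m)
  rw [this]
  exact hc.mul_left

theorem lineDeriv (h : HasDensity T a) (k : Fin 3) :
    HasDensity (∂_{e k} T) fun ξ => 2 * Real.pi * Complex.I * ((ξ k : ℝ) : ℂ) * a ξ where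
  measurable := by
    have := h.measurable
    fun_prop
  memLp R := by
    have hm : AEStronglyMeasurable ((Metric.ball (0 : Space) R).indicator
        fun ξ => 2 * Real.pi * Complex.I * ((ξ k : ℝ) : ℂ) * a ξ) volume := by
      have := h.measurable
      exact ((by fun_prop : Measurable fun ξ : Space => 2 * Real.pi * Complex.I *
        ((ξ k : ℝ) : ℂ) * a ξ).indicator measurableSet_ball).aestronglyMeasurable
    refine (h.memLp R).of_le_mul (c := 2 * Real.pi * |R|) hm (.of_forall fun ξ => ?_)
    by_cases hξ : ξ ∈ Metric.ball (0 : Space) R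
    · simp only [Set.indicator_of_mem hξ, norm_mul, Complex.norm_real, Complex.norm_I,
        Real.norm_eq_abs, Complex.norm_ofNat, mul_one, abs_of_pos Real.pi_pos]
      have h1 : |ξ k| ≤ |R| := by
        have h2 := PiLp.norm_apply_le ξ k
        rw [Real.norm_eq_abs] at h2
        have h3 : ‖ξ‖ < R := by simpa using hξ
        exact h2.trans (h3.le.trans (le_abs_self R))
      gcongr
    · simp [Set.indicator_of_notMem hξ]
  apply_eq m hc := by
    rw [fourier_lineDeriv_apply, h.apply_eq _ (hasCompactSupport_mulI hc k)]
    congr 1; funext ξ; rw [mulI_apply]; ring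

end HasDensity

theorem exists_density_of_memLp_op {T : 𝓢'(Space, ℂ)} {m : 𝓢(Space, ℂ)} (hT : MemLp (op m T) 2) :
    ∃ A : Space → ℂ, Measurable A ∧ MemLp A 2 ∧
      ∀ ψ : 𝓢(Space, ℂ), (𝓕 T) (mulS ψ m) = ∫ ξ, ψ ξ * A ξ := by
  have hb : ∀ ψ : 𝓢(Space, ℂ), (𝓕 T) (mulS ψ m) =
      ∫ ξ, ψ ξ * (𝓕 hT.toLp : Lp ℂ 2 (volume : Measure Space)) ξ := by
    intro ψ
    have e1 := congrArg (fun S : 𝓢'(Space, ℂ) => S ψ)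
      (Lp.fourier_toTemperedDistribution_eq hT.toLp)
    simp only [TemperedDistribution.fourier_apply, Lp.toTemperedDistribution_apply,
      smul_eq_mul] at e1
    rw [← e1]
    have e2 : ∫ ξ, (𝓕 ψ) ξ * (hT.toLp (op m T)) ξ = ∫ ξ, (𝓕 ψ) ξ * op m T ξ := by
      refine integral_congr_ae ?_
      filter_upwards [hT.coeFn_toLp] with ξ hξ
      rw [hξ]
    rw [e2, integral_mul_op, FourierTransform.fourierInv_fourier_eq]
  generalize (𝓕 hT.toLp : Lp ℂ 2 (volume : Measure Space)) = b at hb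
  have hAb := (Lp.aestronglyMeasurable b).ae_eq_mk
  refine ⟨(Lp.aestronglyMeasurable b).mk,
    (Lp.aestronglyMeasurable b).stronglyMeasurable_mk.measurable,
    (memLp_congr_ae hAb).1 (Lp.memLp b), fun ψ => ?_⟩
  rw [hb]
  refine integral_congr_ae ?_
  filter_upwards [hAb] with ξ hξ
  rw [hξ]

/-- A distribution whose low frequency parts are all square integrable has a Fourier density. -/
theorem exists_hasDensity {T : 𝓢'(Space, ℂ)} {m : ℕ → 𝓢(Space, ℂ)}
    (hm : ∀ (J : ℕ) (ξ : Space), 9 * ‖ξ‖ ≤ 2 ^ J → m J ξ = 1)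
    (hT : ∀ J, MemLp (op (m J) T) 2) : ∃ a, HasDensity T a := by
  choose A hAm hA2 hb using fun J => exists_density_of_memLp_op (hT J)
  have hA : ∀ J (ψ : 𝓢(Space, ℂ)), (∀ ξ, ψ ξ ≠ 0 → 9 * ‖ξ‖ ≤ 2 ^ J) →
      (𝓕 T) ψ = ∫ ξ, ψ ξ * A J ξ := by
    intro J ψ hψ
    have h1 : mulS ψ (m J) = ψ := by
      ext ξ
      rw [mulS_apply]
      by_cases h : ψ ξ = 0
      · simp [h]
      · rw [hm J ξ (hψ ξ h), mul_one]
    rw [← h1, hb, h1]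
  -- Two of the densities agree where both symbols are equal to `1`.
  have hcompat : ∀ J J', J ≤ J' → ∀ᵐ ξ, ξ ∈ Metric.ball (0 : Space) (2 ^ J / 9) →
      A J ξ = A J' ξ := by
    intro J J' hJ
    have hloc : ∀ J, LocallyIntegrable (A J) := fun J => (hA2 J).locallyIntegrable (by norm_num)
    have := Metric.isOpen_ball.ae_eq_zero_of_integral_contDiff_smul_eq_zero
      (U := Metric.ball (0 : Space) (2 ^ J / 9)) (f := fun ξ => A J ξ - A J' ξ)
      (((hloc J).sub (hloc J')).locallyIntegrableOn _) fun g hg hgc hgs => ?_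
    · filter_upwards [this] with ξ h1 h2
      exact sub_eq_zero.1 (h1 h2)
    · have h1 : HasCompactSupport fun x => (g x : ℂ) :=
        hgc.comp_left (g := fun r : ℝ => (r : ℂ)) rfl
      have h2 : ContDiff ℝ ∞ fun x => (g x : ℂ) := Complex.ofRealCLM.contDiff.comp hg
      have hs : ∀ ξ, (h1.toSchwartzMap h2) ξ ≠ 0 → 9 * ‖ξ‖ ≤ 2 ^ J := by
        intro ξ hξ
        have h3 : g ξ ≠ 0 := by simpa using hξ
        have h4 : ξ ∈ Metric.ball (0 : Space) (2 ^ J / 9) := hgs (subset_tsupport _ h3)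
        rw [mem_ball_zero_iff] at h4
        linarith
      have h3 := hA J _ hs
      have h4 := hA J' _ fun ξ hξ => (hs ξ hξ).trans (pow_le_pow_right₀ (by norm_num) hJ)
      have i : ∀ J, Integrable fun ξ => (h1.toSchwartzMap h2) ξ * A J ξ := fun J =>
        integrable_schwartz_mul _ (hA2 J)
      have h5 : ∫ ξ, ((h1.toSchwartzMap h2) ξ * A J ξ - (h1.toSchwartzMap h2) ξ * A J' ξ) = 0 := by
        rw [integral_sub (i J) (i J'), ← h3, ← h4, sub_self]
      rw [← h5]
      congr 1; funext ξ
      simp [HasCompactSupport.toSchwartzMap_toFun, mul_sub]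
  -- The densities are glued along `N ξ = ⌈9‖ξ‖⌉`; since `n < 2 ^ n`, the symbol `m (N ξ)` is `1` at
  -- `ξ`.
  obtain ⟨N, hN, hN1, hN2⟩ : ∃ N : Space → ℕ, Measurable N ∧ (∀ ξ, 9 * ‖ξ‖ ≤ N ξ) ∧
      ∀ ξ (J : ℕ), 9 * ‖ξ‖ ≤ J → N ξ ≤ J := by
    have : Measurable fun ξ : Space => 9 * ‖ξ‖ := by fun_prop
    exact ⟨fun ξ => ⌈9 * ‖ξ‖⌉₊, Nat.measurable_ceil.comp this, fun ξ => Nat.le_ceil _,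
      fun ξ J h => Nat.ceil_le.2 h⟩
  obtain ⟨a, ham, ha0⟩ : ∃ a : Space → ℂ, Measurable a ∧ ∀ ξ, a ξ = A (N ξ) ξ := by
    have h1 : Measurable fun z : ℕ × Space => A z.1 z.2 :=
      measurable_from_prod_countable_right fun J => hAm J
    exact ⟨fun ξ => A (N ξ) ξ, h1.comp (hN.prodMk measurable_id), fun ξ => rfl⟩
  have ha : ∀ J : ℕ, ∀ᵐ ξ, 9 * ‖ξ‖ ≤ J → a ξ = A J ξ := by
    intro J
    have h1 : ∀ᵐ ξ, ∀ n ≤ J, ξ ∈ Metric.ball (0 : Space) (2 ^ n / 9) → A n ξ = A J ξ := by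
      rw [ae_all_iff]
      intro n
      by_cases hn : n ≤ J
      · filter_upwards [hcompat n J hn] with ξ hξ _ using hξ
      · exact .of_forall fun ξ h => absurd h hn
    filter_upwards [h1] with ξ hξ hJ
    rw [ha0]
    refine hξ (N ξ) (hN2 ξ J hJ) ?_
    rw [mem_ball_zero_iff, lt_div_iff₀ (by norm_num)]
    have h2 := hN1 ξ
    have h3 : ((N ξ : ℕ) : ℝ) < 2 ^ N ξ := by exact_mod_cast Nat.lt_two_pow_self
    linarith
  refine ⟨a, ham, fun R => ?_, fun ψ hψ => ?_⟩
  · obtain ⟨J, hJ⟩ := exists_nat_ge (9 * R)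
    refine (hA2 J).of_le (ham.indicator measurableSet_ball).aestronglyMeasurable ?_
    filter_upwards [ha J] with ξ hξ
    by_cases h : ξ ∈ Metric.ball (0 : Space) R
    · rw [Set.indicator_of_mem h, hξ]
      rw [mem_ball_zero_iff] at h
      linarith
    · simp [Set.indicator_of_notMem h]
  · obtain ⟨R, hR⟩ := hψ.isCompact.isBounded.subset_ball 0
    obtain ⟨J, hJ⟩ := exists_nat_ge (9 * R)
    have hs : ∀ ξ, ψ ξ ≠ 0 → 9 * ‖ξ‖ ≤ J := by
      intro ξ hξ
      have := hR (subset_tsupport _ hξ)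
      rw [mem_ball_zero_iff] at this
      linarith
    have h3 : (J : ℝ) ≤ 2 ^ J := by exact_mod_cast Nat.lt_two_pow_self.le
    rw [hA J ψ fun ξ hξ => (hs ξ hξ).trans h3]
    refine integral_congr_ae ?_
    filter_upwards [ha J] with ξ hξ
    by_cases h : ψ ξ = 0
    · simp [h]
    · rw [hξ (hs ξ h), mul_comm]

/-! ### Dyadic symbols -/

/-- A product of a compactly supported Schwartz function vanishing near the origin with a function
that is smooth away from the origin. -/
theorem exists_schwartz_mul {m : 𝓢(Space, ℂ)} (hc : HasCompactSupport m) {r : ℝ} (hr : 0 < r)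
    (hm : ∀ ξ, ‖ξ‖ < r → m ξ = 0) {g : Space → ℂ} (hg : ∀ ξ, ξ ≠ 0 → ContDiffAt ℝ ∞ g ξ) :
    ∃ n : 𝓢(Space, ℂ), ∀ ξ, n ξ = m ξ * g ξ := by
  have h1 : HasCompactSupport fun ξ => m ξ * g ξ := hc.mul_right
  have h2 : ContDiff ℝ ∞ fun ξ => m ξ * g ξ := by
    refine contDiff_iff_contDiffAt.2 fun ξ => ?_
    by_cases h : ξ = 0
    · subst h
      have : (fun ξ => m ξ * g ξ) =ᶠ[𝓝 0] fun _ => 0 := by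
        filter_upwards [Metric.ball_mem_nhds (0 : Space) hr] with ξ hξ
        rw [hm ξ (mem_ball_zero_iff.1 hξ), zero_mul]
      exact contDiffAt_const.congr_of_eventuallyEq this
    · exact ((m.smooth ⊤).contDiffAt).mul (hg ξ h)
  exact ⟨h1.toSchwartzMap h2, fun ξ => rfl⟩

theorem hasCompactSupport_dil (q : ℤ) {m : 𝓢(Space, ℂ)} (hc : HasCompactSupport m) :
    HasCompactSupport (dil q m) :=
  hc.comp_smul (c := (2 : ℝ) ^ (-q)) (by positivity)

theorem exists_scaled_schwartz {f : Space → ℝ} (hf : ContDiff ℝ ∞ f) {R : ℝ}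
    (h : ∀ ξ, f ξ ≠ 0 → ‖ξ‖ ≤ R) :
    ∃ m : 𝓢(Space, ℂ), HasCompactSupport m ∧ ∀ ξ, m ξ = (f ((2 * Real.pi) • ξ) : ℂ) := by
  have hc : (2 * Real.pi) ≠ 0 := by positivity
  have h1 : HasCompactSupport fun ξ : Space => f ((2 * Real.pi) • ξ) :=
    (hasCompactSupport_of_bound h).comp_smul hc
  have h2 : HasCompactSupport fun ξ : Space => (f ((2 * Real.pi) • ξ) : ℂ) :=
    h1.comp_left (g := fun r : ℝ => (r : ℂ)) (by simp)
  have h3 : ContDiff ℝ ∞ fun ξ : Space => (f ((2 * Real.pi) • ξ) : ℂ) :=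
    Complex.ofRealCLM.contDiff.comp (hf.comp (contDiff_const_smul _))
  exact ⟨h2.toSchwartzMap h3, h2, fun ξ => rfl⟩

namespace LittlewoodPaley

variable (P : LittlewoodPaley)

/-- The symbol of `χ(D)`. -/
def chi0 : 𝓢(Space, ℂ) := (exists_scaled_schwartz P.chi_smooth P.chi_supp).choose

/-- The symbol of `φ(D)`. -/
def phi0 : 𝓢(Space, ℂ) :=
  (exists_scaled_schwartz P.phi_smooth fun ξ hξ => (P.phi_supp ξ hξ).2).choose

theorem hasCompactSupport_chi0 : HasCompactSupport P.chi0 :=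
  (exists_scaled_schwartz P.chi_smooth P.chi_supp).choose_spec.1

theorem hasCompactSupport_phi0 : HasCompactSupport P.phi0 :=
  (exists_scaled_schwartz P.phi_smooth fun ξ hξ => (P.phi_supp ξ hξ).2).choose_spec.1

theorem chi0_apply (ξ : Space) : P.chi0 ξ = (P.chi ((2 * Real.pi) • ξ) : ℂ) :=
  (exists_scaled_schwartz P.chi_smooth P.chi_supp).choose_spec.2 ξ

theorem phi0_apply (ξ : Space) : P.phi0 ξ = (P.phi ((2 * Real.pi) • ξ) : ℂ) :=
  (exists_scaled_schwartz P.phi_smooth fun ξ hξ => (P.phi_supp ξ hξ).2).choose_spec.2 ξ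

/-- The symbol of `χ(2⁻^q D)`, for an integer `q` of any sign. -/
def chiS (q : ℤ) : 𝓢(Space, ℂ) := dil q P.chi0

/-- The symbol of `φ(2⁻^q D)`, for an integer `q` of any sign. -/
def phiS (q : ℤ) : 𝓢(Space, ℂ) := dil q P.phi0

theorem hasCompactSupport_chiS (q : ℤ) : HasCompactSupport (P.chiS q) :=
  hasCompactSupport_dil q P.hasCompactSupport_chi0

theorem hasCompactSupport_phiS (q : ℤ) : HasCompactSupport (P.phiS q) :=
  hasCompactSupport_dil q P.hasCompactSupport_phi0

theorem chiS_apply (q : ℤ) (ξ : Space) :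
    P.chiS q ξ = (P.chi ((2 : ℝ) ^ (-q) • (2 * Real.pi) • ξ) : ℂ) := by
  rw [chiS, dil_apply, chi0_apply, smul_comm]

theorem phiS_apply (q : ℤ) (ξ : Space) :
    P.phiS q ξ = (P.phi ((2 : ℝ) ^ (-q) • (2 * Real.pi) • ξ) : ℂ) := by
  rw [phiS, dil_apply, phi0_apply, smul_comm]

theorem norm_scaled (q : ℤ) (ξ : Space) :
    ‖(2 : ℝ) ^ (-q) • (2 * Real.pi) • ξ‖ = (2 : ℝ) ^ (-q) * (2 * Real.pi * ‖ξ‖) := by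
  rw [norm_smul, norm_smul, Real.norm_of_nonneg (by positivity),
    Real.norm_of_nonneg (by positivity)]

theorem chiS_supp {q : ℤ} {ξ : Space} (h : P.chiS q ξ ≠ 0) :
    2 * Real.pi * ‖ξ‖ ≤ 4 / 3 * (2 : ℝ) ^ q := by
  rw [chiS_apply, Ne, Complex.ofReal_eq_zero] at h
  have := P.chi_supp _ h
  rwa [norm_scaled, zpow_neg, inv_mul_le_iff₀ (by positivity), mul_comm ((2 : ℝ) ^ q)] at this

theorem phiS_supp {q : ℤ} {ξ : Space} (h : P.phiS q ξ ≠ 0) :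
    3 / 4 * (2 : ℝ) ^ q ≤ 2 * Real.pi * ‖ξ‖ ∧ 2 * Real.pi * ‖ξ‖ ≤ 8 / 3 * (2 : ℝ) ^ q := by
  rw [phiS_apply, Ne, Complex.ofReal_eq_zero] at h
  have := P.phi_supp _ h
  rwa [norm_scaled, zpow_neg, inv_mul_le_iff₀ (by positivity), le_inv_mul_iff₀ (by positivity),
    mul_comm, mul_comm ((2 : ℝ) ^ q)] at this

theorem chi_eq_one {ξ : Space} (h : ‖ξ‖ < 3 / 4) : P.chi ξ = 1 := by
  have h0 : ∀ j : ℕ, P.phi (((2 : ℝ) ^ j)⁻¹ • ξ) = 0 := by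
    intro j
    by_contra hne
    have h1 := (P.phi_supp _ hne).1
    rw [norm_smul, Real.norm_of_nonneg (by positivity)] at h1
    have h2 : ((2 : ℝ) ^ j)⁻¹ ≤ 1 := inv_le_one_of_one_le₀ (one_le_pow₀ (by norm_num))
    nlinarith [norm_nonneg ξ]
  have := P.sum_eq_one ξ
  simp only [h0] at this
  have h1 := this.unique hasSum_zero
  linarith

theorem chiS_eq_one {q : ℤ} {ξ : Space} (h : 2 * Real.pi * ‖ξ‖ < 3 / 4 * (2 : ℝ) ^ q) :
    P.chiS q ξ = 1 := by
  rw [chiS_apply, P.chi_eq_one, Complex.ofReal_one]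
  rwa [norm_scaled, zpow_neg, inv_mul_lt_iff₀ (by positivity), mul_comm ((2 : ℝ) ^ q)]

theorem chi_half (η : Space) : P.chi η = P.chi ((2 : ℝ) • η) + P.phi ((2 : ℝ) • η) := by
  have h1 := P.sum_eq_one η
  have h2 := P.sum_eq_one ((2 : ℝ) • η)
  rw [← hasSum_nat_add_iff' 1] at h2
  have h3 : (fun j : ℕ => P.phi (((2 : ℝ) ^ (j + 1))⁻¹ • (2 : ℝ) • η)) =
      fun j : ℕ => P.phi (((2 : ℝ) ^ j)⁻¹ • η) := by
    funext j
    rw [smul_smul, pow_succ]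
    congr 2
    field_simp
  rw [h3] at h2
  have h4 := h1.unique h2
  simp at h4
  linarith

theorem chiS_succ (q : ℤ) : P.chiS (q + 1) = P.chiS q + P.phiS q := by
  ext ξ
  rw [add_apply, chiS_apply, chiS_apply, phiS_apply, P.chi_half, ← Complex.ofReal_add]
  have : (2 : ℝ) • (2 : ℝ) ^ (-(q + 1)) • (2 * Real.pi) • ξ =
      (2 : ℝ) ^ (-q) • (2 * Real.pi) • ξ := by
    rw [smul_smul]
    congr 1
    rw [neg_add, zpow_add₀ two_ne_zero]
    norm_num
    field_simp
  rw [this]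

theorem chiS_add_nat (q : ℤ) (n : ℕ) :
    P.chiS (q + n) = P.chiS q + ∑ i ∈ Finset.range n, P.phiS (q + i) := by
  induction n with
  | zero => simp
  | succ n ih =>
    rw [Finset.sum_range_succ, ← add_assoc, ← ih, ← chiS_succ]
    congr 1
    push_cast; ring

theorem lowPass_eq (j : ℕ) (T : 𝓢'(Space, ℂ)) : lowPass P j T = op (P.chiS j) T := by
  funext x
  rw [lowPass, op]
  congr 1
  ext ξ
  rw [HasCompactSupport.toSchwartzMap_toFun, modulated, modS_apply, chiS_apply, mul_comm, chr,
    smul_smul]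
  congr 4
  rw [zpow_neg, zpow_natCast]
  field_simp

theorem shell_eq (j : ℕ) (T : 𝓢'(Space, ℂ)) : shell P j T = op (P.phiS j) T := by
  funext x
  rw [shell, op]
  congr 1
  ext ξ
  rw [HasCompactSupport.toSchwartzMap_toFun, modulated, modS_apply, phiS_apply, mul_comm, chr,
    smul_smul]
  congr 4
  rw [zpow_neg, zpow_natCast]
  field_simp

theorem phi0_eq_zero {ξ : Space} (h : ‖ξ‖ < 1 / 16) : P.phi0 ξ = 0 := by
  by_contra hne
  rw [phi0_apply, Complex.ofReal_eq_zero] at hne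
  have h1 := (P.phi_supp _ hne).1
  rw [norm_smul, Real.norm_of_nonneg (by positivity)] at h1
  have := Real.pi_lt_four
  nlinarith [norm_nonneg ξ]

theorem exists_leray0 (i l : Fin 3) : ∃ n : 𝓢(Space, ℂ), ∀ ξ, n ξ = P.phi0 ξ *
    (((if i = l then 1 else 0) - ξ i * ξ l / ‖ξ‖ ^ 2 : ℝ) : ℂ) := by
  refine exists_schwartz_mul P.hasCompactSupport_phi0 (r := 1 / 16) (by norm_num)
    (fun ξ hξ => P.phi0_eq_zero hξ)
    (g := fun ξ => (((if i = l then 1 else 0) - ξ i * ξ l / ‖ξ‖ ^ 2 : ℝ) : ℂ)) fun ξ hξ => ?_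
  refine Complex.ofRealCLM.contDiff.contDiffAt.comp ξ (contDiffAt_const.sub ?_)
  refine ContDiffAt.div (ContDiffAt.mul ?_ ?_) (contDiff_norm_sq ℝ).contDiffAt (by simpa using hξ)
  · exact (EuclideanSpace.proj (𝕜 := ℝ) i : Space →L[ℝ] ℝ).contDiff.contDiffAt
  · exact (EuclideanSpace.proj (𝕜 := ℝ) l : Space →L[ℝ] ℝ).contDiff.contDiffAt

/-- The entries of the symbol of the Leray projector composed with `φ(D)`. -/
def leray0 (i l : Fin 3) : 𝓢(Space, ℂ) := (P.exists_leray0 i l).choose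

theorem leray0_apply (i l : Fin 3) (ξ : Space) : P.leray0 i l ξ = P.phi0 ξ *
    (((if i = l then 1 else 0) - ξ i * ξ l / ‖ξ‖ ^ 2 : ℝ) : ℂ) :=
  (P.exists_leray0 i l).choose_spec ξ

/-- The entries of the symbol of the Leray projector composed with `φ(2⁻^q D)`. -/
def leray (q : ℤ) (i l : Fin 3) : 𝓢(Space, ℂ) := dil q (P.leray0 i l)

theorem leray_apply (q : ℤ) (i l : Fin 3) (ξ : Space) : P.leray q i l ξ = P.phiS q ξ *
    (((if i = l then 1 else 0) - ξ i * ξ l / ‖ξ‖ ^ 2 : ℝ) : ℂ) := by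
  rw [leray, dil_apply, leray0_apply, phiS, dil_apply]
  congr 3
  have : ((2 : ℝ) ^ (-q)) ≠ 0 := by positivity
  rw [PiLp.smul_apply, PiLp.smul_apply, norm_smul, Real.norm_of_nonneg (by positivity), smul_eq_mul,
    smul_eq_mul]
  field_simp

theorem hasCompactSupport_leray (q : ℤ) (i l : Fin 3) : HasCompactSupport (P.leray q i l) := by
  have : ⇑(P.leray q i l) = fun ξ => P.phiS q ξ *
    (((if i = l then 1 else 0) - ξ i * ξ l / ‖ξ‖ ^ 2 : ℝ) : ℂ) := funext (P.leray_apply q i l)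
  rw [this]
  exact (P.hasCompactSupport_phiS q).mul_right

theorem phiS_ne_of_leray {q : ℤ} {i l : Fin 3} {ξ : Space} (h : P.leray q i l ξ ≠ 0) :
    P.phiS q ξ ≠ 0 := by
  rw [leray_apply] at h
  exact left_ne_zero_of_mul h

theorem sum_mulI_leray (q : ℤ) (i : Fin 3) : ∑ l, mulI l (P.leray q i l) = 0 := by
  ext ξ
  simp only [Fin.sum_univ_three, add_apply, mulI_apply, leray_apply, zero_apply]
  by_cases hξ : ξ = 0
  · subst hξ; simp
  have h2 : (‖ξ‖ : ℂ) ^ 2 ≠ 0 := by simpa using hξ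
  have h1 : (‖ξ‖ : ℂ) ^ 2 = (ξ 0 : ℂ) ^ 2 + (ξ 1 : ℂ) ^ 2 + (ξ 2 : ℂ) ^ 2 := by
    have := EuclideanSpace.real_norm_sq_eq ξ
    rw [Fin.sum_univ_three] at this
    exact_mod_cast this
  have h3 : ((‖ξ‖ : ℂ) ^ 2)⁻¹ * ((ξ 0 : ℂ) ^ 2 + (ξ 1 : ℂ) ^ 2 + (ξ 2 : ℂ) ^ 2) = 1 := by
    rw [← h1, inv_mul_cancel₀ h2]
  have h4 : ∀ c : ℂ, 2 * Real.pi * Complex.I * P.phiS q ξ * c * (((‖ξ‖ : ℂ) ^ 2)⁻¹ *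
      ((ξ 0 : ℂ) ^ 2 + (ξ 1 : ℂ) ^ 2 + (ξ 2 : ℂ) ^ 2)) =
      2 * Real.pi * Complex.I * P.phiS q ξ * c := fun c => by rw [h3, mul_one]
  push_cast
  simp only [div_eq_mul_inv]
  fin_cases i
  · simp; linear_combination -h4 (ξ 0)
  · simp; linear_combination -h4 (ξ 1)
  · simp; linear_combination -h4 (ξ 2)

end LittlewoodPaley

/-! ### Log-Lipschitz fields -/

/-- The log-Lipschitz bound `‖∇ S_q T‖_{L^∞} ≤ (q + 1) h` for `q ≥ 2`. -/
def LLBound (P : LittlewoodPaley) (T : 𝓢'(Space, ℂ)) (h : ℝ) : Prop :=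
  ∀ q : ℕ, 2 ≤ q → ∀ (k : Fin 3) (x : Space), ‖op (P.chiS q) (∂_{e k} T) x‖ ≤ (q + 1) * h

theorem norm_le_of_eLpNorm_top_le {f : Space → ℂ} (hf : Continuous f) {c : ℝ} (hc : 0 ≤ c)
    (h : eLpNorm f ⊤ volume ≤ ENNReal.ofReal c) (x : Space) : ‖f x‖ ≤ c := by
  have h1 : ∀ᵐ x, ‖f x‖ₑ ≤ ENNReal.ofReal c := by
    filter_upwards [ae_le_eLpNormEssSup (f := f) (μ := volume)] with x hx
    rw [eLpNorm_exponent_top] at h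
    exact hx.trans h
  have h2 : IsOpen {x | c < ‖f x‖} := isOpen_lt continuous_const hf.norm
  have h3 : volume {x | c < ‖f x‖} = 0 := by
    refine measure_mono_null (fun x hx => ?_) (ae_iff.1 h1)
    simp only [Set.mem_ofPred_eq, not_le]
    rw [← ofReal_norm]
    exact (ENNReal.ofReal_lt_ofReal_iff_of_nonneg hc).2 hx
  rw [h2.measure_eq_zero_iff volume] at h3
  by_contra hx
  have : x ∈ {x | c < ‖f x‖} := not_le.1 hx
  rw [h3] at this
  exact this

theorem LLBound.of_llNorm {P : LittlewoodPaley} {w : Fin 3 → 𝓢'(Space, ℂ)} {h : ℝ} (h0 : 0 ≤ h)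
    (hw : llNorm P w ≤ ENNReal.ofReal h) (i : Fin 3) : LLBound P (w i) h := by
  intro q hq k x
  have h1 : eLpNorm (lowPass P q (∂_{e k} (w i))) ⊤ volume / ((q : ℝ≥0∞) + 1) ≤
      ENNReal.ofReal h := by
    refine le_trans ?_ hw
    refine le_trans ?_ (le_iSup₂ (f := fun (q : ℕ) (_ : 2 ≤ q) => (⨆ (k : Fin 3) (i : Fin 3),
      eLpNorm (lowPass P q (∂_{e k} (w i))) ⊤ volume) / ((q : ℝ≥0∞) + 1)) q hq)
    gcongr
    exact le_iSup₂ (f := fun (k : Fin 3) (i : Fin 3) =>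
      eLpNorm (lowPass P q (∂_{e k} (w i))) ⊤ volume) k i
  rw [ENNReal.div_le_iff (by simp) (by simp), P.lowPass_eq] at h1
  refine norm_le_of_eLpNorm_top_le (continuous_op _ _) (by positivity) (h1.trans_eq ?_) x
  rw [mul_comm, ENNReal.ofReal_mul (by positivity), ENNReal.ofReal_add (by positivity) zero_le_one]
  simp

theorem integrable_kernel (a : 𝓢(Space, ℂ)) : Integrable fun x => ‖(𝓕⁻ a) x‖ :=
  (𝓕⁻ a).integrable.norm

/-- Convolution with a kernel is bounded on bounded functions. -/
theorem norm_op_mulS_le {a m : 𝓢(Space, ℂ)} {T : 𝓢'(Space, ℂ)} {c : ℝ}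
    (h : ∀ x, ‖op m T x‖ ≤ c) (x : Space) : ‖op (mulS a m) T x‖ ≤ kerNorm a * c := by
  rw [op_mulS]
  have h1 : Integrable fun y => ‖(𝓕⁻ a) (x - y)‖ := (integrable_kernel a).comp_sub_left x
  calc ‖∫ y, (𝓕⁻ a) (x - y) * op m T y‖ ≤ ∫ y, ‖(𝓕⁻ a) (x - y) * op m T y‖ :=
        norm_integral_le_integral_norm _
    _ ≤ ∫ y, ‖(𝓕⁻ a) (x - y)‖ * c := by
        refine integral_mono (integrable_kernel_mul_op a m T x).norm (h1.mul_const c) fun y => ?_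
        simp only [norm_mul]
        gcongr
        exact h y
    _ = kerNorm a * c := by
        rw [integral_mul_const, kerNorm]
        congr 1
        exact integral_sub_left_eq_self (fun y => ‖(𝓕⁻ a) y‖) volume x

theorem dil_sub (q : ℤ) (m m' : 𝓢(Space, ℂ)) : dil q (m - m') = dil q m - dil q m' := by
  ext ξ; simp

/-- A symbol which vanishes near the origin is a sum of derivatives, of the symbols `nₖ(ξ) = ξₖ m(ξ)
/ (2πi|ξ|²)`. -/
theorem exists_div_symbol {m : 𝓢(Space, ℂ)} (hc : HasCompactSupport m) {r : ℝ} (hr : 0 < r)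
    (hm : ∀ ξ, ‖ξ‖ < r → m ξ = 0) : ∃ n : Fin 3 → 𝓢(Space, ℂ), m = ∑ k, mulI k (n k) ∧
      ∀ k ξ, n k ξ ≠ 0 → m ξ ≠ 0 := by
  have h : ∀ k : Fin 3, ∃ n : 𝓢(Space, ℂ), ∀ ξ, n ξ = m ξ *
      (((ξ k / ‖ξ‖ ^ 2 : ℝ) : ℂ) * (2 * Real.pi * Complex.I)⁻¹) := by
    intro k
    refine exists_schwartz_mul hc hr hm
      (g := fun ξ => (((ξ k / ‖ξ‖ ^ 2 : ℝ) : ℂ) * (2 * Real.pi * Complex.I)⁻¹)) fun ξ hξ => ?_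
    refine (Complex.ofRealCLM.contDiff.contDiffAt.comp ξ ?_).mul contDiffAt_const
    refine ContDiffAt.div ?_ (contDiff_norm_sq ℝ).contDiffAt (by simpa using hξ)
    exact (EuclideanSpace.proj (𝕜 := ℝ) k : Space →L[ℝ] ℝ).contDiff.contDiffAt
  choose n hn using h
  refine ⟨n, ?_, fun k ξ hne => ?_⟩
  · ext ξ
    simp only [Fin.sum_univ_three, add_apply, mulI_apply, hn]
    by_cases hξ : ξ = 0
    · subst hξ
      rw [hm 0 (by simpa using hr)]
      simp
    have h2 : (‖ξ‖ : ℂ) ^ 2 ≠ 0 := by simpa using hξ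
    have h1 : (‖ξ‖ : ℂ) ^ 2 = (ξ 0 : ℂ) ^ 2 + (ξ 1 : ℂ) ^ 2 + (ξ 2 : ℂ) ^ 2 := by
      have := EuclideanSpace.real_norm_sq_eq ξ
      rw [Fin.sum_univ_three] at this
      exact_mod_cast this
    have h3 : ((‖ξ‖ : ℂ) ^ 2)⁻¹ * ((ξ 0 : ℂ) ^ 2 + (ξ 1 : ℂ) ^ 2 + (ξ 2 : ℂ) ^ 2) = 1 := by
      rw [← h1, inv_mul_cancel₀ h2]
    have h4 : (2 * Real.pi * Complex.I) * (2 * Real.pi * Complex.I : ℂ)⁻¹ = 1 :=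
      mul_inv_cancel₀ Complex.two_pi_I_ne_zero
    push_cast
    simp only [div_eq_mul_inv] at h4 ⊢
    linear_combination (-m ξ) * h3 - (m ξ * (((‖ξ‖ : ℂ) ^ 2)⁻¹ *
      ((ξ 0 : ℂ) ^ 2 + (ξ 1 : ℂ) ^ 2 + (ξ 2 : ℂ) ^ 2))) * h4
  · rw [hn] at hne
    exact left_ne_zero_of_mul hne

/-- Symbols supported in a dyadic shell gain a power of the frequency on log-Lipschitz functions. -/
theorem exists_shell_bound (P : LittlewoodPaley) {m : 𝓢(Space, ℂ)} (hc : HasCompactSupport m)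
    {r : ℝ} (hr : 0 < r) (hm : ∀ ξ, ‖ξ‖ < r → m ξ = 0)
    (hs : ∀ ξ, m ξ ≠ 0 → 2 * Real.pi * ‖ξ‖ < 3) :
    ∃ C : ℝ, 0 ≤ C ∧ ∀ (T : 𝓢'(Space, ℂ)) (h : ℝ), LLBound P T h → ∀ (j : ℤ) (x : Space),
      ‖op (dil j m) T x‖ ≤ C * ((2 : ℝ) ^ (-j) * (j.toNat + 3) * h) := by
  obtain ⟨n, hn, hns⟩ := exists_div_symbol hc hr hm
  refine ⟨∑ k, kerNorm (n k), Finset.sum_nonneg fun k _ => kerNorm_nonneg _,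
    fun T h hT j x => ?_⟩
  have h1 : dil j m = ∑ k, ((2 : ℂ) ^ (-j)) • mulI k (dil j (n k)) := by
    have : ∀ k, dil j (mulI k (n k)) = ((2 : ℂ) ^ (-j)) • mulI k (dil j (n k)) := by
      intro k
      rw [mulI_dil, smul_smul, ← zpow_add₀ two_ne_zero]
      simp
    simp only [← this]
    ext ξ
    simp only [dil_apply, Fin.sum_univ_three, add_apply]
    conv_lhs => rw [hn]
    simp only [Fin.sum_univ_three, add_apply]
  -- `S_{j⁺+2}` is the identity on the shell, so that its bound from the log-Lipschitz norm applies.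
  have h2 : ∀ k, mulS (dil j (n k)) (P.chiS ((j.toNat + 2 : ℕ) : ℤ)) = dil j (n k) := by
    intro k
    ext ξ
    rw [mulS_apply]
    by_cases hz : dil j (n k) ξ = 0
    · rw [hz, zero_mul]
    · have h3 : 2 * Real.pi * ‖(2 : ℝ) ^ (-j) • ξ‖ < 3 := hs _ (hns k _ hz)
      rw [P.chiS_eq_one, mul_one]
      rw [norm_smul, Real.norm_of_nonneg (by positivity), zpow_neg] at h3
      have h4 : 2 * Real.pi * ‖ξ‖ < 3 * (2 : ℝ) ^ j := by
        have : 2 * Real.pi * ‖ξ‖ = (2 * Real.pi * (((2 : ℝ) ^ j)⁻¹ * ‖ξ‖)) * (2 : ℝ) ^ j := by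
          field_simp
        rw [this]
        gcongr
      have h5 : (2 : ℝ) ^ j ≤ (2 : ℝ) ^ ((j.toNat : ℕ) : ℤ) :=
        zpow_le_zpow_right₀ (by norm_num) (Int.self_le_toNat j)
      have h6 : (2 : ℝ) ^ ((j.toNat + 2 : ℕ) : ℤ) = (2 : ℝ) ^ ((j.toNat : ℕ) : ℤ) * 4 := by
        push_cast
        rw [zpow_add₀ two_ne_zero]
        norm_num
      rw [h6]
      linarith
  have h3 : ∀ k, ‖op (mulI k (dil j (n k))) T x‖ ≤ kerNorm (n k) * ((j.toNat + 3) * h) := by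
    intro k
    rw [← op_lineDeriv, ← h2 k]
    refine (norm_op_mulS_le (fun y => hT (j.toNat + 2) (by omega) k y) x).trans_eq ?_
    rw [kerNorm_dil]
    push_cast
    ring
  rw [h1, op_sum_left]
  calc _ ≤ ∑ k, ‖op (((2 : ℂ) ^ (-j)) • mulI k (dil j (n k))) T x‖ := norm_sum_le _ _
    _ ≤ ∑ k, (2 : ℝ) ^ (-j) * (kerNorm (n k) * ((j.toNat + 3) * h)) := by
        refine Finset.sum_le_sum fun k _ => ?_
        rw [op_smul_left, norm_mul, norm_zpow, Complex.norm_ofNat]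
        gcongr
        exact h3 k
    _ = _ := by rw [← Finset.mul_sum, ← Finset.sum_mul]; ring

theorem sum_geometric_linear (B : ℝ) (n : ℕ) :
    ∑ i ∈ Finset.range n, ((2 : ℝ) ^ i)⁻¹ * (B + i) =
      2 * B + 2 - ((2 : ℝ) ^ n)⁻¹ * (2 * B + 2 * n + 2) := by
  induction n with
  | zero => simp
  | succ n ih =>
    rw [Finset.sum_range_succ, ih, pow_succ]
    push_cast
    field_simp
    ring

/-- Reflection `m ↦ m(-·)` of a symbol. -/
def refl (m : 𝓢(Space, ℂ)) : 𝓢(Space, ℂ) :=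
  SchwartzMap.compCLMOfContinuousLinearEquiv ℂ (ContinuousLinearEquiv.neg ℝ) m

@[simp] theorem refl_apply (m : 𝓢(Space, ℂ)) (ξ : Space) : refl m ξ = m (-ξ) := rfl

/-- Complex conjugation on the Schwartz space. -/
def conjS (ψ : 𝓢(Space, ℂ)) : 𝓢(Space, ℂ) :=
  SchwartzMap.postcompCLM (𝕜 := ℝ) (Complex.conjCLE : ℂ →L[ℝ] ℂ) ψ

@[simp] theorem conjS_apply (ψ : 𝓢(Space, ℂ)) (x : Space) :
    conjS ψ x = starRingEnd ℂ (ψ x) := rfl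

theorem IsRealDistribution.apply_conjS {T : 𝓢'(Space, ℂ)} (hT : IsRealDistribution T)
    (ψ : 𝓢(Space, ℂ)) : T (conjS ψ) = starRingEnd ℂ (T ψ) := by
  set a : 𝓢(Space, ℂ) := (1 / 2 : ℂ) • (ψ + conjS ψ) with ha
  set b : 𝓢(Space, ℂ) := (-Complex.I / 2 : ℂ) • (ψ - conjS ψ) with hb
  have h1 : ψ = a + Complex.I • b := by
    ext x
    simp only [ha, hb, add_apply, smul_apply, sub_apply, smul_eq_mul]
    linear_combination ((ψ x - conjS ψ x) / 2) * Complex.I_sq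
  have h2 : conjS ψ = a - Complex.I • b := by
    ext x
    simp only [ha, hb, add_apply, smul_apply, sub_apply, smul_eq_mul]
    linear_combination (-(ψ x - conjS ψ x) / 2) * Complex.I_sq
  have h3 : (T a).im = 0 := hT a fun x => by simp [ha]
  have h4 : (T b).im = 0 := hT b fun x => by simp [hb]
  rw [h2]
  conv_rhs => rw [h1]
  simp only [map_sub, map_add, map_smul, smul_eq_mul, map_mul, Complex.conj_I,
    Complex.conj_eq_iff_im.2 h3, Complex.conj_eq_iff_im.2 h4]
  ring

theorem conj_op {T : 𝓢'(Space, ℂ)} (hT : IsRealDistribution T) {m : 𝓢(Space, ℂ)}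
    (hm : ∀ ξ, (m ξ).im = 0) (x : Space) : starRingEnd ℂ (op m T x) = op (refl m) T x := by
  rw [op_eq_apply_fourier, op_eq_apply_fourier, ← hT.apply_conjS]
  congr 1
  ext y
  rw [conjS_apply, fourier_modS, fourier_modS, fourierInv_schwartz_apply,
    fourierInv_schwartz_apply, ← integral_conj, ← integral_neg_eq_self]
  congr 1
  funext ξ
  rw [map_mul, ← chr_neg_right, Complex.conj_eq_iff_im.2 (hm _), neg_neg, refl_apply]

namespace LittlewoodPaley

variable (P : LittlewoodPaley)

theorem exists_phi_bound : ∃ C : ℝ, 0 ≤ C ∧ ∀ (T : 𝓢'(Space, ℂ)) (h : ℝ), LLBound P T h →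
    ∀ (j : ℤ) (x : Space), ‖op (P.phiS j) T x‖ ≤ C * ((2 : ℝ) ^ (-j) * (j.toNat + 3) * h) := by
  refine exists_shell_bound P P.hasCompactSupport_phi0 (r := 1 / 16) (by norm_num)
    (fun ξ hξ => P.phi0_eq_zero hξ) fun ξ hξ => ?_
  rw [phi0_apply, Ne, Complex.ofReal_eq_zero] at hξ
  have := (P.phi_supp _ hξ).2
  rw [norm_smul, Real.norm_of_nonneg (by positivity)] at this
  linarith

theorem exists_odd_bound : ∃ C : ℝ, 0 ≤ C ∧ ∀ (T : 𝓢'(Space, ℂ)) (h : ℝ), LLBound P T h →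
    ∀ (j : ℤ) (x : Space), ‖op (dil j (P.chi0 - refl P.chi0)) T x‖ ≤
      C * ((2 : ℝ) ^ (-j) * (j.toNat + 3) * h) := by
  -- Both `χ` and `χ(-·)` are equal to `1` near the origin, so their difference is supported in a
  -- shell.
  have hc : HasCompactSupport (refl P.chi0) :=
    P.hasCompactSupport_chi0.comp_homeomorph (Homeomorph.neg Space)
  refine exists_shell_bound P (P.hasCompactSupport_chi0.sub hc) (r := 1 / 16) (by norm_num)
    (fun ξ hξ => ?_) fun ξ hξ => ?_
  · have h1 : ∀ η : Space, ‖η‖ < 1 / 16 → P.chi0 η = 1 := by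
      intro η hη
      rw [chi0_apply, P.chi_eq_one, Complex.ofReal_one]
      rw [norm_smul, Real.norm_of_nonneg (by positivity)]
      have := Real.pi_lt_four
      nlinarith [norm_nonneg η]
    rw [sub_apply, refl_apply, h1 ξ hξ, h1 (-ξ) (by rwa [norm_neg]), sub_self]
  · by_contra hcon
    have h1 : ∀ η : Space, 3 ≤ 2 * Real.pi * ‖η‖ → P.chi0 η = 0 := by
      intro η hη
      by_contra hne
      rw [chi0_apply, Complex.ofReal_eq_zero] at hne
      have := P.chi_supp _ hne
      rw [norm_smul, Real.norm_of_nonneg (by positivity)] at this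
      linarith
    rw [not_lt] at hcon
    rw [sub_apply, refl_apply, h1 ξ hcon, h1 (-ξ) (by rwa [norm_neg]), sub_self] at hξ
    exact hξ rfl

/-- The high frequencies of a log-Lipschitz function are bounded. -/
theorem exists_chi_sub_bound : ∃ C : ℝ, 0 ≤ C ∧ ∀ (T : 𝓢'(Space, ℂ)) (h : ℝ), 0 ≤ h →
    LLBound P T h → ∀ (b a : ℤ), b ≤ a → ∀ x : Space,
      ‖op (P.chiS a) T x - op (P.chiS b) T x‖ ≤ C * ((2 : ℝ) ^ (-b) * (b.toNat + 3) * h) := by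
  obtain ⟨C, hC, hb⟩ := P.exists_phi_bound
  refine ⟨4 * C, by positivity, fun T h h0 hT b a hab x => ?_⟩
  obtain ⟨n, rfl⟩ := Int.le.dest hab
  rw [chiS_add_nat, op_add_left, op_sum_left, add_sub_cancel_left]
  calc _ ≤ ∑ i ∈ Finset.range n, ‖op (P.phiS (b + i)) T x‖ := norm_sum_le _ _
    _ ≤ ∑ i ∈ Finset.range n,
        C * ((2 : ℝ) ^ (-b) * (((2 : ℝ) ^ i)⁻¹ * ((b.toNat + 3) + i)) * h) := by
        refine Finset.sum_le_sum fun i _ => (hb T h hT _ x).trans ?_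
        have h1 : (2 : ℝ) ^ (-(b + (i : ℤ))) = (2 : ℝ) ^ (-b) * ((2 : ℝ) ^ i)⁻¹ := by
          rw [neg_add, zpow_add₀ two_ne_zero, zpow_neg _ (i : ℤ), zpow_natCast]
        have h2 : (((b + i).toNat : ℕ) : ℝ) ≤ b.toNat + i := by
          exact_mod_cast (show (b + i).toNat ≤ b.toNat + i by omega)
        rw [h1, mul_assoc ((2 : ℝ) ^ (-b))]
        gcongr C * ((2 : ℝ) ^ (-b) * (_ * ?_) * h)
        linarith
    _ = C * ((2 : ℝ) ^ (-b) * (2 * (b.toNat + 3) + 2 -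
          ((2 : ℝ) ^ n)⁻¹ * (2 * (b.toNat + 3) + 2 * n + 2)) * h) := by
        rw [← Finset.mul_sum, ← Finset.sum_mul, ← Finset.mul_sum, sum_geometric_linear]
    _ ≤ C * ((2 : ℝ) ^ (-b) * (4 * (b.toNat + 3)) * h) := by
        gcongr
        have : 0 ≤ ((2 : ℝ) ^ n)⁻¹ * (2 * (b.toNat + 3) + 2 * n + 2) := by positivity
        have h3 : (0 : ℝ) ≤ b.toNat := by positivity
        linarith
    _ = _ := by ring

/-- The imaginary part of a low frequency cut-off of a real log-Lipschitz function, which need not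
vanish since `χ` is not assumed to be even, only contains high frequencies. -/
theorem exists_im_bound : ∃ C : ℝ, 0 ≤ C ∧ ∀ (T : 𝓢'(Space, ℂ)) (h : ℝ), IsRealDistribution T →
    LLBound P T h → ∀ (j : ℤ) (x : Space), ‖op (P.chiS j) T x - ((op (P.chiS j) T x).re : ℂ)‖ ≤
      C * ((2 : ℝ) ^ (-j) * (j.toNat + 3) * h) := by
  obtain ⟨C, hC, hb⟩ := P.exists_odd_bound
  refine ⟨C, hC, fun T h hr hT j x => ?_⟩
  have h1 := hb T h hT j x
  have h2 : refl (P.chiS j) = dil j (refl P.chi0) := by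
    ext ξ; simp [chiS]
  rw [dil_sub, op_sub_left, ← h2, ← conj_op hr (fun ξ => by rw [chiS_apply]; simp), ← chiS] at h1
  have h3 : op (P.chiS j) T x - ((op (P.chiS j) T x).re : ℂ) =
      (op (P.chiS j) T x - starRingEnd ℂ (op (P.chiS j) T x)) / 2 := by
    rw [Complex.sub_conj]
    apply Complex.ext <;> simp
  rw [h3, norm_div, Complex.norm_ofNat]
  linarith [norm_nonneg (op (P.chiS j) T x - starRingEnd ℂ (op (P.chiS j) T x))]

end LittlewoodPaley

theorem LLBound.lipschitz {P : LittlewoodPaley} {T : 𝓢'(Space, ℂ)} {h : ℝ} (hT : LLBound P T h)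
    {q : ℕ} (hq : 2 ≤ q) (x y : Space) :
    ‖op (P.chiS q) T y - op (P.chiS q) T x‖ ≤ 3 * ((q + 1) * h) * ‖y - x‖ := by
  have h0 : 0 ≤ (q + 1) * h := (norm_nonneg _).trans (hT q hq 0 0)
  refine Convex.norm_image_sub_le_of_norm_fderiv_le (𝕜 := ℝ) (s := Set.univ)
    (fun z _ => differentiable_op _ _ z) (fun z _ => ?_) convex_univ (Set.mem_univ x)
    (Set.mem_univ y)
  refine ContinuousLinearMap.opNorm_le_bound _ (by positivity) fun v => ?_
  rw [fderiv_op_apply]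
  calc _ ≤ ∑ k, ‖v k • op (mulI k (P.chiS q)) T z‖ := norm_sum_le _ _
    _ ≤ ∑ k : Fin 3, ‖v‖ * ((q + 1) * h) := by
        refine Finset.sum_le_sum fun k _ => ?_
        rw [norm_smul, ← op_lineDeriv]
        gcongr
        · exact PiLp.norm_apply_le v k
        · exact hT q hq k z
    _ = _ := by simp; ring

theorem op_sum_right {ι : Type*} (s : Finset ι) (m : 𝓢(Space, ℂ)) (T : ι → 𝓢'(Space, ℂ))
    (x : Space) : op m (∑ i ∈ s, T i) x = ∑ i ∈ s, op m (T i) x := by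
  simp only [op_eq_apply_fourier]
  exact sum_apply s T _

theorem sum_op_mulI_eq_zero {w : Fin 3 → 𝓢'(Space, ℂ)} (hw : divergence w = 0) (m : 𝓢(Space, ℂ))
    (x : Space) : ∑ k, op (mulI k m) (w k) x = 0 := by
  simp only [← op_lineDeriv]
  rw [← op_sum_right]
  have : ∑ k, ∂_{e k} (w k) = 0 := hw
  rw [this]
  simp [op_eq_apply_fourier]

/-! ### Convolution inequalities -/

theorem lintegral_mul_sq_le {α : Type*} [MeasurableSpace α] (μ : Measure α) {f g : α → ℝ≥0∞}
    (hf : AEMeasurable f μ) (hg : AEMeasurable g μ) :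
    (∫⁻ x, f x * g x ∂μ) ^ 2 ≤ (∫⁻ x, f x ∂μ) * ∫⁻ x, f x * g x ^ 2 ∂μ := by
  have h := ENNReal.lintegral_mul_le_Lp_mul_Lq μ Real.HolderConjugate.two_two
    (hf.pow_const (1 / 2 : ℝ)) ((hf.pow_const (1 / 2 : ℝ)).mul hg)
  have e1 : ∀ x, f x ^ (1 / 2 : ℝ) * (f x ^ (1 / 2 : ℝ) * g x) = f x * g x := by
    intro x
    rw [← mul_assoc, ← ENNReal.rpow_add_of_nonneg _ _ (by norm_num) (by norm_num)]
    norm_num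
  have e2 : ∀ x, (f x ^ (1 / 2 : ℝ)) ^ (2 : ℝ) = f x := by
    intro x
    rw [← ENNReal.rpow_mul]; norm_num
  simp only [Pi.mul_apply, e1, ENNReal.mul_rpow_of_nonneg _ _ (zero_le_two : (0 : ℝ) ≤ 2), e2] at h
  have h2 := pow_le_pow_left' h 2
  rw [mul_pow, ← ENNReal.rpow_natCast, ← ENNReal.rpow_natCast (_ ^ _),
    ← ENNReal.rpow_natCast (_ ^ _),
    ← ENNReal.rpow_mul, ← ENNReal.rpow_mul] at h2
  simpa using h2

/-- The convolution of the absolute values of two functions. -/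
def conv (k w : Space → ℂ) (x : Space) : ℝ≥0∞ := ∫⁻ y, ‖k (x - y)‖ₑ * ‖w y‖ₑ

theorem measurable_conv {k w : Space → ℂ} (hk : Measurable k) (hw : Measurable w) :
    Measurable (conv k w) := by
  unfold conv
  refine Measurable.lintegral_prod_right'
    (f := fun z : Space × Space => ‖k (z.1 - z.2)‖ₑ * ‖w z.2‖ₑ) ?_
  fun_prop

theorem eLpNorm_two_sq {α : Type*} [MeasurableSpace α] {μ : Measure α} {ε : Type*} [ENorm ε]
    (f : α → ε) : eLpNorm f 2 μ ^ 2 = ∫⁻ x, ‖f x‖ₑ ^ 2 ∂μ := by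
  rw [eLpNorm_eq_lintegral_rpow_enorm_toReal (by norm_num) (by norm_num), ← ENNReal.rpow_natCast,
    ← ENNReal.rpow_mul]
  simp

theorem eLpNorm_two_le {α : Type*} [MeasurableSpace α] {μ : Measure α} {ε : Type*} [ENorm ε]
    {f : α → ε} {c : ℝ≥0∞} (h : ∫⁻ x, ‖f x‖ₑ ^ 2 ∂μ ≤ c ^ 2) : eLpNorm f 2 μ ≤ c := by
  rw [← eLpNorm_two_sq] at h
  exact (ENNReal.pow_le_pow_left_iff two_ne_zero).1 h

/-- Young's inequality `L¹ * L² ⊆ L²`. -/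
theorem eLpNorm_conv_le {k w : Space → ℂ} (hk : Measurable k) (hw : Measurable w) :
    eLpNorm (conv k w) 2 volume ≤ (∫⁻ x, ‖k x‖ₑ) * eLpNorm w 2 volume := by
  refine eLpNorm_two_le ?_
  have hx : ∀ x, ∫⁻ y, ‖k (x - y)‖ₑ = ∫⁻ y, ‖k y‖ₑ := fun x =>
    lintegral_sub_left_eq_self (fun y => ‖k y‖ₑ) x
  calc ∫⁻ x, ‖conv k w x‖ₑ ^ 2
      ≤ ∫⁻ x, (∫⁻ y, ‖k y‖ₑ) * ∫⁻ y, ‖k (x - y)‖ₑ * ‖w y‖ₑ ^ 2 := by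
        refine lintegral_mono fun x => ?_
        simp only [enorm_eq_self, conv]
        refine (lintegral_mul_sq_le volume (by fun_prop) (by fun_prop)).trans_eq ?_
        rw [hx]
    _ = (∫⁻ y, ‖k y‖ₑ) * ∫⁻ x, ∫⁻ y, ‖k (x - y)‖ₑ * ‖w y‖ₑ ^ 2 := by
        rw [lintegral_const_mul]
        refine Measurable.lintegral_prod_right'
          (f := fun z : Space × Space => ‖k (z.1 - z.2)‖ₑ * ‖w z.2‖ₑ ^ 2) ?_
        fun_prop
    _ = (∫⁻ y, ‖k y‖ₑ) * ∫⁻ y, ∫⁻ x, ‖k (x - y)‖ₑ * ‖w y‖ₑ ^ 2 := by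
        rw [lintegral_lintegral_swap]
        fun_prop
    _ = (∫⁻ y, ‖k y‖ₑ) * ∫⁻ y, (∫⁻ y, ‖k y‖ₑ) * ‖w y‖ₑ ^ 2 := by
        congr 2; funext y
        rw [lintegral_mul_const _ (by fun_prop), lintegral_sub_right_eq_self (fun x => ‖k x‖ₑ) y]
    _ = _ := by
        rw [lintegral_const_mul _ (by fun_prop), mul_pow, eLpNorm_two_sq]
        ring

theorem eLpNorm_two_add_le {α : Type*} [MeasurableSpace α] {μ : Measure α} {f g : α → ℝ≥0∞}
    (hf : Measurable f) (hg : Measurable g) :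
    eLpNorm (fun x => f x + g x) 2 μ ≤ eLpNorm f 2 μ + eLpNorm g 2 μ :=
  eLpNorm_add_le hf.aestronglyMeasurable hg.aestronglyMeasurable (by norm_num)

theorem eLpNorm_two_sum_le {α : Type*} [MeasurableSpace α] {μ : Measure α} {ι : Type*}
    (s : Finset ι) {f : ι → α → ℝ≥0∞} (hf : ∀ i, Measurable (f i)) :
    eLpNorm (fun x => ∑ i ∈ s, f i x) 2 μ ≤ ∑ i ∈ s, eLpNorm (f i) 2 μ := by
  have := eLpNorm_sum_le (μ := μ) (p := 2) (s := s) (f := f)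
    (fun i _ => (hf i).aestronglyMeasurable) (by norm_num)
  refine le_of_eq_of_le ?_ this
  congr 1; funext x; simp

theorem eLpNorm_two_tsum_le {α : Type*} [MeasurableSpace α] {μ : Measure α}
    {f : ℕ → α → ℝ≥0∞} (hf : ∀ i, Measurable (f i)) :
    eLpNorm (fun x => ∑' i, f i x) 2 μ ≤ ∑' i, eLpNorm (f i) 2 μ := by
  refine eLpNorm_two_le ?_
  have h1 : ∀ x, Tendsto (fun n => (∑ i ∈ Finset.range n, f i x) ^ 2) atTop
      (𝓝 ((∑' i, f i x) ^ 2)) := fun x =>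
    ((ENNReal.continuous_pow 2).tendsto _).comp ENNReal.summable.hasSum.tendsto_sum_nat
  calc ∫⁻ x, ‖∑' i, f i x‖ₑ ^ 2 ∂μ
      = ∫⁻ x, liminf (fun n => (∑ i ∈ Finset.range n, f i x) ^ 2) atTop ∂μ := by
        congr 1; funext x
        rw [enorm_eq_self, (h1 x).liminf_eq]
    _ ≤ liminf (fun n => ∫⁻ x, (∑ i ∈ Finset.range n, f i x) ^ 2 ∂μ) atTop :=
        lintegral_liminf_le fun n => by fun_prop
    _ ≤ liminf (fun _ : ℕ => (∑' i, eLpNorm (f i) 2 μ) ^ 2) atTop := by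
        refine liminf_le_liminf (.of_forall fun n => ?_)
        have := eLpNorm_two_sum_le (μ := μ) (Finset.range n) hf
        have h2 := pow_le_pow_left' (this.trans (ENNReal.sum_le_tsum _)) 2
        rw [eLpNorm_two_sq] at h2
        simpa using h2
    _ = _ := by simp

theorem eLpNorm_const_mul_ennreal {α : Type*} [MeasurableSpace α] {μ : Measure α} (c : ℝ≥0∞)
    {f : α → ℝ≥0∞} (hf : Measurable f) :
    eLpNorm (fun x => c * f x) 2 μ ≤ c * eLpNorm f 2 μ := by
  refine eLpNorm_two_le ?_
  simp only [enorm_eq_self, mul_pow]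
  rw [lintegral_const_mul _ (by fun_prop), eLpNorm_two_sq]
  simp

/-! ### Products of a distribution and a field, tested against a kernel -/

/-- The value at `x` of `K * (b w)`, where `K` is the kernel of the symbol `m`. -/
def bil (m : 𝓢(Space, ℂ)) (b w : Space → ℂ) (x : Space) : ℂ := ∫ y, (𝓕⁻ m) (x - y) * (b y * w y)

theorem integrable_bil (m n n' : 𝓢(Space, ℂ)) (T T' : 𝓢'(Space, ℂ)) (x : Space) :
    Integrable fun y => (𝓕⁻ m) (x - y) * (op n T y * op n' T' y) := by
  obtain ⟨C, N, h1⟩ := growth_op n T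
  obtain ⟨C', N', h2⟩ := growth_op n' T'
  have := integrable_schwartz_smul (f := fun y => op n T y * op n' T' y) (C := C * C') (N := N + N')
    ((continuous_op n T).mul (continuous_op n' T')) (fun y => ?_) (𝓕 (modS x m))
  · simpa only [fourier_modS, smul_eq_mul] using this
  · rw [norm_mul, pow_add]
    calc _ ≤ (C * (1 + ‖y‖) ^ N) * (C' * (1 + ‖y‖) ^ N') :=
          mul_le_mul (h1 y) (h2 y) (norm_nonneg _) ((norm_nonneg _).trans (h1 y))
      _ = _ := by ring

theorem hasFDerivAt_fourierInv (m : 𝓢(Space, ℂ)) (z : Space) (k : Fin 3) :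
    fderiv ℝ ⇑(𝓕⁻ m : 𝓢(Space, ℂ)) z (e k) = (𝓕⁻ (mulI k m)) z := by
  have h := congrArg (fun f : 𝓢(Space, ℂ) => f z) (SchwartzMap.lineDerivOp_fourierInv_eq m (e k))
  simp only [SchwartzMap.lineDerivOp_apply_eq_fderiv] at h
  rw [h]
  congr 2
  ext ξ
  rw [smul_apply, SchwartzMap.smulLeftCLM_apply_apply (by fun_prop), mulI_apply, inner_e]
  simp
  ring

/-- Integration by parts against a divergence free field. -/
theorem sum_bil_mulI {u : Fin 3 → 𝓢'(Space, ℂ)} (hu : divergence u = 0) (m n n' : 𝓢(Space, ℂ))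
    (T : 𝓢'(Space, ℂ)) (x : Space) :
    ∑ k, bil m (op n (u k)) (op (mulI k n') T) x =
      ∑ k, bil (mulI k m) (op n (u k)) (op n' T) x := by
  have hK : ∀ y, DifferentiableAt ℝ (fun y => (𝓕⁻ m) (x - y)) y := fun y =>
    DifferentiableAt.comp y (𝓕⁻ m).differentiableAt (differentiableAt_id.const_sub x)
  have hK' : ∀ (y : Space) (k : Fin 3), fderiv ℝ (fun y => (𝓕⁻ m) (x - y)) y (e k) =
      -(𝓕⁻ (mulI k m)) (x - y) := by
    intro y k
    have : HasFDerivAt (fun y : Space => x - y) (-ContinuousLinearMap.id ℝ Space) y :=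
      (hasFDerivAt_id y).const_sub x
    have h2 := ((𝓕⁻ m).hasFDerivAt (x - y)).comp y this
    have h3 := h2.fderiv
    rw [show (⇑(𝓕⁻ m : 𝓢(Space, ℂ)) ∘ fun y : Space => x - y) = fun y => (𝓕⁻ m) (x - y) from rfl]
      at h3
    rw [h3]
    simp [hasFDerivAt_fourierInv]
  have hF : ∀ (y : Space) (k : Fin 3),
      fderiv ℝ (fun y => (𝓕⁻ m) (x - y) * op n (u k) y) y (e k) =
        (𝓕⁻ m) (x - y) * op (mulI k n) (u k) y - (𝓕⁻ (mulI k m)) (x - y) * op n (u k) y := by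
    intro y k
    have h3 : fderiv ℝ (fun y => (𝓕⁻ m) (x - y) * op n (u k) y) y = _ :=
      ((hK y).hasFDerivAt.mul (differentiable_op n (u k) y).hasFDerivAt).fderiv
    rw [h3]
    simp only [add_apply, smul_apply, smul_eq_mul, hK', fderiv_op]
    ring
  have hI1 : ∀ k, Integrable fun y => (𝓕⁻ m) (x - y) * op (mulI k n) (u k) y * op n' T y := by
    intro k; simpa only [mul_assoc] using integrable_bil m (mulI k n) n' (u k) T x
  have hI2 : ∀ k, Integrable fun y => (𝓕⁻ (mulI k m)) (x - y) * op n (u k) y * op n' T y := by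
    intro k; simpa only [mul_assoc] using integrable_bil (mulI k m) n n' (u k) T x
  have hk : ∀ k, bil m (op n (u k)) (op (mulI k n') T) x =
      bil (mulI k m) (op n (u k)) (op n' T) x -
        ∫ y, (𝓕⁻ m) (x - y) * op (mulI k n) (u k) y * op n' T y := by
    intro k
    have h := integral_mul_fderiv_eq_neg_fderiv_mul_of_integrable (μ := (volume : Measure Space))
      (f := fun y => (𝓕⁻ m) (x - y) * op n (u k) y) (g := op n' T) (v := e k) ?_ ?_ ?_ ?_
      (fun y _ => differentiable_op n' T y)
    · simp only [fderiv_op, hF] at h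
      simp only [bil, ← mul_assoc]
      rw [h, ← integral_sub (hI2 k) (hI1 k), ← integral_neg]
      congr 1; funext y; ring
    · simp only [hF, sub_mul]
      exact (hI1 k).sub (hI2 k)
    · simp only [fderiv_op]
      simpa only [mul_assoc] using integrable_bil m n (mulI k n') (u k) T x
    · simpa only [mul_assoc] using integrable_bil m n n' (u k) T x
    · exact fun y _ => DifferentiableAt.fun_mul (hK y) (differentiable_op n (u k) y)
  -- Summing over `k`, the terms in which the derivative falls on `u` add up to its divergence.
  rw [Finset.sum_congr rfl fun k _ => hk k, Finset.sum_sub_distrib,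
    ← integral_finsetSum _ fun k _ => hI1 k]
  have : ∀ y, ∑ k, (𝓕⁻ m) (x - y) * op (mulI k n) (u k) y * op n' T y = 0 := by
    intro y
    rw [← Finset.sum_mul, ← Finset.mul_sum, sum_op_mulI_eq_zero hu, mul_zero, zero_mul]
  simp [this]

theorem fourierInv_modS (ξ : Space) (ψ : 𝓢(Space, ℂ)) (η : Space) :
    (𝓕⁻ (modS ξ ψ)) η = (𝓕⁻ ψ) (η + ξ) := by
  rw [fourierInv_schwartz_apply, fourierInv_schwartz_apply]
  congr 1; funext z
  rw [modS_apply, chr_add]; ring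

theorem integral_chr_mul_kernel {m n : 𝓢(Space, ℂ)} {S : 𝓢'(Space, ℂ)} {ξ : Space}
    (h : ∀ η, n η ≠ 0 → m (ξ + η) = 0) (x : Space) :
    ∫ y, chr y ξ * ((𝓕⁻ m) (x - y) * op n S y) = 0 := by
  have h1 := integral_mul_op n S (modS ξ (𝓕 (modS x m)))
  have h4 : (𝓕⁻ (𝓕 (modS x m) : 𝓢(Space, ℂ)) : 𝓢(Space, ℂ)) = modS x m :=
    FourierTransform.fourierInv_fourier_eq _
  have h2 : mulS (𝓕⁻ (modS ξ (𝓕 (modS x m)))) n = 0 := by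
    ext η
    rw [mulS_apply, zero_apply, fourierInv_modS, h4, modS_apply, add_comm]
    by_cases hη : n η = 0
    · rw [hη, mul_zero]
    · rw [h η hη, mul_zero, zero_mul]
  rw [h2, map_zero] at h1
  rw [← h1]
  congr 1; funext y
  rw [modS_apply, fourier_modS, chr_comm]; ring

/-- The frequencies of a product are sums of frequencies of the factors. -/
theorem bil_eq_zero_of_support {T : 𝓢'(Space, ℂ)} {a : Space → ℂ} (ha : HasDensity T a)
    {m n n' : 𝓢(Space, ℂ)} (hc : HasCompactSupport n') (S : 𝓢'(Space, ℂ))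
    (h : ∀ ξ η, n' ξ ≠ 0 → n η ≠ 0 → m (ξ + η) = 0) (x : Space) :
    bil m (op n S) (op n' T) x = 0 := by
  -- The last factor is written as a Fourier integral and the integrals are exchanged: for each of
  -- its frequencies the integral over space vanishes by the support condition.
  have hi := ha.integrable_mul n'.continuous hc
  have hprod : Integrable (Function.uncurry fun y ξ =>
      chr y ξ * (((𝓕⁻ m) (x - y) * op n S y) * (a ξ * n' ξ)))
        ((volume : Measure Space).prod volume) :=
    ((integrable_kernel_mul_op m n S x).mul_prod hi).bdd_mul (c := 1)
      continuous_chr_uncurry.aestronglyMeasurable (.of_forall fun z => (norm_chr _ _).le)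
  have e1 : ∀ y, (𝓕⁻ m) (x - y) * (op n S y * op n' T y) =
      ∫ ξ, chr y ξ * (((𝓕⁻ m) (x - y) * op n S y) * (a ξ * n' ξ)) := by
    intro y
    rw [ha.op_eq hc, invFourier, ← mul_assoc, ← integral_const_mul]
    congr 1; funext ξ; ring
  have e2 : ∀ ξ, ∫ y, chr y ξ * (((𝓕⁻ m) (x - y) * op n S y) * (a ξ * n' ξ)) = 0 := by
    intro ξ
    by_cases hξ : n' ξ = 0
    · simp [hξ]
    · have h5 : ∀ y, chr y ξ * (((𝓕⁻ m) (x - y) * op n S y) * (a ξ * n' ξ)) =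
          (chr y ξ * ((𝓕⁻ m) (x - y) * op n S y)) * (a ξ * n' ξ) := fun y => by ring
      simp only [h5]
      rw [integral_mul_const, integral_chr_mul_kernel (fun η hη => h ξ η hξ hη), zero_mul]
  rw [bil]
  simp only [e1]
  rw [integral_integral_swap hprod]
  simp only [e2, integral_zero]

theorem enorm_bil_le {m : 𝓢(Space, ℂ)} {b w : Space → ℂ} {c : ℝ} (hb : ∀ y, ‖b y‖ ≤ c) (x : Space) :
    ‖bil m b w x‖ₑ ≤ ENNReal.ofReal c * conv ⇑(𝓕⁻ m : 𝓢(Space, ℂ)) w x := by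
  refine (enorm_integral_le_lintegral_enorm _).trans ?_
  rw [conv, ← lintegral_const_mul' _ _ ENNReal.ofReal_ne_top]
  refine lintegral_mono fun y => ?_
  rw [enorm_mul, enorm_mul, mul_left_comm]
  gcongr
  rw [← ofReal_norm]
  exact ENNReal.ofReal_le_ofReal (hb y)

theorem lintegral_kernel (m : 𝓢(Space, ℂ)) :
    ∫⁻ x, ‖(𝓕⁻ m) x‖ₑ = ENNReal.ofReal (kerNorm m) := by
  rw [kerNorm, ofReal_integral_norm_eq_lintegral_enorm (𝓕⁻ m).integrable]

theorem eLpNorm_conv_kernel_le (m : 𝓢(Space, ℂ)) {w : Space → ℂ} (hw : Measurable w) :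
    eLpNorm (conv ⇑(𝓕⁻ m : 𝓢(Space, ℂ)) w) 2 volume ≤ ENNReal.ofReal (kerNorm m) *
      eLpNorm w 2 volume := by
  rw [← lintegral_kernel]
  exact eLpNorm_conv_le (𝓕⁻ m).continuous.measurable hw

theorem lintegral_kernel_moment (m : 𝓢(Space, ℂ)) :
    ∫⁻ x, ‖((‖x‖ : ℝ) : ℂ) * (𝓕⁻ m) x‖ₑ = ENNReal.ofReal (kerMoment m) := by
  have h : Integrable fun x => ((‖x‖ : ℝ) : ℂ) * (𝓕⁻ m) x := by
    have := (𝓕⁻ m).integrable_pow_mul (volume : Measure Space) 1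
    refine this.mono' (by fun_prop) (.of_forall fun x => ?_)
    simp
  rw [kerMoment, ← ofReal_integral_norm_eq_lintegral_enorm h]
  simp

theorem eLpNorm_conv_moment_le (m : 𝓢(Space, ℂ)) {w : Space → ℂ} (hw : Measurable w) :
    eLpNorm (conv (fun z => ((‖z‖ : ℝ) : ℂ) * (𝓕⁻ m) z) w) 2 volume ≤
      ENNReal.ofReal (kerMoment m) * eLpNorm w 2 volume := by
  rw [← lintegral_kernel_moment]
  exact eLpNorm_conv_le (by fun_prop) hw

/-! ### The commutator with the convection term -/

namespace LittlewoodPaley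

variable (P : LittlewoodPaley)

/-- The even part of the symbol of `χ(2⁻^q D)`; the operator it defines preserves real
distributions. -/
def chiE (q : ℤ) : 𝓢(Space, ℂ) := (1 / 2 : ℂ) • (P.chiS q + refl (P.chiS q))

theorem op_chiE {T : 𝓢'(Space, ℂ)} (hT : IsRealDistribution T) (q : ℤ) (x : Space) :
    op (P.chiE q) T x = ((op (P.chiS q) T x).re : ℂ) := by
  rw [chiE, op_smul_left, op_add_left, ← conj_op hT (fun ξ => by rw [chiS_apply]; simp),
    Complex.add_conj]
  push_cast
  ring

end LittlewoodPaley

theorem bil_add_right (m n n' n'' : 𝓢(Space, ℂ)) (T T' : 𝓢'(Space, ℂ)) (x : Space) :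
    bil m (op n T) (op (n' + n'') T') x = bil m (op n T) (op n' T') x +
      bil m (op n T) (op n'' T') x := by
  rw [bil, bil, bil, ← integral_add (integrable_bil m n n' T T' x) (integrable_bil m n n'' T T' x)]
  congr 1; funext y
  rw [op_add_left]; ring

theorem bil_add_left (m n n' n'' : 𝓢(Space, ℂ)) (T T' : 𝓢'(Space, ℂ)) (x : Space) :
    bil m (op (n + n') T) (op n'' T') x = bil m (op n T) (op n'' T') x +
      bil m (op n' T) (op n'' T') x := by
  rw [bil, bil, bil,
    ← integral_add (integrable_bil m n n'' T T' x) (integrable_bil m n' n'' T T' x)]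
  congr 1; funext y
  rw [op_add_left]; ring

theorem bil_sum_right {ι : Type*} (s : Finset ι) (m n : 𝓢(Space, ℂ)) (n' : ι → 𝓢(Space, ℂ))
    (T T' : 𝓢'(Space, ℂ)) (x : Space) :
    bil m (op n T) (op (∑ i ∈ s, n' i) T') x = ∑ i ∈ s, bil m (op n T) (op (n' i) T') x := by
  simp only [bil]
  rw [← integral_finsetSum _ fun i _ => integrable_bil m n (n' i) T T' x]
  congr 1; funext y
  rw [op_sum_left, Finset.mul_sum, Finset.mul_sum]

/-- Low frequencies of the first factor may be removed when they do not reach the support of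
the symbol. -/
theorem bil_sub_low {T : 𝓢'(Space, ℂ)} {a : Space → ℂ} (ha : HasDensity T a)
    {m n n' : 𝓢(Space, ℂ)} (hc : HasCompactSupport n') (S : 𝓢'(Space, ℂ)) (n₀ : 𝓢(Space, ℂ))
    (h : ∀ ξ η, n' ξ ≠ 0 → n η ≠ 0 → m (ξ + η) = 0) (x : Space) :
    bil m (op n₀ S) (op n' T) x = bil m (op (n₀ - n) S) (op n' T) x := by
  have := bil_add_left m (n₀ - n) n n' S T x
  rw [sub_add_cancel, bil_eq_zero_of_support ha hc S h, add_zero] at this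
  exact this

theorem norm_add_le_sum {p : ℤ} {ξ η : Space} {a b : ℝ} (hξ : 2 * Real.pi * ‖ξ‖ ≤ a * (2 : ℝ) ^ p)
    (hη : 2 * Real.pi * ‖η‖ ≤ b * (2 : ℝ) ^ p) : 2 * Real.pi * ‖ξ + η‖ ≤ (a + b) * (2 : ℝ) ^ p := by
  have h := mul_le_mul_of_nonneg_left (norm_add_le ξ η) (by positivity : 0 ≤ 2 * Real.pi)
  linarith

namespace LittlewoodPaley

variable (P : LittlewoodPaley)

theorem mulI_ne {k : Fin 3} {m : 𝓢(Space, ℂ)} {ξ : Space} (h : mulI k m ξ ≠ 0) : m ξ ≠ 0 := by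
  rw [mulI_apply] at h
  exact right_ne_zero_of_mul h

theorem leray_low_support (q : ℤ) (i l k : Fin 3) (ξ η : Space)
    (hξ : mulI k (P.chiS (q - 2)) ξ ≠ 0) (hη : P.chiS (q - 2) η ≠ 0) :
    P.leray q i l (ξ + η) = 0 := by
  by_contra hne
  have h1 := P.chiS_supp (mulI_ne hξ)
  have h2 := P.chiS_supp hη
  have h3 := (P.phiS_supp (P.phiS_ne_of_leray hne)).1
  have h4 := norm_add_le_sum h1 h2
  have h5 : (2 : ℝ) ^ (q - 2) = (2 : ℝ) ^ q / 4 := by rw [zpow_sub₀ two_ne_zero]; norm_num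
  rw [h5] at h4
  have : (0 : ℝ) < (2 : ℝ) ^ q := by positivity
  linarith

theorem leray_high_support {q j : ℤ} (hj : q + 3 ≤ j) (i l k : Fin 3) (ξ η : Space)
    (hξ : mulI k (P.phiS j) ξ ≠ 0) (hη : P.chiS (j - 2) η ≠ 0) :
    P.leray q i l (ξ + η) = 0 := by
  by_contra hne
  have h1 := (P.phiS_supp (mulI_ne hξ)).1
  have h2 := P.chiS_supp hη
  have h3 := (P.phiS_supp (P.phiS_ne_of_leray hne)).2
  have h5 : (2 : ℝ) ^ (j - 2) = (2 : ℝ) ^ j / 4 := by rw [zpow_sub₀ two_ne_zero]; norm_num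
  have h6 : (2 : ℝ) ^ q * 8 ≤ (2 : ℝ) ^ j := by
    have := zpow_le_zpow_right₀ (by norm_num : (1 : ℝ) ≤ 2) hj
    rw [zpow_add₀ two_ne_zero] at this
    norm_num at this
    exact this
  have h7 : ‖ξ‖ ≤ ‖ξ + η‖ + ‖η‖ := by
    have := norm_sub_le (ξ + η) η
    rwa [add_sub_cancel_right] at this
  have h8 := mul_le_mul_of_nonneg_left h7 (by positivity : 0 ≤ 2 * Real.pi)
  have : (0 : ℝ) < (2 : ℝ) ^ j := by positivity
  rw [h5] at h2
  linarith

/-- The symbol of the frequencies comparable to `2^q`. -/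
def mid (q : ℤ) : 𝓢(Space, ℂ) := ∑ i ∈ Finset.range 5, P.phiS (q - 2 + (i : ℤ))

theorem mid_eq (q : ℤ) : P.mid q = P.chiS (q + 3) - P.chiS (q - 2) := by
  have := P.chiS_add_nat (q - 2) 5
  rw [show q - 2 + ((5 : ℕ) : ℤ) = q + 3 by push_cast; ring] at this
  rw [mid, this, add_sub_cancel_left]

theorem mid_eq_one {q : ℤ} {ξ : Space} (h : P.phiS q ξ ≠ 0) : P.mid q ξ = 1 := by
  have h1 := P.phiS_supp h
  have h0 : (0 : ℝ) < (2 : ℝ) ^ q := by positivity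
  have h5 : (2 : ℝ) ^ (q - 2) = (2 : ℝ) ^ q / 4 := by rw [zpow_sub₀ two_ne_zero]; norm_num
  have h6 : (2 : ℝ) ^ (q + 3) = (2 : ℝ) ^ q * 8 := by rw [zpow_add₀ two_ne_zero]; norm_num
  have h2 : P.chiS (q - 2) ξ = 0 := by
    by_contra hne
    have := P.chiS_supp hne
    rw [h5] at this
    linarith [h1.1]
  rw [mid_eq, sub_apply, h2, P.chiS_eq_one, sub_zero]
  rw [h6]
  linarith [h1.2]

theorem mulS_mulI_leray_mid (q : ℤ) (i l k : Fin 3) :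
    mulS (mulI k (P.leray q i l)) (P.mid q) = mulI k (P.leray q i l) := by
  ext ξ
  rw [mulS_apply]
  by_cases h : mulI k (P.leray q i l) ξ = 0
  · rw [h, zero_mul]
  · rw [P.mid_eq_one (P.phiS_ne_of_leray (mulI_ne h)), mul_one]

/-- The projected block differs from the block of the identity by a gradient, the one of `ξᵢ
φ(2^{-q}ξ) / (2πi|ξ|²)`. -/
theorem exists_gradient_symbol (q : ℤ) (i : Fin 3) : ∃ n : 𝓢(Space, ℂ), ∀ l,
    P.leray q i l = (if i = l then P.phiS q else 0) - mulI l n := by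
  have hd : ∃ n : 𝓢(Space, ℂ), ∀ ξ, n ξ = P.phiS q ξ *
      (((ξ i / ‖ξ‖ ^ 2 : ℝ) : ℂ) * (2 * Real.pi * Complex.I)⁻¹) := by
    refine exists_schwartz_mul (P.hasCompactSupport_phiS q) (r := (2 : ℝ) ^ q / 16) (by positivity)
      (fun ξ hξ => ?_)
      (g := fun ξ => (((ξ i / ‖ξ‖ ^ 2 : ℝ) : ℂ) * (2 * Real.pi * Complex.I)⁻¹)) fun ξ hξ => ?_
    · rw [phiS, dil_apply]
      apply P.phi0_eq_zero
      rw [norm_smul, Real.norm_of_nonneg (by positivity), zpow_neg, inv_mul_lt_iff₀ (by positivity)]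
      linarith
    refine (Complex.ofRealCLM.contDiff.contDiffAt.comp ξ ?_).mul contDiffAt_const
    refine ContDiffAt.div ?_ (contDiff_norm_sq ℝ).contDiffAt (by simpa using hξ)
    exact (EuclideanSpace.proj (𝕜 := ℝ) i : Space →L[ℝ] ℝ).contDiff.contDiffAt
  obtain ⟨n, hn⟩ := hd
  refine ⟨n, fun l => ?_⟩
  ext ξ
  rw [leray_apply, sub_apply, mulI_apply, hn]
  have h4 : (2 * Real.pi * Complex.I) * (2 * Real.pi * Complex.I : ℂ)⁻¹ = 1 :=
    mul_inv_cancel₀ Complex.two_pi_I_ne_zero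
  have h5 : (if i = l then P.phiS q else 0 : 𝓢(Space, ℂ)) ξ = P.phiS q ξ *
    (if i = l then 1 else 0) := by
    split_ifs <;> simp
  rw [h5]
  push_cast
  simp only [div_eq_mul_inv] at h4 ⊢
  have h6 : ((if i = l then (1 : ℝ) else 0 : ℝ) : ℂ) = if i = l then 1 else 0 := by
    split_ifs <;> simp
  rw [h6]
  linear_combination (P.phiS q ξ * (ξ i : ℂ) * (ξ l : ℂ) * ((‖ξ‖ : ℂ) ^ 2)⁻¹) * h4

theorem mulI_comm (k l : Fin 3) (m : 𝓢(Space, ℂ)) : mulI k (mulI l m) = mulI l (mulI k m) := by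
  ext ξ; simp only [mulI_apply]; ring

/-- The Leray projector is the identity on divergence free fields. -/
theorem sum_op_leray {w : Fin 3 → 𝓢'(Space, ℂ)} (hw : divergence w = 0) (q : ℤ) (i : Fin 3)
    (x : Space) : ∑ l, op (P.leray q i l) (w l) x = op (P.phiS q) (w i) x := by
  obtain ⟨n, hn⟩ := P.exists_gradient_symbol q i
  have h1 : ∀ l, op (P.leray q i l) (w l) x =
      (if i = l then op (P.phiS q) (w i) x else 0) - op (mulI l n) (w l) x := by
    intro l
    rw [hn, op_sub_left]
    split_ifs with h
    · rw [h]
    · rw [op_zero_left]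
  rw [Finset.sum_congr rfl fun l _ => h1 l, Finset.sum_sub_distrib, sum_op_mulI_eq_zero hw]
  simp

theorem sum_op_mulI_leray {w : Fin 3 → 𝓢'(Space, ℂ)} (hw : divergence w = 0) (q : ℤ) (i k : Fin 3)
    (x : Space) : ∑ l, op (mulI k (P.leray q i l)) (w l) x = op (mulI k (P.phiS q)) (w i) x := by
  obtain ⟨n, hn⟩ := P.exists_gradient_symbol q i
  have h1 : ∀ l, op (mulI k (P.leray q i l)) (w l) x =
      (if i = l then op (mulI k (P.phiS q)) (w i) x else 0) - op (mulI l (mulI k n)) (w l) x := by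
    intro l
    rw [hn, map_sub, op_sub_left, mulI_comm k l]
    split_ifs with h
    · rw [h]
    · rw [map_zero, op_zero_left]
  rw [Finset.sum_congr rfl fun l _ => h1 l, Finset.sum_sub_distrib, sum_op_mulI_eq_zero hw]
  simp

end LittlewoodPaley

/-- A real, divergence free, log-Lipschitz vector field, with bound `h`. -/
structure IsTransport (P : LittlewoodPaley) (u : Fin 3 → 𝓢'(Space, ℂ)) (h : ℝ) : Prop where
  nonneg : 0 ≤ h
  real : ∀ k, IsRealDistribution (u k)
  bound : ∀ k, LLBound P (u k) h
  div : divergence u = 0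

/-- The size of the frequencies larger than `2^q` of a log-Lipschitz field. -/
def gain (q : ℤ) : ℝ := (2 : ℝ) ^ (-q) * (q.toNat + 5)

theorem gain_nonneg (q : ℤ) : 0 ≤ gain q := by unfold gain; positivity

theorem shift_le_gain (q : ℤ) : (2 : ℝ) ^ (-(q - 2)) * ((q - 2).toNat + 3) ≤ 4 * gain q := by
  have h1 : (2 : ℝ) ^ (-(q - 2)) = 4 * (2 : ℝ) ^ (-q) := by
    rw [neg_sub, sub_eq_add_neg, zpow_add₀ two_ne_zero]; norm_num
  have h2 : (((q - 2).toNat : ℕ) : ℝ) ≤ q.toNat := by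
    exact_mod_cast (show (q - 2).toNat ≤ q.toNat by omega)
  rw [h1, gain, mul_assoc]
  gcongr
  norm_num

namespace LittlewoodPaley

variable (P : LittlewoodPaley)

/-- What the low frequency cut-offs omit is bounded, with the gain `gain q`; on a real field `chiE`
acts as the real part of the low frequency cut-off, so the second bound also uses that the imaginary
part only has high frequencies. -/
theorem exists_high_freq_bound : ∃ C : ℝ, 0 ≤ C ∧ ∀ (u : Fin 3 → 𝓢'(Space, ℂ)) (h : ℝ),
    IsTransport P u h →
    (∀ (k : Fin 3) (q a : ℤ), q - 2 ≤ a → ∀ x,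
      ‖op (P.chiS a - P.chiS (q - 2)) (u k) x‖ ≤ C * gain q * h) ∧
    (∀ (k : Fin 3) (q a : ℤ), (q.toNat : ℤ) + 2 ≤ a → ∀ x,
      ‖op (P.chiS a - P.chiE ((q.toNat : ℤ) + 2)) (u k) x‖ ≤ C * gain q * h) := by
  obtain ⟨C₁, h1, hb1⟩ := P.exists_chi_sub_bound
  obtain ⟨C₂, h2, hb2⟩ := P.exists_im_bound
  refine ⟨4 * C₁ + C₂, by positivity, fun u h hu => ⟨fun k q a hqa x => ?_, fun k q a hqa x => ?_⟩⟩
  · rw [op_sub_left]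
    refine (hb1 (u k) h hu.nonneg (hu.bound k) _ _ hqa x).trans ?_
    have h3 := mul_le_mul_of_nonneg_right (shift_le_gain q) hu.nonneg
    have h4 := mul_le_mul_of_nonneg_left h3 h1
    have h5 : 0 ≤ C₂ * gain q * h := mul_nonneg (mul_nonneg h2 (gain_nonneg q)) hu.nonneg
    nlinarith
  · set Q : ℤ := (q.toNat : ℤ) + 2 with hQ
    have h3 : (2 : ℝ) ^ (-Q) * (Q.toNat + 3) ≤ gain q := by
      have h4 : (2 : ℝ) ^ (-Q) ≤ (2 : ℝ) ^ (-q) :=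
        zpow_le_zpow_right₀ (by norm_num) (by omega)
      have h5 : ((Q.toNat : ℕ) : ℝ) + 3 = q.toNat + 5 := by
        exact_mod_cast (show Q.toNat + 3 = q.toNat + 5 by omega)
      rw [gain, h5]
      gcongr
    have e : op (P.chiS a - P.chiE Q) (u k) x = (op (P.chiS a) (u k) x - op (P.chiS Q) (u k) x) +
        (op (P.chiS Q) (u k) x - ((op (P.chiS Q) (u k) x).re : ℂ)) := by
      rw [op_sub_left, P.op_chiE (hu.real k)]; ring
    rw [e]
    refine (norm_add_le _ _).trans ((add_le_add (hb1 (u k) h hu.nonneg (hu.bound k) Q a hqa x)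
      (hb2 (u k) h (hu.real k) (hu.bound k) Q x)).trans ?_)
    have h6 := mul_le_mul_of_nonneg_right h3 hu.nonneg
    have h7 := mul_le_mul_of_nonneg_left h6 h1
    have h8 := mul_le_mul_of_nonneg_left h6 h2
    have h9 : 0 ≤ C₁ * (gain q * h) := mul_nonneg h1 (mul_nonneg (gain_nonneg q) hu.nonneg)
    nlinarith

end LittlewoodPaley

theorem IsTransport.lipschitz {P : LittlewoodPaley} {u : Fin 3 → 𝓢'(Space, ℂ)} {h : ℝ}
    (hu : IsTransport P u h) (k : Fin 3) (q : ℤ) (x y : Space) :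
    ‖op (P.chiE ((q.toNat : ℤ) + 2)) (u k) y - op (P.chiE ((q.toNat : ℤ) + 2)) (u k) x‖ ≤
      3 * ((q.toNat + 5) * h) * ‖y - x‖ := by
  rw [P.op_chiE (hu.real k), P.op_chiE (hu.real k), ← Complex.ofReal_sub, ← Complex.sub_re,
    Complex.norm_real]
  refine (Complex.abs_re_le_norm _).trans ?_
  have := (hu.bound k).lipschitz (q := q.toNat + 2) (by omega) x y
  push_cast at this
  refine this.trans ?_
  have := hu.nonneg
  gcongr ?_ * ‖y - x‖
  nlinarith

section Pieces

variable {P : LittlewoodPaley} {u : Fin 3 → 𝓢'(Space, ℂ)} {h C : ℝ}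

theorem enorm_sum_bil_le {n : 𝓢(Space, ℂ)} {m' : Fin 3 → 𝓢(Space, ℂ)} {c : ℝ}
    (hb : ∀ k y, ‖op n (u k) y‖ ≤ c) (w : Fin 3 → Space → ℂ) (x : Space) :
    ‖∑ k, bil (m' k) (op n (u k)) (w k) x‖ₑ ≤
      ∑ k, ENNReal.ofReal c * conv ⇑(𝓕⁻ (m' k) : 𝓢(Space, ℂ)) (w k) x :=
  (enorm_sum_le _ _).trans (Finset.sum_le_sum fun k _ => enorm_bil_le (hb k) x)

theorem enorm_low_le
    (hb : ∀ (k : Fin 3) (q a : ℤ), q - 2 ≤ a → ∀ x,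
      ‖op (P.chiS a - P.chiS (q - 2)) (u k) x‖ ≤ C * gain q * h)
    {w : 𝓢'(Space, ℂ)} {a : Space → ℂ} (ha : HasDensity w a) {q J : ℤ} (hJ : q - 2 ≤ J)
    (i l : Fin 3) (x : Space) :
    ‖∑ k, bil (P.leray q i l) (op (P.chiS J) (u k)) (op (mulI k (P.chiS (q - 2))) w) x‖ₑ ≤
      ∑ k, ENNReal.ofReal (C * gain q * h) * conv ⇑(𝓕⁻ (P.leray q i l) : 𝓢(Space, ℂ))
        (op (mulI k (P.chiS (q - 2))) w) x := by
  rw [Finset.sum_congr rfl fun k _ => bil_sub_low ha (n := P.chiS (q - 2))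
    (HasDensity.hasCompactSupport_mulI (P.hasCompactSupport_chiS _) k) (u k) (P.chiS J)
    (P.leray_low_support q i l k) x]
  exact enorm_sum_bil_le (m' := fun _ => P.leray q i l) (fun k y => hb k q J hJ y) _ x

theorem enorm_high_le (hu : divergence u = 0)
    (hb : ∀ (k : Fin 3) (q a : ℤ), q - 2 ≤ a → ∀ x,
      ‖op (P.chiS a - P.chiS (q - 2)) (u k) x‖ ≤ C * gain q * h)
    {w : 𝓢'(Space, ℂ)} {a : Space → ℂ} (ha : HasDensity w a) {q j J : ℤ} (hj : q + 3 ≤ j)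
    (hJ : j - 2 ≤ J) (i l : Fin 3) (x : Space) :
    ‖∑ k, bil (P.leray q i l) (op (P.chiS J) (u k)) (op (mulI k (P.phiS j)) w) x‖ₑ ≤
      ∑ k, ENNReal.ofReal (C * gain j * h) * conv ⇑(𝓕⁻ (mulI k (P.leray q i l)) : 𝓢(Space, ℂ))
        (op (P.phiS j) w) x := by
  rw [Finset.sum_congr rfl fun k _ => bil_sub_low ha (n := P.chiS (j - 2))
    (HasDensity.hasCompactSupport_mulI (P.hasCompactSupport_phiS _) k) (u k) (P.chiS J)
    (P.leray_high_support hj i l k) x, sum_bil_mulI hu]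
  exact enorm_sum_bil_le (m' := fun k => mulI k (P.leray q i l)) (fun k y => hb k j J hJ y)
    (fun _ => op (P.phiS j) w) x

theorem enorm_mid_le (hu : divergence u = 0)
    (hb : ∀ (k : Fin 3) (q a : ℤ), (q.toNat : ℤ) + 2 ≤ a → ∀ x,
      ‖op (P.chiS a - P.chiE ((q.toNat : ℤ) + 2)) (u k) x‖ ≤ C * gain q * h)
    (w : 𝓢'(Space, ℂ)) {q J : ℤ} (hJ : (q.toNat : ℤ) + 2 ≤ J) (i l : Fin 3) (x : Space) :
    ‖∑ k, bil (P.leray q i l) (op (P.chiS J - P.chiE ((q.toNat : ℤ) + 2)) (u k))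
        (op (mulI k (P.mid q)) w) x‖ₑ ≤
      ∑ k, ENNReal.ofReal (C * gain q * h) * conv ⇑(𝓕⁻ (mulI k (P.leray q i l)) : 𝓢(Space, ℂ))
        (op (P.mid q) w) x := by
  rw [sum_bil_mulI hu]
  exact enorm_sum_bil_le (m' := fun k => mulI k (P.leray q i l)) (fun k y => hb k q J hJ y)
    (fun _ => op (P.mid q) w) x

/-- The commutator with the convolution kernel gains a derivative on a Lipschitz field. -/
theorem enorm_commutator_le (hu : IsTransport P u h) {v : Fin 3 → 𝓢'(Space, ℂ)}
    (hv : divergence v = 0) (q : ℤ) (i : Fin 3) (x : Space) :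
    ‖(∑ l, ∑ k, bil (P.leray q i l) (op (P.chiE ((q.toNat : ℤ) + 2)) (u k))
        (op (mulI k (P.mid q)) (v l)) x) -
      ∑ k, op (P.chiE ((q.toNat : ℤ) + 2)) (u k) x * op (mulI k (P.phiS q)) (v i) x‖ₑ ≤
    ∑ l, ∑ k, ENNReal.ofReal (3 * ((q.toNat + 5) * h)) *
      conv (fun z => ((‖z‖ : ℝ) : ℂ) * (𝓕⁻ (mulI k (P.leray q i l))) z) (op (P.mid q) (v l)) x := by
  set U : Fin 3 → Space → ℂ := fun k => op (P.chiE ((q.toNat : ℤ) + 2)) (u k) with hU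
  -- The block of `v` is a convolution of `mid q v` with the same kernels as the projected
  -- convection term.
  have h1 : ∀ k, op (mulI k (P.phiS q)) (v i) x =
      ∑ l, ∫ y, (𝓕⁻ (mulI k (P.leray q i l))) (x - y) * op (P.mid q) (v l) y := by
    intro k
    rw [← P.sum_op_mulI_leray hv]
    refine Finset.sum_congr rfl fun l _ => ?_
    rw [← op_mulS, P.mulS_mulI_leray_mid]
  -- After an integration by parts the commutator contains only differences of the field.
  have h2 : (∑ l, ∑ k, bil (P.leray q i l) (U k) (op (mulI k (P.mid q)) (v l)) x) -
      ∑ k, U k x * op (mulI k (P.phiS q)) (v i) x =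
      ∑ l, ∑ k, ∫ y, (𝓕⁻ (mulI k (P.leray q i l))) (x - y) *
        ((U k y - U k x) * op (P.mid q) (v l) y) := by
    rw [Finset.sum_congr rfl fun l _ => sum_bil_mulI hu.div (P.leray q i l) _ (P.mid q) (v l) x]
    simp only [h1, Finset.mul_sum]
    rw [Finset.sum_comm (f := fun k l => U k x * _), ← Finset.sum_sub_distrib]
    refine Finset.sum_congr rfl fun l _ => ?_
    rw [← Finset.sum_sub_distrib]
    refine Finset.sum_congr rfl fun k _ => ?_
    rw [bil, ← integral_const_mul, ← integral_sub (integrable_bil _ _ _ _ _ x)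
      ((integrable_kernel_mul_op _ _ _ x).const_mul _)]
    congr 1; funext y
    ring
  rw [h2]
  refine (enorm_sum_le _ _).trans (Finset.sum_le_sum fun l _ => (enorm_sum_le _ _).trans
    (Finset.sum_le_sum fun k _ => ?_))
  refine (enorm_integral_le_lintegral_enorm _).trans ?_
  rw [conv, ← lintegral_const_mul' _ _ ENNReal.ofReal_ne_top]
  refine lintegral_mono fun y => ?_
  have h3 : ‖U k y - U k x‖ₑ ≤
      ENNReal.ofReal (3 * ((q.toNat + 5) * h)) * ‖((‖x - y‖ : ℝ) : ℂ)‖ₑ := by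
    have h4 := hu.lipschitz k q x y
    have : 0 ≤ 3 * ((q.toNat + 5) * h) := by have := hu.nonneg; positivity
    rw [← ofReal_norm, ← ofReal_norm, ← ENNReal.ofReal_mul this]
    refine ENNReal.ofReal_le_ofReal (h4.trans_eq ?_)
    rw [Complex.norm_real, norm_norm, norm_sub_rev]
  simp only [enorm_mul]
  calc _ ≤ ‖(𝓕⁻ (mulI k (P.leray q i l))) (x - y)‖ₑ *
        ((ENNReal.ofReal (3 * ((q.toNat + 5) * h)) * ‖((‖x - y‖ : ℝ) : ℂ)‖ₑ) *
          ‖op (P.mid q) (v l) y‖ₑ) := by gcongr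
    _ = _ := by ring

end Pieces

/-- The off-diagonal decay of the commutator estimate. -/
def decay (q j : ℤ) : ℝ := (2 : ℝ) ^ (-|q - j|) * ((max q j).toNat + 5)

theorem decay_nonneg (q j : ℤ) : 0 ≤ decay q j := by unfold decay; positivity

theorem decay_of_le {q j : ℤ} (h : j ≤ q) : decay q j = gain q * (2 : ℝ) ^ j := by
  rw [decay, gain, abs_of_nonneg (by omega), max_eq_left h, neg_sub, sub_eq_neg_add,
    zpow_add₀ two_ne_zero]
  ring

theorem decay_of_ge {q j : ℤ} (h : q ≤ j) : decay q j = gain j * (2 : ℝ) ^ q := by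
  rw [decay, gain, abs_of_nonpos (by omega), max_eq_right h, neg_neg, sub_eq_neg_add,
    zpow_add₀ two_ne_zero]
  ring

theorem le_decay {q j : ℤ} (h : |q - j| ≤ 2) : (q.toNat : ℝ) + 5 ≤ 4 * decay q j := by
  have h1 : (1 / 4 : ℝ) ≤ (2 : ℝ) ^ (-|q - j|) := by
    have := zpow_le_zpow_right₀ (by norm_num : (1 : ℝ) ≤ 2) (neg_le_neg h)
    norm_num at this ⊢
    exact this
  have h2 : (q.toNat : ℝ) ≤ (max q j).toNat := by
    exact_mod_cast Int.toNat_le_toNat (le_max_left q j)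
  rw [decay]
  have h3 : (0 : ℝ) ≤ q.toNat := by positivity
  nlinarith

theorem tsum_nat_le_tsum_int (f : ℤ → ℝ≥0∞) {g : ℕ → ℤ} (hg : Function.Injective g) :
    ∑' n, f (g n) ≤ ∑' j, f j := ENNReal.tsum_comp_le_tsum_of_injective hg f

theorem eLpNorm_op_sum_le {ι : Type*} (s : Finset ι) (m : ι → 𝓢(Space, ℂ)) (w : 𝓢'(Space, ℂ)) :
    eLpNorm (op (∑ i ∈ s, m i) w) 2 volume ≤ ∑ i ∈ s, eLpNorm (op (m i) w) 2 volume := by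
  have : op (∑ i ∈ s, m i) w = ∑ i ∈ s, op (m i) w := by
    funext x; rw [op_sum_left, Finset.sum_apply]
  rw [this]
  exact eLpNorm_sum_le (fun i _ => (continuous_op _ _).aestronglyMeasurable) (by norm_num)

namespace LittlewoodPaley

variable (P : LittlewoodPaley)

theorem enorm_chiS_le_tsum (q : ℤ) {ξ : Space} (hξ : ξ ≠ 0) :
    ‖P.chiS q ξ‖ₑ ≤ ∑' n : ℕ, ‖P.phiS (q - 1 - n) ξ‖ₑ := by
  obtain ⟨M, hM⟩ : ∃ M : ℕ, P.chiS (q - M) ξ = 0 := by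
    have hpos : 0 < 2 * Real.pi * ‖ξ‖ := by have := norm_pos_iff.2 hξ; positivity
    obtain ⟨M, hM⟩ := exists_pow_lt_of_lt_one
      (show 0 < 2 * Real.pi * ‖ξ‖ / (4 / 3 * (2 : ℝ) ^ q) by positivity)
      (by norm_num : (1 / 2 : ℝ) < 1)
    refine ⟨M, ?_⟩
    by_contra hne
    have h1 := P.chiS_supp hne
    rw [zpow_sub₀ two_ne_zero, zpow_natCast] at h1
    rw [lt_div_iff₀ (by positivity), one_div, inv_pow] at hM
    have : 4 / 3 * ((2 : ℝ) ^ q / 2 ^ M) = (2 ^ M)⁻¹ * (4 / 3 * 2 ^ q) := by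
      field_simp
    linarith
  have h1 := P.chiS_add_nat (q - M) M
  rw [sub_add_cancel] at h1
  rw [h1, add_apply, hM, zero_add, sum_apply, ← Finset.sum_range_reflect]
  refine (enorm_sum_le _ _).trans ?_
  refine le_trans (le_of_eq ?_) (ENNReal.sum_le_tsum (Finset.range M))
  refine Finset.sum_congr rfl fun i hi => ?_
  have := Finset.mem_range.1 hi
  congr 3
  omega

theorem eLpNorm_low_le {w : 𝓢'(Space, ℂ)} {a : Space → ℂ} (ha : HasDensity w a) (q : ℤ)
    (k : Fin 3) : eLpNorm (op (mulI k (P.chiS q)) w) 2 volume ≤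
      ∑' n : ℕ, ENNReal.ofReal (8 / 3 * (2 : ℝ) ^ (q - 1 - n)) *
        eLpNorm (op (P.phiS (q - 1 - n)) w) 2 volume := by
  have hm := ha.measurable
  have h1 : ∀ n : ℕ, eLpNorm (op (P.phiS (q - 1 - n)) w) 2 volume =
      eLpNorm (fun ξ => ‖a ξ * P.phiS (q - 1 - n) ξ‖ₑ) 2 volume := by
    intro n
    rw [ha.eLpNorm_op (P.hasCompactSupport_phiS _), eLpNorm_enorm]
  rw [ha.eLpNorm_op (HasDensity.hasCompactSupport_mulI (P.hasCompactSupport_chiS _) k),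
    ← eLpNorm_enorm]
  calc _ ≤ eLpNorm (fun ξ => ∑' n : ℕ, ENNReal.ofReal (8 / 3 * (2 : ℝ) ^ (q - 1 - n)) *
        ‖a ξ * P.phiS (q - 1 - n) ξ‖ₑ) 2 volume := by
        refine eLpNorm_mono_enorm_ae ?_
        have h0 : ∀ᵐ ξ : Space, ξ ≠ 0 := by simp [ae_iff, measure_singleton]
        filter_upwards [h0] with ξ hξ
        simp only [enorm_eq_self]
        rw [mulI_apply, enorm_mul (a ξ), enorm_mul _ (P.chiS q ξ)]
        calc _ ≤ ‖a ξ‖ₑ * (‖2 * Real.pi * Complex.I * ((ξ k : ℝ) : ℂ)‖ₑ *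
              ∑' n : ℕ, ‖P.phiS (q - 1 - n) ξ‖ₑ) := by
              gcongr
              exact P.enorm_chiS_le_tsum q hξ
          _ = ∑' n : ℕ, ‖a ξ‖ₑ * (‖2 * Real.pi * Complex.I * ((ξ k : ℝ) : ℂ)‖ₑ *
                ‖P.phiS (q - 1 - n) ξ‖ₑ) := by
              rw [ENNReal.tsum_mul_left, ENNReal.tsum_mul_left]
          _ ≤ _ := by
              refine ENNReal.tsum_le_tsum fun n => ?_
              rw [enorm_mul (a ξ), mul_left_comm]
              by_cases hz : P.phiS (q - 1 - n) ξ = 0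
              · simp [hz]
              gcongr
              rw [← ofReal_norm]
              refine ENNReal.ofReal_le_ofReal ?_
              have h2 := (P.phiS_supp hz).2
              have h3 : |ξ k| ≤ ‖ξ‖ := PiLp.norm_apply_le ξ k
              simp only [norm_mul, Complex.norm_ofNat, Complex.norm_real, Complex.norm_I,
                Real.norm_eq_abs, abs_of_pos Real.pi_pos, mul_one]
              have := mul_le_mul_of_nonneg_left h3 (by positivity : 0 ≤ 2 * Real.pi)
              linarith
    _ ≤ ∑' n : ℕ, eLpNorm (fun ξ => ENNReal.ofReal (8 / 3 * (2 : ℝ) ^ (q - 1 - n)) *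
        ‖a ξ * P.phiS (q - 1 - n) ξ‖ₑ) 2 volume := by
        refine eLpNorm_two_tsum_le fun n => ?_
        have := (P.phiS (q - 1 - n)).continuous.measurable
        fun_prop
    _ ≤ _ := by
        refine ENNReal.tsum_le_tsum fun n => ?_
        rw [h1]
        refine eLpNorm_const_mul_ennreal _ ?_
        have := (P.phiS (q - 1 - n)).continuous.measurable
        fun_prop

/-- The pointwise bound of the commutator, with constants `C` and `h`. -/
def commBound (C h : ℝ) (v : Fin 3 → 𝓢'(Space, ℂ)) (q : ℤ) (i l : Fin 3) (x : Space) : ℝ≥0∞ :=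
  ((∑ k, ENNReal.ofReal (C * gain q * h) * conv ⇑(𝓕⁻ (P.leray q i l) : 𝓢(Space, ℂ))
      (op (mulI k (P.chiS (q - 2))) (v l)) x) +
    (∑ k, ENNReal.ofReal (C * gain q * h) * conv ⇑(𝓕⁻ (mulI k (P.leray q i l)) : 𝓢(Space, ℂ))
      (op (P.mid q) (v l)) x)) +
  ((∑ k, ENNReal.ofReal (3 * ((q.toNat + 5) * h)) *
      conv (fun z => ((‖z‖ : ℝ) : ℂ) * (𝓕⁻ (mulI k (P.leray q i l))) z) (op (P.mid q) (v l)) x) +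
    ∑' n : ℕ, ∑ k, ENNReal.ofReal (C * gain (q + 3 + n) * h) *
      conv ⇑(𝓕⁻ (mulI k (P.leray q i l)) : 𝓢(Space, ℂ)) (op (P.phiS (q + 3 + n)) (v l)) x)

theorem enorm_remainder_le {u v : Fin 3 → 𝓢'(Space, ℂ)} {h C : ℝ} (hu : IsTransport P u h)
    (hb1 : ∀ (k : Fin 3) (q a : ℤ), q - 2 ≤ a → ∀ x,
      ‖op (P.chiS a - P.chiS (q - 2)) (u k) x‖ ≤ C * gain q * h)
    (hb2 : ∀ (k : Fin 3) (q a : ℤ), (q.toNat : ℤ) + 2 ≤ a → ∀ x,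
      ‖op (P.chiS a - P.chiE ((q.toNat : ℤ) + 2)) (u k) x‖ ≤ C * gain q * h)
    (hv : divergence v = 0) (ha : ∀ l, ∃ a, HasDensity (v l) a) {q J : ℤ} (hJ : q + 3 ≤ J)
    (hJ' : (q.toNat : ℤ) + 2 ≤ J) (i : Fin 3) (x : Space) :
    ‖(∑ l, ∑ k, bil (P.leray q i l) (op (P.chiS J) (u k)) (op (mulI k (P.chiS J)) (v l)) x) -
      ∑ k, op (P.chiE ((q.toNat : ℤ) + 2)) (u k) x * op (mulI k (P.phiS q)) (v i) x‖ₑ ≤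
    ∑ l, P.commBound C h v q i l x := by
  choose a ha using ha
  obtain ⟨n, hn⟩ := Int.le.dest hJ
  obtain ⟨E, hE⟩ : ∃ E, E = P.chiE ((q.toNat : ℤ) + 2) := ⟨_, rfl⟩
  have h1 : P.chiS J = P.chiS (q - 2) + P.mid q + ∑ i ∈ Finset.range n, P.phiS (q + 3 + i) := by
    rw [← hn, chiS_add_nat, mid_eq]
    abel
  -- Low, middle and high frequencies of `v`. On the middle ones, the transport by `E u` is split
  -- off from the field.
  have h2 : ∀ l, ∑ k, bil (P.leray q i l) (op (P.chiS J) (u k)) (op (mulI k (P.chiS J)) (v l)) x =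
      (∑ k, bil (P.leray q i l) (op (P.chiS J) (u k)) (op (mulI k (P.chiS (q - 2))) (v l)) x) +
      (∑ k, bil (P.leray q i l) (op (P.chiS J - E) (u k)) (op (mulI k (P.mid q)) (v l)) x) +
      (∑ j ∈ Finset.range n, ∑ k, bil (P.leray q i l) (op (P.chiS J) (u k))
        (op (mulI k (P.phiS (q + 3 + j))) (v l)) x) +
      ∑ k, bil (P.leray q i l) (op E (u k)) (op (mulI k (P.mid q)) (v l)) x := by
    intro l
    rw [Finset.sum_comm (s := Finset.range n), ← Finset.sum_add_distrib, ← Finset.sum_add_distrib,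
      ← Finset.sum_add_distrib]
    refine Finset.sum_congr rfl fun k _ => ?_
    have e1 := bil_add_left (P.leray q i l) (P.chiS J - E) E (mulI k (P.mid q)) (u k) (v l) x
    rw [sub_add_cancel] at e1
    have e2 : mulI k (P.chiS J) = mulI k (P.chiS (q - 2)) + mulI k (P.mid q) +
        ∑ j ∈ Finset.range n, mulI k (P.phiS (q + 3 + j)) := by
      rw [h1, map_add, map_add, map_sum]
    rw [e2, bil_add_right, bil_add_right, bil_sum_right, e1]
    ring
  have hD := enorm_commutator_le hu hv q i x
  have hA := fun l => enorm_low_le hb1 (ha l) (show q - 2 ≤ J by omega) i l x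
  have hB := fun l => enorm_mid_le hu.div hb2 (v l) hJ' i l x
  have hH : ∀ l, ‖∑ j ∈ Finset.range n, ∑ k, bil (P.leray q i l) (op (P.chiS J) (u k))
        (op (mulI k (P.phiS (q + 3 + j))) (v l)) x‖ₑ ≤
      ∑' n : ℕ, ∑ k, ENNReal.ofReal (C * gain (q + 3 + n) * h) *
        conv ⇑(𝓕⁻ (mulI k (P.leray q i l)) : 𝓢(Space, ℂ)) (op (P.phiS (q + 3 + n)) (v l)) x := by
    intro l
    refine (enorm_sum_le _ _).trans ((Finset.sum_le_sum fun j hj => ?_).trans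
      (ENNReal.sum_le_tsum (Finset.range n)))
    exact enorm_high_le hu.div hb1 (ha l) (by omega)
      (by have := Finset.mem_range.1 hj; omega) i l x
  rw [← hE] at hD hB ⊢
  rw [Finset.sum_congr rfl fun l _ => h2 l, Finset.sum_add_distrib, add_sub_assoc]
  clear h2 h1
  calc _ ≤ (∑ l, ((_ + _) + _)) + _ :=
        (enorm_add_le _ _).trans (add_le_add ((enorm_sum_le _ _).trans (Finset.sum_le_sum
          fun l _ => (enorm_add_le _ _).trans (add_le_add ((enorm_add_le _ _).trans
            (add_le_add (hA l) (hB l))) (hH l)))) hD)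
    _ = _ := by
        rw [← Finset.sum_add_distrib]
        refine Finset.sum_congr rfl fun l _ => ?_
        rw [commBound, add_assoc, add_comm (∑' _, _)]

end LittlewoodPaley

namespace LittlewoodPaley

variable (P : LittlewoodPaley)

/-- A bound of the kernels of the Leray projector on the unit shell. -/
def lerayConst : ℝ := ∑ i, ∑ l, (kerNorm (P.leray0 i l) +
  ∑ k, (kerNorm (mulI k (P.leray0 i l)) + kerMoment (mulI k (P.leray0 i l))))

theorem kerNorm_leray_le (q : ℤ) (i l k : Fin 3) :
    kerNorm (P.leray q i l) ≤ P.lerayConst ∧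
    kerNorm (mulI k (P.leray q i l)) ≤ (2 : ℝ) ^ q * P.lerayConst ∧
    kerMoment (mulI k (P.leray q i l)) ≤ P.lerayConst := by
  have h0 : ∀ i l, 0 ≤ kerNorm (P.leray0 i l) +
      ∑ k, (kerNorm (mulI k (P.leray0 i l)) + kerMoment (mulI k (P.leray0 i l))) := fun i l =>
    add_nonneg (kerNorm_nonneg _) (Finset.sum_nonneg fun k _ =>
      add_nonneg (kerNorm_nonneg _) (kerMoment_nonneg _))
  have h1 : kerNorm (P.leray0 i l) +
      ∑ k, (kerNorm (mulI k (P.leray0 i l)) + kerMoment (mulI k (P.leray0 i l))) ≤ P.lerayConst :=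
    (Finset.single_le_sum (f := fun l => kerNorm (P.leray0 i l) + ∑ k,
      (kerNorm (mulI k (P.leray0 i l)) + kerMoment (mulI k (P.leray0 i l)))) (fun l _ => h0 i l)
      (Finset.mem_univ l)).trans (Finset.single_le_sum (f := fun i => ∑ l, (kerNorm (P.leray0 i l) +
        ∑ k, (kerNorm (mulI k (P.leray0 i l)) + kerMoment (mulI k (P.leray0 i l)))))
        (fun i _ => Finset.sum_nonneg fun l _ => h0 i l) (Finset.mem_univ i))
  have h2 : kerNorm (mulI k (P.leray0 i l)) + kerMoment (mulI k (P.leray0 i l)) ≤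
      ∑ k, (kerNorm (mulI k (P.leray0 i l)) + kerMoment (mulI k (P.leray0 i l))) :=
    Finset.single_le_sum (f := fun k => kerNorm (mulI k (P.leray0 i l)) +
      kerMoment (mulI k (P.leray0 i l))) (fun k _ => add_nonneg (kerNorm_nonneg _)
        (kerMoment_nonneg _)) (Finset.mem_univ k)
  have h3 := kerNorm_nonneg (P.leray0 i l)
  have h4 := kerNorm_nonneg (mulI k (P.leray0 i l))
  have h5 := kerMoment_nonneg (mulI k (P.leray0 i l))
  refine ⟨?_, ?_, ?_⟩
  · rw [leray, kerNorm_dil]; linarith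
  · rw [leray, kerNorm_mulI_dil]
    gcongr
    linarith
  · rw [leray, kerMoment_mulI_dil]; linarith

/-- The sequence that dominates the commutator in the shell `q`. -/
def decaySum (F : ℤ → ℝ≥0∞) (q : ℤ) : ℝ≥0∞ := ∑' j, ENNReal.ofReal (decay q j) * F j

theorem eLpNorm_commBound_le {v : Fin 3 → 𝓢'(Space, ℂ)} {h C : ℝ} (hC : 0 ≤ C) (h0 : 0 ≤ h)
    (q : ℤ) (i l : Fin 3) (ha : ∃ a, HasDensity (v l) a) :
    eLpNorm (P.commBound C h v q i l) 2 volume ≤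
      ENNReal.ofReal ((23 * C + 36) * P.lerayConst * h) *
        decaySum (fun j => eLpNorm (op (P.phiS j) (v l)) 2 volume) q := by
  obtain ⟨a, ha⟩ := ha
  set F : ℤ → ℝ≥0∞ := fun j => eLpNorm (op (P.phiS j) (v l)) 2 volume with hF
  set S := decaySum F q with hS
  set K := P.lerayConst with hK
  have hK0 : 0 ≤ K := (kerNorm_nonneg _).trans (P.kerNorm_leray_le 0 0 0 0).1
  have hop : ∀ m T, Measurable (op m T) := fun m T => (continuous_op m T).measurable
  have hker : ∀ m : 𝓢(Space, ℂ), Measurable ⇑(𝓕⁻ m : 𝓢(Space, ℂ)) := fun m =>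
    (𝓕⁻ m : 𝓢(Space, ℂ)).continuous.measurable
  have hker2 : ∀ m : 𝓢(Space, ℂ), Measurable fun z : Space => ((‖z‖ : ℝ) : ℂ) * (𝓕⁻ m) z :=
    fun m => by fun_prop
  have mA : ∀ (c : ℝ≥0∞) (m : 𝓢(Space, ℂ)) (n : 𝓢(Space, ℂ)),
      Measurable fun x => c * conv ⇑(𝓕⁻ m : 𝓢(Space, ℂ)) (op n (v l)) x := fun c m n =>
    (measurable_conv (hker m) (hop _ _)).const_mul c
  have mB : ∀ (c : ℝ≥0∞) (m : 𝓢(Space, ℂ)) (n : 𝓢(Space, ℂ)),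
      Measurable fun x => c * conv (fun z => ((‖z‖ : ℝ) : ℂ) * (𝓕⁻ m) z) (op n (v l)) x :=
    fun c m n => (measurable_conv (hker2 m) (hop _ _)).const_mul c
  have lA : ∀ (c b : ℝ) (m n : 𝓢(Space, ℂ)), 0 ≤ c → kerNorm m ≤ b →
      eLpNorm (fun x => ENNReal.ofReal c * conv ⇑(𝓕⁻ m : 𝓢(Space, ℂ)) (op n (v l)) x) 2 volume ≤
        ENNReal.ofReal (c * b) * eLpNorm (op n (v l)) 2 volume := by
    intro c b m n hc hb
    refine (eLpNorm_const_mul_ennreal _ (measurable_conv (hker m) (hop _ _))).trans ?_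
    rw [ENNReal.ofReal_mul hc, mul_assoc]
    gcongr
    refine (eLpNorm_conv_kernel_le m (hop _ _)).trans ?_
    gcongr
  have lB : ∀ (c b : ℝ) (m n : 𝓢(Space, ℂ)), 0 ≤ c → kerMoment m ≤ b →
      eLpNorm (fun x => ENNReal.ofReal c *
        conv (fun z => ((‖z‖ : ℝ) : ℂ) * (𝓕⁻ m) z) (op n (v l)) x) 2 volume ≤
        ENNReal.ofReal (c * b) * eLpNorm (op n (v l)) 2 volume := by
    intro c b m n hc hb
    refine (eLpNorm_const_mul_ennreal _ (measurable_conv (hker2 m) (hop _ _))).trans ?_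
    rw [ENNReal.ofReal_mul hc, mul_assoc]
    gcongr
    refine (eLpNorm_conv_moment_le m (hop _ _)).trans ?_
    gcongr
  -- The middle frequencies are within two shells of `q`, where `decay` is at least `(q⁺ + 5) / 4`.
  have hmid : ENNReal.ofReal (q.toNat + 5) * eLpNorm (op (P.mid q) (v l)) 2 volume ≤
      ENNReal.ofReal 4 * S := by
    calc _ ≤ ENNReal.ofReal (q.toNat + 5) * ∑ n ∈ Finset.range 5, F (q - 2 + (n : ℤ)) := by
          gcongr; exact eLpNorm_op_sum_le _ _ _
      _ = ∑ n ∈ Finset.range 5, ENNReal.ofReal (q.toNat + 5) * F (q - 2 + (n : ℤ)) :=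
        Finset.mul_sum ..
      _ ≤ ∑ n ∈ Finset.range 5, ENNReal.ofReal 4 *
          (ENNReal.ofReal (decay q (q - 2 + (n : ℤ))) * F (q - 2 + (n : ℤ))) := by
          refine Finset.sum_le_sum fun n hn => ?_
          rw [← mul_assoc, ← ENNReal.ofReal_mul (by norm_num)]
          gcongr
          have := Finset.mem_range.1 hn
          exact le_decay (abs_le.2 ⟨by omega, by omega⟩)
      _ ≤ ENNReal.ofReal 4 * ∑' n : ℕ,
          (ENNReal.ofReal (decay q (q - 2 + (n : ℤ))) * F (q - 2 + (n : ℤ))) := by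
          rw [← Finset.mul_sum]; gcongr; exact ENNReal.sum_le_tsum _
      _ ≤ _ := by
          gcongr
          exact tsum_nat_le_tsum_int (fun j => ENNReal.ofReal (decay q j) * F j)
            (g := fun n : ℕ => q - 2 + (n : ℤ)) fun a b hab => by simpa using hab
  -- The gradient of the low frequencies is a sum over the shells `j < q - 2`, of size `2 ^ j`.
  have hlow : ∀ k, ENNReal.ofReal (gain q) * eLpNorm (op (mulI k (P.chiS (q - 2))) (v l)) 2 volume ≤
      ENNReal.ofReal (8 / 3) * S := by
    intro k
    calc _ ≤ ENNReal.ofReal (gain q) * ∑' n : ℕ,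
      ENNReal.ofReal (8 / 3 * (2 : ℝ) ^ (q - 2 - 1 - n)) *
          F (q - 2 - 1 - n) := by
          gcongr; exact P.eLpNorm_low_le ha (q - 2) k
      _ = ENNReal.ofReal (8 / 3) * ∑' n : ℕ, ENNReal.ofReal (decay q (q - 2 - 1 - n)) *
          F (q - 2 - 1 - n) := by
          rw [← ENNReal.tsum_mul_left, ← ENNReal.tsum_mul_left]
          congr 1; funext n
          rw [decay_of_le (by omega), ← mul_assoc, ← mul_assoc,
            ← ENNReal.ofReal_mul (gain_nonneg q),
            ← ENNReal.ofReal_mul (by norm_num)]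
          congr 2; ring
      _ ≤ _ := by
          gcongr
          exact tsum_nat_le_tsum_int (fun j => ENNReal.ofReal (decay q j) * F j)
            (g := fun n : ℕ => q - 2 - 1 - (n : ℤ)) fun a b hab => by simpa using hab
  have hhigh : ∑' n : ℕ, ENNReal.ofReal (decay q (q + 3 + n)) * F (q + 3 + n) ≤ S :=
    tsum_nat_le_tsum_int (fun j => ENNReal.ofReal (decay q j) * F j)
      (g := fun n : ℕ => q + 3 + (n : ℤ)) fun a b hab => by simpa using hab
  have hg := gain_nonneg q
  have hgq : gain q * (2 : ℝ) ^ q = q.toNat + 5 := by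
    rw [gain, mul_right_comm, ← zpow_add₀ two_ne_zero]; simp
  -- The four terms of `commBound`: low frequencies of `v`, middle frequencies with high frequencies
  -- of `u`, commutator, and high frequencies of `v`.
  have bA : eLpNorm (fun x => ∑ k, ENNReal.ofReal (C * gain q * h) *
      conv ⇑(𝓕⁻ (P.leray q i l) : 𝓢(Space, ℂ)) (op (mulI k (P.chiS (q - 2))) (v l)) x) 2 volume ≤
      ENNReal.ofReal (8 * C * K * h) * S := by
    refine (eLpNorm_two_sum_le _ fun k => mA _ _ _).trans ?_
    calc _ ≤ ∑ k : Fin 3, ENNReal.ofReal (C * K * h) * (ENNReal.ofReal (8 / 3) * S) := by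
          refine Finset.sum_le_sum fun k _ => ?_
          refine (lA _ K _ _ (by positivity) (P.kerNorm_leray_le q i l 0).1).trans ?_
          rw [show C * gain q * h * K = (C * K * h) * gain q by ring,
            ENNReal.ofReal_mul (by positivity), mul_assoc]
          exact mul_le_mul' le_rfl (hlow k)
      _ = _ := by
          rw [Finset.sum_const, Finset.card_univ, Fintype.card_fin, nsmul_eq_mul, ← mul_assoc,
            ← mul_assoc, ← ENNReal.ofReal_natCast, ← ENNReal.ofReal_mul (by norm_num),
            ← ENNReal.ofReal_mul (by positivity)]
          congr 2; push_cast; ring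
  have bB : eLpNorm (fun x => ∑ k, ENNReal.ofReal (C * gain q * h) *
      conv ⇑(𝓕⁻ (mulI k (P.leray q i l)) : 𝓢(Space, ℂ)) (op (P.mid q) (v l)) x) 2 volume ≤
      ENNReal.ofReal (12 * C * K * h) * S := by
    refine (eLpNorm_two_sum_le _ fun k => mA _ _ _).trans ?_
    calc _ ≤ ∑ k : Fin 3, ENNReal.ofReal (C * K * h) * (ENNReal.ofReal 4 * S) := by
          refine Finset.sum_le_sum fun k _ => ?_
          refine (lA _ ((2 : ℝ) ^ q * K) _ _ (by positivity) (P.kerNorm_leray_le q i l k).2.1).trans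
            ?_
          rw [show C * gain q * h * ((2 : ℝ) ^ q * K) = (C * K * h) *
            (q.toNat + 5) by rw [← hgq]; ring,
            ENNReal.ofReal_mul (by positivity), mul_assoc]
          gcongr
      _ = _ := by
          rw [Finset.sum_const, Finset.card_univ, Fintype.card_fin, nsmul_eq_mul, ← mul_assoc,
            ← mul_assoc, ← ENNReal.ofReal_natCast, ← ENNReal.ofReal_mul (by norm_num),
            ← ENNReal.ofReal_mul (by positivity)]
          congr 2; push_cast; ring
  have bD : eLpNorm (fun x => ∑ k, ENNReal.ofReal (3 * ((q.toNat + 5) * h)) *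
      conv (fun z => ((‖z‖ : ℝ) : ℂ) * (𝓕⁻ (mulI k (P.leray q i l))) z)
        (op (P.mid q) (v l)) x) 2 volume ≤ ENNReal.ofReal (36 * K * h) * S := by
    refine (eLpNorm_two_sum_le _ fun k => mB _ _ _).trans ?_
    calc _ ≤ ∑ k : Fin 3, ENNReal.ofReal (3 * K * h) * (ENNReal.ofReal 4 * S) := by
          refine Finset.sum_le_sum fun k _ => ?_
          refine (lB _ K _ _ (by positivity) (P.kerNorm_leray_le q i l k).2.2).trans ?_
          rw [show 3 * ((q.toNat + 5) * h) * K = (3 * K * h) * (q.toNat + 5) by ring,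
            ENNReal.ofReal_mul (by positivity), mul_assoc]
          gcongr
      _ = _ := by
          rw [Finset.sum_const, Finset.card_univ, Fintype.card_fin, nsmul_eq_mul, ← mul_assoc,
            ← mul_assoc, ← ENNReal.ofReal_natCast, ← ENNReal.ofReal_mul (by norm_num),
            ← ENNReal.ofReal_mul (by positivity)]
          congr 2; push_cast; ring
  have bH : eLpNorm (fun x => ∑' n : ℕ, ∑ k, ENNReal.ofReal (C * gain (q + 3 + n) * h) *
      conv ⇑(𝓕⁻ (mulI k (P.leray q i l)) : 𝓢(Space, ℂ)) (op (P.phiS (q + 3 + n)) (v l)) x) 2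
        volume ≤
      ENNReal.ofReal (3 * C * K * h) * S := by
    refine (eLpNorm_two_tsum_le fun n => Finset.measurable_fun_sum _ fun k _ => mA _ _ _).trans ?_
    calc _ ≤ ∑' n : ℕ, ENNReal.ofReal (3 * C * K * h) *
          (ENNReal.ofReal (decay q (q + 3 + n)) * F (q + 3 + n)) := by
          refine ENNReal.tsum_le_tsum fun n => (eLpNorm_two_sum_le _ fun k => mA _ _ _).trans ?_
          have hg' := gain_nonneg (q + 3 + n)
          calc _ ≤ ∑ k : Fin 3, ENNReal.ofReal (C * K * h) *
              (ENNReal.ofReal (decay q (q + 3 + n)) * F (q + 3 + n)) := by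
                refine Finset.sum_le_sum fun k _ => ?_
                refine (lA _ ((2 : ℝ) ^ q * K) _ _ (by positivity)
                  (P.kerNorm_leray_le q i l k).2.1).trans ?_
                rw [show C * gain (q + 3 + n) * h * ((2 : ℝ) ^ q * K) =
                  (C * K * h) * decay q (q + 3 + n) by rw [decay_of_ge (by omega)]; ring,
                  ENNReal.ofReal_mul (by positivity), mul_assoc]
            _ = _ := by
                rw [Finset.sum_const, Finset.card_univ, Fintype.card_fin, nsmul_eq_mul, ← mul_assoc,
                  ← ENNReal.ofReal_natCast, ← ENNReal.ofReal_mul (by norm_num)]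
                congr 2; push_cast; ring
      _ ≤ _ := by
          rw [ENNReal.tsum_mul_left]
          gcongr
  have mH : Measurable fun x => ∑' n : ℕ, ∑ k, ENNReal.ofReal (C * gain (q + 3 + n) * h) *
      conv ⇑(𝓕⁻ (mulI k (P.leray q i l)) : 𝓢(Space, ℂ)) (op (P.phiS (q + 3 + n)) (v l)) x :=
    Measurable.tsum fun n => Finset.measurable_fun_sum _ fun k _ => mA _ _ _
  have mS : ∀ f : Fin 3 → Space → ℝ≥0∞, (∀ k, Measurable (f k)) →
      Measurable fun x => ∑ k, f k x := fun f hf => Finset.measurable_fun_sum _ fun k _ => hf k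
  unfold commBound
  refine (eLpNorm_two_add_le ((mS _ fun k => mA _ _ _).add (mS _ fun k => mA _ _ _))
    ((mS _ fun k => mB _ _ _).add mH)).trans ?_
  refine (add_le_add (eLpNorm_two_add_le (mS _ fun k => mA _ _ _) (mS _ fun k => mA _ _ _))
    (eLpNorm_two_add_le (mS _ fun k => mB _ _ _) mH)).trans ?_
  refine (add_le_add (add_le_add bA bB) (add_le_add bD bH)).trans_eq ?_
  rw [← add_mul, ← add_mul, ← add_mul, ← ENNReal.ofReal_add (by positivity) (by positivity),
    ← ENNReal.ofReal_add (by positivity) (by positivity),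
    ← ENNReal.ofReal_add (by positivity) (by positivity)]
  congr 2; ring

/-- The tested convection term is the limit of its approximations. -/
theorem tendsto_convection {u : Fin 3 → 𝓢'(Space, ℂ)} {w N : 𝓢'(Space, ℂ)}
    (hN : IsConvection P u w N) (m : 𝓢(Space, ℂ)) (x : Space) :
    Tendsto (fun J : ℕ => ∑ k, bil m (op (P.chiS J) (u k)) (op (mulI k (P.chiS J)) w) x) atTop
      (𝓝 (op m N x)) := by
  refine (hN (𝓕 (modS x m))).congr fun J => ?_
  simp only [bil]
  rw [← integral_finsetSum _ fun k _ => integrable_bil _ _ _ _ _ x]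
  congr 1; funext y
  rw [fourier_modS, ← Finset.mul_sum, mul_comm]
  congr 1
  refine Finset.sum_congr rfl fun k _ => ?_
  rw [lowPass_eq, lowPass_eq, op_lineDeriv]

/-- The difference between a dyadic block of the projected convection term and the transport of the
block by the low frequencies of the field. -/
def remainder (u v N : Fin 3 → 𝓢'(Space, ℂ)) (q : ℤ) (i : Fin 3) (x : Space) : ℂ :=
  (∑ l, op (P.leray q i l) (N l) x) -
    ∑ k, op (P.chiE ((q.toNat : ℤ) + 2)) (u k) x * op (mulI k (P.phiS q)) (v i) x

/-- The commutator estimate. -/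
theorem exists_remainder_bound : ∃ C : ℝ, 0 ≤ C ∧ ∀ (u v N : Fin 3 → 𝓢'(Space, ℂ)) (h : ℝ),
    IsTransport P u h → divergence v = 0 → (∀ l, ∃ a, HasDensity (v l) a) →
    (∀ l, IsConvection P u (v l) (N l)) → ∀ (q : ℤ) (i : Fin 3),
      eLpNorm (P.remainder u v N q i) 2 volume ≤ ENNReal.ofReal (C * h) *
        decaySum (fun j => ∑ l, eLpNorm (op (P.phiS j) (v l)) 2 volume) q := by
  obtain ⟨C, hC, hb⟩ := P.exists_high_freq_bound
  have hK0 : 0 ≤ P.lerayConst := (kerNorm_nonneg _).trans (P.kerNorm_leray_le 0 0 0 0).1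
  refine ⟨(23 * C + 36) * P.lerayConst, by positivity, fun u v N h hu hv ha hN q i => ?_⟩
  obtain ⟨hb1, hb2⟩ := hb u h hu
  -- The pointwise bound of the approximations does not depend on `J`, and passes to the limit.
  have hp : ∀ x, ‖P.remainder u v N q i x‖ₑ ≤ ∑ l, P.commBound C h v q i l x := by
    intro x
    have ht := (tendsto_finsetSum Finset.univ fun l _ =>
      P.tendsto_convection (hN l) (P.leray q i l) x).sub_const
        (∑ k, op (P.chiE ((q.toNat : ℤ) + 2)) (u k) x * op (mulI k (P.phiS q)) (v i) x)
    refine le_of_tendsto ht.enorm ?_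
    filter_upwards [eventually_ge_atTop (q.toNat + 3)] with J hJ
    exact P.enorm_remainder_le hu hb1 hb2 hv ha (by omega) (by omega) i x
  have hm : ∀ l, Measurable (P.commBound C h v q i l) := by
    intro l
    have hop : ∀ m T, Measurable (op m T) := fun m T => (continuous_op m T).measurable
    have hker : ∀ m : 𝓢(Space, ℂ), Measurable ⇑(𝓕⁻ m : 𝓢(Space, ℂ)) := fun m =>
      (𝓕⁻ m : 𝓢(Space, ℂ)).continuous.measurable
    have hker2 : ∀ m : 𝓢(Space, ℂ), Measurable fun z : Space => ((‖z‖ : ℝ) : ℂ) * (𝓕⁻ m) z :=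
      fun m => by fun_prop
    refine ((Finset.measurable_fun_sum _ fun k _ => ?_).add
      (Finset.measurable_fun_sum _ fun k _ => ?_)).add
      ((Finset.measurable_fun_sum _ fun k _ => ?_).add
      (Measurable.tsum fun n => Finset.measurable_fun_sum _ fun k _ => ?_))
    · exact (measurable_conv (hker _) (hop _ _)).const_mul _
    · exact (measurable_conv (hker _) (hop _ _)).const_mul _
    · exact (measurable_conv (hker2 _) (hop _ _)).const_mul _
    · exact (measurable_conv (hker _) (hop _ _)).const_mul _
  calc eLpNorm (P.remainder u v N q i) 2 volume
      ≤ eLpNorm (fun x => ∑ l, P.commBound C h v q i l x) 2 volume :=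
        eLpNorm_mono_enorm fun x => by simpa using hp x
    _ ≤ ∑ l, eLpNorm (P.commBound C h v q i l) 2 volume := eLpNorm_two_sum_le _ hm
    _ ≤ ∑ l, ENNReal.ofReal ((23 * C + 36) * P.lerayConst * h) *
        decaySum (fun j => eLpNorm (op (P.phiS j) (v l)) 2 volume) q :=
        Finset.sum_le_sum fun l _ => P.eLpNorm_commBound_le hC hu.nonneg q i l (ha l)
    _ = _ := by
        rw [← Finset.mul_sum]
        congr 1
        simp only [decaySum, Finset.mul_sum]
        exact (Summable.tsum_finsetSum fun _ _ => ENNReal.summable).symm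

end LittlewoodPaley

/-! ### Absolutely continuous functions of time -/

/-- `F` is a primitive of the integrable function `f` on `[0,T]`. -/
structure HasPrim (T : ℝ) (F f : ℝ → ℝ) : Prop where
  integrable : IntervalIntegrable f volume 0 T
  eq : ∀ t ∈ Set.Icc 0 T, F t = F 0 + ∫ τ in (0 : ℝ)..t, f τ

namespace HasPrim

variable {T : ℝ} {F f G g : ℝ → ℝ}

theorem of_ac (hT : 0 ≤ T) (hF : AbsolutelyContinuousOnInterval F 0 T)
    (hd : ∀ᵐ x, x ∈ Set.uIcc 0 T → HasDerivAt F (f x) x) : HasPrim T F f := by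
  have hd' : ∀ᵐ x, x ∈ Set.uIcc 0 T → deriv F x = f x := by
    filter_upwards [hd] with x hx hxT using (hx hxT).deriv
  refine ⟨(intervalIntegrable_congr_ae ?_).1 hF.intervalIntegrable_deriv, fun t ht => ?_⟩
  · rw [EventuallyEq, ae_restrict_iff' measurableSet_uIoc]
    filter_upwards [hd'] with x hx hxT using hx (Set.uIoc_subset_uIcc hxT)
  · have hsub : Set.uIcc 0 t ⊆ Set.uIcc 0 T := by
      rw [Set.uIcc_of_le hT, Set.uIcc_of_le ht.1]; exact Set.Icc_subset_Icc_right ht.2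
    have h := (hF.mono hsub).integral_deriv_eq_sub
    rw [← intervalIntegral.integral_congr_ae (f := deriv F), h]
    · ring
    · filter_upwards [hd'] with x hx hxT using hx (hsub (Set.uIoc_subset_uIcc hxT))

theorem congr (h : HasPrim T F f) (hT : 0 ≤ T) (hFG : ∀ t ∈ Set.Icc 0 T, F t = G t)
    (hfg : ∀ t ∈ Set.Icc 0 T, f t = g t) : HasPrim T G g := by
  have h0 : (0 : ℝ) ∈ Set.Icc 0 T := ⟨le_rfl, hT⟩
  refine ⟨h.integrable.congr fun x hx => ?_, fun t ht => ?_⟩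
  · rw [Set.uIoc_of_le hT] at hx
    exact hfg x ⟨hx.1.le, hx.2⟩
  · rw [← hFG t ht, ← hFG 0 h0, h.eq t ht]
    congr 1
    refine intervalIntegral.integral_congr fun x hx => ?_
    rw [Set.uIcc_of_le ht.1] at hx
    exact hfg x ⟨hx.1, hx.2.trans ht.2⟩

/-- A primitive has an absolutely continuous representative with the right derivative. -/
theorem exists_ac (h : HasPrim T F f) : ∃ F' : ℝ → ℝ,
    (∀ t ∈ Set.Icc 0 T, F t = F' t) ∧ AbsolutelyContinuousOnInterval F' 0 T ∧
      ∀ᵐ x, x ∈ Set.uIcc 0 T → HasDerivAt F' (f x) x := by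
  refine ⟨fun t => F 0 + ∫ τ in (0 : ℝ)..t, f τ, h.eq, ?_, ?_⟩
  · exact (LipschitzWith.const (F 0)).lipschitzOnWith.absolutelyContinuousOnInterval.fun_add
      (h.integrable.absolutelyContinuousOnInterval_intervalIntegral Set.left_mem_uIcc)
  · filter_upwards [h.integrable.ae_hasDerivAt_integral] with x hx hxT
    exact (hx hxT 0 Set.left_mem_uIcc).const_add (F 0)

theorem mul (h : HasPrim T F f) (h' : HasPrim T G g) (hT : 0 ≤ T) :
    HasPrim T (fun t => F t * G t) fun t => f t * G t + F t * g t := by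
  obtain ⟨F', h1, h2, h3⟩ := h.exists_ac
  obtain ⟨G', h1', h2', h3'⟩ := h'.exists_ac
  have h4 : HasPrim T (fun t => F' t * G' t) fun t => f t * G' t + F' t * g t := by
    refine of_ac hT (h2.fun_mul h2') ?_
    filter_upwards [h3, h3'] with x hx hx' hxT using (hx hxT).mul (hx' hxT)
  exact h4.congr hT (fun t ht => by rw [h1 t ht, h1' t ht]) fun t ht => by rw [h1 t ht, h1' t ht]

theorem continuousOn (h : HasPrim T F f) (hT : 0 ≤ T) : ContinuousOn F (Set.Icc 0 T) := by
  obtain ⟨F', h1, h2, -⟩ := h.exists_ac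
  have := h2.continuousOn
  rw [Set.uIcc_of_le hT] at this
  exact this.congr h1

theorem const_mul (h : HasPrim T F f) (c : ℝ) : HasPrim T (fun t => c * F t) fun t => c * f t :=
  ⟨h.integrable.const_mul c, fun t ht => by
    rw [h.eq t ht, intervalIntegral.integral_const_mul]; ring⟩

theorem mono_right (h : HasPrim T F f) {t : ℝ} (ht : t ∈ Set.Icc 0 T) : HasPrim t F f :=
  ⟨h.integrable.mono_set (by
    rw [Set.uIcc_of_le ht.1, Set.uIcc_of_le (ht.1.trans ht.2)]
    exact Set.Icc_subset_Icc_right ht.2), fun x hx => h.eq x ⟨hx.1, hx.2.trans ht.2⟩⟩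

theorem add (h : HasPrim T F f) (h' : HasPrim T G g) :
    HasPrim T (fun t => F t + G t) fun t => f t + g t :=
  ⟨h.integrable.add h'.integrable, fun t ht => by
    have hs : Set.uIcc 0 t ⊆ Set.uIcc 0 T := by
      rw [Set.uIcc_of_le ht.1, Set.uIcc_of_le (ht.1.trans ht.2)]
      exact Set.Icc_subset_Icc_right ht.2
    rw [h.eq t ht, h'.eq t ht, intervalIntegral.integral_add (h.integrable.mono_set hs)
      (h'.integrable.mono_set hs)]
    ring⟩

theorem sum {ι : Type*} (s : Finset ι) {F f : ι → ℝ → ℝ} (h : ∀ i ∈ s, HasPrim T (F i) (f i)) :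
    HasPrim T (fun t => ∑ i ∈ s, F i t) fun t => ∑ i ∈ s, f i t := by
  classical
  induction s using Finset.induction_on with
  | empty => exact ⟨by simp, by simp⟩
  | insert a s ha ih =>
    simp only [Finset.sum_insert ha]
    exact (h a (by simp)).add (ih fun i hi => h i (by simp [hi]))

theorem exp (h : HasPrim T F f) (hT : 0 ≤ T) :
    HasPrim T (fun t => Real.exp (F t)) fun t => Real.exp (F t) * f t := by
  obtain ⟨F', h1, h2, h3⟩ := h.exists_ac
  obtain ⟨C, hC⟩ := h2.exists_bound
  have h4 : HasPrim T (fun t => Real.exp (F' t)) fun t => Real.exp (F' t) * f t := by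
    refine of_ac hT ?_ ?_
    · obtain ⟨K, hK⟩ := (Real.contDiff_exp (n := 1)).contDiffOn.exists_lipschitzOnWith
        (by simp) (convex_Icc (-C) C) isCompact_Icc
      rw [absolutelyContinuousOnInterval_iff] at h2 ⊢
      intro ε hε
      obtain ⟨δ, hδ, h5⟩ := h2 (ε / (K + 1)) (by positivity)
      refine ⟨δ, hδ, fun E hE hE2 => ?_⟩
      have h6 := h5 E hE hE2
      have hmem : ∀ x ∈ Set.uIcc 0 T, F' x ∈ Set.Icc (-C) C := fun x hx => abs_le.1 (hC x hx)
      calc _ ≤ ∑ i ∈ Finset.range E.1, K * dist (F' (E.2 i).1) (F' (E.2 i).2) := by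
            refine Finset.sum_le_sum fun i hi => ?_
            have h7 := hE.1 i hi
            exact hK.dist_le_mul _ (hmem _ h7.1) _ (hmem _ h7.2)
        _ = K * ∑ i ∈ Finset.range E.1, dist (F' (E.2 i).1) (F' (E.2 i).2) := by
            rw [Finset.mul_sum]
        _ ≤ (K + 1) * ∑ i ∈ Finset.range E.1, dist (F' (E.2 i).1) (F' (E.2 i).2) := by
            gcongr
            linarith
        _ < (K + 1) * (ε / (K + 1)) := by gcongr
        _ = ε := by field_simp
    · filter_upwards [h3] with x hx hxT using (hx hxT).exp
  exact h4.congr hT (fun t ht => by rw [h1 t ht]) fun t ht => by rw [h1 t ht]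

end HasPrim

/-- The product rule for the square of the modulus of an absolutely continuous complex function. -/
theorem hasPrim_normSq {T : ℝ} (hT : 0 ≤ T) {y g : ℝ → ℂ} (hg : IntervalIntegrable g volume 0 T)
    (hy : ∀ t ∈ Set.Icc 0 T, y t = y 0 + ∫ τ in (0 : ℝ)..t, g τ) :
    HasPrim T (fun t => ‖y t‖ ^ 2) fun t => 2 * inner ℝ (y t) (g t) := by
  have hs : ∀ t ∈ Set.Icc 0 T, IntervalIntegrable g volume 0 t := fun t ht => hg.mono_set (by
    rw [Set.uIcc_of_le ht.1, Set.uIcc_of_le hT]; exact Set.Icc_subset_Icc_right ht.2)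
  have hre : HasPrim T (fun t => (y t).re) fun t => (g t).re := by
    refine ⟨⟨hg.1.re, hg.2.re⟩, fun t ht => ?_⟩
    have h1 := Complex.reCLM.intervalIntegral_comp_comm (hs t ht)
    simp only [Complex.reCLM_apply] at h1
    rw [h1, ← Complex.add_re, ← hy t ht]
  have him : HasPrim T (fun t => (y t).im) fun t => (g t).im := by
    refine ⟨⟨hg.1.im, hg.2.im⟩, fun t ht => ?_⟩
    have h1 := Complex.imCLM.intervalIntegral_comp_comm (hs t ht)
    simp only [Complex.imCLM_apply] at h1
    rw [h1, ← Complex.add_im, ← hy t ht]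
  refine ((hre.mul hre hT).add (him.mul him hT)).congr hT (fun t _ => ?_) fun t _ => ?_
  · rw [← Complex.normSq_eq_norm_sq, Complex.normSq_apply]
  · rw [Complex.inner, Complex.mul_re, Complex.conj_re, Complex.conj_im]; ring

/-! ### The energy identity for a transport equation -/

/-- A cut-off at infinity, whose decay allows velocity fields of linear growth. -/
def cut (n : ℕ) (x : Space) : ℝ := (1 + ‖x‖ ^ 2 / (n + 1))⁻¹

/-- The error made by transporting the cut-off. -/
def cutError (n : ℕ) (x : Space) : ℝ := 6 * (‖x‖ * (1 + ‖x‖) / (n + 1)) * cut n x ^ 2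

theorem cut_pos (n : ℕ) (x : Space) : 0 < cut n x := by unfold cut; positivity

theorem cut_le_one (n : ℕ) (x : Space) : cut n x ≤ 1 :=
  inv_le_one_of_one_le₀ (le_add_of_nonneg_right (by positivity))

theorem cutError_nonneg (n : ℕ) (x : Space) : 0 ≤ cutError n x := by unfold cutError; positivity

theorem cut_mul_le (n : ℕ) (x : Space) : cut n x * (1 + ‖x‖) ≤ n + 2 := by
  rw [cut, inv_mul_le_iff₀ (by positivity)]
  have h1 : ((n : ℝ) + 2) * (‖x‖ ^ 2 / (n + 1)) ≥ ‖x‖ ^ 2 := by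
    rw [ge_iff_le, mul_div_assoc', le_div_iff₀ (by positivity)]
    nlinarith [sq_nonneg ‖x‖]
  have h2 : (0 : ℝ) ≤ n := by positivity
  nlinarith [sq_nonneg (‖x‖ - 1)]

theorem cutError_le (n : ℕ) (x : Space) : cutError n x ≤ 9 := by
  have h1 : cut n x * (1 + ‖x‖ ^ 2 / (n + 1)) = 1 := inv_mul_cancel₀ (by positivity)
  have h2 : ‖x‖ * (1 + ‖x‖) / (n + 1) ≤ 3 / 2 * (1 + ‖x‖ ^ 2 / (n + 1)) := by
    have : 3 / 2 * (1 + ‖x‖ ^ 2 / ((n : ℝ) + 1)) = (3 / 2 * (n + 1 + ‖x‖ ^ 2)) / (n + 1) := by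
      field_simp
    rw [this]
    refine div_le_div_of_nonneg_right ?_ (by positivity)
    have h2 : (0 : ℝ) ≤ n := by positivity
    nlinarith [sq_nonneg (‖x‖ - 1)]
  have h3 := cut_pos n x
  have h4 := cut_le_one n x
  calc cutError n x ≤ 6 * (3 / 2 * (1 + ‖x‖ ^ 2 / (n + 1))) * cut n x ^ 2 := by
        unfold cutError; gcongr
    _ = 9 * cut n x * (cut n x * (1 + ‖x‖ ^ 2 / (n + 1))) := by ring
    _ ≤ 9 := by rw [h1]; linarith

theorem tendsto_cut (x : Space) : Tendsto (fun n => cut n x) atTop (𝓝 1) := by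
  have h : Tendsto (fun n : ℕ => ‖x‖ ^ 2 / ((n : ℝ) + 1)) atTop (𝓝 0) :=
    tendsto_const_nhds.div_atTop (tendsto_atTop_add_const_right _ _ tendsto_natCast_atTop_atTop)
  have h2 := (h.const_add 1).inv₀ (by norm_num)
  simpa [cut] using h2

theorem tendsto_cutError (x : Space) : Tendsto (fun n => cutError n x) atTop (𝓝 0) := by
  have h : Tendsto (fun n : ℕ => ‖x‖ * (1 + ‖x‖) / ((n : ℝ) + 1)) atTop (𝓝 0) :=
    tendsto_const_nhds.div_atTop (tendsto_atTop_add_const_right _ _ tendsto_natCast_atTop_atTop)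
  have h2 := (h.const_mul 6).mul ((tendsto_cut x).pow 2)
  simpa [cutError] using h2

theorem continuous_cut (n : ℕ) : Continuous (cut n) := by
  unfold cut
  exact Continuous.inv₀ (by fun_prop) fun x => by positivity

theorem continuous_cutError (n : ℕ) : Continuous (cutError n) := by
  have := continuous_cut n
  unfold cutError
  fun_prop

theorem hasFDerivAt_cut (n : ℕ) (x : Space) :
    HasFDerivAt (cut n) ((-(2 / (n + 1)) * cut n x ^ 2) • (innerSL ℝ x : Space →L[ℝ] ℝ)) x := by
  have h1 : HasFDerivAt (fun x : Space => 1 + ‖x‖ ^ 2 / ((n : ℝ) + 1))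
      ((2 / ((n : ℝ) + 1)) • (innerSL ℝ x : Space →L[ℝ] ℝ)) x := by
    have := ((hasStrictFDerivAt_norm_sq x).hasFDerivAt.mul_const (((n : ℝ) + 1)⁻¹)).const_add 1
    simp only [← div_eq_mul_inv] at this
    refine this.congr_fderiv ?_
    ext v
    simp
    ring
  have h0 : 1 + ‖x‖ ^ 2 / ((n : ℝ) + 1) ≠ 0 := by positivity
  have h2 := (hasDerivAt_inv h0).comp_hasFDerivAt x h1
  refine h2.congr_fderiv ?_
  ext v
  simp only [smul_apply, smul_eq_mul, cut]
  field_simp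

theorem integrable_mul_bdd {f g : Space → ℝ} (hf : Integrable f)
    (hg : AEStronglyMeasurable g volume)
    {c : ℝ} (hc : ∀ x, |g x| ≤ c) : Integrable fun x => g x * f x :=
  hf.bdd_mul hg (.of_forall hc)

/-- Transport by a divergence free field preserves the energy up to the error of the cut-off. -/
theorem abs_integral_transport_le {y : Space → ℂ} {U : Fin 3 → Space → ℝ} {α : ℝ}
    (hy : Differentiable ℝ y) (hy2 : MemLp y 2) (hdy : ∀ k, MemLp (fun x => fderiv ℝ y x (e k)) 2)
    (hU : ∀ k, Differentiable ℝ (U k)) (hUb : ∀ k x, |U k x| ≤ α * (1 + ‖x‖))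
    (hdU : ∀ k x, |fderiv ℝ (U k) x (e k)| ≤ α) (hdiv : ∀ x, ∑ k, fderiv ℝ (U k) x (e k) = 0)
    (n : ℕ) :
    |∫ x, cut n x * inner ℝ (y x) (∑ k, (U k x : ℂ) * fderiv ℝ y x (e k))| ≤
      α * ∫ x, cutError n x * ‖y x‖ ^ 2 := by
  have hα : 0 ≤ α := (abs_nonneg _).trans (hdU 0 0)
  have hcut := continuous_cut n
  have iy : Integrable fun x => ‖y x‖ ^ 2 := hy2.integrable_norm_pow (by norm_num)
  have iydy : ∀ k, Integrable fun x => inner ℝ (y x) (fderiv ℝ y x (e k)) := by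
    intro k
    have h1 : Integrable fun x => ‖y x‖ * ‖fderiv ℝ y x (e k)‖ :=
      hy2.norm.integrable_mul (hdy k).norm
    refine h1.mono' (hy2.1.inner (hdy k).1) (.of_forall fun x => ?_)
    exact norm_inner_le_norm _ _
  have hsq : ∀ x k, fderiv ℝ (fun x => ‖y x‖ ^ 2) x (e k) = 2 *
    inner ℝ (y x) (fderiv ℝ y x (e k)) := by
    intro x k
    rw [((hy x).hasFDerivAt.norm_sq).fderiv]
    simp
    ring
  have hcutU : ∀ k x, |cut n x * U k x| ≤ α * (n + 2) := by
    intro k x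
    rw [abs_mul, abs_of_pos (cut_pos n x)]
    calc cut n x * |U k x| ≤ cut n x * (α * (1 + ‖x‖)) :=
          mul_le_mul_of_nonneg_left (hUb k x) (cut_pos n x).le
      _ = α * (cut n x * (1 + ‖x‖)) := by ring
      _ ≤ _ := mul_le_mul_of_nonneg_left (cut_mul_le n x) hα
  have hprod : ∀ k x, fderiv ℝ (fun x => cut n x * U k x) x (e k) =
      (-(2 / (n + 1)) * cut n x ^ 2 * x k) * U k x + cut n x * fderiv ℝ (U k) x (e k) := by
    intro k x
    have h1 : HasFDerivAt (fun x => cut n x * U k x) _ x :=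
      (hasFDerivAt_cut n x).mul (hU k x).hasFDerivAt
    rw [h1.fderiv]
    simp only [add_apply, smul_apply, smul_eq_mul, innerSL_apply_apply, inner_e]
    ring
  have hd1 : ∀ k x, |(-(2 / ((n : ℝ) + 1)) * cut n x ^ 2 * x k) * U k x| ≤
      α * (cutError n x / 3) := by
    intro k x
    have h3 : |x k| ≤ ‖x‖ := PiLp.norm_apply_le x k
    rw [abs_mul, abs_mul, abs_mul, abs_neg, abs_of_nonneg (by positivity : 0 ≤ 2 / ((n : ℝ) + 1)),
      abs_of_nonneg (by positivity : 0 ≤ cut n x ^ 2)]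
    calc _ ≤ 2 / ((n : ℝ) + 1) * cut n x ^ 2 * ‖x‖ * (α * (1 + ‖x‖)) := by
          gcongr
          exact hUb k x
      _ = _ := by unfold cutError; ring
  have mdU : ∀ k, AEStronglyMeasurable (fun x => fderiv ℝ (U k) x (e k)) volume := fun k =>
    (measurable_fderiv_apply_const ℝ (U k) (e k)).aestronglyMeasurable
  have mU : ∀ k, AEStronglyMeasurable (U k) volume := fun k =>
    (hU k).continuous.aestronglyMeasurable
  have i1 : ∀ k, Integrable fun x => (-(2 / ((n : ℝ) + 1)) * cut n x ^ 2 * x k) * U k x *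
    ‖y x‖ ^ 2 := by
    intro k
    refine integrable_mul_bdd iy ?_ (c := α * 3) fun x => (hd1 k x).trans ?_
    · refine AEStronglyMeasurable.mul ?_ (mU k)
      exact (by fun_prop : Continuous fun x : Space =>
        -(2 / ((n : ℝ) + 1)) * cut n x ^ 2 * x k).aestronglyMeasurable
    · have := cutError_le n x
      gcongr
      linarith
  have i2 : ∀ k, Integrable fun x => cut n x * fderiv ℝ (U k) x (e k) * ‖y x‖ ^ 2 := by
    intro k
    refine integrable_mul_bdd iy (hcut.aestronglyMeasurable.mul (mdU k)) (c := α) fun x => ?_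
    rw [abs_mul, abs_of_pos (cut_pos n x)]
    have := hdU k x
    have h4 := cut_le_one n x
    have h5 := cut_pos n x
    nlinarith [abs_nonneg (fderiv ℝ (U k) x (e k))]
  have i3 : ∀ k, Integrable fun x => cut n x * U k x * inner ℝ (y x) (fderiv ℝ y x (e k)) :=
    fun k =>
    integrable_mul_bdd (iydy k) (hcut.aestronglyMeasurable.mul (mU k)) (hcutU k)
  -- Integration by parts: the derivative falls on the cut-off or on the field.
  have hk : ∀ k, 2 * ∫ x, cut n x * U k x * inner ℝ (y x) (fderiv ℝ y x (e k)) =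
      -((∫ x, (-(2 / ((n : ℝ) + 1)) * cut n x ^ 2 * x k) * U k x * ‖y x‖ ^ 2) +
        ∫ x, cut n x * fderiv ℝ (U k) x (e k) * ‖y x‖ ^ 2) := by
    intro k
    have h := integral_mul_fderiv_eq_neg_fderiv_mul_of_integrable (μ := (volume : Measure Space))
      (f := fun x => cut n x * U k x) (g := fun x => ‖y x‖ ^ 2) (v := e k) ?_ ?_ ?_ ?_ ?_
    · simp only [hprod, hsq, add_mul] at h
      rw [integral_add (i1 k) (i2 k)] at h
      rw [← h, ← integral_const_mul]
      congr 1; funext x; ring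
    · simp only [hprod, add_mul]
      exact (i1 k).add (i2 k)
    · simp only [hsq]
      refine ((i3 k).const_mul 2).congr (.of_forall fun x => ?_)
      ring
    · exact integrable_mul_bdd iy (hcut.aestronglyMeasurable.mul (mU k)) (hcutU k)
    · exact fun x _ => DifferentiableAt.fun_mul (hasFDerivAt_cut n x).differentiableAt (hU k x)
    · exact fun x _ => (hy x).norm_sq ℝ
  have e1 : (fun x => cut n x * inner ℝ (y x) (∑ k, (U k x : ℂ) * fderiv ℝ y x (e k))) =
      fun x => ∑ k, cut n x * U k x * inner ℝ (y x) (fderiv ℝ y x (e k)) := by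
    funext x
    rw [inner_sum, Finset.mul_sum]
    refine Finset.sum_congr rfl fun k _ => ?_
    rw [← Complex.real_smul, real_inner_smul_right]
    ring
  -- The field is divergence free.
  have e2 : ∑ k, ∫ x, cut n x * fderiv ℝ (U k) x (e k) * ‖y x‖ ^ 2 = 0 := by
    rw [← integral_finsetSum _ fun k _ => i2 k]
    have : ∀ x, ∑ k, cut n x * fderiv ℝ (U k) x (e k) * ‖y x‖ ^ 2 = 0 := by
      intro x
      rw [← Finset.sum_mul, ← Finset.mul_sum, hdiv, mul_zero, zero_mul]
    simp [this]
  have e3 : 2 * ∫ x, cut n x * inner ℝ (y x) (∑ k, (U k x : ℂ) * fderiv ℝ y x (e k)) =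
      -∑ k, ∫ x, (-(2 / ((n : ℝ) + 1)) * cut n x ^ 2 * x k) * U k x * ‖y x‖ ^ 2 := by
    rw [e1, integral_finsetSum _ fun k _ => i3 k, Finset.mul_sum, Finset.sum_congr rfl fun k _ =>
      hk k,
      Finset.sum_neg_distrib, Finset.sum_add_distrib, e2, add_zero]
  have ie : Integrable fun x => cutError n x * ‖y x‖ ^ 2 :=
    integrable_mul_bdd iy (continuous_cutError n).aestronglyMeasurable (c := 9) fun x => by
      rw [abs_of_nonneg (cutError_nonneg n x)]; exact cutError_le n x
  have h5 : ∀ k, |∫ x, (-(2 / ((n : ℝ) + 1)) * cut n x ^ 2 * x k) * U k x * ‖y x‖ ^ 2| ≤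
      α / 3 * ∫ x, cutError n x * ‖y x‖ ^ 2 := by
    intro k
    rw [← integral_const_mul]
    refine abs_integral_le_integral_abs.trans
      (integral_mono (i1 k).abs (ie.const_mul _) fun x => ?_)
    rw [abs_mul, abs_of_nonneg (sq_nonneg ‖y x‖)]
    calc _ ≤ α * (cutError n x / 3) * ‖y x‖ ^ 2 := by gcongr; exact hd1 k x
      _ = _ := by ring
  have h6 := Finset.abs_sum_le_sum_abs (fun k => ∫ x, (-(2 / ((n : ℝ) + 1)) * cut n x ^ 2 * x k) *
    U k x * ‖y x‖ ^ 2) Finset.univ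
  have h7 := Finset.sum_le_sum fun k (_ : k ∈ Finset.univ) => h5 k
  rw [Finset.sum_const, Finset.card_univ, Fintype.card_fin, nsmul_eq_mul] at h7
  have h8 : 2 * |∫ x, cut n x * inner ℝ (y x) (∑ k, (U k x : ℂ) * fderiv ℝ y x (e k))| =
      |∑ k, ∫ x, (-(2 / ((n : ℝ) + 1)) * cut n x ^ 2 * x k) * U k x * ‖y x‖ ^ 2| := by
    rw [← abs_neg (∑ k, _), ← e3, abs_mul, abs_two]
  have h9 : 0 ≤ ∫ x, cutError n x * ‖y x‖ ^ 2 := integral_nonneg fun x =>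
    mul_nonneg (cutError_nonneg n x) (sq_nonneg _)
  have h10 : 0 ≤ α * ∫ x, cutError n x * ‖y x‖ ^ 2 := mul_nonneg hα h9
  push_cast at h7
  linarith

theorem lintegral_enorm_mul_le {α : Type*} [MeasurableSpace α] {μ : Measure α} {f g : α → ℂ}
    (hf : AEStronglyMeasurable f μ) (hg : AEStronglyMeasurable g μ) :
    ∫⁻ x, ‖f x‖ₑ * ‖g x‖ₑ ∂μ ≤ eLpNorm f 2 μ * eLpNorm g 2 μ := by
  have h := ENNReal.lintegral_mul_le_Lp_mul_Lq μ Real.HolderConjugate.two_two hf.enorm hg.enorm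
  refine h.trans_eq ?_
  rw [eLpNorm_eq_lintegral_rpow_enorm_toReal (by norm_num) (by norm_num),
    eLpNorm_eq_lintegral_rpow_enorm_toReal (by norm_num) (by norm_num)]
  simp

theorem integrable_prod_of_lintegral {μ : Measure ℝ} [SFinite μ] {f : ℝ × Space → ℝ}
    (hf : AEStronglyMeasurable f (μ.prod volume)) {g : ℝ → ℝ≥0∞} (hg : ∫⁻ τ, g τ ∂μ < ⊤)
    (h : ∀ᵐ τ ∂μ, ∫⁻ x, ‖f (τ, x)‖ₑ ≤ g τ) : Integrable f (μ.prod volume) := by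
  refine ⟨hf, ?_⟩
  rw [HasFiniteIntegral, lintegral_prod _ hf.enorm]
  exact (lintegral_mono_ae h).trans_lt hg

theorem enorm_inner_le (a b : ℂ) : ‖inner ℝ a b‖ₑ ≤ ‖a‖ₑ * ‖b‖ₑ := by
  rw [← ofReal_norm, ← ofReal_norm, ← ofReal_norm, ← ENNReal.ofReal_mul (norm_nonneg _)]
  exact ENNReal.ofReal_le_ofReal (norm_inner_le_norm a b)

/-- The energy identity for `∂_t y + B = A`, where `B` is the transport of `y` by a divergence free
field of linear growth, in the sense that it preserves the energy up to the error of the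
cut-offs. -/
theorem hasPrim_energy {T : ℝ} (hT : 0 ≤ T) {y A B : ℝ → Space → ℂ} {α : ℝ → ℝ} {M : ℝ≥0∞}
    (hint : ∀ x, IntervalIntegrable (fun τ => A τ x - B τ x) volume 0 T)
    (heq : ∀ x, ∀ t ∈ Set.Icc 0 T, y t x = y 0 x + ∫ τ in (0 : ℝ)..t, (A τ x - B τ x))
    (my : AEStronglyMeasurable (Function.uncurry y) ((volume.restrict (Set.Icc 0 T)).prod volume))
    (mA : AEStronglyMeasurable (Function.uncurry A) ((volume.restrict (Set.Icc 0 T)).prod volume))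
    (mB : AEStronglyMeasurable (Function.uncurry B) ((volume.restrict (Set.Icc 0 T)).prod volume))
    (hM : M ≠ ⊤) (hy : ∀ t ∈ Set.Icc 0 T, Continuous (y t) ∧ eLpNorm (y t) 2 volume ≤ M)
    (hA : ∫⁻ τ in Set.Icc 0 T, eLpNorm (A τ) 2 volume < ⊤)
    (hB : ∫⁻ τ in Set.Icc 0 T, eLpNorm (fun x => (((1 + ‖x‖)⁻¹ : ℝ) : ℂ) * B τ x) 2 volume < ⊤)
    (hα : IntegrableOn α (Set.Icc 0 T))
    (hBcut : ∀ᵐ τ ∂volume.restrict (Set.Icc 0 T), ∀ n,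
      |∫ x, cut n x * inner ℝ (y τ x) (B τ x)| ≤ α τ * ∫ x, cutError n x * ‖y τ x‖ ^ 2) :
    HasPrim T (fun t => ∫ x, ‖y t x‖ ^ 2) fun τ => 2 * ∫ x, inner ℝ (y τ x) (A τ x) := by
  have hmem : ∀ᵐ τ ∂volume.restrict (Set.Icc 0 T), τ ∈ Set.Icc 0 T :=
    ae_restrict_mem measurableSet_Icc
  have hy2 : ∀ t ∈ Set.Icc 0 T, MemLp (y t) 2 volume := fun t ht =>
    ⟨(hy t ht).1.aestronglyMeasurable, (hy t ht).2.trans_lt hM.lt_top⟩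
  have iy : ∀ t ∈ Set.Icc 0 T, Integrable fun x => ‖y t x‖ ^ 2 := fun t ht =>
    (hy2 t ht).integrable_norm_pow (by norm_num)
  -- integrability on the product space
  have IA : Integrable (fun z : ℝ × Space => inner ℝ (y z.1 z.2) (A z.1 z.2))
      ((volume.restrict (Set.Icc 0 T)).prod volume) := by
    refine integrable_prod_of_lintegral (my.inner mA) (g := fun τ => M * eLpNorm (A τ) 2 volume) ?_
      ?_
    · rw [lintegral_const_mul' _ _ hM]
      exact ENNReal.mul_lt_top hM.lt_top hA
    · filter_upwards [hmem, mA.prodMk_left] with τ hτ hAτ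
      calc _ ≤ ∫⁻ x, ‖y τ x‖ₑ * ‖A τ x‖ₑ := lintegral_mono fun x => enorm_inner_le _ _
        _ ≤ eLpNorm (y τ) 2 volume * eLpNorm (A τ) 2 volume :=
            lintegral_enorm_mul_le (hy2 τ hτ).1 hAτ
        _ ≤ _ := by gcongr; exact (hy τ hτ).2
  have IB : ∀ n, Integrable (fun z : ℝ × Space => cut n z.2 * inner ℝ (y z.1 z.2) (B z.1 z.2))
      ((volume.restrict (Set.Icc 0 T)).prod volume) := by
    intro n
    refine integrable_prod_of_lintegral
      (((continuous_cut n).comp continuous_snd).aestronglyMeasurable.mul (my.inner mB))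
      (g := fun τ => M * (ENNReal.ofReal (n + 2) *
        eLpNorm (fun x => (((1 + ‖x‖)⁻¹ : ℝ) : ℂ) * B τ x) 2 volume)) ?_ ?_
    · rw [lintegral_const_mul' _ _ hM, lintegral_const_mul' _ _ ENNReal.ofReal_ne_top]
      exact ENNReal.mul_lt_top hM.lt_top (ENNReal.mul_lt_top ENNReal.ofReal_lt_top hB)
    · filter_upwards [hmem, mB.prodMk_left] with τ hτ hBτ
      have mB' : AEStronglyMeasurable (fun x => (((1 + ‖x‖)⁻¹ : ℝ) : ℂ) * B τ x) volume := by
        refine AEStronglyMeasurable.mul (Continuous.aestronglyMeasurable ?_) hBτ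
        exact Complex.continuous_ofReal.comp
          (Continuous.inv₀ (by fun_prop) fun x => by positivity)
      calc _ ≤ ∫⁻ x, ENNReal.ofReal (n + 2) *
            (‖y τ x‖ₑ * ‖(((1 + ‖x‖)⁻¹ : ℝ) : ℂ) * B τ x‖ₑ) := by
            refine lintegral_mono fun x => ?_
            rw [enorm_mul, enorm_mul]
            have h1 : ‖cut n x‖ₑ ≤ ENNReal.ofReal (n + 2) * ‖(((1 + ‖x‖)⁻¹ : ℝ) : ℂ)‖ₑ := by
              rw [← ofReal_norm, ← ofReal_norm, ← ENNReal.ofReal_mul (by positivity)]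
              refine ENNReal.ofReal_le_ofReal ?_
              rw [Complex.norm_real, Real.norm_of_nonneg (cut_pos n x).le,
                Real.norm_of_nonneg (by positivity), ← div_eq_mul_inv, le_div_iff₀ (by positivity)]
              exact cut_mul_le n x
            calc _ ≤ (ENNReal.ofReal (n + 2) * ‖(((1 + ‖x‖)⁻¹ : ℝ) : ℂ)‖ₑ) *
                  (‖y τ x‖ₑ * ‖B τ x‖ₑ) := mul_le_mul' h1 (enorm_inner_le _ _)
              _ = _ := by ring
        _ = ENNReal.ofReal (n + 2) *
            ∫⁻ x, ‖y τ x‖ₑ * ‖(((1 + ‖x‖)⁻¹ : ℝ) : ℂ) * B τ x‖ₑ :=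
            lintegral_const_mul' _ _ ENNReal.ofReal_ne_top
        _ ≤ ENNReal.ofReal (n + 2) * (eLpNorm (y τ) 2 volume *
            eLpNorm (fun x => (((1 + ‖x‖)⁻¹ : ℝ) : ℂ) * B τ x) 2 volume) := by
            gcongr; exact lintegral_enorm_mul_le (hy2 τ hτ).1 mB'
        _ ≤ _ := by
            rw [mul_left_comm]
            gcongr; exact (hy τ hτ).2
  have IE : Integrable (fun z : ℝ × Space => α z.1 * ‖y z.1 z.2‖ ^ 2)
      ((volume.restrict (Set.Icc 0 T)).prod volume) := by
    refine integrable_prod_of_lintegral (hα.1.comp_fst.mul (my.norm.pow 2))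
      (g := fun τ => ‖α τ‖ₑ * M ^ 2) ?_ ?_
    · rw [lintegral_mul_const' _ _ (ENNReal.pow_ne_top hM)]
      exact ENNReal.mul_lt_top hα.2 (ENNReal.pow_lt_top hM.lt_top)
    · filter_upwards [hmem] with τ hτ
      calc _ = ∫⁻ x, ‖α τ‖ₑ * ‖y τ x‖ₑ ^ 2 := by
            congr 1; funext x; rw [enorm_mul, enorm_pow, enorm_norm]
        _ = ‖α τ‖ₑ * ∫⁻ x, ‖y τ x‖ₑ ^ 2 := lintegral_const_mul' _ _ enorm_ne_top
        _ ≤ _ := by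
            rw [← eLpNorm_two_sq]
            gcongr
            exact (hy τ hτ).2
  have hIcc : volume.restrict (Set.Ioc 0 T) = volume.restrict (Set.Icc 0 T) :=
    restrict_Ioc_eq_restrict_Icc
  refine ⟨?_, fun t ht => ?_⟩
  · rw [intervalIntegrable_iff_integrableOn_Ioc_of_le hT, IntegrableOn, hIcc]
    exact IA.integral_prod_left.const_mul 2
  have h0 : (0 : ℝ) ∈ Set.Icc 0 T := ⟨le_rfl, hT⟩
  have hsub : Set.Ioc 0 t ⊆ Set.Icc 0 T := fun x hx => ⟨hx.1.le, hx.2.trans ht.2⟩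
  have hle : volume.restrict (Set.Ioc 0 t) ≤ volume.restrict (Set.Icc 0 T) :=
    Measure.restrict_mono hsub le_rfl
  have hle2 : (volume.restrict (Set.Ioc 0 t)).prod (volume : Measure Space) ≤
      (volume.restrict (Set.Icc 0 T)).prod volume := Measure.prod_mono hle le_rfl
  replace IA := IA.mono_measure hle2
  replace IB := fun n => (IB n).mono_measure hle2
  replace IE := IE.mono_measure hle2
  have IAn : ∀ n, Integrable (fun z : ℝ × Space => cut n z.2 * inner ℝ (y z.1 z.2) (A z.1 z.2))
      ((volume.restrict (Set.Ioc 0 t)).prod volume) := by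
    intro n
    refine IA.bdd_mul (c := 1) ((continuous_cut n).comp continuous_snd).aestronglyMeasurable
      (.of_forall fun z => ?_)
    rw [Real.norm_of_nonneg (cut_pos n _).le]
    exact cut_le_one n _
  have hcy : ∀ s ∈ Set.Icc 0 T, ∀ n, Integrable fun x => cut n x * ‖y s x‖ ^ 2 := by
    intro s hs n
    refine integrable_mul_bdd (iy s hs) (continuous_cut n).aestronglyMeasurable (c := 1) fun x => ?_
    rw [abs_of_pos (cut_pos n x)]
    exact cut_le_one n x
  -- the truncated identity
  have hn : ∀ n, ∫ x, cut n x * ‖y t x‖ ^ 2 = (∫ x, cut n x * ‖y 0 x‖ ^ 2) +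
      2 * ((∫ z, cut n z.2 * inner ℝ (y z.1 z.2) (A z.1 z.2)
          ∂((volume.restrict (Set.Ioc 0 t)).prod volume)) -
        ∫ z, cut n z.2 * inner ℝ (y z.1 z.2) (B z.1 z.2)
          ∂((volume.restrict (Set.Ioc 0 t)).prod volume)) := by
    intro n
    have h1 : ∀ x, cut n x * ‖y t x‖ ^ 2 = cut n x * ‖y 0 x‖ ^ 2 +
        2 * ∫ τ in Set.Ioc 0 t, (cut n x * inner ℝ (y τ x) (A τ x) -
          cut n x * inner ℝ (y τ x) (B τ x)) := by
      intro x
      rw [(hasPrim_normSq hT (hint x) (heq x)).eq t ht, intervalIntegral.integral_of_le ht.1,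
        mul_add,
        ← integral_const_mul, ← integral_const_mul]
      congr 1
      congr 1; funext τ
      rw [inner_sub_right]; ring
    have h2 : Integrable (fun z : ℝ × Space => cut n z.2 * inner ℝ (y z.1 z.2) (A z.1 z.2) -
        cut n z.2 * inner ℝ (y z.1 z.2) (B z.1 z.2))
        ((volume.restrict (Set.Ioc 0 t)).prod volume) := (IAn n).sub (IB n)
    have h3 : Integrable fun x => ∫ τ in Set.Ioc 0 t, (cut n x * inner ℝ (y τ x) (A τ x) -
          cut n x * inner ℝ (y τ x) (B τ x)) := h2.integral_prod_right
    simp only [h1]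
    rw [integral_add (hcy 0 h0 n) (h3.const_mul 2), integral_const_mul,
      ← integral_sub (IAn n) (IB n),
      integral_prod_symm _ h2]
  -- removal of the cut-off
  have l1 : ∀ s ∈ Set.Icc 0 T, Tendsto (fun n => ∫ x, cut n x * ‖y s x‖ ^ 2) atTop
      (𝓝 (∫ x, ‖y s x‖ ^ 2)) := by
    intro s hs
    refine tendsto_integral_of_dominated_convergence (fun x => ‖y s x‖ ^ 2)
      (fun n => (hcy s hs n).1) (iy s hs) (fun n => .of_forall fun x => ?_) (.of_forall fun x => ?_)
    · rw [norm_mul, Real.norm_of_nonneg (cut_pos n x).le, Real.norm_of_nonneg (by positivity)]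
      exact mul_le_of_le_one_left (by positivity) (cut_le_one n x)
    · simpa using (tendsto_cut x).mul_const (‖y s x‖ ^ 2)
  have l2 : Tendsto (fun n => ∫ z, cut n z.2 * inner ℝ (y z.1 z.2) (A z.1 z.2)
      ∂((volume.restrict (Set.Ioc 0 t)).prod volume)) atTop
      (𝓝 (∫ z, inner ℝ (y z.1 z.2) (A z.1 z.2)
        ∂((volume.restrict (Set.Ioc 0 t)).prod volume))) := by
    refine tendsto_integral_of_dominated_convergence
      (fun z => ‖(inner ℝ (y z.1 z.2) (A z.1 z.2) : ℝ)‖)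
      (fun n => (IAn n).1) IA.norm (fun n => .of_forall fun z => ?_) (.of_forall fun z => ?_)
    · rw [norm_mul, Real.norm_of_nonneg (cut_pos n _).le]
      exact mul_le_of_le_one_left (norm_nonneg _) (cut_le_one n _)
    · simpa using (tendsto_cut z.2).mul_const (inner ℝ (y z.1 z.2) (A z.1 z.2))
  have l3 : Tendsto (fun n => ∫ z, cut n z.2 * inner ℝ (y z.1 z.2) (B z.1 z.2)
      ∂((volume.restrict (Set.Ioc 0 t)).prod volume)) atTop (𝓝 0) := by
    have IEn : ∀ n, Integrable (fun z : ℝ × Space => cutError n z.2 * (α z.1 * ‖y z.1 z.2‖ ^ 2))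
        ((volume.restrict (Set.Ioc 0 t)).prod volume) := by
      intro n
      refine IE.bdd_mul (c := 9) ((continuous_cutError n).comp continuous_snd).aestronglyMeasurable
        (.of_forall fun z => ?_)
      rw [Real.norm_of_nonneg (cutError_nonneg n _)]
      exact cutError_le n _
    have h4 : Tendsto (fun n => ∫ z, cutError n z.2 * (α z.1 * ‖y z.1 z.2‖ ^ 2)
        ∂((volume.restrict (Set.Ioc 0 t)).prod volume)) atTop (𝓝 0) := by
      have := tendsto_integral_of_dominated_convergence
        (μ := (volume.restrict (Set.Ioc 0 t)).prod (volume : Measure Space))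
        (F := fun n z => cutError n z.2 * (α z.1 * ‖y z.1 z.2‖ ^ 2)) (f := fun _ => (0 : ℝ))
        (fun z => 9 * ‖α z.1 * ‖y z.1 z.2‖ ^ 2‖) (fun n => (IEn n).1) (IE.norm.const_mul 9)
        (fun n => .of_forall fun z => ?_) (.of_forall fun z => ?_)
      · simpa using this
      · rw [norm_mul, Real.norm_of_nonneg (cutError_nonneg n _)]
        gcongr
        exact cutError_le n _
      · simpa using (tendsto_cutError z.2).mul_const (α z.1 * ‖y z.1 z.2‖ ^ 2)
    refine squeeze_zero_norm (fun n => ?_) h4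
    rw [integral_prod _ (IB n), integral_prod _ (IEn n)]
    refine norm_integral_le_of_norm_le (IEn n).integral_prod_left ?_
    filter_upwards [ae_mono hle hBcut] with τ hτ
    rw [Real.norm_eq_abs]
    refine (hτ n).trans_eq ?_
    rw [← integral_const_mul]
    congr 1; funext x; ring
  have l4 := (l1 0 h0).add ((l2.sub l3).const_mul 2)
  have h5 := tendsto_nhds_unique (l1 t ht) (l4.congr fun n => (hn n).symm)
  rw [h5, intervalIntegral.integral_of_le ht.1, sub_zero, integral_prod _ IA, integral_const_mul]

/-! ### Sobolev norms and dyadic blocks -/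

theorem ofReal_mul_block_le (P : LittlewoodPaley) (σ : ℝ) {ι : Type*} [Fintype ι]
    (w : ι → 𝓢'(Space, ℂ)) (n : ℕ) :
    ENNReal.ofReal ((2 : ℝ) ^ (2 * σ * ((n : ℝ) - 1))) *
      ∑ i, eLpNorm (block P n (w i)) 2 volume ^ 2 ≤ sobolevNorm P σ w ^ 2 := by
  have h : sobolevNorm P σ w ^ 2 = ∑' n : ℕ, ENNReal.ofReal ((2 : ℝ) ^ (2 * σ * ((n : ℝ) - 1))) *
      ∑ i, eLpNorm (block P n (w i)) 2 volume ^ 2 := by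
    rw [sobolevNorm, ← ENNReal.rpow_natCast, ← ENNReal.rpow_mul]
    simp
  rw [h]
  exact ENNReal.le_tsum n

theorem eLpNorm_block_le (P : LittlewoodPaley) (σ : ℝ) {ι : Type*} [Fintype ι]
    (w : ι → 𝓢'(Space, ℂ)) (n : ℕ) (i : ι) :
    eLpNorm (block P n (w i)) 2 volume ≤
      ENNReal.ofReal ((2 : ℝ) ^ (-(σ * ((n : ℝ) - 1)))) * sobolevNorm P σ w := by
  have h := ofReal_mul_block_le P σ w n
  have h1 : ENNReal.ofReal ((2 : ℝ) ^ (2 * σ * ((n : ℝ) - 1))) *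
      eLpNorm (block P n (w i)) 2 volume ^ 2 ≤ sobolevNorm P σ w ^ 2 := by
    refine le_trans ?_ h
    gcongr
    exact Finset.single_le_sum (f := fun i => eLpNorm (block P n (w i)) 2 volume ^ 2)
      (fun _ _ => zero_le) (Finset.mem_univ i)
  refine (ENNReal.pow_le_pow_left_iff two_ne_zero).1 ?_
  rw [mul_pow, ← ENNReal.ofReal_pow (by positivity)]
  have h2 : ENNReal.ofReal (((2 : ℝ) ^ (-(σ * ((n : ℝ) - 1)))) ^ 2) *
      ENNReal.ofReal ((2 : ℝ) ^ (2 * σ * ((n : ℝ) - 1))) = 1 := by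
    rw [← ENNReal.ofReal_mul (by positivity), ← Real.rpow_natCast, ← Real.rpow_mul (by norm_num),
      ← Real.rpow_add (by norm_num)]
    norm_num
    ring_nf
    norm_num
  calc _ = ENNReal.ofReal (((2 : ℝ) ^ (-(σ * ((n : ℝ) - 1)))) ^ 2) *
        (ENNReal.ofReal ((2 : ℝ) ^ (2 * σ * ((n : ℝ) - 1))) *
          eLpNorm (block P n (w i)) 2 volume ^ 2) := by rw [← mul_assoc, h2, one_mul]
    _ ≤ _ := by gcongr

theorem block_zero (P : LittlewoodPaley) (T : 𝓢'(Space, ℂ)) : block P 0 T = op (P.chiS 0) T := by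
  rw [block, P.lowPass_eq]; rfl

theorem block_succ (P : LittlewoodPaley) (j : ℕ) (T : 𝓢'(Space, ℂ)) :
    block P (j + 1) T = op (P.phiS j) T := by
  rw [block, P.shell_eq]

/-- A distribution with square integrable dyadic blocks has a locally square integrable Fourier
transform. -/
theorem exists_density_of_block (P : LittlewoodPaley) {T : 𝓢'(Space, ℂ)}
    (h : ∀ n, eLpNorm (block P n T) 2 volume < ⊤) : ∃ a, HasDensity T a := by
  refine exists_hasDensity (m := fun J => P.chiS J) (fun J ξ hξ => ?_) fun J =>
    ⟨(continuous_op _ _).aestronglyMeasurable, ?_⟩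
  · apply P.chiS_eq_one
    rw [zpow_natCast]
    have h1 := Real.pi_lt_d4
    have h2 := norm_nonneg ξ
    have h3 : (0 : ℝ) < 2 ^ J := by positivity
    nlinarith
  · have e := P.chiS_add_nat 0 J
    rw [zero_add] at e
    have e2 : op (P.chiS J) T = op (P.chiS 0) T + op (∑ i ∈ Finset.range J, P.phiS (0 + i)) T := by
      funext x
      rw [e, op_add_left, Pi.add_apply]
    rw [e2]
    refine (eLpNorm_add_le (continuous_op _ _).aestronglyMeasurable
      (continuous_op _ _).aestronglyMeasurable (by norm_num)).trans_lt
        (ENNReal.add_lt_top.2 ⟨?_, ?_⟩)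
    · rw [← block_zero]; exact h 0
    · refine (eLpNorm_op_sum_le _ _ _).trans_lt (ENNReal.sum_lt_top.2 fun i _ => ?_)
      rw [zero_add, ← block_succ]
      exact h (i + 1)

theorem exists_density_of_sobolevNorm (P : LittlewoodPaley) {σ : ℝ} {ι : Type*} [Fintype ι]
    {w : ι → 𝓢'(Space, ℂ)} (h : sobolevNorm P σ w < ⊤) (i : ι) : ∃ a, HasDensity (w i) a :=
  exists_density_of_block P fun n => (eLpNorm_block_le P σ w n i).trans_lt
    (ENNReal.mul_lt_top ENNReal.ofReal_lt_top h)

/-- Comparison of the `L²` norms of two frequency localizations. -/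
theorem eLpNorm_op_le_of_norm_le {T : 𝓢'(Space, ℂ)} {a : Space → ℂ} (ha : HasDensity T a)
    {m m' : 𝓢(Space, ℂ)} (hc : HasCompactSupport m) (hc' : HasCompactSupport m') {c : ℝ}
    (h : ∀ ξ, ‖m ξ‖ ≤ c * ‖m' ξ‖) :
    eLpNorm (op m T) 2 volume ≤ ENNReal.ofReal c * eLpNorm (op m' T) 2 volume := by
  rw [ha.eLpNorm_op hc, ha.eLpNorm_op hc']
  refine eLpNorm_le_mul_eLpNorm_of_ae_le_mul (.of_forall fun ξ => ?_) 2
  rw [norm_mul, norm_mul, mul_left_comm]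
  exact mul_le_mul_of_nonneg_left (h ξ) (norm_nonneg _)

namespace LittlewoodPaley

variable (P : LittlewoodPaley)

theorem norm_phiS_le_chiS {q : ℤ} (hq : q < 0) (ξ : Space) : ‖P.phiS q ξ‖ ≤ ‖P.chiS 0 ξ‖ := by
  obtain ⟨n, hn⟩ := Int.le.dest (show q + 1 ≤ 0 by omega)
  have h := P.chiS_add_nat (q + 1) n
  rw [hn, chiS_succ] at h
  have hp : ∀ j, P.phiS j ξ = (((P.phiS j ξ).re : ℝ) : ℂ) ∧ 0 ≤ (P.phiS j ξ).re := by
    intro j; rw [phiS_apply]; simp [(P.phi_mem _).1]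
  have hc : ∀ j, P.chiS j ξ = (((P.chiS j ξ).re : ℝ) : ℂ) ∧ 0 ≤ (P.chiS j ξ).re := by
    intro j; rw [chiS_apply]; simp [(P.chi_mem _).1]
  have h2 := congrArg (fun m : 𝓢(Space, ℂ) => (m ξ).re) h
  simp only [add_apply, sum_apply, Complex.add_re, Complex.re_sum] at h2
  rw [(hp q).1, (hc 0).1, Complex.norm_real, Complex.norm_real, Real.norm_of_nonneg (hp q).2,
    Real.norm_of_nonneg (hc 0).2, h2]
  have h3 := Finset.sum_nonneg fun i (_ : i ∈ Finset.range n) => (hp (q + 1 + i)).2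
  linarith [(hc q).2]

theorem norm_leray_le (q : ℤ) (i l : Fin 3) (ξ : Space) : ‖P.leray q i l ξ‖ ≤ 1 * ‖P.phiS q ξ‖ := by
  rw [leray_apply, norm_mul, one_mul, Complex.norm_real]
  refine mul_le_of_le_one_right (norm_nonneg _) ?_
  rw [Real.norm_eq_abs, abs_le]
  by_cases hξ : ξ = 0
  · subst hξ
    split_ifs <;> simp
  have h0 : 0 < ‖ξ‖ ^ 2 := by have := norm_pos_iff.2 hξ; positivity
  have h1 : ‖ξ‖ ^ 2 = ξ 0 ^ 2 + ξ 1 ^ 2 + ξ 2 ^ 2 := by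
    rw [EuclideanSpace.real_norm_sq_eq, Fin.sum_univ_three]
  have h2 : |ξ i * ξ l / ‖ξ‖ ^ 2| ≤ 1 := by
    rw [abs_div, abs_of_pos h0, div_le_one h0, abs_mul]
    have hi : |ξ i| ≤ ‖ξ‖ := PiLp.norm_apply_le ξ i
    have hl : |ξ l| ≤ ‖ξ‖ := PiLp.norm_apply_le ξ l
    nlinarith [abs_nonneg (ξ i), abs_nonneg (ξ l)]
  by_cases h : i = l
  · subst h
    rw [if_pos rfl]
    have h3 : 0 ≤ ξ i * ξ i / ‖ξ‖ ^ 2 := div_nonneg (mul_self_nonneg _) h0.le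
    rw [abs_of_nonneg h3] at h2
    constructor <;> linarith
  · rw [if_neg h, zero_sub]
    rw [abs_le] at h2
    constructor <;> linarith [h2.1, h2.2]

theorem norm_mulI_phiS_le (q : ℤ) (k : Fin 3) (ξ : Space) :
    ‖mulI k (P.phiS q) ξ‖ ≤ (8 / 3 * (2 : ℝ) ^ q) * ‖P.phiS q ξ‖ := by
  rw [mulI_apply, norm_mul]
  by_cases h : P.phiS q ξ = 0
  · simp [h]
  gcongr
  have h2 := (P.phiS_supp h).2
  have h3 : |ξ k| ≤ ‖ξ‖ := PiLp.norm_apply_le ξ k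
  simp only [norm_mul, Complex.norm_ofNat, Complex.norm_real, Complex.norm_I,
    Real.norm_eq_abs, abs_of_pos Real.pi_pos, mul_one]
  have := mul_le_mul_of_nonneg_left h3 (by positivity : 0 ≤ 2 * Real.pi)
  linarith

theorem exists_shell_le_sobolevNorm (σ : ℝ) (q : ℤ) : ∃ c : ℝ≥0∞, c ≠ ⊤ ∧ c ≠ 0 ∧
    ∀ {ι : Type} [Fintype ι] (w : ι → 𝓢'(Space, ℂ)) (i : ι),
      eLpNorm (op (P.phiS q) (w i)) 2 volume ≤ c * sobolevNorm P σ w := by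
  by_cases hq : q < 0
  · refine ⟨ENNReal.ofReal ((2 : ℝ) ^ (-(σ * (((0 : ℕ) : ℝ) - 1)))), ENNReal.ofReal_ne_top,
      ne_of_gt (ENNReal.ofReal_pos.2 (by positivity)), fun w i => ?_⟩
    by_cases hw : sobolevNorm P σ w = ⊤
    · rw [hw, ENNReal.mul_top (ne_of_gt (ENNReal.ofReal_pos.2 (by positivity)))]
      exact le_top
    · obtain ⟨a, ha⟩ := exists_density_of_sobolevNorm P (lt_top_iff_ne_top.2 hw) i
      have h1 := eLpNorm_op_le_of_norm_le ha (P.hasCompactSupport_phiS q)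
        (P.hasCompactSupport_chiS 0) (c := 1) fun ξ => by
          rw [one_mul]; exact P.norm_phiS_le_chiS hq ξ
      rw [ENNReal.ofReal_one, one_mul, ← block_zero] at h1
      exact h1.trans (eLpNorm_block_le P σ w 0 i)
  · obtain ⟨n, rfl⟩ := Int.eq_ofNat_of_zero_le (not_lt.1 hq)
    refine ⟨ENNReal.ofReal ((2 : ℝ) ^ (-(σ * (((n + 1 : ℕ) : ℝ) - 1)))), ENNReal.ofReal_ne_top,
      ne_of_gt (ENNReal.ofReal_pos.2 (by positivity)), fun w i => ?_⟩
    rw [← block_succ]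
    exact eLpNorm_block_le P σ w (n + 1) i

end LittlewoodPaley

/-! ### The system in time -/

theorem mem_closure_of_ae {T : ℝ} (hT : 0 < T) {p : ℝ → Prop}
    (h : ∀ᵐ τ ∂volume.restrict (Set.Icc 0 T), p τ) {t : ℝ} (ht : t ∈ Set.Icc 0 T) :
    t ∈ closure {τ | τ ∈ Set.Icc 0 T ∧ p τ} := by
  rw [ae_restrict_iff' measurableSet_Icc] at h
  have h1 : Dense {τ | τ ∈ Set.Icc 0 T → p τ} := Measure.dense_of_ae h
  have h2 : Set.Ioo 0 T ⊆ closure (Set.Ioo 0 T ∩ {τ | τ ∈ Set.Icc 0 T → p τ}) :=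
    h1.open_subset_closure_inter isOpen_Ioo
  have h3 : t ∈ closure (Set.Ioo 0 T) := by rwa [closure_Ioo hT.ne]
  have h4 := closure_mono h2 h3
  rw [closure_closure] at h4
  have h5 : Set.Ioo 0 T ∩ {τ | τ ∈ Set.Icc 0 T → p τ} ⊆ {τ | τ ∈ Set.Icc 0 T ∧ p τ} :=
    fun τ hτ => ⟨Set.Ioo_subset_Icc_self hτ.1, hτ.2 (Set.Ioo_subset_Icc_self hτ.1)⟩
  exact closure_mono h5 h4

/-- A bound of `L²` norms that holds for almost every time holds for all times, when the functions
depend continuously on time. -/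
theorem eLpNorm_le_of_ae {T : ℝ} (hT : 0 < T) {F : ℝ → Space → ℂ}
    (hF : ∀ x, ContinuousOn (fun t => F t x) (Set.Icc 0 T)) (hm : ∀ t, Continuous (F t)) {M : ℝ≥0∞}
    (h : ∀ᵐ τ ∂volume.restrict (Set.Icc 0 T), eLpNorm (F τ) 2 volume ≤ M) {t : ℝ}
    (ht : t ∈ Set.Icc 0 T) : eLpNorm (F t) 2 volume ≤ M := by
  obtain ⟨τ, hτ, hlim⟩ := mem_closure_iff_seq_limit.1 (mem_closure_of_ae hT h ht)
  have hlim2 : Tendsto τ atTop (𝓝[Set.Icc 0 T] t) :=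
    tendsto_nhdsWithin_iff.2 ⟨hlim, .of_forall fun n => (hτ n).1⟩
  refine (Lp.eLpNorm_lim_le_liminf_eLpNorm (f := fun n => F (τ n))
    (fun n => (hm _).aestronglyMeasurable) (F t) (.of_forall fun x => ?_)).trans ?_
  · exact (hF x t ht).tendsto.comp hlim2
  · calc _ ≤ liminf (fun _ : ℕ => M) atTop := liminf_le_liminf (.of_forall fun n => (hτ n).2)
      _ = M := by simp

theorem aestronglyMeasurable_op {μ : Measure ℝ} [SFinite μ] {w : ℝ → 𝓢'(Space, ℂ)}
    (hw : ∀ ψ, AEMeasurable (fun τ => w τ ψ) μ) (m : 𝓢(Space, ℂ)) :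
    AEStronglyMeasurable (fun z : ℝ × Space => op m (w z.1) z.2) (μ.prod volume) := by
  obtain ⟨F, h1, -, h2⟩ := exists_measurable_op hw m
  refine h1.aestronglyMeasurable.congr ?_
  have h3 := (Measure.quasiMeasurePreserving_fst (μ := μ) (ν := (volume : Measure Space))).ae h2
  filter_upwards [h3] with z hz
  exact (hz z.2).symm

theorem WeaklyIntegrable.aemeasurable {T : ℝ} {w : ℝ → 𝓢'(Space, ℂ)} (hw : WeaklyIntegrable T w)
    (ψ : 𝓢(Space, ℂ)) : AEMeasurable (fun τ => w τ ψ) (volume.restrict (Set.Icc 0 T)) :=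
  (hw ψ).1.aemeasurable

theorem WeaklyIntegrable.lineDeriv {T : ℝ} {w : ℝ → 𝓢'(Space, ℂ)} (hw : WeaklyIntegrable T w)
    (k : Fin 3) : WeaklyIntegrable T fun τ => ∂_{e k} (w τ) := by
  intro ψ
  simp only [TemperedDistribution.lineDerivOp_apply_apply]
  exact hw _

theorem WeaklyIntegrable.add {T : ℝ} {w w' : ℝ → 𝓢'(Space, ℂ)} (hw : WeaklyIntegrable T w)
    (hw' : WeaklyIntegrable T w') : WeaklyIntegrable T fun τ => w τ + w' τ :=
  fun ψ => (hw ψ).add (hw' ψ)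

theorem WeaklyIntegrable.sub {T : ℝ} {w w' : ℝ → 𝓢'(Space, ℂ)} (hw : WeaklyIntegrable T w)
    (hw' : WeaklyIntegrable T w') : WeaklyIntegrable T fun τ => w τ - w' τ := by
  intro ψ
  have := (hw ψ).sub (hw' ψ)
  refine this.congr (.of_forall fun τ => ?_)
  simp

/-- The time derivative of the velocity, with convection term `N`. -/
def tendency (v f : ℝ → Fin 3 → 𝓢'(Space, ℂ)) (p g : ℝ → 𝓢'(Space, ℂ))
    (N : ℝ → Fin 3 → 𝓢'(Space, ℂ)) (i : Fin 3) (τ : ℝ) : 𝓢'(Space, ℂ) :=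
  f τ i + (if i = 2 then g τ else 0) - N τ i + horizontalLaplacian (v τ i) - ∂_{e i} (p τ)

namespace IsSolution

variable {P : LittlewoodPaley} {T : ℝ} {u v f : ℝ → Fin 3 → 𝓢'(Space, ℂ)}
  {p g : ℝ → 𝓢'(Space, ℂ)} {v₀ : Fin 3 → 𝓢'(Space, ℂ)} {N : ℝ → Fin 3 → 𝓢'(Space, ℂ)}

theorem weaklyIntegrable_tendency (sol : IsSolution P T u v f p g v₀)
    (hN : ∀ i, WeaklyIntegrable T fun τ => N τ i) (i : Fin 3) :
    WeaklyIntegrable T (tendency v f p g N i) := by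
  refine (((sol.f_integrable i).add ?_).sub (hN i)).add
    ((((sol.v_integrable i).lineDeriv 0).lineDeriv 0).add
      (((sol.v_integrable i).lineDeriv 1).lineDeriv 1)) |>.sub (sol.p_integrable.lineDeriv i)
  by_cases h : i = 2
  · simp only [h, if_true]; exact sol.g_integrable
  · simp only [h, if_false]
    intro ψ
    exact integrableOn_zero

end IsSolution

/-- The momentum equation, integrated in time and tested. -/
def Momentum (T : ℝ) (v : ℝ → Fin 3 → 𝓢'(Space, ℂ)) (G : Fin 3 → ℝ → 𝓢'(Space, ℂ)) : Prop :=
  (∀ i, WeaklyIntegrable T (G i)) ∧ ∀ t ∈ Set.Icc 0 T, ∀ (i : Fin 3) (ψ : 𝓢(Space, ℂ)),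
    v t i ψ = v 0 i ψ + ∫ τ in (0 : ℝ)..t, G i τ ψ

namespace Momentum

variable {T : ℝ} {v : ℝ → Fin 3 → 𝓢'(Space, ℂ)} {G : Fin 3 → ℝ → 𝓢'(Space, ℂ)}

theorem intervalIntegrable (h : Momentum T v G) (hT : 0 ≤ T) (i : Fin 3) (ψ : 𝓢(Space, ℂ)) :
    IntervalIntegrable (fun τ => G i τ ψ) volume 0 T := by
  rw [intervalIntegrable_iff_integrableOn_Icc_of_le hT]
  exact h.1 i ψ

theorem continuousOn (h : Momentum T v G) (hT : 0 ≤ T) (i : Fin 3) (ψ : 𝓢(Space, ℂ)) :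
    ContinuousOn (fun t => v t i ψ) (Set.Icc 0 T) := by
  have h0 : IntegrableOn (fun τ => G i τ ψ) (Set.uIcc 0 T) := by
    rw [Set.uIcc_of_le hT]
    exact h.1 i ψ
  have h1 := intervalIntegral.continuousOn_primitive_interval h0
  rw [Set.uIcc_of_le hT] at h1
  exact (continuousOn_const.add h1).congr fun t ht => h.2 t ht i ψ

/-- The velocity is divergence free at all times. -/
theorem divergence_eq_zero (h : Momentum T v G) (hT : 0 < T)
    (hd : ∀ᵐ τ ∂volume.restrict (Set.Icc 0 T), divergence (v τ) = 0) {t : ℝ}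
    (ht : t ∈ Set.Icc 0 T) : divergence (v t) = 0 := by
  have h1 : ∀ (τ : ℝ) (ψ : 𝓢(Space, ℂ)), divergence (v τ) ψ = ∑ k, v τ k (-∂_{e k} ψ) := by
    intro τ ψ
    rw [divergence, sum_apply]
    rfl
  ext ψ
  obtain ⟨τ, hτ, hlim⟩ := mem_closure_iff_seq_limit.1 (mem_closure_of_ae hT hd ht)
  have hlim2 : Tendsto τ atTop (𝓝[Set.Icc 0 T] t) :=
    tendsto_nhdsWithin_iff.2 ⟨hlim, .of_forall fun n => (hτ n).1⟩
  have h2 : ContinuousOn (fun t => divergence (v t) ψ) (Set.Icc 0 T) := by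
    simp only [h1]
    exact continuousOn_finsetSum _ fun k _ => h.continuousOn hT.le k _
  have h3 := (h2 t ht).tendsto.comp hlim2
  have h4 : Tendsto ((fun t => divergence (v t) ψ) ∘ τ) atTop (𝓝 0) := by
    refine tendsto_const_nhds.congr fun n => ?_
    simp [(hτ n).2]
  exact tendsto_nhds_unique h3 h4

end Momentum

theorem IsSolution.exists_momentum {P : LittlewoodPaley} {T : ℝ} (hT : 0 ≤ T)
    {u v f : ℝ → Fin 3 → 𝓢'(Space, ℂ)} {p g : ℝ → 𝓢'(Space, ℂ)} {v₀ : Fin 3 → 𝓢'(Space, ℂ)}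
    (sol : IsSolution P T u v f p g v₀) : v 0 = v₀ ∧ ∃ N : ℝ → Fin 3 → 𝓢'(Space, ℂ),
      Momentum T v (tendency v f p g N) ∧ (∀ i, WeaklyIntegrable T fun τ => N τ i) ∧
      ∀ᵐ τ ∂volume.restrict (Set.Icc 0 T), ∀ i, IsConvection P (u τ) (v τ i) (N τ i) := by
  obtain ⟨N, hN, hc, hm⟩ := sol.momentum
  have h0 : v 0 = v₀ := by
    funext i
    ext ψ
    rw [hm 0 ⟨le_rfl, hT⟩ i ψ]
    simp
  refine ⟨h0, N, ⟨sol.weaklyIntegrable_tendency hN, fun t ht i ψ => ?_⟩, hN, hc⟩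
  rw [hm t ht i ψ, h0]
  rfl

/-- Finiteness of the series that dominates the commutator, for a field of regularity `-1/2`. -/
theorem decaySum_lt_top {F : ℤ → ℝ≥0∞} {M : ℝ≥0∞}
    (hF : ∀ j, F j ≤ ENNReal.ofReal ((2 : ℝ) ^ ((j.toNat : ℝ) / 2)) * M) (q : ℤ) :
    LittlewoodPaley.decaySum F q ≤
      (∑' j, ENNReal.ofReal (decay q j * (2 : ℝ) ^ ((j.toNat : ℝ) / 2))) * M ∧
      ∑' j, ENNReal.ofReal (decay q j * (2 : ℝ) ^ ((j.toNat : ℝ) / 2)) ≠ ⊤ := by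
  constructor
  · rw [← ENNReal.tsum_mul_right]
    refine ENNReal.tsum_le_tsum fun j => ?_
    rw [ENNReal.ofReal_mul (decay_nonneg q j), mul_assoc]
    gcongr
    exact hF j
  · have hsum : Summable fun j : ℤ => decay q j * (2 : ℝ) ^ ((j.toNat : ℝ) / 2) := by
      -- the terms are `O(j 2^{-|j|/2})`
      have hr : ‖((2 : ℝ) ^ (-(1 / 2) : ℝ))‖ < 1 := by
        rw [Real.norm_of_nonneg (by positivity)]
        exact Real.rpow_lt_one_of_one_lt_of_neg (by norm_num) (by norm_num)
      have hs1 := (summable_geometric_of_norm_lt_one hr)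
      have hs2 := summable_pow_mul_geometric_of_norm_lt_one 1 hr
      have hs3 := ((hs1.mul_left ((q.natAbs : ℝ) + 5)).add hs2).mul_left ((2 : ℝ) ^ (q.natAbs : ℝ))
      have hbase : ∀ n : ℕ, ((2 : ℝ) ^ (-(1 / 2) : ℝ)) ^ n = (2 : ℝ) ^ (-(n : ℝ) / 2) := by
        intro n
        rw [← Real.rpow_natCast, ← Real.rpow_mul (by norm_num)]
        congr 1; ring
      have hq : ∀ j : ℤ, decay q j * (2 : ℝ) ^ ((j.toNat : ℝ) / 2) ≤ (2 : ℝ) ^ (q.natAbs : ℝ) *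
          (((q.natAbs : ℝ) + 5) * ((2 : ℝ) ^ (-(1 / 2) : ℝ)) ^ j.natAbs +
            (j.natAbs : ℝ) ^ 1 * ((2 : ℝ) ^ (-(1 / 2) : ℝ)) ^ j.natAbs) := by
        intro j
        rw [hbase, decay, ← Real.rpow_intCast]
        have h1 : (((max q j).toNat : ℕ) : ℝ) ≤ q.natAbs + j.natAbs := by
          exact_mod_cast (show (max q j).toNat ≤ q.natAbs + j.natAbs by omega)
        have h2 : (((-|q - j| : ℤ)) : ℝ) + (j.toNat : ℝ) / 2 ≤ q.natAbs + -(j.natAbs : ℝ) / 2 := by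
          have h3 : 2 * (-|q - j| : ℤ) + j.toNat ≤ 2 * q.natAbs - j.natAbs := by
            rcases abs_cases (q - j) with h | h <;> omega
          have h4 : (2 : ℝ) * (((-|q - j| : ℤ)) : ℝ) + j.toNat ≤ 2 * q.natAbs - j.natAbs := by
            exact_mod_cast h3
          linarith
        calc _ = (2 : ℝ) ^ ((((-|q - j| : ℤ)) : ℝ) + (j.toNat : ℝ) / 2) *
              ((max q j).toNat + 5) := by
              rw [Real.rpow_add (by norm_num)]; ring
          _ ≤ (2 : ℝ) ^ ((q.natAbs : ℝ) + -(j.natAbs : ℝ) / 2) * (q.natAbs + j.natAbs + 5) := by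
              refine mul_le_mul (Real.rpow_le_rpow_of_exponent_le (by norm_num) h2) ?_
                (by positivity) (by positivity)
              linarith
          _ = _ := by rw [Real.rpow_add (by norm_num)]; ring
      refine Summable.of_nonneg_of_le (fun j => mul_nonneg (decay_nonneg q j) (by positivity)) hq ?_
      refine Summable.of_nat_of_neg ?_ ?_
      · simpa using hs3
      · simpa using hs3
    rw [← ENNReal.ofReal_tsum_of_nonneg (fun j => mul_nonneg (decay_nonneg q j) (by positivity))
      hsum]
    exact ENNReal.ofReal_ne_top

/-! ### The equation of a dyadic block at a fixed time -/

theorem op_add_right (m : 𝓢(Space, ℂ)) (T T' : 𝓢'(Space, ℂ)) (x : Space) :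
    op m (T + T') x = op m T x + op m T' x := rfl

theorem op_sub_right (m : 𝓢(Space, ℂ)) (T T' : 𝓢'(Space, ℂ)) (x : Space) :
    op m (T - T') x = op m T x - op m T' x := by
  simp only [op_eq_apply_fourier]
  exact sub_apply T T' _

theorem op_zero_right (m : 𝓢(Space, ℂ)) (x : Space) : op m 0 x = 0 := rfl

namespace LittlewoodPaley

variable (P : LittlewoodPaley)

theorem sum_op_mulI_mulI_leray {w : Fin 3 → 𝓢'(Space, ℂ)} (hw : divergence w = 0) (q : ℤ)
    (i k : Fin 3) (x : Space) : ∑ l, op (mulI k (mulI k (P.leray q i l))) (w l) x =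
      op (mulI k (mulI k (P.phiS q))) (w i) x := by
  have h1 : (fun x => ∑ l, op (mulI k (P.leray q i l)) (w l) x) = op (mulI k (P.phiS q)) (w i) :=
    funext fun x => P.sum_op_mulI_leray hw q i k x
  rw [← fderiv_op, ← h1, fderiv_fun_sum fun l _ => differentiable_op _ _ x]
  simp [sum_apply, fderiv_op]

/-- The Leray projection of the block of a gradient vanishes. -/
theorem sum_op_leray_gradient (p : 𝓢'(Space, ℂ)) (q : ℤ) (i : Fin 3) (x : Space) :
    ∑ l, op (P.leray q i l) (∂_{e l} p) x = 0 := by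
  simp only [op_lineDeriv]
  rw [← op_sum_left, P.sum_mulI_leray, op_zero_left]

theorem sum_op_leray_horizontalLaplacian {w : Fin 3 → 𝓢'(Space, ℂ)} (hw : divergence w = 0) (q : ℤ)
    (i : Fin 3) (x : Space) : ∑ l, op (P.leray q i l) (horizontalLaplacian (w l)) x =
      op (mulI 0 (mulI 0 (P.phiS q))) (w i) x + op (mulI 1 (mulI 1 (P.phiS q))) (w i) x := by
  simp only [horizontalLaplacian, op_add_right, op_lineDeriv, Finset.sum_add_distrib,
    P.sum_op_mulI_mulI_leray hw]

/-- The block of index `q` of the transport velocity, a real smooth vector field. -/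
def velocity (u : Fin 3 → 𝓢'(Space, ℂ)) (q : ℤ) (k : Fin 3) (x : Space) : ℝ :=
  (op (P.chiE (q.toNat + 2)) (u k) x).re

/-- The transport term of the equation of the block of index `q`. -/
def transport (u v : Fin 3 → 𝓢'(Space, ℂ)) (q : ℤ) (i : Fin 3) (x : Space) : ℂ :=
  ∑ k, op (P.chiE (q.toNat + 2)) (u k) x * op (mulI k (P.phiS q)) (v i) x

/-- The diffusion, commutator and source terms of the equation of the block of index `q`. -/
def forcing (u v N f : Fin 3 → 𝓢'(Space, ℂ)) (g : 𝓢'(Space, ℂ)) (q : ℤ) (i : Fin 3) (x : Space) :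
    ℂ :=
  ∑ l, op (P.leray q i l) (f l) x + op (P.leray q i 2) g x - P.remainder u v N q i x +
    (op (mulI 0 (mulI 0 (P.phiS q))) (v i) x + op (mulI 1 (mulI 1 (P.phiS q))) (v i) x)

theorem sum_op_leray_tendency {v f : ℝ → Fin 3 → 𝓢'(Space, ℂ)} {p g : ℝ → 𝓢'(Space, ℂ)}
    {N : ℝ → Fin 3 → 𝓢'(Space, ℂ)} {τ : ℝ} (hw : divergence (v τ) = 0) (u : Fin 3 → 𝓢'(Space, ℂ))
    (q : ℤ) (i : Fin 3) (x : Space) : ∑ l, op (P.leray q i l) (tendency v f p g N l τ) x =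
      P.forcing u (v τ) (N τ) (f τ) (g τ) q i x - P.transport u (v τ) q i x := by
  have h1 : ∑ l, op (P.leray q i l) (if l = 2 then g τ else 0) x = op (P.leray q i 2) (g τ) x := by
    rw [Finset.sum_eq_single 2]
    · simp
    · intro l _ hl; simp [hl, op_zero_right]
    · simp
  simp only [tendency, op_add_right, op_sub_right, Finset.sum_add_distrib, Finset.sum_sub_distrib,
    h1, P.sum_op_leray_gradient, P.sum_op_leray_horizontalLaplacian hw, forcing, remainder,
      transport]
  ring

end LittlewoodPaley

namespace IsTransport

variable {P : LittlewoodPaley} {u : Fin 3 → 𝓢'(Space, ℂ)} {h : ℝ}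

theorem velocity_eq (hu : IsTransport P u h) (q : ℤ) (k : Fin 3) (x : Space) :
    (P.velocity u q k x : ℂ) = op (P.chiE (q.toNat + 2)) (u k) x := by
  rw [LittlewoodPaley.velocity, P.op_chiE (hu.real k), Complex.ofReal_re]

/-- A bound of the block of index `q` of the transport velocity, relative to `1 + |x|`, and of its
gradient. -/
def growth (P : LittlewoodPaley) (u : Fin 3 → 𝓢'(Space, ℂ)) (h : ℝ) (q : ℤ) : ℝ :=
  ∑ k, ‖op (P.chiE (q.toNat + 2)) (u k) 0‖ + 3 * ((q.toNat + 5) * h)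

theorem norm_op_le (hu : IsTransport P u h) (q : ℤ) (k : Fin 3) (x : Space) :
    ‖op (P.chiE (q.toNat + 2)) (u k) x‖ ≤ growth P u h q * (1 + ‖x‖) := by
  have h1 := hu.lipschitz k q 0 x
  have h2 : ‖op (P.chiE (q.toNat + 2)) (u k) 0‖ ≤ ∑ k, ‖op (P.chiE (q.toNat + 2)) (u k) 0‖ :=
    Finset.single_le_sum (f := fun k => ‖op (P.chiE (q.toNat + 2)) (u k) 0‖)
      (fun _ _ => norm_nonneg _) (Finset.mem_univ k)
  have h3 := norm_sub_norm_le (op (P.chiE (q.toNat + 2)) (u k) x)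
    (op (P.chiE (q.toNat + 2)) (u k) 0)
  have h4 : 0 ≤ ∑ k, ‖op (P.chiE (q.toNat + 2)) (u k) 0‖ := Finset.sum_nonneg fun _ _ =>
    norm_nonneg _
  have h5 : 0 ≤ 3 * ((q.toNat + 5) * h) := by have := hu.nonneg; positivity
  rw [sub_zero] at h1
  have h6 := mul_nonneg h4 (norm_nonneg x)
  unfold growth
  nlinarith

theorem hasFDerivAt_velocity (u : Fin 3 → 𝓢'(Space, ℂ)) (q : ℤ) (k : Fin 3) (x : Space) :
    HasFDerivAt (P.velocity u q k)
      (Complex.reCLM.comp (fderiv ℝ (op (P.chiE (q.toNat + 2)) (u k)) x)) x :=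
  Complex.reCLM.hasFDerivAt.comp x (differentiable_op _ _ x).hasFDerivAt

theorem fderiv_velocity (u : Fin 3 → 𝓢'(Space, ℂ)) (q : ℤ) (k : Fin 3) (x : Space) :
    fderiv ℝ (P.velocity u q k) x (e k) = (op (mulI k (P.chiE (q.toNat + 2))) (u k) x).re := by
  rw [(hasFDerivAt_velocity u q k x).fderiv, ← fderiv_op]
  rfl

theorem norm_e (k : Fin 3) : ‖e k‖ = 1 := by simp [e]

theorem abs_fderiv_velocity_le (hu : IsTransport P u h) (q : ℤ) (k : Fin 3) (x : Space) :
    |fderiv ℝ (P.velocity u q k) x (e k)| ≤ growth P u h q := by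
  have h5 : 0 ≤ 3 * ((q.toNat + 5) * h) := by have := hu.nonneg; positivity
  have h1 : ‖fderiv ℝ (P.velocity u q k) x‖ ≤ 3 * ((q.toNat + 5) * h) := by
    refine norm_fderiv_le_of_lip' ℝ h5 (.of_forall fun y => ?_)
    rw [LittlewoodPaley.velocity, LittlewoodPaley.velocity, ← Complex.sub_re]
    exact (Complex.abs_re_le_norm _).trans (hu.lipschitz k q x y)
  have h2 := (fderiv ℝ (P.velocity u q k) x).le_opNorm (e k)
  rw [norm_e, mul_one] at h2
  have h4 : 0 ≤ ∑ k, ‖op (P.chiE (q.toNat + 2)) (u k) 0‖ := Finset.sum_nonneg fun _ _ =>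
    norm_nonneg _
  rw [← Real.norm_eq_abs]
  unfold growth
  linarith

theorem sum_fderiv_velocity (hu : IsTransport P u h) (q : ℤ) (x : Space) :
    ∑ k, fderiv ℝ (P.velocity u q k) x (e k) = 0 := by
  simp only [fderiv_velocity, ← Complex.re_sum, sum_op_mulI_eq_zero hu.div, Complex.zero_re]

theorem abs_integral_cut_le (hu : IsTransport P u h) {v : Fin 3 → 𝓢'(Space, ℂ)} {a : Space → ℂ}
    {i : Fin 3} (ha : HasDensity (v i) a) (q : ℤ) (n : ℕ) :
    |∫ x, cut n x * inner ℝ (op (P.phiS q) (v i) x) (P.transport u v q i x)| ≤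
      growth P u h q * ∫ x, cutError n x * ‖op (P.phiS q) (v i) x‖ ^ 2 := by
  have h1 := abs_integral_transport_le (y := op (P.phiS q) (v i)) (U := P.velocity u q)
    (α := growth P u h q) (differentiable_op _ _) (ha.memLp_op (P.hasCompactSupport_phiS q))
    (fun k => by
      simp only [fderiv_op]
      exact ha.memLp_op (HasDensity.hasCompactSupport_mulI (P.hasCompactSupport_phiS q) k))
    (fun k x => (hasFDerivAt_velocity u q k x).differentiableAt)
    (fun k x => (Complex.abs_re_le_norm _).trans (hu.norm_op_le q k x))
    (fun k x => hu.abs_fderiv_velocity_le q k x) (fun x => hu.sum_fderiv_velocity q x) n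
  simpa only [fderiv_op, hu.velocity_eq, LittlewoodPaley.transport] using h1

theorem eLpNorm_transport_le (hu : IsTransport P u h) (v : Fin 3 → 𝓢'(Space, ℂ)) (q : ℤ)
    (i : Fin 3) : eLpNorm (fun x => (((1 + ‖x‖)⁻¹ : ℝ) : ℂ) * P.transport u v q i x) 2 volume ≤
      ENNReal.ofReal (growth P u h q) * ∑ k, eLpNorm (op (mulI k (P.phiS q)) (v i)) 2 volume := by
  have h1 : ∀ x, (((1 + ‖x‖)⁻¹ : ℝ) : ℂ) * P.transport u v q i x = ∑ k,
      (((1 + ‖x‖)⁻¹ : ℝ) : ℂ) * op (P.chiE (q.toNat + 2)) (u k) x *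
        op (mulI k (P.phiS q)) (v i) x := by
    intro x
    rw [LittlewoodPaley.transport, Finset.mul_sum]
    exact Finset.sum_congr rfl fun k _ => by ring
  simp only [h1]
  have hc : Continuous fun x : Space => (((1 + ‖x‖)⁻¹ : ℝ) : ℂ) := by
    refine Complex.continuous_ofReal.comp (Continuous.inv₀ (by fun_prop) fun x => ?_)
    positivity
  have h2 : (fun x => ∑ k, (((1 + ‖x‖)⁻¹ : ℝ) : ℂ) * op (P.chiE (q.toNat + 2)) (u k) x *
        op (mulI k (P.phiS q)) (v i) x) = ∑ k, fun x =>
        (((1 + ‖x‖)⁻¹ : ℝ) : ℂ) * op (P.chiE (q.toNat + 2)) (u k) x *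
        op (mulI k (P.phiS q)) (v i) x := by
    ext x; rw [Finset.sum_apply]
  rw [h2, Finset.mul_sum]
  refine (eLpNorm_sum_le (fun k _ => ((hc.mul (continuous_op _ _)).mul
    (continuous_op _ _)).aestronglyMeasurable) (by norm_num)).trans
      (Finset.sum_le_sum fun k _ => ?_)
  refine eLpNorm_le_mul_eLpNorm_of_ae_le_mul (.of_forall fun x => ?_) 2
  change ‖(((1 + ‖x‖)⁻¹ : ℝ) : ℂ) * op (P.chiE (q.toNat + 2)) (u k) x *
    op (mulI k (P.phiS q)) (v i) x‖ ≤ _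
  rw [norm_mul, norm_mul, Complex.norm_real, Real.norm_of_nonneg (by positivity)]
  gcongr
  rw [inv_mul_le_iff₀ (by positivity), mul_comm]
  exact hu.norm_op_le q k x

end IsTransport

/-! ### The energy of a dyadic block -/

theorem ofReal_integral_inner_le {y F : Space → ℂ} (hy : AEStronglyMeasurable y volume)
    (hF : AEStronglyMeasurable F volume) :
    ENNReal.ofReal (∫ x, inner ℝ (y x) (F x)) ≤ eLpNorm y 2 volume * eLpNorm F 2 volume :=
  calc ENNReal.ofReal (∫ x, inner ℝ (y x) (F x)) ≤ ‖∫ x, inner ℝ (y x) (F x)‖ₑ := by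
        rw [← ofReal_norm]
        exact ENNReal.ofReal_le_ofReal (le_abs_self _)
    _ ≤ ∫⁻ x, ‖inner ℝ (y x) (F x)‖ₑ := enorm_integral_le_lintegral_enorm _
    _ ≤ ∫⁻ x, ‖y x‖ₑ * ‖F x‖ₑ := lintegral_mono fun x => enorm_inner_le _ _
    _ ≤ _ := lintegral_enorm_mul_le hy hF

theorem ofReal_integral_normSq {y : Space → ℂ} (hy : MemLp y 2 volume) :
    ENNReal.ofReal (∫ x, ‖y x‖ ^ 2) = eLpNorm y 2 volume ^ 2 := by
  rw [eLpNorm_two_sq, ofReal_integral_eq_lintegral_ofReal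
    (hy.integrable_norm_pow (by norm_num)) (.of_forall fun x => by positivity)]
  refine lintegral_congr fun x => ?_
  rw [ENNReal.ofReal_pow (norm_nonneg _), ofReal_norm]

theorem ennreal_mul_le_half (a b : ℝ≥0∞) : a * b ≤ a ^ 2 / 2 + b ^ 2 / 2 := by
  have h := ENNReal.young_inequality a b Real.HolderConjugate.two_two
  simpa using h

theorem inner_eq_re (z w : ℂ) : inner ℝ z w = (starRingEnd ℂ z * w).re := by
  rw [Complex.inner, mul_comm]

theorem aemeasurable_eLpNorm_op {μ : Measure ℝ} [SFinite μ] {w : ℝ → 𝓢'(Space, ℂ)}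
    (hw : ∀ ψ, AEMeasurable (fun τ => w τ ψ) μ) (m : 𝓢(Space, ℂ)) :
    AEMeasurable (fun τ => eLpNorm (op m (w τ)) 2 volume) μ := by
  have h1 := aestronglyMeasurable_op hw m
  have h2 : AEMeasurable (fun τ => ∫⁻ x, ‖op m (w τ) x‖ₑ ^ (2 : ℝ)) μ :=
    (h1.enorm.pow_const (2 : ℝ)).lintegral_prod_right'
  refine (h2.pow_const (1 / 2 : ℝ)).congr (.of_forall fun τ => ?_)
  simp only
  rw [eLpNorm_eq_lintegral_rpow_enorm_toReal (by norm_num) (by norm_num)]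
  simp

namespace LittlewoodPaley

variable (P : LittlewoodPaley)

/-- The energy of the block of index `q` of a vector field. -/
def energy (w : Fin 3 → 𝓢'(Space, ℂ)) (q : ℤ) : ℝ := ∑ i, ∫ x, ‖op (P.phiS q) (w i) x‖ ^ 2

/-- The square of the `L²` norm of the horizontal gradient of the block of index `q`. -/
def dissipation (w : Fin 3 → 𝓢'(Space, ℂ)) (q : ℤ) : ℝ :=
  ∑ i, ((∫ x, ‖op (mulI 0 (P.phiS q)) (w i) x‖ ^ 2) + ∫ x, ‖op (mulI 1 (P.phiS q)) (w i) x‖ ^ 2)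

theorem energy_nonneg (w : Fin 3 → 𝓢'(Space, ℂ)) (q : ℤ) : 0 ≤ P.energy w q :=
  Finset.sum_nonneg fun _ _ => integral_nonneg fun _ => by positivity

theorem dissipation_nonneg (w : Fin 3 → 𝓢'(Space, ℂ)) (q : ℤ) : 0 ≤ P.dissipation w q :=
  Finset.sum_nonneg fun _ _ => add_nonneg (integral_nonneg fun _ => sq_nonneg _)
    (integral_nonneg fun _ => sq_nonneg _)

theorem ofReal_energy {w : Fin 3 → 𝓢'(Space, ℂ)} (hw : ∀ l, ∃ a, HasDensity (w l) a) (q : ℤ) :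
    ENNReal.ofReal (P.energy w q) = ∑ i, eLpNorm (op (P.phiS q) (w i)) 2 volume ^ 2 := by
  rw [energy, ENNReal.ofReal_sum_of_nonneg fun _ _ => integral_nonneg fun _ => by positivity]
  refine Finset.sum_congr rfl fun i _ => ?_
  obtain ⟨a, ha⟩ := hw i
  exact ofReal_integral_normSq (ha.memLp_op (P.hasCompactSupport_phiS q))

theorem eLpNorm_le_energy {w : Fin 3 → 𝓢'(Space, ℂ)} (hw : ∀ l, ∃ a, HasDensity (w l) a) (q : ℤ)
    (i : Fin 3) :
    eLpNorm (op (P.phiS q) (w i)) 2 volume ≤ ENNReal.ofReal (√(P.energy w q)) := by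
  rw [← ENNReal.pow_le_pow_left_iff two_ne_zero, ← ENNReal.ofReal_pow (Real.sqrt_nonneg _),
    Real.sq_sqrt (P.energy_nonneg w q), P.ofReal_energy hw]
  exact Finset.single_le_sum (f := fun i => eLpNorm (op (P.phiS q) (w i)) 2 volume ^ 2)
    (fun _ _ => zero_le) (Finset.mem_univ i)

/-- The symbol of the Leray projection of a vertical field is bounded by `|ξ_h| / |ξ|`. -/
theorem norm_leray_vertical_le (q : ℤ) (i : Fin 3) (ξ : Space) :
    ‖P.phiS q ξ‖ * ‖P.leray q i 2 ξ‖ ≤ 4 / 3 * (2 : ℝ) ^ (-q) *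
      ((‖mulI 0 (P.phiS q) ξ‖ + ‖mulI 1 (P.phiS q) ξ‖) * ‖P.phiS q ξ‖) := by
  by_cases h0 : P.phiS q ξ = 0
  · simp [h0]
  have hs := (P.phiS_supp h0).1
  have h2q : (0 : ℝ) < 2 ^ q := by positivity
  have hpi := Real.pi_pos
  have hr : 0 < ‖ξ‖ := by
    by_contra hr
    have : ‖ξ‖ = 0 := le_antisymm (not_lt.1 hr) (norm_nonneg _)
    rw [this] at hs
    linarith
  have hc : ∀ k, |ξ k| ≤ ‖ξ‖ := fun k => PiLp.norm_apply_le ξ k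
  have h1 : ‖ξ‖ ^ 2 = ξ 0 ^ 2 + ξ 1 ^ 2 + ξ 2 ^ 2 := by
    rw [EuclideanSpace.real_norm_sq_eq, Fin.sum_univ_three]
  -- For `i = 2` the left-hand side is `ξ₀² + ξ₁²`.
  have h3 : |(if i = 2 then 1 else 0) * ‖ξ‖ ^ 2 - ξ i * ξ 2| ≤ (|ξ 0| + |ξ 1|) * ‖ξ‖ := by
    have a0 := mul_le_mul_of_nonneg_left (hc 0) (abs_nonneg (ξ 0))
    have a1 := mul_le_mul_of_nonneg_left (hc 1) (abs_nonneg (ξ 1))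
    have b0 := mul_le_mul_of_nonneg_left (hc 2) (abs_nonneg (ξ 0))
    have b1 := mul_le_mul_of_nonneg_left (hc 2) (abs_nonneg (ξ 1))
    have c0 := mul_nonneg (abs_nonneg (ξ 0)) hr.le
    have c1 := mul_nonneg (abs_nonneg (ξ 1)) hr.le
    rw [add_mul]
    fin_cases i
    · simp only [Fin.zero_eta, Fin.reduceEq, if_false, zero_mul, zero_sub, abs_neg, abs_mul]
      linarith
    · simp only [Fin.mk_one, Fin.reduceEq, if_false, zero_mul, zero_sub, abs_neg, abs_mul]
      linarith
    · simp only [Fin.reduceFinMk, if_true, one_mul]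
      rw [h1, abs_le]
      rw [abs_mul_abs_self] at a0 a1
      constructor <;> nlinarith [sq_nonneg (ξ 0), sq_nonneg (ξ 1)]
  have h4 : |(if i = 2 then 1 else 0) - ξ i * ξ 2 / ‖ξ‖ ^ 2| * ‖ξ‖ ≤ |ξ 0| + |ξ 1| := by
    have h5 : (if i = 2 then 1 else 0) - ξ i * ξ 2 / ‖ξ‖ ^ 2 =
        ((if i = 2 then 1 else 0) * ‖ξ‖ ^ 2 - ξ i * ξ 2) / ‖ξ‖ ^ 2 := by
      field_simp
    rw [h5, abs_div, abs_of_pos (by positivity : 0 < ‖ξ‖ ^ 2), div_mul_eq_mul_div,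
      div_le_iff₀ (by positivity)]
    nlinarith [mul_le_mul_of_nonneg_right h3 hr.le]
  have h6 : ‖P.leray q i 2 ξ‖ ≤ 4 / 3 * (2 : ℝ) ^ (-q) * (2 * Real.pi * (|ξ 0| + |ξ 1|)) *
      ‖P.phiS q ξ‖ := by
    rw [leray_apply, norm_mul, Complex.norm_real, mul_comm]
    gcongr
    rw [zpow_neg, Real.norm_eq_abs]
    have h7 : 1 ≤ 4 / 3 * ((2 : ℝ) ^ q)⁻¹ * (2 * Real.pi * ‖ξ‖) := by
      rw [← div_eq_mul_inv, div_mul_eq_mul_div, le_div_iff₀ h2q]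
      linarith
    refine le_trans (le_mul_of_one_le_right (abs_nonneg _) h7) ?_
    have h8 : 0 ≤ 4 / 3 * ((2 : ℝ) ^ q)⁻¹ * (2 * Real.pi) := by positivity
    nlinarith [mul_le_mul_of_nonneg_left h4 h8]
  have h9 : ∀ k, ‖mulI k (P.phiS q) ξ‖ = 2 * Real.pi * |ξ k| * ‖P.phiS q ξ‖ := by
    intro k
    simp [mulI_apply, abs_of_pos hpi]
  rw [h9, h9]
  calc _ ≤ ‖P.phiS q ξ‖ * _ := mul_le_mul_of_nonneg_left h6 (norm_nonneg _)
    _ = _ := by ring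

theorem integral_inner_laplacian {w : 𝓢'(Space, ℂ)} {a : Space → ℂ} (ha : HasDensity w a) (q : ℤ)
    (k : Fin 3) : ∫ x, inner ℝ (op (P.phiS q) w x) (op (mulI k (mulI k (P.phiS q))) w x) =
      -∫ x, ‖op (mulI k (P.phiS q)) w x‖ ^ 2 := by
  have c0 := P.hasCompactSupport_phiS q
  have c1 := HasDensity.hasCompactSupport_mulI c0 k
  have c2 := HasDensity.hasCompactSupport_mulI c1 k
  have m0 := ha.memLp_op c0
  have m2 := ha.memLp_op c2
  have h1 := ha.integral_conj_op ha c0 c2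
  have h2 := ha.integral_conj_op ha c1 c1
  have h3 : ∫ x, starRingEnd ℂ (op (P.phiS q) w x) * op (mulI k (mulI k (P.phiS q))) w x =
      -∫ x, starRingEnd ℂ (op (mulI k (P.phiS q)) w x) * op (mulI k (P.phiS q)) w x := by
    rw [h1, h2, ← integral_neg]
    congr 1
    ext ξ
    simp only [mulI_apply, map_mul, Complex.conj_I, Complex.conj_ofReal, map_ofNat]
    ring
  have h4 : ∫ x, starRingEnd ℂ (op (mulI k (P.phiS q)) w x) * op (mulI k (P.phiS q)) w x =
      ((∫ x, ‖op (mulI k (P.phiS q)) w x‖ ^ 2 : ℝ) : ℂ) := by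
    rw [← integral_complex_ofReal]
    congr 1
    ext x
    rw [mul_comm, Complex.mul_conj, Complex.normSq_eq_norm_sq]
  rw [h4] at h3
  have h5 : Integrable fun x => starRingEnd ℂ (op (P.phiS q) w x) *
      op (mulI k (mulI k (P.phiS q))) w x := m0.star.integrable_mul m2
  simp only [inner_eq_re]
  have h6 := integral_re h5
  simp only [RCLike.re_to_complex] at h6
  rw [h6, h3]
  simp

/-- The vertical force is controlled by the horizontal dissipation. -/
theorem ofReal_integral_inner_leray_le {w g : 𝓢'(Space, ℂ)} {a b : Space → ℂ} (ha : HasDensity w a)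
    (hb : HasDensity g b) (q : ℤ) (i : Fin 3) :
    ENNReal.ofReal ((∫ x, inner ℝ (op (P.phiS q) w x) (op (P.leray q i 2) g x)) -
      ((∫ x, ‖op (mulI 0 (P.phiS q)) w x‖ ^ 2) + ∫ x, ‖op (mulI 1 (P.phiS q)) w x‖ ^ 2) / 2) ≤
      ENNReal.ofReal ((4 / 3 * (2 : ℝ) ^ (-q)) ^ 2) * eLpNorm (op (P.phiS q) g) 2 volume ^ 2 := by
  have c0 := P.hasCompactSupport_phiS q
  have c1 := fun k => HasDensity.hasCompactSupport_mulI c0 k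
  have cl := P.hasCompactSupport_leray q i 2
  have m0 := ha.memLp_op c0
  have ml := hb.memLp_op cl
  have hd := fun k => ofReal_integral_normSq (ha.memLp_op (c1 k))
  have hK : 0 ≤ 4 / 3 * (2 : ℝ) ^ (-q) := by positivity
  set γ := eLpNorm (op (P.phiS q) g) 2 volume with hγ
  have mb : AEStronglyMeasurable (fun ξ => b ξ * P.phiS q ξ) volume :=
    (hb.memLp_mul (P.phiS q).continuous c0).1
  -- Plancherel and the bound of the symbol give a horizontal derivative on `w`.
  have h1 : ENNReal.ofReal (∫ x, inner ℝ (op (P.phiS q) w x) (op (P.leray q i 2) g x)) ≤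
      ENNReal.ofReal (4 / 3 * (2 : ℝ) ^ (-q)) *
        (eLpNorm (op (mulI 0 (P.phiS q)) w) 2 volume * γ +
          eLpNorm (op (mulI 1 (P.phiS q)) w) 2 volume * γ) := by
    have h5 : Integrable fun x => starRingEnd ℂ (op (P.phiS q) w x) * op (P.leray q i 2) g x :=
      m0.star.integrable_mul ml
    have h6 := integral_re h5
    simp only [RCLike.re_to_complex] at h6
    simp only [inner_eq_re]
    rw [h6, ha.integral_conj_op hb c0 cl]
    have mA : ∀ k, AEStronglyMeasurable (fun ξ => a ξ * mulI k (P.phiS q) ξ) volume := fun k =>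
      (ha.memLp_mul (mulI k (P.phiS q)).continuous (c1 k)).1
    calc _ ≤ ‖∫ ξ, starRingEnd ℂ (a ξ * P.phiS q ξ) * (b ξ * P.leray q i 2 ξ)‖ₑ := by
          rw [← ofReal_norm]
          exact ENNReal.ofReal_le_ofReal ((le_abs_self _).trans (Complex.abs_re_le_norm _))
      _ ≤ ∫⁻ ξ, ‖starRingEnd ℂ (a ξ * P.phiS q ξ) * (b ξ * P.leray q i 2 ξ)‖ₑ :=
          enorm_integral_le_lintegral_enorm _
      _ ≤ ∫⁻ ξ, ENNReal.ofReal (4 / 3 * (2 : ℝ) ^ (-q)) *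
          (‖a ξ * mulI 0 (P.phiS q) ξ‖ₑ * ‖b ξ * P.phiS q ξ‖ₑ +
            ‖a ξ * mulI 1 (P.phiS q) ξ‖ₑ * ‖b ξ * P.phiS q ξ‖ₑ) := by
          refine lintegral_mono fun ξ => ?_
          simp only [← ofReal_norm]
          rw [← ENNReal.ofReal_mul (norm_nonneg _), ← ENNReal.ofReal_mul (norm_nonneg _),
            ← ENNReal.ofReal_add (by positivity) (by positivity), ← ENNReal.ofReal_mul hK]
          refine ENNReal.ofReal_le_ofReal ?_
          simp only [norm_mul, RCLike.norm_conj]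
          have h7 := mul_le_mul_of_nonneg_left (P.norm_leray_vertical_le q i ξ)
            (mul_nonneg (norm_nonneg (a ξ)) (norm_nonneg (b ξ)))
          calc _ = ‖a ξ‖ * ‖b ξ‖ * (‖P.phiS q ξ‖ * ‖P.leray q i 2 ξ‖) := by ring
            _ ≤ _ := h7
            _ = _ := by ring
      _ = ENNReal.ofReal (4 / 3 * (2 : ℝ) ^ (-q)) *
          ((∫⁻ ξ, ‖a ξ * mulI 0 (P.phiS q) ξ‖ₑ * ‖b ξ * P.phiS q ξ‖ₑ) +
            ∫⁻ ξ, ‖a ξ * mulI 1 (P.phiS q) ξ‖ₑ * ‖b ξ * P.phiS q ξ‖ₑ) := by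
          rw [lintegral_const_mul' _ _ ENNReal.ofReal_ne_top,
            lintegral_add_left' ((mA 0).enorm.fun_mul mb.enorm)]
      _ ≤ _ := by
          rw [ha.eLpNorm_op (c1 0), ha.eLpNorm_op (c1 1), hγ, hb.eLpNorm_op c0]
          gcongr
          · exact lintegral_enorm_mul_le (mA 0) mb
          · exact lintegral_enorm_mul_le (mA 1) mb
  -- Young's inequality leaves half of the dissipation.
  rw [ENNReal.ofReal_sub _ (by positivity), tsub_le_iff_left]
  refine h1.trans ?_
  rw [add_div, ENNReal.ofReal_add (by positivity) (by positivity),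
    ENNReal.ofReal_div_of_pos two_pos,
    ENNReal.ofReal_div_of_pos two_pos, hd, hd, ENNReal.ofReal_ofNat, ENNReal.ofReal_pow hK,
      ← mul_pow]
  set κ := ENNReal.ofReal (4 / 3 * (2 : ℝ) ^ (-q))
  have h2 := ennreal_mul_le_half (eLpNorm (op (mulI 0 (P.phiS q)) w) 2 volume) (κ * γ)
  have h3 := ennreal_mul_le_half (eLpNorm (op (mulI 1 (P.phiS q)) w) 2 volume) (κ * γ)
  calc _ = eLpNorm (op (mulI 0 (P.phiS q)) w) 2 volume * (κ * γ) +
        eLpNorm (op (mulI 1 (P.phiS q)) w) 2 volume * (κ * γ) := by ring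
    _ ≤ _ := add_le_add h2 h3
    _ = eLpNorm (op (mulI 0 (P.phiS q)) w) 2 volume ^ 2 / 2 +
        eLpNorm (op (mulI 1 (P.phiS q)) w) 2 volume ^ 2 / 2 +
          ((κ * γ) ^ 2 / 2 + (κ * γ) ^ 2 / 2) := by ring
    _ = _ := by rw [ENNReal.add_halves]

end LittlewoodPaley

theorem integrable_inner {y F : Space → ℂ} (hy : MemLp y 2 volume) (hF : MemLp F 2 volume) :
    Integrable fun x => inner ℝ (y x) (F x) := by
  refine ⟨hy.1.inner hF.1, ?_⟩
  calc ∫⁻ x, ‖inner ℝ (y x) (F x)‖ₑ ≤ ∫⁻ x, ‖y x‖ₑ * ‖F x‖ₑ := lintegral_mono fun x =>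
    enorm_inner_le _ _
    _ ≤ eLpNorm y 2 volume * eLpNorm F 2 volume := lintegral_enorm_mul_le hy.1 hF.1
    _ < ⊤ := ENNReal.mul_lt_top hy.2 hF.2

theorem ofReal_sum_le {ι : Type*} (s : Finset ι) (f : ι → ℝ) :
    ENNReal.ofReal (∑ i ∈ s, f i) ≤ ∑ i ∈ s, ENNReal.ofReal (f i) := by
  classical
  induction s using Finset.induction_on with
  | empty => simp
  | insert a s ha ih =>
    rw [Finset.sum_insert ha, Finset.sum_insert ha]
    exact ENNReal.ofReal_add_le.trans (by gcongr)

theorem eLpNorm_finsetSum_le {ι : Type*} (s : Finset ι) {F : ι → Space → ℂ}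
    (hF : ∀ i ∈ s, AEStronglyMeasurable (F i) volume) :
    eLpNorm (fun x => ∑ i ∈ s, F i x) 2 volume ≤ ∑ i ∈ s, eLpNorm (F i) 2 volume := by
  have h : (fun x => ∑ i ∈ s, F i x) = ∑ i ∈ s, F i := by
    ext x; rw [Finset.sum_apply]
  rw [h]
  exact eLpNorm_sum_le hF (by norm_num)

namespace LittlewoodPaley

variable (P : LittlewoodPaley)

theorem continuous_remainder (u v N : Fin 3 → 𝓢'(Space, ℂ)) (q : ℤ) (i : Fin 3) :
    Continuous (P.remainder u v N q i) :=
  (continuous_finsetSum _ fun _ _ => continuous_op _ _).sub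
    (continuous_finsetSum _ fun _ _ => (continuous_op _ _).mul (continuous_op _ _))

theorem decaySum_mono {F F' : ℤ → ℝ≥0∞} (h : ∀ j, F j ≤ F' j) (q : ℤ) :
    decaySum F q ≤ decaySum F' q :=
  ENNReal.tsum_le_tsum fun j => mul_le_mul' le_rfl (h j)

theorem decaySum_const_mul (c : ℝ≥0∞) (F : ℤ → ℝ≥0∞) (q : ℤ) :
    decaySum (fun j => c * F j) q = c * decaySum F q := by
  rw [decaySum, decaySum, ← ENNReal.tsum_mul_left]
  exact tsum_congr fun j => by ring

theorem eLpNorm_leray_le {w : 𝓢'(Space, ℂ)} {a : Space → ℂ} (ha : HasDensity w a) (q : ℤ)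
    (i l : Fin 3) :
    eLpNorm (op (P.leray q i l) w) 2 volume ≤ eLpNorm (op (P.phiS q) w) 2 volume := by
  have h := eLpNorm_op_le_of_norm_le ha (P.hasCompactSupport_leray q i l)
    (P.hasCompactSupport_phiS q) (P.norm_leray_le q i l)
  simpa using h

section FixedTime

variable {u v N f : Fin 3 → 𝓢'(Space, ℂ)} {g : 𝓢'(Space, ℂ)} {c : ℝ}

/-- The sources of the block of index `q`, with the commutator. -/
theorem memLp_source (hf : ∀ l, ∃ a, HasDensity (f l) a) {q : ℤ} {i : Fin 3}
    (hR : eLpNorm (P.remainder u v N q i) 2 volume < ⊤) :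
    MemLp (fun x => ∑ l, op (P.leray q i l) (f l) x - P.remainder u v N q i x) 2 volume ∧
    eLpNorm (fun x => ∑ l, op (P.leray q i l) (f l) x - P.remainder u v N q i x) 2 volume ≤
      ∑ l, eLpNorm (op (P.phiS q) (f l)) 2 volume + eLpNorm (P.remainder u v N q i) 2 volume := by
  choose a ha using hf
  have hm : ∀ l, MemLp (op (P.leray q i l) (f l)) 2 volume := fun l =>
    (ha l).memLp_op (P.hasCompactSupport_leray q i l)
  have hr : MemLp (P.remainder u v N q i) 2 volume :=
    ⟨(P.continuous_remainder u v N q i).aestronglyMeasurable, hR⟩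
  have hs : MemLp (fun x => ∑ l, op (P.leray q i l) (f l) x) 2 volume :=
    memLp_finsetSum _ fun l _ => hm l
  refine ⟨hs.sub hr, (eLpNorm_sub_le hs.1 hr.1 (by norm_num)).trans ?_⟩
  gcongr
  refine (eLpNorm_finsetSum_le _ fun l _ => (hm l).1).trans (Finset.sum_le_sum fun l _ => ?_)
  exact P.eLpNorm_leray_le (ha l) q i l

theorem integral_inner_forcing (hv : ∀ l, ∃ a, HasDensity (v l) a)
    (hf : ∀ l, ∃ a, HasDensity (f l) a) (hg : ∃ b, HasDensity g b) {q : ℤ} {i : Fin 3}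
    (hR : eLpNorm (P.remainder u v N q i) 2 volume < ⊤) :
    ∫ x, inner ℝ (op (P.phiS q) (v i) x) (P.forcing u v N f g q i x) =
      (∫ x, inner ℝ (op (P.phiS q) (v i) x)
        (∑ l, op (P.leray q i l) (f l) x - P.remainder u v N q i x)) +
      (∫ x, inner ℝ (op (P.phiS q) (v i) x) (op (P.leray q i 2) g x)) -
      ((∫ x, ‖op (mulI 0 (P.phiS q)) (v i) x‖ ^ 2) +
        ∫ x, ‖op (mulI 1 (P.phiS q)) (v i) x‖ ^ 2) := by
  obtain ⟨a, ha⟩ := hv i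
  obtain ⟨b, hb⟩ := hg
  have c0 := P.hasCompactSupport_phiS q
  have c2 := fun k => HasDensity.hasCompactSupport_mulI (HasDensity.hasCompactSupport_mulI c0 k) k
  have m0 := ha.memLp_op c0
  have i1 := integrable_inner m0 (P.memLp_source hf hR).1
  have i2 := integrable_inner m0 (hb.memLp_op (P.hasCompactSupport_leray q i 2))
  have i3 := fun k => integrable_inner m0 (ha.memLp_op (c2 k))
  have h0 := P.integral_inner_laplacian ha q 0
  have h1 := P.integral_inner_laplacian ha q 1
  have h2 : ∀ x, inner ℝ (op (P.phiS q) (v i) x) (P.forcing u v N f g q i x) =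
      inner ℝ (op (P.phiS q) (v i) x)
        (∑ l, op (P.leray q i l) (f l) x - P.remainder u v N q i x) +
      inner ℝ (op (P.phiS q) (v i) x) (op (P.leray q i 2) g x) +
      (inner ℝ (op (P.phiS q) (v i) x) (op (mulI 0 (mulI 0 (P.phiS q))) (v i) x) +
      inner ℝ (op (P.phiS q) (v i) x) (op (mulI 1 (mulI 1 (P.phiS q))) (v i) x)) := by
    intro x
    rw [← inner_add_right, ← inner_add_right, ← inner_add_right, forcing]
    congr 1
    ring
  simp only [h2]
  rw [integral_add (i1.fun_add i2) ((i3 0).fun_add (i3 1)), integral_add i1 i2,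
    integral_add (i3 0) (i3 1),
    h0, h1]
  ring

/-- The work of the forcing on the block of index `q`. Half of the dissipation absorbs the vertical
force at high frequencies. -/
theorem ofReal_work_le (hv : ∀ l, ∃ a, HasDensity (v l) a)
    (hf : ∀ l, ∃ a, HasDensity (f l) a) (hg : ∃ b, HasDensity g b) {q : ℤ}
    (hR : ∀ i, eLpNorm (P.remainder u v N q i) 2 volume < ⊤)
    (hR' : ∀ i, eLpNorm (P.remainder u v N q i) 2 volume ≤ ENNReal.ofReal c *
      decaySum (fun j => ∑ l, eLpNorm (op (P.phiS j) (v l)) 2 volume) q) :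
    ENNReal.ofReal ((∑ i, ∫ x, inner ℝ (op (P.phiS q) (v i) x) (P.forcing u v N f g q i x)) +
      P.dissipation v q / 2) ≤
      ENNReal.ofReal (√(P.energy v q)) * (ENNReal.ofReal (9 * c) *
        decaySum (fun j => ENNReal.ofReal (√(P.energy v j))) q +
          3 * ∑ l, eLpNorm (op (P.phiS q) (f l)) 2 volume) +
      if 0 ≤ q then
        ENNReal.ofReal ((2 : ℝ) ^ (-2 * q)) * (3 * eLpNorm (op (P.phiS q) g) 2 volume) ^ 2
      else ENNReal.ofReal (√(P.energy v q)) * (3 * eLpNorm (op (P.phiS q) g) 2 volume) := by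
  set A := ENNReal.ofReal (√(P.energy v q))
  set Fq := ∑ l, eLpNorm (op (P.phiS q) (f l)) 2 volume
  set γ := eLpNorm (op (P.phiS q) g) 2 volume
  set S := decaySum (fun j => ENNReal.ofReal (√(P.energy v j))) q
  have hS : decaySum (fun j => ∑ l, eLpNorm (op (P.phiS j) (v l)) 2 volume) q ≤ 3 * S := by
    rw [← decaySum_const_mul]
    refine decaySum_mono (fun j => ?_) q
    calc _ ≤ ∑ l : Fin 3, ENNReal.ofReal (√(P.energy v j)) :=
          Finset.sum_le_sum fun l _ => P.eLpNorm_le_energy hv j l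
      _ = _ := by simp
  -- In each component one half of the dissipation is kept, and the other half is used against the
  -- vertical force, for `q ≥ 0` only.
  have key : ∀ i, ENNReal.ofReal ((∫ x, inner ℝ (op (P.phiS q) (v i) x)
      (P.forcing u v N f g q i x)) + ((∫ x, ‖op (mulI 0 (P.phiS q)) (v i) x‖ ^ 2) +
        ∫ x, ‖op (mulI 1 (P.phiS q)) (v i) x‖ ^ 2) / 2) ≤
      A * (ENNReal.ofReal c * (3 * S) + Fq) +
        if 0 ≤ q then ENNReal.ofReal ((4 / 3 * (2 : ℝ) ^ (-q)) ^ 2) * γ ^ 2 else A * γ := by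
    intro i
    obtain ⟨a, ha⟩ := hv i
    obtain ⟨b, hb⟩ := hg
    have hy := P.eLpNorm_le_energy hv q i
    have hsrc := P.memLp_source (u := u) (v := v) (N := N) hf (hR i)
    have hm := ha.memLp_op (P.hasCompactSupport_phiS q)
    have hd : 0 ≤ (∫ x, ‖op (mulI 0 (P.phiS q)) (v i) x‖ ^ 2) +
        ∫ x, ‖op (mulI 1 (P.phiS q)) (v i) x‖ ^ 2 :=
      add_nonneg (integral_nonneg fun _ => sq_nonneg _) (integral_nonneg fun _ => sq_nonneg _)
    rw [P.integral_inner_forcing hv hf ⟨b, hb⟩ (hR i)]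
    set d := (∫ x, ‖op (mulI 0 (P.phiS q)) (v i) x‖ ^ 2) +
        ∫ x, ‖op (mulI 1 (P.phiS q)) (v i) x‖ ^ 2 with hdd
    rw [show ∀ a b d : ℝ, a + b - d + d / 2 = a + (b - d / 2) by intros; ring]
    refine ENNReal.ofReal_add_le.trans (add_le_add ?_ ?_)
    · refine (ofReal_integral_inner_le hm.1 hsrc.1.1).trans (mul_le_mul' hy (hsrc.2.trans ?_))
      rw [add_comm]
      gcongr
      exact (hR' i).trans (mul_le_mul' le_rfl hS)
    · split_ifs with hq
      · exact P.ofReal_integral_inner_leray_le ha hb q i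
      · have ml := hb.memLp_op (P.hasCompactSupport_leray q i 2)
        refine (ENNReal.ofReal_le_ofReal (sub_le_self _ (by positivity))).trans ?_
        exact (ofReal_integral_inner_le hm.1 ml.1).trans
          (mul_le_mul' hy (P.eLpNorm_leray_le hb q i 2))
  have h1 : (∑ i, ∫ x, inner ℝ (op (P.phiS q) (v i) x) (P.forcing u v N f g q i x)) +
      P.dissipation v q / 2 = ∑ i, ((∫ x, inner ℝ (op (P.phiS q) (v i) x)
      (P.forcing u v N f g q i x)) + ((∫ x, ‖op (mulI 0 (P.phiS q)) (v i) x‖ ^ 2) +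
        ∫ x, ‖op (mulI 1 (P.phiS q)) (v i) x‖ ^ 2) / 2) := by
    rw [dissipation, Finset.sum_div, Finset.sum_add_distrib]
  rw [h1]
  refine (ofReal_sum_le _ _).trans ((Finset.sum_le_sum fun i _ => key i).trans ?_)
  rw [Finset.sum_const, Finset.card_univ, Fintype.card_fin, nsmul_eq_mul, mul_add]
  refine add_le_add (le_of_eq ?_) ?_
  · rw [ENNReal.ofReal_mul (by norm_num), ENNReal.ofReal_ofNat]
    push_cast
    ring
  · split_ifs with hq
    · rw [mul_pow 3, ← mul_assoc, ← mul_assoc]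
      refine mul_le_mul' ?_ le_rfl
      have h9 : (3 : ℝ≥0∞) ^ 2 = ENNReal.ofReal 9 := by
        rw [ENNReal.ofReal_ofNat]; norm_num
      have h3 : ((3 : ℕ) : ℝ≥0∞) = ENNReal.ofReal 3 := by
        rw [ENNReal.ofReal_ofNat]; norm_num
      rw [h9, h3, ← ENNReal.ofReal_mul (by norm_num), ← ENNReal.ofReal_mul (by positivity)]
      refine ENNReal.ofReal_le_ofReal ?_
      have h5 : ((2 : ℝ) ^ (-q)) ^ 2 = (2 : ℝ) ^ (-2 * q) := by
        rw [← zpow_natCast, ← zpow_mul]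
        congr 1
        push_cast
        ring
      rw [mul_pow, h5]
      have : (0 : ℝ) < (2 : ℝ) ^ (-2 * q) := by positivity
      linarith
    · refine le_of_eq ?_
      push_cast
      ring

end FixedTime

end LittlewoodPaley

/-! ### The evolution of the dyadic energies -/

/-- A solution of the system at the regularity in which the energy of each block can be computed:
the velocity `v` is divergence free, with locally square integrable Fourier transform and with
blocks bounded as in `H^{-1/2}`, at all times, and `h` controls the transporting field `u`. -/
structure Flow (P : LittlewoodPaley) (T : ℝ) (u v f : ℝ → Fin 3 → 𝓢'(Space, ℂ))
    (p g : ℝ → 𝓢'(Space, ℂ)) (N : ℝ → Fin 3 → 𝓢'(Space, ℂ)) (h : ℝ → ℝ) : Prop where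
  pos : 0 < T
  momentum : Momentum T v (tendency v f p g N)
  u_int : ∀ i, WeaklyIntegrable T fun τ => u τ i
  v_int : ∀ i, WeaklyIntegrable T fun τ => v τ i
  f_int : ∀ i, WeaklyIntegrable T fun τ => f τ i
  g_int : WeaklyIntegrable T g
  h_int : IntegrableOn h (Set.Icc 0 T)
  div : ∀ t ∈ Set.Icc 0 T, divergence (v t) = 0
  density : ∀ t ∈ Set.Icc 0 T, ∀ l, ∃ a, HasDensity (v t l) a
  bound : ∃ M : ℝ≥0∞, M ≠ ⊤ ∧ ∀ t ∈ Set.Icc 0 T, ∀ j l, eLpNorm (op (P.phiS j) (v t l)) 2 volume ≤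
    ENNReal.ofReal ((2 : ℝ) ^ ((j.toNat : ℝ) / 2)) * M
  f_density : ∀ᵐ τ ∂volume.restrict (Set.Icc 0 T), ∀ l, ∃ a, HasDensity (f τ l) a
  g_density : ∀ᵐ τ ∂volume.restrict (Set.Icc 0 T), ∃ a, HasDensity (g τ) a
  f_fin : ∀ q l, ∫⁻ τ in Set.Icc 0 T, eLpNorm (op (P.phiS q) (f τ l)) 2 volume < ⊤
  g_fin : ∀ q, ∫⁻ τ in Set.Icc 0 T, eLpNorm (op (P.phiS q) (g τ)) 2 volume < ⊤
  transport : ∀ᵐ τ ∂volume.restrict (Set.Icc 0 T), IsTransport P (u τ) (h τ)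
  convection : ∀ᵐ τ ∂volume.restrict (Set.Icc 0 T), ∀ l, IsConvection P (u τ) (v τ l) (N τ l)

theorem Momentum.op {T : ℝ} {v : ℝ → Fin 3 → 𝓢'(Space, ℂ)} {G : Fin 3 → ℝ → 𝓢'(Space, ℂ)}
    (h : Momentum T v G) (m : 𝓢(Space, ℂ)) {t : ℝ} (ht : t ∈ Set.Icc 0 T) (l : Fin 3) (x : Space) :
    LosingEstimate.op m (v t l) x =
      LosingEstimate.op m (v 0 l) x + ∫ τ in (0 : ℝ)..t, LosingEstimate.op m (G l τ) x :=
  h.2 t ht l _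

theorem Momentum.intervalIntegrable_op {T : ℝ} {v : ℝ → Fin 3 → 𝓢'(Space, ℂ)}
    {G : Fin 3 → ℝ → 𝓢'(Space, ℂ)} (h : Momentum T v G) (hT : 0 ≤ T) (m : 𝓢(Space, ℂ)) (l : Fin 3)
    (x : Space) : IntervalIntegrable (fun τ => LosingEstimate.op m (G l τ) x) volume 0 T :=
  h.intervalIntegrable hT l _

theorem WeaklyIntegrable.integrableOn_op {T : ℝ} {w : ℝ → 𝓢'(Space, ℂ)} (hw : WeaklyIntegrable T w)
    (m : 𝓢(Space, ℂ)) (x : Space) : IntegrableOn (fun τ => op m (w τ) x) (Set.Icc 0 T) := hw _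

theorem aestronglyMeasurable_finsetSum_prod {μ : Measure ℝ} [SFinite μ] {F : Fin 3 → ℝ → Space → ℂ}
    (h : ∀ k, AEStronglyMeasurable (fun z : ℝ × Space => F k z.1 z.2) (μ.prod volume)) :
    AEStronglyMeasurable (fun z : ℝ × Space => ∑ k, F k z.1 z.2) (μ.prod volume) :=
  Finset.aestronglyMeasurable_fun_sum _ fun k _ => h k

theorem LittlewoodPaley.eLpNorm_forcing_le (P : LittlewoodPaley) {u v N f : Fin 3 → 𝓢'(Space, ℂ)}
    {g : 𝓢'(Space, ℂ)} (hv : ∀ l, ∃ a, HasDensity (v l) a) (hf : ∀ l, ∃ a, HasDensity (f l) a)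
    (hg : ∃ b, HasDensity g b) {q : ℤ} {i : Fin 3}
    (hR : eLpNorm (P.remainder u v N q i) 2 volume < ⊤) :
    eLpNorm (P.forcing u v N f g q i) 2 volume ≤
      ∑ l, eLpNorm (op (P.phiS q) (f l)) 2 volume +
        eLpNorm (P.remainder u v N q i) 2 volume +
        eLpNorm (op (P.phiS q) g) 2 volume +
        2 * (ENNReal.ofReal ((8 / 3 * (2 : ℝ) ^ q) ^ 2) *
          eLpNorm (op (P.phiS q) (v i)) 2 volume) := by
  obtain ⟨a, ha⟩ := hv i
  obtain ⟨b, hb⟩ := hg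
  have c0 := P.hasCompactSupport_phiS q
  have c1 := fun k => HasDensity.hasCompactSupport_mulI c0 k
  have c2 := fun k => HasDensity.hasCompactSupport_mulI (c1 k) k
  have hsrc := P.memLp_source (u := u) (v := v) (N := N) hf hR
  have hl := hb.memLp_op (P.hasCompactSupport_leray q i 2)
  have hk : ∀ k, eLpNorm (op (mulI k (mulI k (P.phiS q))) (v i)) 2 volume ≤
      ENNReal.ofReal ((8 / 3 * (2 : ℝ) ^ q) ^ 2) * eLpNorm (op (P.phiS q) (v i)) 2 volume := by
    intro k
    refine eLpNorm_op_le_of_norm_le ha (c2 k) c0 fun ξ => ?_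
    have h1 := P.norm_mulI_phiS_le q k ξ
    by_cases h0 : P.phiS q ξ = 0
    · simp [mulI_apply, h0]
    have h2 : ‖mulI k (mulI k (P.phiS q)) ξ‖ * ‖P.phiS q ξ‖ = ‖mulI k (P.phiS q) ξ‖ ^ 2 := by
      simp only [mulI_apply, norm_mul]; ring
    have h3 : 0 < ‖P.phiS q ξ‖ := norm_pos_iff.2 h0
    refine le_of_mul_le_mul_right ?_ h3
    rw [h2]
    calc _ ≤ (8 / 3 * (2 : ℝ) ^ q * ‖P.phiS q ξ‖) ^ 2 := by gcongr
      _ = _ := by ring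
  have hfor : P.forcing u v N f g q i =
      ((fun x => ∑ l, op (P.leray q i l) (f l) x - P.remainder u v N q i x) +
        op (P.leray q i 2) g) + (op (mulI 0 (mulI 0 (P.phiS q))) (v i) +
          op (mulI 1 (mulI 1 (P.phiS q))) (v i)) := by
    ext x
    simp only [LittlewoodPaley.forcing, Pi.add_apply]
    ring
  have m2 := fun k => (ha.memLp_op (c2 k)).1
  rw [hfor]
  refine (eLpNorm_add_le (hsrc.1.1.add hl.1) ((m2 0).add (m2 1)) (by norm_num)).trans ?_
  refine add_le_add ((eLpNorm_add_le hsrc.1.1 hl.1 (by norm_num)).trans ?_)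
    ((eLpNorm_add_le (m2 0) (m2 1) (by norm_num)).trans ?_)
  · exact add_le_add hsrc.2 (P.eLpNorm_leray_le hb q i 2)
  · rw [two_mul]
    exact add_le_add (hk 0) (hk 1)

namespace Flow

variable {P : LittlewoodPaley} {T : ℝ} {u v f : ℝ → Fin 3 → 𝓢'(Space, ℂ)}
  {p g : ℝ → 𝓢'(Space, ℂ)} {N : ℝ → Fin 3 → 𝓢'(Space, ℂ)} {h : ℝ → ℝ}

/-- A uniform bound of the commutator terms. -/
theorem exists_remainder_le (F : Flow P T u v f p g N h) {C : ℝ}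
    (hC : ∀ (u v N : Fin 3 → 𝓢'(Space, ℂ)) (h : ℝ), IsTransport P u h → divergence v = 0 →
      (∀ l, ∃ a, HasDensity (v l) a) → (∀ l, IsConvection P u (v l) (N l)) → ∀ q i,
      eLpNorm (P.remainder u v N q i) 2 volume ≤ ENNReal.ofReal (C * h) *
        LittlewoodPaley.decaySum (fun j => ∑ l, eLpNorm (op (P.phiS j) (v l)) 2 volume) q) (q : ℤ) :
    ∃ K : ℝ≥0∞, K ≠ ⊤ ∧ ∀ᵐ τ ∂volume.restrict (Set.Icc 0 T), ∀ i,
      eLpNorm (P.remainder (u τ) (v τ) (N τ) q i) 2 volume ≤ ENNReal.ofReal (C * h τ) *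
        LittlewoodPaley.decaySum (fun j => ∑ l, eLpNorm (op (P.phiS j) (v τ l)) 2 volume) q ∧
      LittlewoodPaley.decaySum (fun j => ∑ l, eLpNorm (op (P.phiS j) (v τ l)) 2 volume) q ≤ K := by
  obtain ⟨M, hM, hb⟩ := F.bound
  have h1 : ∀ τ ∈ Set.Icc 0 T, ∀ j, ∑ l, eLpNorm (op (P.phiS j) (v τ l)) 2 volume ≤
      ENNReal.ofReal ((2 : ℝ) ^ ((j.toNat : ℝ) / 2)) * (3 * M) := by
    intro τ hτ j
    refine (Finset.sum_le_sum fun l _ => hb τ hτ j l).trans_eq ?_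
    simp only [Finset.sum_const, Finset.card_univ, Fintype.card_fin, nsmul_eq_mul]
    push_cast
    ring
  refine ⟨(∑' j, ENNReal.ofReal (decay q j * (2 : ℝ) ^ ((j.toNat : ℝ) / 2))) * (3 * M),
    ENNReal.mul_ne_top (decaySum_lt_top (F := 0) (M := 0) (by simp) q).2
      (ENNReal.mul_ne_top (by norm_num) hM), ?_⟩
  filter_upwards [F.transport, F.convection, ae_restrict_mem measurableSet_Icc] with τ h2 h3 hτ i
  exact ⟨hC _ _ _ _ h2 (F.div τ hτ) (F.density τ hτ) h3 q i, (decaySum_lt_top (h1 τ hτ) q).1⟩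

theorem lintegral_forcing_lt_top (F : Flow P T u v f p g N h) (q : ℤ) (i : Fin 3) :
    ∫⁻ τ in Set.Icc 0 T, eLpNorm (P.forcing (u τ) (v τ) (N τ) (f τ) (g τ) q i) 2 volume < ⊤ := by
  set μ := volume.restrict (Set.Icc 0 T)
  have hmem : ∀ᵐ τ ∂μ, τ ∈ Set.Icc 0 T := ae_restrict_mem measurableSet_Icc
  obtain ⟨M, hM, hb⟩ := F.bound
  obtain ⟨C, hC0, hC⟩ := P.exists_remainder_bound
  obtain ⟨K, hK, hR⟩ := F.exists_remainder_le hC q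
  set b : ℝ → ℝ≥0∞ := fun τ => ∑ l, eLpNorm (op (P.phiS q) (f τ l)) 2 volume +
      ENNReal.ofReal (C * h τ) * K + eLpNorm (op (P.phiS q) (g τ)) 2 volume +
      2 * (ENNReal.ofReal ((8 / 3 * (2 : ℝ) ^ q) ^ 2) *
        (ENNReal.ofReal ((2 : ℝ) ^ ((q.toNat : ℝ) / 2)) * M))
  have hle : ∀ᵐ τ ∂μ, eLpNorm (P.forcing (u τ) (v τ) (N τ) (f τ) (g τ) q i) 2 volume ≤ b τ := by
    filter_upwards [hmem, F.f_density, F.g_density, hR] with τ hτ h1 h2 h3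
    have h4 := (h3 i).1.trans (mul_le_mul' le_rfl (h3 i).2)
    refine (P.eLpNorm_forcing_le (F.density τ hτ) h1 h2
      (h4.trans_lt (ENNReal.mul_lt_top ENNReal.ofReal_lt_top hK.lt_top))).trans ?_
    have h5 := hb τ hτ q i
    simp only [b]
    gcongr
  refine (lintegral_mono_ae hle).trans_lt ?_
  have mh : AEMeasurable (fun τ => ENNReal.ofReal (C * h τ) * K) μ :=
    ((F.h_int.1.aemeasurable.const_mul C).ennreal_ofReal).mul_const K
  have mf : ∀ l, AEMeasurable (fun τ => eLpNorm (op (P.phiS q) (f τ l)) 2 volume) μ := fun l =>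
    aemeasurable_eLpNorm_op (F.f_int l).aemeasurable _
  have msf : AEMeasurable (fun τ => ∑ l, eLpNorm (op (P.phiS q) (f τ l)) 2 volume) μ :=
    Finset.aemeasurable_fun_sum _ fun l _ => mf l
  have mg : AEMeasurable (fun τ => eLpNorm (op (P.phiS q) (g τ)) 2 volume) μ :=
    aemeasurable_eLpNorm_op F.g_int.aemeasurable _
  simp only [b]
  rw [lintegral_add_left' ((msf.fun_add mh).fun_add mg), lintegral_add_left' (msf.fun_add mh),
    lintegral_add_left' msf, lintegral_finsetSum' _ fun l _ => mf l, lintegral_mul_const' _ _ hK,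
    lintegral_const]
  refine ENNReal.add_lt_top.2 ⟨ENNReal.add_lt_top.2 ⟨ENNReal.add_lt_top.2 ⟨?_, ?_⟩, F.g_fin q⟩, ?_⟩
  · exact ENNReal.sum_lt_top.2 fun l _ => F.f_fin q l
  · refine ENNReal.mul_lt_top ?_ hK.lt_top
    exact Integrable.lintegral_lt_top (F.h_int.const_mul C)
  · refine ENNReal.mul_lt_top ?_ (by simp [μ])
    exact ENNReal.mul_lt_top (by norm_num) (ENNReal.mul_lt_top ENNReal.ofReal_lt_top
      (ENNReal.mul_lt_top ENNReal.ofReal_lt_top hM.lt_top))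

theorem integrableOn_growth (F : Flow P T u v f p g N h) (q : ℤ) :
    IntegrableOn (fun τ => IsTransport.growth P (u τ) (h τ) q) (Set.Icc 0 T) := by
  refine Integrable.add (integrable_finsetSum _ fun k _ => ?_) ((F.h_int.const_mul _).const_mul _)
  exact ((F.u_int k).integrableOn_op _ 0).norm

theorem lintegral_transport_lt_top (F : Flow P T u v f p g N h) (q : ℤ) (i : Fin 3) :
    ∫⁻ τ in Set.Icc 0 T, eLpNorm (fun x => (((1 + ‖x‖)⁻¹ : ℝ) : ℂ) *
      P.transport (u τ) (v τ) q i x) 2 volume < ⊤ := by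
  have hα := F.integrableOn_growth q
  set μ := volume.restrict (Set.Icc 0 T)
  have hmem : ∀ᵐ τ ∂μ, τ ∈ Set.Icc 0 T := ae_restrict_mem measurableSet_Icc
  obtain ⟨M, hM, hb⟩ := F.bound
  have c0 := P.hasCompactSupport_phiS q
  set L := ENNReal.ofReal (8 / 3 * (2 : ℝ) ^ q) *
    (ENNReal.ofReal ((2 : ℝ) ^ ((q.toNat : ℝ) / 2)) * M)
  have hL : 3 * L ≠ ⊤ := ENNReal.mul_ne_top (by norm_num)
    (ENNReal.mul_ne_top ENNReal.ofReal_ne_top (ENNReal.mul_ne_top ENNReal.ofReal_ne_top hM))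
  have hle : ∀ᵐ τ ∂μ,
    eLpNorm (fun x => (((1 + ‖x‖)⁻¹ : ℝ) : ℂ) * P.transport (u τ) (v τ) q i x) 2 volume ≤
      ENNReal.ofReal (IsTransport.growth P (u τ) (h τ) q) * (3 * L) := by
    filter_upwards [hmem, F.transport] with τ hτ h1
    refine (h1.eLpNorm_transport_le (v τ) q i).trans (mul_le_mul' le_rfl ?_)
    obtain ⟨a, ha⟩ := F.density τ hτ i
    calc _ ≤ ∑ k : Fin 3, L := Finset.sum_le_sum fun k _ =>
          (eLpNorm_op_le_of_norm_le ha (HasDensity.hasCompactSupport_mulI c0 k) c0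
            (P.norm_mulI_phiS_le q k)).trans (mul_le_mul' le_rfl (hb τ hτ q i))
      _ = _ := by simp
  refine (lintegral_mono_ae hle).trans_lt ?_
  rw [lintegral_mul_const' _ _ hL]
  exact ENNReal.mul_lt_top (Integrable.lintegral_lt_top hα) hL.lt_top

theorem hasPrim_block (F : Flow P T u v f p g N h) (q : ℤ) (i : Fin 3) :
    HasPrim T (fun t => ∫ x, ‖op (P.phiS q) (v t i) x‖ ^ 2) fun τ =>
      2 * ∫ x, inner ℝ (op (P.phiS q) (v τ i) x)
        (P.forcing (u τ) (v τ) (N τ) (f τ) (g τ) q i x) := by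
  have hT := F.pos.le
  have hmem : ∀ᵐ τ ∂volume.restrict (Set.Icc 0 T), τ ∈ Set.Icc 0 T :=
    ae_restrict_mem measurableSet_Icc
  obtain ⟨M, hM, hb⟩ := F.bound
  have mB : AEStronglyMeasurable (Function.uncurry fun τ => P.transport (u τ) (v τ) q i)
      ((volume.restrict (Set.Icc 0 T)).prod volume) :=
    aestronglyMeasurable_finsetSum_prod (F := fun k τ x =>
      op (P.chiE (q.toNat + 2)) (u τ k) x * op (mulI k (P.phiS q)) (v τ i) x) fun k =>
      (aestronglyMeasurable_op (F.u_int k).aemeasurable _).mul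
        (aestronglyMeasurable_op (F.v_int i).aemeasurable _)
  obtain ⟨A, hA⟩ : ∃ A : ℝ → Space → ℂ, A = fun τ x =>
      ∑ l, op (P.leray q i l) (tendency v f p g N l τ) x + P.transport (u τ) (v τ) q i x := ⟨_, rfl⟩
  have hAB : ∀ τ x, A τ x - P.transport (u τ) (v τ) q i x =
      ∑ l, op (P.leray q i l) (tendency v f p g N l τ) x := by
    intro τ x
    rw [hA]
    exact add_sub_cancel_right _ _
  have hAf : ∀ τ ∈ Set.Icc 0 T, A τ = P.forcing (u τ) (v τ) (N τ) (f τ) (g τ) q i := by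
    intro τ hτ
    ext x
    rw [← sub_left_inj (a := P.transport (u τ) (v τ) q i x), hAB,
      P.sum_op_leray_tendency (F.div τ hτ) (u τ)]
  have mA : AEStronglyMeasurable (Function.uncurry A)
      ((volume.restrict (Set.Icc 0 T)).prod volume) := by
    rw [hA]
    exact (aestronglyMeasurable_finsetSum_prod
      (F := fun l τ x => op (P.leray q i l) (tendency v f p g N l τ) x) fun l =>
      aestronglyMeasurable_op (F.momentum.1 l).aemeasurable _).add mB
  have hint : ∀ l x, IntervalIntegrable
      (fun τ => op (P.leray q i l) (tendency v f p g N l τ) x) volume 0 T :=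
    fun l x => F.momentum.intervalIntegrable_op hT _ l x
  have hint' : ∀ x, IntervalIntegrable
      (fun τ => A τ x - P.transport (u τ) (v τ) q i x) volume 0 T := by
    intro x
    simp only [hAB]
    have h1 := IntervalIntegrable.sum Finset.univ fun l _ => hint l x
    rwa [Finset.sum_fn] at h1
  have heq : ∀ x, ∀ t ∈ Set.Icc 0 T, op (P.phiS q) (v t i) x = op (P.phiS q) (v 0 i) x +
      ∫ τ in (0 : ℝ)..t, (A τ x - P.transport (u τ) (v τ) q i x) := by
    intro x t ht
    simp only [hAB]
    have hs : Set.uIcc 0 t ⊆ Set.uIcc 0 T := by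
      rw [Set.uIcc_of_le ht.1, Set.uIcc_of_le hT]; exact Set.Icc_subset_Icc_right ht.2
    rw [← P.sum_op_leray (F.div t ht), ← P.sum_op_leray (F.div 0 ⟨le_rfl, hT⟩),
      intervalIntegral.integral_finsetSum fun l _ => (hint l x).mono_set hs,
        ← Finset.sum_add_distrib]
    exact Finset.sum_congr rfl fun l _ => F.momentum.op _ ht l x
  have hAfin : ∫⁻ τ in Set.Icc 0 T, eLpNorm (A τ) 2 volume < ⊤ := by
    refine (F.lintegral_forcing_lt_top q i).trans_le' (lintegral_mono_ae ?_)
    filter_upwards [hmem] with τ hτ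
    rw [hAf τ hτ]
  have hcut : ∀ᵐ τ ∂volume.restrict (Set.Icc 0 T), ∀ n,
      |∫ x, cut n x * inner ℝ (op (P.phiS q) (v τ i) x) (P.transport (u τ) (v τ) q i x)| ≤
        IsTransport.growth P (u τ) (h τ) q * ∫ x, cutError n x * ‖op (P.phiS q) (v τ i) x‖ ^ 2 := by
    filter_upwards [hmem, F.transport] with τ hτ h1 n
    obtain ⟨a, ha⟩ := F.density τ hτ i
    exact h1.abs_integral_cut_le ha q n
  have key := LosingEstimate.hasPrim_energy hT (y := fun t => op (P.phiS q) (v t i)) (A := A)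
    (B := fun τ => P.transport (u τ) (v τ) q i)
    (α := fun τ => IsTransport.growth P (u τ) (h τ) q) hint' heq
    (aestronglyMeasurable_op (F.v_int i).aemeasurable _) mA mB
    (M := ENNReal.ofReal ((2 : ℝ) ^ ((q.toNat : ℝ) / 2)) * M)
    (ENNReal.mul_ne_top ENNReal.ofReal_ne_top hM)
    (fun t ht => ⟨continuous_op _ _, hb t ht q i⟩) hAfin (F.lintegral_transport_lt_top q i)
    (F.integrableOn_growth q) hcut
  refine key.congr hT (fun _ _ => rfl) fun τ hτ => ?_
  simp only [hAf τ hτ]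

theorem hasPrim_energy (F : Flow P T u v f p g N h) (q : ℤ) :
    HasPrim T (fun t => P.energy (v t) q) fun τ => 2 * ∑ i, ∫ x, inner ℝ (op (P.phiS q) (v τ i) x)
        (P.forcing (u τ) (v τ) (N τ) (f τ) (g τ) q i x) := by
  have h1 := HasPrim.sum Finset.univ fun i _ => F.hasPrim_block q i
  simp only [← Finset.mul_sum] at h1
  exact h1

theorem integrableOn_dissipation (F : Flow P T u v f p g N h) (q : ℤ) :
    IntegrableOn (fun τ => P.dissipation (v τ) q) (Set.Icc 0 T) := by
  obtain ⟨M, hM, hb⟩ := F.bound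
  set L := ENNReal.ofReal (8 / 3 * (2 : ℝ) ^ q) *
    (ENNReal.ofReal ((2 : ℝ) ^ ((q.toNat : ℝ) / 2)) * M)
  have hL : L ≠ ⊤ :=
      (ENNReal.mul_ne_top ENNReal.ofReal_ne_top (ENNReal.mul_ne_top ENNReal.ofReal_ne_top hM))
  have key : ∀ i k, IntegrableOn (fun τ => ∫ x, ‖op (mulI k (P.phiS q)) (v τ i) x‖ ^ 2)
      (Set.Icc 0 T) := by
    intro i k
    have m1 := aestronglyMeasurable_op (F.v_int i).aemeasurable (mulI k (P.phiS q))
    have m2 : AEStronglyMeasurable (fun τ => ∫ x, ‖op (mulI k (P.phiS q)) (v τ i) x‖ ^ 2)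
        (volume.restrict (Set.Icc 0 T)) := (m1.norm.pow 2).integral_prod_right'
    refine Integrable.of_bound m2 (L ^ 2).toReal ?_
    filter_upwards [ae_restrict_mem measurableSet_Icc] with τ hτ
    obtain ⟨a, ha⟩ := F.density τ hτ i
    have c0 := P.hasCompactSupport_phiS q
    have c1 := HasDensity.hasCompactSupport_mulI c0 k
    rw [Real.norm_of_nonneg (integral_nonneg fun _ => sq_nonneg _),
      ← ENNReal.ofReal_le_iff_le_toReal (ENNReal.pow_ne_top hL),
        ofReal_integral_normSq (ha.memLp_op c1)]
    gcongr
    exact (eLpNorm_op_le_of_norm_le ha c1 c0 (P.norm_mulI_phiS_le q k)).trans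
      (mul_le_mul' le_rfl (hb τ hτ q i))
  exact integrable_finsetSum _ fun i _ => (key i 0).add (key i 1)

end Flow

/-! ### Weights that lose regularity -/

/-- The weight of the block of index `q` when the accumulated log-Lipschitz norm is `H`. It is
`2^{2 q (s - lam H)}` for `0 ≤ q ≤ N` and `1` for `q < 0`. For `q > N` it decreases in `q`, with a
slope that makes it summable against the energies of a field of regularity larger than `-9/16`. -/
def lossWeight (s lam c : ℝ) (N : ℕ) (H : ℝ) (q : ℤ) : ℝ :=
  (2 : ℝ) ^ (2 * ((s - lam * H) * (min q.toNat N : ℕ) - (5 / 8 + c * H) * (q.toNat - N : ℕ)))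

/-- The rate of decrease of `lossWeight`, as a function of `H`. -/
def lossRate (lam c : ℝ) (N : ℕ) (q : ℤ) : ℝ :=
  Real.log 2 * (lam * (min q.toNat N : ℕ) + c * (q.toNat - N : ℕ))

theorem toNat_split (N : ℕ) (q : ℤ) :
    ((q.toNat : ℕ) : ℝ) = (min q.toNat N : ℕ) + (q.toNat - N : ℕ) := by
  rw [← Nat.cast_add]
  congr 1
  omega

section Weight

variable {s lam c H : ℝ} {N : ℕ} {q : ℤ}

theorem lossWeight_pos : 0 < lossWeight s lam c N H q := by unfold lossWeight; positivity

theorem lossRate_nonneg (hlam : 0 ≤ lam) (hc : 0 ≤ c) : 0 ≤ lossRate lam c N q := by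
  have := Real.log_pos (one_lt_two (α := ℝ))
  unfold lossRate
  positivity

theorem lossWeight_of_le (h : q.toNat ≤ N) :
    lossWeight s lam c N H q = (2 : ℝ) ^ (2 * (s - lam * H) * q.toNat) := by
  rw [lossWeight, min_eq_left h, Nat.sub_eq_zero_of_le h]
  congr 1
  simp
  ring

theorem lossWeight_of_neg (h : q < 0) : lossWeight s lam c N H q = 1 := by
  rw [lossWeight_of_le (by omega), Int.toNat_of_nonpos h.le]
  simp

theorem lossWeight_le (hs : -(5 / 8) ≤ s) (hlam : 0 ≤ lam) (hc : 0 ≤ c) (hH : 0 ≤ H) :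
    lossWeight s lam c N H q ≤ (2 : ℝ) ^ (2 * s * q.toNat) := by
  refine Real.rpow_le_rpow_of_exponent_le (by norm_num) ?_
  rw [toNat_split N q]
  set x : ℝ := ((min q.toNat N : ℕ) : ℝ)
  set y : ℝ := ((q.toNat - N : ℕ) : ℝ)
  have hx : 0 ≤ x := Nat.cast_nonneg _
  have hy : 0 ≤ y := Nat.cast_nonneg _
  have h1 : 0 ≤ lam * H * x := by positivity
  have h2 : 0 ≤ c * H * y := by positivity
  nlinarith [mul_nonneg (by linarith : 0 ≤ s + 5 / 8) hy]

theorem lossWeight_le_decay (hs : s ≤ 1) (hlam : 0 ≤ lam) (hc : 0 ≤ c) (hH : 0 ≤ H) :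
    lossWeight s lam c N H q ≤ (2 : ℝ) ^ (13 / 4 * (N : ℝ)) *
      (2 : ℝ) ^ (-(5 / 4) * (q.toNat : ℝ)) := by
  rw [← Real.rpow_add (by norm_num)]
  refine Real.rpow_le_rpow_of_exponent_le (by norm_num) ?_
  rw [toNat_split N q]
  have hN : ((min q.toNat N : ℕ) : ℝ) ≤ N := by exact_mod_cast min_le_right _ _
  set x : ℝ := ((min q.toNat N : ℕ) : ℝ)
  set y : ℝ := ((q.toNat - N : ℕ) : ℝ)
  have hx : 0 ≤ x := Nat.cast_nonneg _
  have hy : 0 ≤ y := Nat.cast_nonneg _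
  have h1 : 0 ≤ lam * H * x := by positivity
  have h2 : 0 ≤ c * H * y := by positivity
  nlinarith [mul_nonneg (by linarith : 0 ≤ 1 - s) hx]

/-- The weights are summable, with the rates, against the energies of a field of regularity
larger than `-9/16`. -/
theorem exists_lossRate_mul_le (hs : s ≤ 1) (hlam : 0 ≤ lam) (hc : 0 ≤ c) (N : ℕ) :
    ∃ K : ℝ, 0 ≤ K ∧ ∀ H, 0 ≤ H → ∀ q : ℤ, (1 + lossRate lam c N q) * lossWeight s lam c N H q ≤
      K * (2 : ℝ) ^ (-(9 / 8) * (q.toNat : ℝ)) := by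
  have hl := Real.log_pos (one_lt_two (α := ℝ))
  refine ⟨(1 + 8 * (lam + c)) * (2 : ℝ) ^ (13 / 4 * (N : ℝ)), by positivity, fun H hH q => ?_⟩
  have h1 : lossRate lam c N q ≤ Real.log 2 * ((lam + c) * q.toNat) := by
    rw [toNat_split N q, lossRate]
    have hx : (0 : ℝ) ≤ ((min q.toNat N : ℕ) : ℝ) := Nat.cast_nonneg _
    have hy : (0 : ℝ) ≤ ((q.toNat - N : ℕ) : ℝ) := Nat.cast_nonneg _
    refine mul_le_mul_of_nonneg_left ?_ hl.le
    nlinarith [mul_nonneg hc hx, mul_nonneg hlam hy]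
  have h2 : Real.log 2 * (q.toNat / 8) + 1 ≤ (2 : ℝ) ^ ((q.toNat : ℝ) / 8) := by
    rw [Real.rpow_def_of_pos two_pos]
    exact Real.add_one_le_exp _
  have hq : (0 : ℝ) ≤ q.toNat := Nat.cast_nonneg _
  have h3 : 1 + lossRate lam c N q ≤ (1 + 8 * (lam + c)) * (2 : ℝ) ^ ((q.toNat : ℝ) / 8) := by
    have h4 : 0 ≤ lam + c := by positivity
    have h5 : 0 ≤ Real.log 2 * (q.toNat / 8) := by positivity
    nlinarith [mul_le_mul_of_nonneg_left h2 (by positivity : 0 ≤ 1 + 8 * (lam + c))]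
  calc _ ≤ ((1 + 8 * (lam + c)) * (2 : ℝ) ^ ((q.toNat : ℝ) / 8)) *
        ((2 : ℝ) ^ (13 / 4 * (N : ℝ)) * (2 : ℝ) ^ (-(5 / 4) * (q.toNat : ℝ))) :=
        mul_le_mul h3 (lossWeight_le_decay hs hlam hc hH) lossWeight_pos.le (by positivity)
    _ = (1 + 8 * (lam + c)) * (2 : ℝ) ^ (13 / 4 * (N : ℝ)) *
        ((2 : ℝ) ^ ((q.toNat : ℝ) / 8) * (2 : ℝ) ^ (-(5 / 4) * (q.toNat : ℝ))) := by ring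
    _ = _ := by
        rw [← Real.rpow_add two_pos]
        congr 2
        ring

theorem hasPrim_lossWeight {T : ℝ} (hT : 0 ≤ T) {h Hf : ℝ → ℝ} (hH : HasPrim T Hf h) (N : ℕ)
    (q : ℤ) :
    HasPrim T (fun t => lossWeight s lam c N (Hf t) q)
      fun t => lossWeight s lam c N (Hf t) q * (-2 * lossRate lam c N q * h t) := by
  have h0 : HasPrim T (fun _ => Real.log 2 * (2 * (s * (min q.toNat N : ℕ) -
      5 / 8 * (q.toNat - N : ℕ)))) fun _ => 0 := ⟨by simp, by simp⟩
  refine ((h0.add (hH.const_mul (-2 * lossRate lam c N q))).exp hT).congr hT (fun t _ => ?_)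
    fun t _ => ?_
  · rw [lossWeight, Real.rpow_def_of_pos two_pos, lossRate]
    congr 1
    ring
  · rw [lossWeight, Real.rpow_def_of_pos two_pos, zero_add]
    congr 2
    rw [lossRate]
    ring

/-- The kernel that bounds the interaction of the blocks. -/
def schurKernel (ε : ℝ) (n : ℤ) : ℝ := (2 : ℝ) ^ (-(ε * |(n : ℝ)|)) * (1 + |(n : ℝ)|)

theorem schurKernel_nonneg (ε : ℝ) (n : ℤ) : 0 ≤ schurKernel ε n := by
  unfold schurKernel; positivity

/-- The `ℓ¹` norm of `schurKernel`. -/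
def schurConst (ε : ℝ) : ℝ≥0∞ := ∑' n : ℤ, ENNReal.ofReal (schurKernel ε n)

theorem schurConst_ne_top {ε : ℝ} (hε : 0 < ε) : schurConst ε ≠ ⊤ := by
  have hr : ‖((2 : ℝ) ^ (-ε))‖ < 1 := by
    rw [Real.norm_of_nonneg (by positivity)]
    exact Real.rpow_lt_one_of_one_lt_of_neg (by norm_num) (by linarith)
  have hs := (summable_geometric_of_norm_lt_one hr).add
    (summable_pow_mul_geometric_of_norm_lt_one 1 hr)
  have hk : ∀ n : ℕ, ((2 : ℝ) ^ (-ε)) ^ n + (n : ℝ) ^ 1 * ((2 : ℝ) ^ (-ε)) ^ n =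
      schurKernel ε n := by
    intro n
    rw [schurKernel, ← Real.rpow_natCast, ← Real.rpow_mul (by norm_num)]
    simp only [Int.cast_natCast, Nat.abs_cast, pow_one, neg_mul]
    ring
  have hk' : ∀ n : ℤ, schurKernel ε (-n) = schurKernel ε n := by
    intro n
    simp [schurKernel]
  simp only [hk] at hs
  have hsum : Summable (schurKernel ε) := by
    refine Summable.of_nat_of_neg hs ?_
    simpa only [hk'] using hs
  rw [schurConst, ← ENNReal.ofReal_tsum_of_nonneg (schurKernel_nonneg ε) hsum]
  exact ENNReal.ofReal_ne_top

/-- The weights vary more slowly than the decay of the interactions. -/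
theorem lossWeight_mul_decay_le {ε : ℝ} (hs : s ≤ 1 - ε) (hε : ε ≤ 1 / 4) (hlam : 0 ≤ lam)
    (hH : 0 ≤ H) (hlow : -(1 / 2) ≤ s - lam * H) (hc : 0 ≤ c) (hcH : c * H ≤ 1 / 8) (q j : ℤ)
    {x y : ℝ} (hx : 0 ≤ x) (hy : 0 ≤ y) :
    lossWeight s lam c N H q * (x * (decay q j * y)) ≤ schurKernel ε (q - j) / 2 *
      ((q.toNat + 5) * (lossWeight s lam c N H q * x ^ 2) +
        (j.toNat + 5) * (lossWeight s lam c N H j * y ^ 2)) := by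
  set lw : ℤ → ℝ := fun q =>
    (s - lam * H) * (min q.toNat N : ℕ) - (5 / 8 + c * H) * (q.toNat - N : ℕ)
  have hW : ∀ q, lossWeight s lam c N H q = ((2 : ℝ) ^ lw q) ^ 2 := by
    intro q
    rw [lossWeight, mul_comm, Real.rpow_mul (by norm_num)]
    norm_cast
  -- `lw` grows by at most `(1 - ε) (q - j)` from `j` to `q > j`, because `s ≤ 1 - ε`, and by at
  -- most `3 / 4 (j - q)` from `j` to `q < j`, because the regularity stays above `-1 / 2` and `5 /
  -- 8 + c * H ≤ 3 / 4`.
  have hlw : lw q + (-(|(((q - j : ℤ)) : ℝ)|)) ≤ lw j + -(ε * |(((q - j : ℤ)) : ℝ)|) := by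
    have hlamH : 0 ≤ lam * H := by positivity
    have hcH' : 0 ≤ c * H := by positivity
    rcases le_total j q with hjq | hjq
    · have h1 : (0 : ℝ) ≤ ((min q.toNat N : ℕ) : ℝ) - ((min j.toNat N : ℕ) : ℝ) := by
        rw [sub_nonneg]; exact_mod_cast (by omega : min j.toNat N ≤ min q.toNat N)
      have h2 : (0 : ℝ) ≤ ((q.toNat - N : ℕ) : ℝ) - ((j.toNat - N : ℕ) : ℝ) := by
        rw [sub_nonneg]; exact_mod_cast (by omega : j.toNat - N ≤ q.toNat - N)
      have h3 : ((min q.toNat N : ℕ) : ℝ) + ((q.toNat - N : ℕ) : ℝ) - ((min j.toNat N : ℕ) : ℝ) -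
          ((j.toNat - N : ℕ) : ℝ) ≤ ((q - j : ℤ) : ℝ) := by
        rw [← toNat_split, show ∀ a b c : ℝ, a - b - c = a - (b + c) by intros; ring, ← toNat_split,
          sub_le_iff_le_add]
        exact_mod_cast (by omega : (q.toNat : ℤ) ≤ q - j + j.toNat)
      have h4 : (0 : ℝ) ≤ ((q - j : ℤ) : ℝ) := by exact_mod_cast (by omega : 0 ≤ q - j)
      rw [abs_of_nonneg h4]
      simp only [lw]
      set d := ((q - j : ℤ) : ℝ)
      set x1 := ((min q.toNat N : ℕ) : ℝ) - ((min j.toNat N : ℕ) : ℝ) with hx1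
      set y1 := ((q.toNat - N : ℕ) : ℝ) - ((j.toNat - N : ℕ) : ℝ) with hy1
      have h5 : (s - lam * H) * x1 ≤ (1 - ε) * d := by
        have : x1 ≤ d := by linarith
        have h6 : (s - lam * H) * x1 ≤ (1 - ε) * x1 := mul_le_mul_of_nonneg_right (by linarith) h1
        have h7 : (1 - ε) * x1 ≤ (1 - ε) * d := mul_le_mul_of_nonneg_left this (by linarith)
        linarith
      have h6 : 0 ≤ (5 / 8 + c * H) * y1 := by positivity
      rw [hx1] at h5
      rw [hy1] at h6
      linarith
    · have h1 : (0 : ℝ) ≤ ((min j.toNat N : ℕ) : ℝ) - ((min q.toNat N : ℕ) : ℝ) := by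
        rw [sub_nonneg]; exact_mod_cast (by omega : min q.toNat N ≤ min j.toNat N)
      have h2 : (0 : ℝ) ≤ ((j.toNat - N : ℕ) : ℝ) - ((q.toNat - N : ℕ) : ℝ) := by
        rw [sub_nonneg]; exact_mod_cast (by omega : q.toNat - N ≤ j.toNat - N)
      have h3 : ((min j.toNat N : ℕ) : ℝ) + ((j.toNat - N : ℕ) : ℝ) - ((min q.toNat N : ℕ) : ℝ) -
          ((q.toNat - N : ℕ) : ℝ) ≤ -((q - j : ℤ) : ℝ) := by
        rw [← toNat_split, show ∀ a b c : ℝ, a - b - c = a - (b + c) by intros; ring, ← toNat_split,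
          sub_le_iff_le_add]
        exact_mod_cast (by omega : (j.toNat : ℤ) ≤ -(q - j) + q.toNat)
      have h4 : ((q - j : ℤ) : ℝ) ≤ 0 := by exact_mod_cast (by omega : q - j ≤ 0)
      rw [abs_of_nonpos h4]
      simp only [lw]
      set d := ((q - j : ℤ) : ℝ)
      set x1 := ((min j.toNat N : ℕ) : ℝ) - ((min q.toNat N : ℕ) : ℝ) with hx1
      set y1 := ((j.toNat - N : ℕ) : ℝ) - ((q.toNat - N : ℕ) : ℝ) with hy1
      have h5 : -(1 / 2) * x1 ≤ (s - lam * H) * x1 := mul_le_mul_of_nonneg_right hlow h1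
      have h6 : (5 / 8 + c * H) * y1 ≤ 3 / 4 * y1 := mul_le_mul_of_nonneg_right (by linarith) h2
      have h7 : ε * -d ≤ 1 / 4 * -d := mul_le_mul_of_nonneg_right hε (by linarith)
      rw [hx1] at h5
      rw [hy1] at h6
      linarith
  have hr : (2 : ℝ) ^ lw q * (2 : ℝ) ^ (-|q - j|) ≤ (2 : ℝ) ^ lw j *
    (2 : ℝ) ^ (-(ε * |((q - j : ℤ) : ℝ)|)) := by
    rw [← Real.rpow_intCast, ← Real.rpow_add two_pos, ← Real.rpow_add two_pos]
    refine Real.rpow_le_rpow_of_exponent_le (by norm_num) ?_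
    push_cast at hlw ⊢
    exact hlw
  set a := (2 : ℝ) ^ lw q
  set b := (2 : ℝ) ^ lw j
  set k := (2 : ℝ) ^ (-(ε * |((q - j : ℤ) : ℝ)|)) with hk
  have ha : 0 < a := by positivity
  have hb : 0 < b := by positivity
  have hk0 : 0 < k := by positivity
  rw [hW, hW, decay, schurKernel, ← hk]
  set m : ℝ := ((max q j).toNat : ℝ) + 5
  set d := |((q - j : ℤ) : ℝ)|
  have hd : 0 ≤ d := abs_nonneg _
  have hm0 : 0 ≤ m := by positivity
  -- The logarithmic loss can be carried by either of the two blocks.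
  have hmq : m ≤ (q.toNat + 5) * (1 + d) := by
    have h1 : ((max q j).toNat : ℝ) ≤ q.toNat + d := by
      simp only [d]
      rw [← Int.cast_abs]
      have : ((max q j).toNat : ℤ) ≤ q.toNat + |q - j| := by
        rcases abs_cases (q - j) with h | h <;> omega
      exact_mod_cast this
    have h2 : (0 : ℝ) ≤ q.toNat := Nat.cast_nonneg _
    simp only [m]
    nlinarith [mul_nonneg h2 hd]
  have hmj : m ≤ (j.toNat + 5) * (1 + d) := by
    have h1 : ((max q j).toNat : ℝ) ≤ j.toNat + d := by
      simp only [d]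
      rw [← Int.cast_abs]
      have : ((max q j).toNat : ℤ) ≤ j.toNat + |q - j| := by
        rcases abs_cases (q - j) with h | h <;> omega
      exact_mod_cast this
    have h2 : (0 : ℝ) ≤ j.toNat := Nat.cast_nonneg _
    simp only [m]
    nlinarith [mul_nonneg h2 hd]
  calc a ^ 2 * (x * ((2 : ℝ) ^ (-|q - j|) * m * y)) = (a * (2 : ℝ) ^ (-|q - j|)) *
    (a * x * y * m) := by
        ring
    _ ≤ (b * k) * (a * x * y * m) := mul_le_mul_of_nonneg_right hr (by positivity)
    _ = k * m * ((a * x) * (b * y)) := by ring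
    _ ≤ k * m * (((a * x) ^ 2 + (b * y) ^ 2) / 2) := by
        refine mul_le_mul_of_nonneg_left ?_ (by positivity)
        nlinarith [sq_nonneg (a * x - b * y)]
    _ = k / 2 * (m * (a * x) ^ 2 + m * (b * y) ^ 2) := by ring
    _ ≤ k / 2 * ((q.toNat + 5) * (1 + d) * (a * x) ^ 2 +
          (j.toNat + 5) * (1 + d) * (b * y) ^ 2) := by
        gcongr
    _ = _ := by ring

/-- Schur test for the interaction of the blocks. -/
theorem tsum_lossWeight_decaySum_le {ε : ℝ} (hs : s ≤ 1 - ε) (hε : ε ≤ 1 / 4) (hlam : 0 ≤ lam)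
    (hH : 0 ≤ H) (hlow : -(1 / 2) ≤ s - lam * H) (hc : 0 ≤ c) (hcH : c * H ≤ 1 / 8) {x : ℤ → ℝ}
    (hx : ∀ q, 0 ≤ x q) :
    ∑' q, ENNReal.ofReal (lossWeight s lam c N H q) * (ENNReal.ofReal (x q) *
      LittlewoodPaley.decaySum (fun j => ENNReal.ofReal (x j)) q) ≤
    schurConst ε * ∑' q : ℤ,
      ENNReal.ofReal ((q.toNat + 5) * (lossWeight s lam c N H q * x q ^ 2)) := by
  set A : ℤ → ℝ≥0∞ := fun q => ENNReal.ofReal ((q.toNat + 5) * (lossWeight s lam c N H q * x q ^ 2))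
  have hA : ∀ q : ℤ, 0 ≤ (q.toNat + 5) * (lossWeight s lam c N H q * x q ^ 2) := fun q => by
    have := lossWeight_pos (s := s) (lam := lam) (c := c) (N := N) (H := H) (q := q)
    positivity
  set k : ℤ → ℝ≥0∞ := fun n => ENNReal.ofReal (schurKernel ε n)
  have hk1 : ∀ q, ∑' j, k (q - j) = schurConst ε := fun q => (Equiv.subLeft q).tsum_eq k
  have hk2 : ∀ j, ∑' q, k (q - j) = schurConst ε := fun j => (Equiv.subRight j).tsum_eq k
  have h1 : ∀ q j, ENNReal.ofReal (lossWeight s lam c N H q) * (ENNReal.ofReal (x q) *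
      (ENNReal.ofReal (decay q j) * ENNReal.ofReal (x j))) ≤ k (q - j) * (A q / 2) + k (q - j) *
        (A j / 2) := by
    intro q j
    rw [← ENNReal.ofReal_mul (decay_nonneg q j), ← ENNReal.ofReal_mul (hx q),
      ← ENNReal.ofReal_mul lossWeight_pos.le]
    refine (ENNReal.ofReal_le_ofReal (lossWeight_mul_decay_le hs hε hlam hH hlow hc hcH q j (hx q)
      (hx j))).trans_eq ?_
    rw [← mul_add, ← ENNReal.ofReal_ofNat 2, ← ENNReal.ofReal_div_of_pos two_pos,
      ← ENNReal.ofReal_div_of_pos two_pos, ← ENNReal.ofReal_add (by have := hA q; positivity)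
      (by have := hA j; positivity), ← ENNReal.ofReal_mul (schurKernel_nonneg ε _)]
    congr 1
    ring
  calc _ = ∑' q, ∑' j, ENNReal.ofReal (lossWeight s lam c N H q) * (ENNReal.ofReal (x q) *
      (ENNReal.ofReal (decay q j) * ENNReal.ofReal (x j))) := by
        refine tsum_congr fun q => ?_
        rw [LittlewoodPaley.decaySum, ← ENNReal.tsum_mul_left, ← ENNReal.tsum_mul_left]
    _ ≤ ∑' q, ∑' j, (k (q - j) * (A q / 2) + k (q - j) * (A j / 2)) :=
        ENNReal.tsum_le_tsum fun q => ENNReal.tsum_le_tsum fun j => h1 q j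
    _ = ∑' q, ∑' j, k (q - j) * (A q / 2) + ∑' j, ∑' q, k (q - j) * (A j / 2) := by
        simp only [ENNReal.tsum_add]
        congr 1
        exact ENNReal.tsum_comm
    _ = schurConst ε * ∑' q, (A q / 2) + schurConst ε * ∑' q, (A q / 2) := by
        simp only [ENNReal.tsum_mul_right, hk1, hk2, ENNReal.tsum_mul_left]
    _ = schurConst ε * ∑' q, (A q / 2 + A q / 2) := by
        rw [ENNReal.tsum_add, mul_add]
    _ = _ := by simp only [ENNReal.add_halves, A]

end Weight

/-! ### Summation of the dyadic energies -/

theorem ofReal_integral_le {α : Type*} [MeasurableSpace α] {μ : Measure α} {f : α → ℝ}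
    (hf : Integrable f μ) : ENNReal.ofReal (∫ x, f x ∂μ) ≤ ∫⁻ x, ENNReal.ofReal (f x) ∂μ := by
  refine ENNReal.ofReal_le_of_le_toReal ?_
  rw [integral_eq_lintegral_pos_part_sub_lintegral_neg_part hf]
  exact sub_le_self _ ENNReal.toReal_nonneg

theorem ofReal_intervalIntegral_eq {t : ℝ} (ht : 0 ≤ t) {f : ℝ → ℝ}
    (hf : IntegrableOn f (Set.Icc 0 t))
    (h0 : ∀ᵐ τ ∂volume.restrict (Set.Icc 0 t), 0 ≤ f τ) :
    ENNReal.ofReal (∫ τ in (0 : ℝ)..t, f τ) = ∫⁻ τ in Set.Icc 0 t, ENNReal.ofReal (f τ) := by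
  rw [intervalIntegral.integral_of_le ht, ← integral_Icc_eq_integral_Ioc,
    ofReal_integral_eq_lintegral_ofReal hf h0]

/-- The Cauchy-Schwarz inequality for series. -/
theorem tsum_mul_le_sqrt {ι : Type*} (a b : ι → ℝ≥0∞) :
    ∑' i, a i * b i ≤ (∑' i, a i ^ 2) ^ (1 / 2 : ℝ) * (∑' i, b i ^ 2) ^ (1 / 2 : ℝ) := by
  let _ : MeasurableSpace ι := ⊤
  have h := ENNReal.lintegral_mul_le_Lp_mul_Lq (Measure.count : Measure ι)
    Real.HolderConjugate.two_two (f := a) (g := b) (measurable_from_top.aemeasurable)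
    (measurable_from_top.aemeasurable)
  simpa [lintegral_count] using h

/-- The Cauchy-Schwarz inequality for weighted energies. -/
theorem tsum_weight_mul_le {ι : Type*} {W E : ι → ℝ} (hW : ∀ q, 0 ≤ W q) (hE : ∀ q, 0 ≤ E q)
    (f : ι → ℝ≥0∞) : ∑' q, ENNReal.ofReal (W q) * (ENNReal.ofReal (√(E q)) * f q) ≤
      (∑' q, ENNReal.ofReal (W q * E q)) ^ (1 / 2 : ℝ) *
        (∑' q, ENNReal.ofReal (W q) * f q ^ 2) ^ (1 / 2 : ℝ) := by
  have h := tsum_mul_le_sqrt (fun q => ENNReal.ofReal (√(W q)) * ENNReal.ofReal (√(E q)))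
    fun q => ENNReal.ofReal (√(W q)) * f q
  have h1 : ∀ x : ℝ, 0 ≤ x → ENNReal.ofReal (√x) ^ 2 = ENNReal.ofReal x := fun x hx => by
    rw [← ENNReal.ofReal_pow (Real.sqrt_nonneg _), Real.sq_sqrt hx]
  simp only [mul_pow, h1 _ (hW _), h1 _ (hE _), ← ENNReal.ofReal_mul (hW _)] at h
  refine le_trans (le_of_eq (tsum_congr fun q => ?_)) h
  nth_rw 1 [← h1 _ (hW q)]
  ring

/-- The absorption of the linear terms of a quadratic inequality. -/
theorem quadratic_absorption {b X φ γ G : ℝ≥0∞} (hb : b ≠ ⊤)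
    (h : 4 * b ^ 2 ≤ 4 * X + b ^ 2 + 8 * b * φ + 8 * b * γ + 8 * G) :
    4 * X + b ^ 2 + 8 * b * φ + 8 * b * γ + 8 * G ≤ 64 * (X + φ ^ 2 + γ ^ 2 + G) := by
  by_cases hX : X = ⊤
  · simp [hX]
  by_cases hφ : φ = ⊤
  · simp [hφ]
  by_cases hγ : γ = ⊤
  · simp [hγ]
  by_cases hG : G = ⊤
  · simp [hG]
  lift b to NNReal using hb
  lift X to NNReal using hX
  lift φ to NNReal using hφ
  lift γ to NNReal using hγ
  lift G to NNReal using hG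
  norm_cast at h ⊢
  rw [← NNReal.coe_le_coe] at h ⊢
  push_cast at h ⊢
  nlinarith [sq_nonneg ((b : ℝ) - 8 * φ), sq_nonneg ((b : ℝ) - 8 * γ), X.coe_nonneg, G.coe_nonneg]

/-- The primitive of `h` that vanishes at `0`. -/
def accum (h : ℝ → ℝ) (t : ℝ) : ℝ := ∫ τ in (0 : ℝ)..t, h τ

/-- A family of dyadic energies `E` and dissipations `D` on `[0,T]`, with
`E' = 2 Θ - D`, where the work `Θ` is bounded by the interaction of the blocks, with intensity
`κ h`, and by the sources `f` and `g`. The energies are those of a field of regularity larger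
than `-9/16`. -/
structure EnergyFamily (T κ : ℝ) (h : ℝ → ℝ) (E D Θ : ℤ → ℝ → ℝ) (f g : ℤ → ℝ → ℝ≥0∞) :
    Prop where
  nonneg : 0 ≤ T
  E_nonneg : ∀ q t, 0 ≤ E q t
  D_nonneg : ∀ q t, 0 ≤ D q t
  h_nonneg : ∀ᵐ τ ∂volume.restrict (Set.Icc 0 T), 0 ≤ h τ
  h_int : IntegrableOn h (Set.Icc 0 T)
  D_int : ∀ q, IntegrableOn (D q) (Set.Icc 0 T)
  prim : ∀ q, HasPrim T (E q) fun τ => 2 * Θ q τ - D q τ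
  f_meas : ∀ q, AEMeasurable (f q) (volume.restrict (Set.Icc 0 T))
  g_meas : ∀ q, AEMeasurable (g q) (volume.restrict (Set.Icc 0 T))
  work : ∀ᵐ τ ∂volume.restrict (Set.Icc 0 T), ∀ q, ENNReal.ofReal (Θ q τ) ≤
    ENNReal.ofReal (√(E q τ)) * (ENNReal.ofReal (κ * h τ) *
      LittlewoodPaley.decaySum (fun j => ENNReal.ofReal (√(E j τ))) q + f q τ) +
    if 0 ≤ q then ENNReal.ofReal ((2 : ℝ) ^ (-2 * q)) * g q τ ^ 2
    else ENNReal.ofReal (√(E q τ)) * g q τ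
  bound : ∃ M : ℝ≥0∞, M ≠ ⊤ ∧ ∀ t ∈ Set.Icc 0 T,
    ∑' q : ℤ, ENNReal.ofReal ((2 : ℝ) ^ (-(9 / 8) * (q.toNat : ℝ)) * E q t) ≤ M

namespace EnergyFamily

variable {T κ : ℝ} {h : ℝ → ℝ} {E D Θ : ℤ → ℝ → ℝ} {f g : ℤ → ℝ → ℝ≥0∞}

theorem mono (F : EnergyFamily T κ h E D Θ f g) {t : ℝ} (ht : t ∈ Set.Icc 0 T) :
    EnergyFamily t κ h E D Θ f g := by
  have hs : Set.Icc 0 t ⊆ Set.Icc 0 T := Set.Icc_subset_Icc_right ht.2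
  obtain ⟨M, hM, hb⟩ := F.bound
  exact ⟨ht.1, F.E_nonneg, F.D_nonneg, ae_restrict_of_ae_restrict_of_subset hs F.h_nonneg,
    F.h_int.mono_set hs, fun q => (F.D_int q).mono_set hs, fun q => (F.prim q).mono_right ht,
    fun q => (F.f_meas q).mono_set hs, fun q => (F.g_meas q).mono_set hs,
    ae_restrict_of_ae_restrict_of_subset hs F.work, M, hM, fun τ hτ => hb τ (hs hτ)⟩

theorem hasPrim_accum (F : EnergyFamily T κ h E D Θ f g) : HasPrim T (accum h) h :=
  ⟨(intervalIntegrable_iff_integrableOn_Icc_of_le F.nonneg).2 F.h_int, fun t _ => by simp [accum]⟩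

theorem integrableOn_work (F : EnergyFamily T κ h E D Θ f g) (q : ℤ) :
    IntegrableOn (Θ q) (Set.Icc 0 T) := by
  have h1 := (intervalIntegrable_iff_integrableOn_Icc_of_le F.nonneg).1 (F.prim q).integrable
  have h2 := (h1.add (F.D_int q)).const_mul (1 / 2 : ℝ)
  refine h2.congr (.of_forall fun τ => ?_)
  simp only [Pi.add_apply]
  ring

theorem accum_mem (F : EnergyFamily T κ h E D Θ f g) {t : ℝ} (ht : t ∈ Set.Icc 0 T) :
    accum h t ∈ Set.Icc 0 (accum h T) := by
  have h1 := F.hasPrim_accum.integrable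
  have h0 : ∀ᵐ τ ∂volume.restrict (Set.Icc 0 T), (0 : ℝ → ℝ) τ ≤ h τ := F.h_nonneg
  constructor
  · refine intervalIntegral.integral_nonneg_of_ae_restrict ht.1 ?_
    exact ae_restrict_of_ae_restrict_of_subset (Set.Icc_subset_Icc_right ht.2) h0
  · exact intervalIntegral.integral_mono_interval le_rfl ht.1 ht.2
      (ae_restrict_of_ae_restrict_of_subset Set.Ioc_subset_Icc_self h0) h1

section Block

variable {s lam c : ℝ} {N : ℕ}

/-- The energy inequality of a block, with a weight that loses regularity. -/
theorem weighted_block_le (F : EnergyFamily T κ h E D Θ f g) (hlam : 0 ≤ lam) (hc : 0 ≤ c) (q : ℤ) :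
    ENNReal.ofReal (lossWeight s lam c N (accum h T) q * E q T) +
      (∫⁻ τ in Set.Icc 0 T, ENNReal.ofReal (lossWeight s lam c N (accum h τ) q * D q τ)) +
      (∫⁻ τ in Set.Icc 0 T, ENNReal.ofReal
        (2 * lossRate lam c N q * h τ * (lossWeight s lam c N (accum h τ) q * E q τ))) ≤
    ENNReal.ofReal (lossWeight s lam c N 0 q * E q 0) +
      2 * ∫⁻ τ in Set.Icc 0 T,
        ENNReal.ofReal (lossWeight s lam c N (accum h τ) q) * ENNReal.ofReal (Θ q τ) := by
  have hT := F.nonneg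
  set W : ℝ → ℝ := fun t => lossWeight s lam c N (accum h t) q
  have hW0 : ∀ t, 0 ≤ W t := fun t => lossWeight_pos.le
  have hR := lossRate_nonneg (N := N) (q := q) hlam hc
  have hWp := hasPrim_lossWeight (s := s) (lam := lam) (c := c) hT F.hasPrim_accum N q
  have hW : ContinuousOn W (Set.Icc 0 T) := hWp.continuousOn hT
  have hE : ContinuousOn (E q) (Set.Icc 0 T) := (F.prim q).continuousOn hT
  have hp := hWp.mul (F.prim q) hT
  have iD : IntegrableOn (fun τ => W τ * D q τ) (Set.Icc 0 T) :=
    (F.D_int q).continuousOn_mul hW isCompact_Icc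
  have iΘ : IntegrableOn (fun τ => W τ * (2 * Θ q τ)) (Set.Icc 0 T) :=
    IntegrableOn.continuousOn_mul hW ((F.integrableOn_work q).const_mul 2) isCompact_Icc
  have iH : IntegrableOn (fun τ => 2 * lossRate lam c N q * h τ * (W τ * E q τ)) (Set.Icc 0 T) :=
    IntegrableOn.mul_continuousOn (F.h_int.const_mul _) (hW.mul hE) isCompact_Icc
  have ii : ∀ {f : ℝ → ℝ}, IntegrableOn f (Set.Icc 0 T) → IntervalIntegrable f volume 0 T :=
    fun hf => (intervalIntegrable_iff_integrableOn_Icc_of_le hT).2 hf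
  -- The product rule for the weight and the energy; the derivative of the weight gives the third
  -- term.
  have heq : W T * E q T + (∫ τ in (0 : ℝ)..T, W τ * D q τ) +
      (∫ τ in (0 : ℝ)..T, 2 * lossRate lam c N q * h τ * (W τ * E q τ)) =
      W 0 * E q 0 + ∫ τ in (0 : ℝ)..T, W τ * (2 * Θ q τ) := by
    have h1 := hp.eq T ⟨hT, le_rfl⟩
    have h2 : ∫ τ in (0 : ℝ)..T, (lossWeight s lam c N (accum h τ) q *
        (-2 * lossRate lam c N q * h τ) * E q τ +
          lossWeight s lam c N (accum h τ) q * (2 * Θ q τ - D q τ)) =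
        (∫ τ in (0 : ℝ)..T, W τ * (2 * Θ q τ)) - (∫ τ in (0 : ℝ)..T, W τ * D q τ) -
          ∫ τ in (0 : ℝ)..T, 2 * lossRate lam c N q * h τ * (W τ * E q τ) := by
      rw [← intervalIntegral.integral_sub (ii iΘ) (ii iD),
        ← intervalIntegral.integral_sub ((ii iΘ).sub (ii iD)) (ii iH)]
      refine intervalIntegral.integral_congr fun τ _ => ?_
      simp only [W]
      ring
    rw [h2] at h1
    simp only [W] at h1 ⊢
    linarith
  have n1 : 0 ≤ W T * E q T := mul_nonneg (hW0 T) (F.E_nonneg q T)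
  have n2 : 0 ≤ ∫ τ in (0 : ℝ)..T, W τ * D q τ :=
    intervalIntegral.integral_nonneg hT fun τ _ => mul_nonneg (hW0 τ) (F.D_nonneg q τ)
  have p3 : ∀ᵐ τ ∂volume.restrict (Set.Icc 0 T),
      0 ≤ 2 * lossRate lam c N q * h τ * (W τ * E q τ) := by
    filter_upwards [F.h_nonneg] with τ hτ
    have := hW0 τ
    have := F.E_nonneg q τ
    positivity
  have n3 : 0 ≤ ∫ τ in (0 : ℝ)..T, 2 * lossRate lam c N q * h τ * (W τ * E q τ) :=
    intervalIntegral.integral_nonneg_of_ae_restrict hT p3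
  have e2 := ofReal_intervalIntegral_eq hT iD
    (.of_forall fun τ => mul_nonneg (hW0 τ) (F.D_nonneg q τ))
  have e3 := ofReal_intervalIntegral_eq hT iH p3
  have hacc : accum h 0 = 0 := by simp [accum]
  have e4 : ENNReal.ofReal (∫ τ in (0 : ℝ)..T, W τ * (2 * Θ q τ)) ≤
      2 * ∫⁻ τ in Set.Icc 0 T, ENNReal.ofReal (W τ) * ENNReal.ofReal (Θ q τ) := by
    rw [intervalIntegral.integral_of_le hT, ← integral_Icc_eq_integral_Ioc]
    refine (ofReal_integral_le iΘ).trans_eq ?_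
    rw [← lintegral_const_mul' _ _ (by norm_num)]
    refine lintegral_congr fun τ => ?_
    rw [ENNReal.ofReal_mul (hW0 τ), ENNReal.ofReal_mul two_pos.le, ENNReal.ofReal_ofNat]
    ring
  rw [← e2, ← e3, ← ENNReal.ofReal_add n1 n2, ← ENNReal.ofReal_add (add_nonneg n1 n2) n3, heq]
  refine ENNReal.ofReal_add_le.trans (add_le_add (le_of_eq ?_) e4)
  simp only [W, hacc]

end Block

end EnergyFamily

namespace EnergyFamily

section Pointwise

variable {s lam c H ε κ η : ℝ} {N : ℕ}

/-- The work of all the blocks at a fixed time. The loss of regularity absorbs the interactions, up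
to a multiple of the energy without logarithmic loss. -/
theorem tsum_work_le {E Θ : ℤ → ℝ} {f g : ℤ → ℝ≥0∞} (hE : ∀ q, 0 ≤ E q) (hη : 0 ≤ η) (hκ : 0 ≤ κ)
    (hs : s ≤ 1 - ε) (hε0 : 0 < ε) (hε : ε ≤ 1 / 4) (hlam : 0 ≤ lam) (hH : 0 ≤ H)
    (hlow : -(1 / 2) ≤ s - lam * H) (hc : 0 ≤ c) (hcH : c * H ≤ 1 / 8)
    (hκlam : κ * (schurConst ε).toReal ≤ Real.log 2 * lam)
    (hκc : κ * (schurConst ε).toReal ≤ Real.log 2 * c)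
    (hwork : ∀ q, ENNReal.ofReal (Θ q) ≤ ENNReal.ofReal (√(E q)) * (ENNReal.ofReal (κ * η) *
      LittlewoodPaley.decaySum (fun j => ENNReal.ofReal (√(E j))) q + f q) +
      if 0 ≤ q then ENNReal.ofReal ((2 : ℝ) ^ (-2 * q)) * g q ^ 2
      else ENNReal.ofReal (√(E q)) * g q) :
    2 * ∑' q, ENNReal.ofReal (lossWeight s lam c N H q) * ENNReal.ofReal (Θ q) ≤
      (∑' q, ENNReal.ofReal (2 * lossRate lam c N q * η * (lossWeight s lam c N H q * E q))) +
      (ENNReal.ofReal (10 * (κ * (schurConst ε).toReal) * η) *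
        (∑' q, ENNReal.ofReal (lossWeight s lam c N H q * E q)) +
      (2 * ((∑' q, ENNReal.ofReal (lossWeight s lam c N H q * E q)) ^ (1 / 2 : ℝ) *
        (∑' q : ℤ, ENNReal.ofReal ((2 : ℝ) ^ (2 * s * q.toNat)) * f q ^ 2) ^ (1 / 2 : ℝ)) +
      (2 * ((∑' q, ENNReal.ofReal (lossWeight s lam c N H q * E q)) ^ (1 / 2 : ℝ) *
        (∑' q : ℤ, ENNReal.ofReal ((2 : ℝ) ^ (2 * (s - 1) * q.toNat)) * g q ^ 2) ^ (1 / 2 : ℝ)) +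
      2 * ∑' q : ℤ, ENNReal.ofReal ((2 : ℝ) ^ (2 * (s - 1) * q.toNat)) * g q ^ 2))) := by
  set W := lossWeight s lam c N H
  have hW : ∀ q, 0 ≤ W q := fun q => lossWeight_pos.le
  have hslow : -(5 / 8) ≤ s := by
    have : 0 ≤ lam * H := by positivity
    linarith
  set X := ∑' q, ENNReal.ofReal (W q * E q)
  set κ₁ := κ * (schurConst ε).toReal with hκ₁
  have hκ₁0 : 0 ≤ κ₁ := by positivity
  set g' : ℤ → ℝ≥0∞ := fun q => if 0 ≤ q then 0 else g q
  set Γ := ∑' q : ℤ, ENNReal.ofReal ((2 : ℝ) ^ (2 * (s - 1) * q.toNat)) * g q ^ 2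
  -- For `q ≥ 0` the weight and the gain `2 ^ (-2 q)` of the vertical force give the weight of
  -- `H^{s-1}`; only the blocks `q < 0` of `g` are paired with the energy.
  have hterm : ∀ q, ENNReal.ofReal (W q) * ENNReal.ofReal (Θ q) ≤
      ENNReal.ofReal (κ * η) * (ENNReal.ofReal (W q) * (ENNReal.ofReal (√(E q)) *
        LittlewoodPaley.decaySum (fun j => ENNReal.ofReal (√(E j))) q)) +
      ENNReal.ofReal (W q) * (ENNReal.ofReal (√(E q)) * f q) +
      ENNReal.ofReal (W q) * (ENNReal.ofReal (√(E q)) * g' q) +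
      ENNReal.ofReal ((2 : ℝ) ^ (2 * (s - 1) * q.toNat)) * g q ^ 2 := by
    intro q
    refine (mul_le_mul' le_rfl (hwork q)).trans ?_
    rw [mul_add, mul_add, mul_add]
    have h1 : ENNReal.ofReal (W q) * (if 0 ≤ q then ENNReal.ofReal ((2 : ℝ) ^ (-2 * q)) * g q ^ 2
        else ENNReal.ofReal (√(E q)) * g q) ≤
        ENNReal.ofReal (W q) * (ENNReal.ofReal (√(E q)) * g' q) +
        ENNReal.ofReal ((2 : ℝ) ^ (2 * (s - 1) * q.toNat)) * g q ^ 2 := by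
      by_cases hq : 0 ≤ q
      · simp only [g', if_pos hq, mul_zero, zero_add]
        rw [← mul_assoc, ← ENNReal.ofReal_mul (hW q)]
        refine mul_le_mul' (ENNReal.ofReal_le_ofReal ?_) le_rfl
        have h2 : (2 : ℝ) ^ (-2 * q) = (2 : ℝ) ^ (-2 * (q.toNat : ℝ)) := by
          rw [← Real.rpow_intCast]
          congr 1
          have : ((q.toNat : ℤ) : ℝ) = (q : ℝ) := by rw [Int.toNat_of_nonneg hq]
          push_cast at this ⊢
          rw [this]
        calc _ ≤ (2 : ℝ) ^ (2 * s * q.toNat) * (2 : ℝ) ^ (-2 * (q.toNat : ℝ)) := by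
              rw [h2]
              exact mul_le_mul_of_nonneg_right (lossWeight_le hslow hlam hc hH) (by positivity)
          _ = _ := by
              rw [← Real.rpow_add two_pos]
              congr 1
              ring
      · simp only [g', if_neg hq]
        exact le_self_add
    calc _ ≤ ENNReal.ofReal (W q) * (ENNReal.ofReal (√(E q)) * (ENNReal.ofReal (κ * η) *
          LittlewoodPaley.decaySum (fun j => ENNReal.ofReal (√(E j))) q)) +
          ENNReal.ofReal (W q) * (ENNReal.ofReal (√(E q)) * f q) + _ := add_le_add le_rfl h1
      _ = _ := by ring
  have hS := tsum_lossWeight_decaySum_le (N := N) hs hε hlam hH hlow hc hcH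
    (x := fun q => √(E q)) fun q => Real.sqrt_nonneg _
  simp only [Real.sq_sqrt (hE _)] at hS
  -- The rate of decrease of the weights dominates `κ₁ q⁺`; the remaining `5 κ₁` is the part without
  -- logarithmic loss.
  have hsch : 2 * (ENNReal.ofReal (κ * η) * (schurConst ε *
      ∑' q : ℤ, ENNReal.ofReal ((q.toNat + 5) * (W q * E q)))) ≤
      (∑' q, ENNReal.ofReal (2 * lossRate lam c N q * η * (W q * E q))) +
        ENNReal.ofReal (10 * κ₁ * η) * X := by
    have h1 : ∀ a : ℝ≥0∞, 2 * (ENNReal.ofReal (κ * η) * (schurConst ε * a)) =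
        ENNReal.ofReal (2 * κ₁ * η) * a := by
      intro a
      rw [show 2 * κ₁ * η = 2 * (κ * η * (schurConst ε).toReal) by rw [hκ₁]; ring,
        ENNReal.ofReal_mul two_pos.le, ENNReal.ofReal_mul (p := κ * η) (by positivity),
        ENNReal.ofReal_ofNat,
        ENNReal.ofReal_toReal (schurConst_ne_top hε0)]
      ring
    rw [h1, ← ENNReal.tsum_mul_left, ← ENNReal.tsum_mul_left, ← ENNReal.tsum_add]
    refine ENNReal.tsum_le_tsum fun q => ?_
    have hWE : 0 ≤ W q * E q := mul_nonneg (hW q) (hE q)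
    have hR := lossRate_nonneg (N := N) (q := q) hlam hc
    rw [← ENNReal.ofReal_mul (by positivity), ← ENNReal.ofReal_mul (by positivity),
      ← ENNReal.ofReal_add (by positivity) (by positivity)]
    refine ENNReal.ofReal_le_ofReal ?_
    have hrate : κ₁ * q.toNat ≤ lossRate lam c N q := by
      rw [lossRate, toNat_split N q]
      have hx : (0 : ℝ) ≤ ((min q.toNat N : ℕ) : ℝ) := Nat.cast_nonneg _
      have hy : (0 : ℝ) ≤ ((q.toNat - N : ℕ) : ℝ) := Nat.cast_nonneg _
      have := mul_le_mul_of_nonneg_right hκlam hx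
      have := mul_le_mul_of_nonneg_right hκc hy
      linarith
    have h2 := mul_le_mul_of_nonneg_right hrate (mul_nonneg hη hWE)
    nlinarith
  have hWsq : ∑' q, ENNReal.ofReal (W q) * f q ^ 2 ≤
      ∑' q : ℤ, ENNReal.ofReal ((2 : ℝ) ^ (2 * s * q.toNat)) * f q ^ 2 :=
    ENNReal.tsum_le_tsum fun q =>
      mul_le_mul' (ENNReal.ofReal_le_ofReal (lossWeight_le hslow hlam hc hH)) le_rfl
  have hWg : ∑' q, ENNReal.ofReal (W q) * g' q ^ 2 ≤ Γ := by
    refine ENNReal.tsum_le_tsum fun q => ?_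
    by_cases hq : 0 ≤ q
    · simp [g', if_pos hq]
    · simp only [g', if_neg hq]
      rw [show W q = 1 from lossWeight_of_neg (not_le.1 hq), Int.toNat_of_nonpos (not_le.1 hq).le]
      simp
  have hf := (tsum_weight_mul_le hW hE f).trans
    (mul_le_mul' le_rfl (ENNReal.rpow_le_rpow hWsq (by norm_num)))
  have hg := (tsum_weight_mul_le hW hE g').trans
    (mul_le_mul' le_rfl (ENNReal.rpow_le_rpow hWg (by norm_num)))
  calc _ ≤ 2 * ∑' q, _ := mul_le_mul' le_rfl (ENNReal.tsum_le_tsum hterm)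
    _ = 2 * (ENNReal.ofReal (κ * η) * ∑' q, (ENNReal.ofReal (W q) * (ENNReal.ofReal (√(E q)) *
        LittlewoodPaley.decaySum (fun j => ENNReal.ofReal (√(E j))) q))) +
        (2 * (∑' q, ENNReal.ofReal (W q) * (ENNReal.ofReal (√(E q)) * f q)) +
        (2 * (∑' q, ENNReal.ofReal (W q) * (ENNReal.ofReal (√(E q)) * g' q)) + 2 * Γ)) := by
        rw [ENNReal.tsum_add, ENNReal.tsum_add, ENNReal.tsum_add, ENNReal.tsum_mul_left]
        ring
    _ ≤ ((∑' q, ENNReal.ofReal (2 * lossRate lam c N q * η * (W q * E q))) +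
        ENNReal.ofReal (10 * κ₁ * η) * X) + (2 * (X ^ (1 / 2 : ℝ) *
          (∑' q : ℤ, ENNReal.ofReal ((2 : ℝ) ^ (2 * s * q.toNat)) * f q ^ 2) ^ (1 / 2 : ℝ)) +
          (2 * (X ^ (1 / 2 : ℝ) * Γ ^ (1 / 2 : ℝ)) + 2 * Γ)) := by
        refine add_le_add ((mul_le_mul' le_rfl (mul_le_mul' le_rfl hS)).trans hsch) ?_
        exact add_le_add (mul_le_mul' le_rfl hf) (add_le_add (mul_le_mul' le_rfl hg) le_rfl)
    _ = _ := by rw [add_assoc]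

end Pointwise

variable {T κ : ℝ} {h : ℝ → ℝ} {E D Θ : ℤ → ℝ → ℝ} {f g : ℤ → ℝ → ℝ≥0∞} {s lam c ε : ℝ} {N : ℕ}

theorem aemeasurable_lossWeight (F : EnergyFamily T κ h E D Θ f g) (q : ℤ) :
    AEMeasurable (fun τ => lossWeight s lam c N (accum h τ) q) (volume.restrict (Set.Icc 0 T)) :=
  ((hasPrim_lossWeight F.nonneg F.hasPrim_accum N q).continuousOn F.nonneg).aemeasurable
    measurableSet_Icc

theorem aemeasurable_energy (F : EnergyFamily T κ h E D Θ f g) (q : ℤ) :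
    AEMeasurable (E q) (volume.restrict (Set.Icc 0 T)) :=
  ((F.prim q).continuousOn F.nonneg).aemeasurable measurableSet_Icc

/-- The energy estimate for the weights that lose regularity, with a constant that does not depend
on the frequency `N` beyond which the weights decrease. -/
theorem truncated_sum_le (F : EnergyFamily T κ h E D Θ f g) (hκ : 0 ≤ κ)
    (hs : s ≤ 1 - ε) (hε0 : 0 < ε) (hε : ε ≤ 1 / 4) (hlam : 0 ≤ lam)
    (hlow : -(1 / 2) ≤ s - lam * accum h T) (hc : 0 ≤ c) (hcH : c * accum h T ≤ 1 / 8)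
    (hκlam : κ * (schurConst ε).toReal ≤ Real.log 2 * lam)
    (hκc : κ * (schurConst ε).toReal ≤ Real.log 2 * c)
    (hsmall : 4 * (10 * (κ * (schurConst ε).toReal) * accum h T) ≤ 1) :
    (∑' q, ENNReal.ofReal (lossWeight s lam c N (accum h T) q * E q T)) +
      (∑' q, ∫⁻ τ in Set.Icc 0 T, ENNReal.ofReal (lossWeight s lam c N (accum h τ) q * D q τ)) ≤
    16 * ((∑' q : ℤ, ENNReal.ofReal ((2 : ℝ) ^ (2 * s * q.toNat) * E q 0)) +
      (∫⁻ τ in Set.Icc 0 T,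
        (∑' q : ℤ, ENNReal.ofReal ((2 : ℝ) ^ (2 * s * q.toNat)) * f q τ ^ 2) ^ (1 / 2 : ℝ)) ^ 2 +
      ENNReal.ofReal T * (∫⁻ τ in Set.Icc 0 T,
        ∑' q : ℤ, ENNReal.ofReal ((2 : ℝ) ^ (2 * (s - 1) * q.toNat)) * g q τ ^ 2) +
      ∫⁻ τ in Set.Icc 0 T,
        ∑' q : ℤ, ENNReal.ofReal ((2 : ℝ) ^ (2 * (s - 1) * q.toNat)) * g q τ ^ 2) := by
  set μ := volume.restrict (Set.Icc 0 T)
  set Φ : ℝ → ℝ≥0∞ := fun τ =>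
    (∑' q : ℤ, ENNReal.ofReal ((2 : ℝ) ^ (2 * s * q.toNat)) * f q τ ^ 2) ^ (1 / 2 : ℝ)
  set Γ : ℝ → ℝ≥0∞ := fun τ =>
    ∑' q : ℤ, ENNReal.ofReal ((2 : ℝ) ^ (2 * (s - 1) * q.toNat)) * g q τ ^ 2
  set X0 := ∑' q : ℤ, ENNReal.ofReal ((2 : ℝ) ^ (2 * s * q.toNat) * E q 0)
  set κ₁ := κ * (schurConst ε).toReal with hκ₁
  have hκ₁0 : 0 ≤ κ₁ := by positivity
  have hT := F.nonneg
  set W : ℤ → ℝ → ℝ := fun q τ => lossWeight s lam c N (accum h τ) q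
  have hW : ∀ q τ, 0 ≤ W q τ := fun q τ => lossWeight_pos.le
  set X : ℝ → ℝ≥0∞ := fun t => ∑' q, ENNReal.ofReal (W q t * E q t)
  set Y : ℝ → ℝ≥0∞ := fun τ => ∑' q, ENNReal.ofReal (2 * lossRate lam c N q * h τ * (W q τ * E q τ))
  have hslow : -(1 / 2) ≤ s := by
    have := (F.accum_mem ⟨hT, le_rfl⟩).1
    have : 0 ≤ lam * accum h T := by positivity
    linarith
  have hs1 : s ≤ 1 := by linarith
  obtain ⟨K, hK0, hK⟩ := exists_lossRate_mul_le (s := s) hs1 hlam hc N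
  obtain ⟨M, hM, hb⟩ := F.bound
  -- the total energy is finite
  have hXK : ∀ t ∈ Set.Icc 0 T, ∑' q, ENNReal.ofReal ((1 + lossRate lam c N q) * (W q t * E q t)) ≤
      ENNReal.ofReal K * M := by
    intro t ht
    refine le_trans ?_ (mul_le_mul' le_rfl (hb t ht))
    rw [← ENNReal.tsum_mul_left]
    refine ENNReal.tsum_le_tsum fun q => ?_
    rw [← ENNReal.ofReal_mul hK0, ← mul_assoc, ← mul_assoc]
    exact ENNReal.ofReal_le_ofReal (mul_le_mul_of_nonneg_right
      (hK _ (F.accum_mem ht).1 q) (F.E_nonneg q t))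
  have hXle : ∀ t ∈ Set.Icc 0 T, X t ≤ ENNReal.ofReal K * M := by
    intro t ht
    refine le_trans (ENNReal.tsum_le_tsum fun q => ENNReal.ofReal_le_ofReal ?_) (hXK t ht)
    have := lossRate_nonneg (N := N) (q := q) hlam hc
    exact le_mul_of_one_le_left (mul_nonneg (hW q t) (F.E_nonneg q t)) (by linarith)
  have hYle : ∀ᵐ τ ∂μ, Y τ ≤ ENNReal.ofReal (2 * h τ) * (ENNReal.ofReal K * M) := by
    filter_upwards [F.h_nonneg, ae_restrict_mem measurableSet_Icc] with τ h0 hτ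
    refine le_trans ?_ (mul_le_mul' le_rfl (hXK τ hτ))
    rw [← ENNReal.tsum_mul_left]
    refine ENNReal.tsum_le_tsum fun q => ?_
    rw [← ENNReal.ofReal_mul (by positivity)]
    refine ENNReal.ofReal_le_ofReal ?_
    have := mul_nonneg h0 (mul_nonneg (hW q τ) (F.E_nonneg q τ))
    nlinarith
  have hYfin : ∫⁻ τ, Y τ ∂μ ≠ ⊤ := by
    refine ((lintegral_mono_ae hYle).trans_lt ?_).ne
    rw [lintegral_mul_const' _ _ (ENNReal.mul_ne_top ENNReal.ofReal_ne_top hM)]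
    exact ENNReal.mul_lt_top (Integrable.lintegral_lt_top (F.h_int.const_mul 2))
      (ENNReal.mul_lt_top ENNReal.ofReal_lt_top hM.lt_top)
  set B := ⨆ t ∈ Set.Icc 0 T, X t
  have hB : B ≠ ⊤ := ((iSup₂_le hXle).trans_lt
    (ENNReal.mul_lt_top ENNReal.ofReal_lt_top hM.lt_top)).ne
  set β := B ^ (1 / 2 : ℝ)
  have hβ : β ≠ ⊤ := ENNReal.rpow_ne_top_of_nonneg (by norm_num) hB
  have hβ2 : β ^ 2 = B := by
    rw [← ENNReal.rpow_natCast, ← ENNReal.rpow_mul]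
    norm_num
  have mΦ : AEMeasurable Φ μ := by
    refine AEMeasurable.pow_const ?_ _
    exact AEMeasurable.tsum fun q => ((F.f_meas q).pow_const 2).const_mul _
  have mΓ : AEMeasurable Γ μ := AEMeasurable.tsum fun q => ((F.g_meas q).pow_const 2).const_mul _
  have hΓsqrt : ∫⁻ τ, Γ τ ^ (1 / 2 : ℝ) ∂μ ≤
      ENNReal.ofReal T ^ (1 / 2 : ℝ) * (∫⁻ τ, Γ τ ∂μ) ^ (1 / 2 : ℝ) := by
    have h1 := ENNReal.lintegral_mul_le_Lp_mul_Lq μ Real.HolderConjugate.two_two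
      (f := fun _ => 1) (g := fun τ => Γ τ ^ (1 / 2 : ℝ)) aemeasurable_const (mΓ.pow_const _)
    have h2 : ∀ x : ℝ≥0∞, (x ^ (1 / 2 : ℝ)) ^ (2 : ℝ) = x := fun x => by
      rw [← ENNReal.rpow_mul]; norm_num
    simp only [Pi.mul_apply, one_mul, h2, ENNReal.one_rpow, lintegral_const] at h1
    simpa [μ] using h1
  -- the remainder terms of the energy inequality
  set R := ENNReal.ofReal (10 * κ₁ * accum h T) * B + (2 * (β * ∫⁻ τ, Φ τ ∂μ) +
    (2 * (β * (ENNReal.ofReal T ^ (1 / 2 : ℝ) * (∫⁻ τ, Γ τ ∂μ) ^ (1 / 2 : ℝ))) + 2 * ∫⁻ τ, Γ τ ∂μ))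
  have key : ∀ t ∈ Set.Icc 0 T, X t +
      (∑' q, ∫⁻ τ in Set.Icc 0 t, ENNReal.ofReal (W q τ * D q τ)) ≤ X0 + R := by
    intro t ht
    have Ft := F.mono ht
    have hsub : Set.Icc 0 t ⊆ Set.Icc 0 T := Set.Icc_subset_Icc_right ht.2
    set ν := volume.restrict (Set.Icc 0 t)
    have hνμ : ν ≤ μ := Measure.restrict_mono hsub le_rfl
    have mY : ∀ q, AEMeasurable (fun τ => ENNReal.ofReal
        (2 * lossRate lam c N q * h τ * (W q τ * E q τ))) ν := fun q =>
      ((Ft.h_int.1.aemeasurable.const_mul _).mul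
        ((Ft.aemeasurable_lossWeight q).mul (Ft.aemeasurable_energy q))).ennreal_ofReal
    have mΘ : ∀ q, AEMeasurable (fun τ => ENNReal.ofReal (W q τ) * ENNReal.ofReal (Θ q τ)) ν :=
      fun q =>
      (Ft.aemeasurable_lossWeight q).ennreal_ofReal.mul
        (Ft.integrableOn_work q).1.aemeasurable.ennreal_ofReal
    have hsum := ENNReal.tsum_le_tsum fun q =>
      Ft.weighted_block_le (s := s) (N := N) hlam hc q
    simp only [ENNReal.tsum_add, ENNReal.tsum_mul_left] at hsum
    rw [← lintegral_tsum mY, ← lintegral_tsum mΘ, ← lintegral_const_mul' _ _ (by norm_num)] at hsum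
    have hinit : ∑' q, ENNReal.ofReal (lossWeight s lam c N 0 q * E q 0) ≤ X0 :=
      ENNReal.tsum_le_tsum fun q => ENNReal.ofReal_le_ofReal (mul_le_mul_of_nonneg_right
        (lossWeight_le (by linarith) hlam hc le_rfl) (F.E_nonneg q 0))
    have hpt : ∀ᵐ τ ∂ν, 2 * ∑' q, ENNReal.ofReal (W q τ) * ENNReal.ofReal (Θ q τ) ≤
        Y τ + (ENNReal.ofReal (10 * κ₁ * h τ) * B + (2 * (β * Φ τ) +
          (2 * (β * Γ τ ^ (1 / 2 : ℝ)) + 2 * Γ τ))) := by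
      filter_upwards [Ft.work, Ft.h_nonneg, ae_restrict_mem measurableSet_Icc] with τ hw h0 hτ
      have hτT := hsub hτ
      have ha := F.accum_mem hτT
      have hXB : X τ ≤ B := le_iSup₂ (f := fun t (_ : t ∈ Set.Icc 0 T) => X t) τ hτT
      refine (tsum_work_le (N := N) (fun q => F.E_nonneg q τ) h0 hκ hs hε0 hε hlam ha.1
        (by have := mul_le_mul_of_nonneg_left ha.2 hlam; linarith) hc
        ((mul_le_mul_of_nonneg_left ha.2 hc).trans hcH) hκlam hκc hw).trans ?_
      have hXβ : X τ ^ (1 / 2 : ℝ) ≤ β := ENNReal.rpow_le_rpow hXB (by norm_num)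
      refine add_le_add le_rfl
        (add_le_add (mul_le_mul' le_rfl hXB) (add_le_add ?_ (add_le_add ?_ le_rfl)))
      · exact mul_le_mul' le_rfl (mul_le_mul' hXβ le_rfl)
      · exact mul_le_mul' le_rfl (mul_le_mul' hXβ le_rfl)
    have hint := lintegral_mono_ae hpt
    rw [lintegral_add_left' (AEMeasurable.tsum mY)] at hint
    have hrest : ∫⁻ τ, (ENNReal.ofReal (10 * κ₁ * h τ) * B + (2 * (β * Φ τ) +
          (2 * (β * Γ τ ^ (1 / 2 : ℝ)) + 2 * Γ τ))) ∂ν ≤ R := by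
      refine (lintegral_mono' hνμ le_rfl).trans ?_
      rw [lintegral_add_left' ((F.h_int.1.aemeasurable.const_mul _).ennreal_ofReal.mul_const _),
        lintegral_add_left' ((mΦ.const_mul _).const_mul _),
        lintegral_add_left' (((mΓ.pow_const _).const_mul _).const_mul _),
        lintegral_mul_const' _ _ hB, lintegral_const_mul' _ _ (by norm_num),
        lintegral_const_mul' _ _ hβ, lintegral_const_mul' _ _ (by norm_num),
        lintegral_const_mul' _ _ hβ, lintegral_const_mul' _ _ (by norm_num)]
      have h1 : ∫⁻ τ, ENNReal.ofReal (10 * κ₁ * h τ) ∂μ = ENNReal.ofReal (10 * κ₁ * accum h T) := by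
        rw [accum, ← intervalIntegral.integral_const_mul,
          ofReal_intervalIntegral_eq hT (F.h_int.const_mul _)]
        filter_upwards [F.h_nonneg] with τ h0
        positivity
      rw [h1]
      exact add_le_add le_rfl (add_le_add le_rfl (add_le_add
        (mul_le_mul' le_rfl (mul_le_mul' le_rfl hΓsqrt)) le_rfl))
    have hYν : ∫⁻ τ, Y τ ∂ν ≠ ⊤ := ((lintegral_mono' hνμ le_rfl).trans_lt hYfin.lt_top).ne
    -- The term produced by the decrease of the weights is finite, and appears on both sides.
    refine ENNReal.le_of_add_le_add_right hYν (hsum.trans ?_)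
    calc _ ≤ X0 + (∫⁻ τ, Y τ ∂ν + R) := add_le_add hinit (hint.trans (add_le_add le_rfl hrest))
      _ = X0 + R + ∫⁻ τ, Y τ ∂ν := by ring
  set γ := ENNReal.ofReal T ^ (1 / 2 : ℝ) * (∫⁻ τ, Γ τ ∂μ) ^ (1 / 2 : ℝ)
  have hγ : γ ^ 2 = ENNReal.ofReal T * ∫⁻ τ, Γ τ ∂μ := by
    have h2 : ∀ x : ℝ≥0∞, (x ^ (1 / 2 : ℝ)) ^ 2 = x := fun x => by
      rw [← ENNReal.rpow_natCast, ← ENNReal.rpow_mul]; norm_num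
    rw [mul_pow, h2, h2]
  have hR : 4 * (X0 + R) ≤
      4 * X0 + β ^ 2 + 8 * β * (∫⁻ τ, Φ τ ∂μ) + 8 * β * γ + 8 * ∫⁻ τ, Γ τ ∂μ := by
    have h1 : 4 * (ENNReal.ofReal (10 * κ₁ * accum h T) * B) ≤ β ^ 2 := by
      rw [hβ2, ← mul_assoc]
      refine mul_le_of_le_one_left' ?_
      rw [← ENNReal.ofReal_ofNat, ← ENNReal.ofReal_mul (by norm_num), ← ENNReal.ofReal_one]
      exact ENNReal.ofReal_le_ofReal hsmall
    calc _ = 4 * X0 + 4 * (ENNReal.ofReal (10 * κ₁ * accum h T) * B) + 8 * β * (∫⁻ τ, Φ τ ∂μ) +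
          8 * β * γ + 8 * ∫⁻ τ, Γ τ ∂μ := by simp only [R]; ring
      _ ≤ _ := by gcongr
  -- The supremum of the energies obeys a quadratic inequality.
  have hquad : 4 * β ^ 2 ≤
      4 * X0 + β ^ 2 + 8 * β * (∫⁻ τ, Φ τ ∂μ) + 8 * β * γ + 8 * ∫⁻ τ, Γ τ ∂μ := by
    refine le_trans (mul_le_mul' le_rfl ?_) hR
    rw [hβ2]
    exact iSup₂_le fun t ht => le_self_add.trans (key t ht)
  have hfin := quadratic_absorption hβ hquad
  have h4 : (4 : ℝ≥0∞) * (X T + ∑' q, ∫⁻ τ in Set.Icc 0 T, ENNReal.ofReal (W q τ * D q τ)) ≤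
      4 * (16 * (X0 + (∫⁻ τ, Φ τ ∂μ) ^ 2 + γ ^ 2 + ∫⁻ τ, Γ τ ∂μ)) := by
    refine ((mul_le_mul' le_rfl (key T ⟨hT, le_rfl⟩)).trans (hR.trans hfin)).trans_eq ?_
    ring
  rw [hγ] at h4
  exact (ENNReal.mul_le_mul_iff_right (by norm_num) (by norm_num)).1 h4

end EnergyFamily

namespace EnergyFamily

/-- The energy estimate with loss of regularity, for dyadic energies. -/
theorem exists_losing_estimate {s₁ s κ : ℝ} (hs₁ : -(1 / 2) ≤ s₁) (hs : s < 1) (hκ : 0 ≤ κ) :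
    ∃ C : ℝ, 0 < C ∧ ∀ (T lam : ℝ) (h : ℝ → ℝ) (E D Θ : ℤ → ℝ → ℝ) (f g : ℤ → ℝ → ℝ≥0∞),
      C < lam → EnergyFamily T κ h E D Θ f g → lam * accum h T ≤ s - s₁ →
    (∑' q : ℤ, (ENNReal.ofReal ((2 : ℝ) ^ (2 * (s - lam * accum h T) * q.toNat) * E q T) +
      ∫⁻ τ in Set.Icc 0 T,
        ENNReal.ofReal ((2 : ℝ) ^ (2 * (s - lam * accum h τ) * q.toNat) * D q τ))) ≤
    16 * ((∑' q : ℤ, ENNReal.ofReal ((2 : ℝ) ^ (2 * s * q.toNat) * E q 0)) +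
      (∫⁻ τ in Set.Icc 0 T,
        (∑' q : ℤ, ENNReal.ofReal ((2 : ℝ) ^ (2 * s * q.toNat)) * f q τ ^ 2) ^ (1 / 2 : ℝ)) ^ 2 +
      ENNReal.ofReal T * (∫⁻ τ in Set.Icc 0 T,
        ∑' q : ℤ, ENNReal.ofReal ((2 : ℝ) ^ (2 * (s - 1) * q.toNat)) * g q τ ^ 2) +
      ∫⁻ τ in Set.Icc 0 T,
        ∑' q : ℤ, ENNReal.ofReal ((2 : ℝ) ^ (2 * (s - 1) * q.toNat)) * g q τ ^ 2) := by
  set ε := min (1 / 4) (1 - s)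
  have hε0 : 0 < ε := lt_min (by norm_num) (by linarith)
  have hε : ε ≤ 1 / 4 := min_le_left _ _
  have hsε : s ≤ 1 - ε := by
    have : ε ≤ 1 - s := min_le_right _ _
    linarith
  set κ₁ := κ * (schurConst ε).toReal with hκ₁
  have hκ₁0 : 0 ≤ κ₁ := by positivity
  have hl := Real.log_pos (one_lt_two (α := ℝ))
  set c := κ₁ / Real.log 2 with hcdef
  have hc : 0 ≤ c := by positivity
  refine ⟨1 + 12 * c + 60 * κ₁, by positivity, fun T lam h E D Θ f g hlam F hT => ?_⟩
  have hlam0 : 0 < lam := by linarith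
  have hH := (F.accum_mem ⟨F.nonneg, le_rfl⟩).1
  -- the accumulated norm is small, since `lam` is large
  have hcH : c * accum h T ≤ 1 / 8 := by
    nlinarith [mul_le_mul_of_nonneg_right (by linarith : 12 * c ≤ lam) hH]
  have hsmall : 4 * (10 * κ₁ * accum h T) ≤ 1 := by
    nlinarith [mul_le_mul_of_nonneg_right (by linarith : 60 * κ₁ ≤ lam) hH]
  have hκc : κ₁ ≤ Real.log 2 * c := by rw [hcdef, mul_div_cancel₀ _ hl.ne']
  have hκlam : κ₁ ≤ Real.log 2 * lam :=
    hκc.trans (mul_le_mul_of_nonneg_left (by linarith) hl.le)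
  rw [ENNReal.tsum_eq_iSup_sum]
  refine iSup_le fun S => ?_
  -- a finite set of blocks is not affected by the truncation
  have h1 := F.truncated_sum_le (N := S.sup Int.toNat) hκ hsε hε0 hε hlam0.le (by linarith) hc hcH
    hκlam hκc hsmall
  refine le_trans ?_ h1
  rw [← ENNReal.tsum_add]
  refine le_trans (le_of_eq (Finset.sum_congr rfl fun q hq => ?_)) (ENNReal.sum_le_tsum S)
  have h2 : q.toNat ≤ S.sup Int.toNat := Finset.le_sup (f := Int.toNat) hq
  simp only [lossWeight_of_le h2]

end EnergyFamily

/-! ### Sobolev norms and homogeneous dyadic blocks -/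

theorem tsum_int_eq (F : ℤ → ℝ≥0∞) : ∑' q, F q = ∑' n : ℕ, F n + ∑' n : ℕ, F (-((n : ℤ) + 1)) :=
  tsum_of_nat_of_neg_add_one ENNReal.summable ENNReal.summable

namespace LittlewoodPaley

variable (P : LittlewoodPaley)

theorem tsum_enorm_phiS_sq_le (ξ : Space) :
    ∑' n : ℕ, ‖P.phiS (-((n : ℤ) + 1)) ξ‖ₑ ^ 2 ≤ ‖P.chiS 0 ξ‖ₑ ^ 2 := by
  have h1 : ∑' n : ℕ, ‖P.phiS (-((n : ℤ) + 1)) ξ‖ₑ ≤ ‖P.chiS 0 ξ‖ₑ := by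
    refine ENNReal.tsum_le_of_sum_range_le fun M => ?_
    have h := P.chiS_add_nat (-(M : ℤ)) M
    rw [neg_add_cancel] at h
    have hp : ∀ j, P.phiS j ξ = (((P.phiS j ξ).re : ℝ) : ℂ) ∧ 0 ≤ (P.phiS j ξ).re := by
      intro j; rw [phiS_apply]; simp [(P.phi_mem _).1]
    have hc : ∀ j, P.chiS j ξ = (((P.chiS j ξ).re : ℝ) : ℂ) ∧ 0 ≤ (P.chiS j ξ).re := by
      intro j; rw [chiS_apply]; simp [(P.chi_mem _).1]
    have h2 := congrArg (fun m : 𝓢(Space, ℂ) => (m ξ).re) h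
    simp only [add_apply, sum_apply, Complex.add_re, Complex.re_sum] at h2
    have h3 : ∀ j, ‖P.phiS j ξ‖ₑ = ENNReal.ofReal (P.phiS j ξ).re := by
      intro j
      rw [(hp j).1, ← ofReal_norm, Complex.norm_real, Real.norm_of_nonneg (hp j).2,
        Complex.ofReal_re]
    have h4 : ‖P.chiS 0 ξ‖ₑ = ENNReal.ofReal (P.chiS 0 ξ).re := by
      rw [(hc 0).1, ← ofReal_norm, Complex.norm_real, Real.norm_of_nonneg (hc 0).2,
        Complex.ofReal_re]
    simp only [h3, h4]
    rw [← ENNReal.ofReal_sum_of_nonneg fun i _ => (hp _).2]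
    refine ENNReal.ofReal_le_ofReal ?_
    have h5 : ∑ i ∈ Finset.range M, (P.phiS (-((i : ℤ) + 1)) ξ).re =
        ∑ i ∈ Finset.range M, (P.phiS (-(M : ℤ) + i) ξ).re := by
      rw [← Finset.sum_range_reflect]
      refine Finset.sum_congr rfl fun i hi => ?_
      have := Finset.mem_range.1 hi
      congr 3
      omega
    rw [h5, h2]
    linarith [(hc (-(M : ℤ))).2]
  have h2 : ∀ x : ℕ → ℝ≥0∞, ∑' n, x n ^ 2 ≤ (∑' n, x n) ^ 2 := by
    intro x
    rw [sq (∑' n, x n), ← ENNReal.tsum_mul_right]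
    exact ENNReal.tsum_le_tsum fun n => by
      rw [sq]; exact mul_le_mul' le_rfl (ENNReal.le_tsum n)
  exact (h2 _).trans (by gcongr)

/-- At most two of the shells meet at a given frequency. -/
theorem enorm_chiS_sq_le {ξ : Space} (hξ : ξ ≠ 0) :
    ‖P.chiS 0 ξ‖ₑ ^ 2 ≤ 2 * ∑' n : ℕ, ‖P.phiS (-((n : ℤ) + 1)) ξ‖ₑ ^ 2 := by
  classical
  have h0 : ‖P.chiS 0 ξ‖ₑ ≤ ∑' n : ℕ, ‖P.phiS (-((n : ℤ) + 1)) ξ‖ₑ := by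
    refine (P.enorm_chiS_le_tsum 0 hξ).trans_eq (tsum_congr fun n => ?_)
    congr 3
    ring
  by_cases hex : ∃ n : ℕ, P.phiS (-((n : ℤ) + 1)) ξ ≠ 0
  · set m := Nat.find hex
    have hm := Nat.find_spec hex
    have hz : ∀ n ∉ ({m, m + 1} : Finset ℕ), P.phiS (-((n : ℤ) + 1)) ξ = 0 := by
      intro n hn
      by_contra hne
      have h1 : m ≤ n := Nat.find_min' hex hne
      have h2 : m + 2 ≤ n := by
        simp only [Finset.mem_insert, Finset.mem_singleton, not_or] at hn
        omega
      have h3 := (P.phiS_supp hm).1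
      have h4 := (P.phiS_supp hne).2
      have h5 : (2 : ℝ) ^ (-((n : ℤ) + 1)) * 4 ≤ (2 : ℝ) ^ (-((m : ℤ) + 1)) := by
        have : (4 : ℝ) = 2 ^ (2 : ℤ) := by norm_num
        rw [this, ← zpow_add₀ two_ne_zero]
        exact zpow_le_zpow_right₀ (by norm_num) (by omega)
      have h6 : (0 : ℝ) < (2 : ℝ) ^ (-((n : ℤ) + 1)) := by positivity
      simp only [m] at h5
      linarith
    have hmm : m ≠ m + 1 := by omega
    have e1 : ∑' n : ℕ, ‖P.phiS (-((n : ℤ) + 1)) ξ‖ₑ =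
        ‖P.phiS (-((m : ℤ) + 1)) ξ‖ₑ + ‖P.phiS (-(((m + 1 : ℕ) : ℤ) + 1)) ξ‖ₑ := by
      rw [tsum_eq_sum (s := {m, m + 1}) fun n hn => by rw [hz n hn, enorm_zero],
        Finset.sum_pair hmm]
    have e2 : ∑' n : ℕ, ‖P.phiS (-((n : ℤ) + 1)) ξ‖ₑ ^ 2 =
        ‖P.phiS (-((m : ℤ) + 1)) ξ‖ₑ ^ 2 + ‖P.phiS (-(((m + 1 : ℕ) : ℤ) + 1)) ξ‖ₑ ^ 2 := by
      rw [tsum_eq_sum (s := {m, m + 1}) fun n hn => by rw [hz n hn, enorm_zero]; simp,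
        Finset.sum_pair hmm]
    rw [e2]
    refine le_trans (pow_le_pow_left' (h0.trans_eq e1) 2) ?_
    set x := ‖P.phiS (-((m : ℤ) + 1)) ξ‖ₑ
    set y := ‖P.phiS (-(((m + 1 : ℕ) : ℤ) + 1)) ξ‖ₑ
    have h7 := ennreal_mul_le_half x y
    calc (x + y) ^ 2 = x ^ 2 + y ^ 2 + 2 * (x * y) := by ring
      _ ≤ x ^ 2 + y ^ 2 + 2 * (x ^ 2 / 2 + y ^ 2 / 2) := by gcongr
      _ = x ^ 2 + y ^ 2 + (x ^ 2 + y ^ 2) := by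
          rw [mul_add, ENNReal.mul_div_cancel (by norm_num) (by norm_num),
            ENNReal.mul_div_cancel (by norm_num) (by norm_num)]
      _ = _ := by ring
  · simp only [not_exists, ne_eq, not_not] at hex
    have : ‖P.chiS 0 ξ‖ₑ = 0 := by
      refine le_antisymm (h0.trans ?_) zero_le
      rw [ENNReal.tsum_eq_zero.2 fun n => by rw [hex n, enorm_zero]]
    rw [this]
    simp

theorem eLpNorm_op_sq {w : 𝓢'(Space, ℂ)} {a : Space → ℂ} (ha : HasDensity w a) {m : 𝓢(Space, ℂ)}
    (hc : HasCompactSupport m) :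
    eLpNorm (op m w) 2 volume ^ 2 = ∫⁻ ξ, ‖a ξ‖ₑ ^ 2 * ‖m ξ‖ₑ ^ 2 := by
  rw [ha.eLpNorm_op hc, eLpNorm_two_sq]
  simp only [enorm_mul, mul_pow]

theorem tsum_eLpNorm_low {w : 𝓢'(Space, ℂ)} {a : Space → ℂ} (ha : HasDensity w a) :
    ∑' n : ℕ, eLpNorm (op (P.phiS (-((n : ℤ) + 1))) w) 2 volume ^ 2 =
      ∫⁻ ξ, ‖a ξ‖ₑ ^ 2 * ∑' n : ℕ, ‖P.phiS (-((n : ℤ) + 1)) ξ‖ₑ ^ 2 := by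
  have hm := ha.measurable
  simp only [eLpNorm_op_sq ha (P.hasCompactSupport_phiS _)]
  rw [← lintegral_tsum fun n => ?_]
  · simp only [ENNReal.tsum_mul_left]
  · have := (P.phiS (-((n : ℤ) + 1))).continuous.measurable
    fun_prop

theorem tsum_low_le {w : 𝓢'(Space, ℂ)} {a : Space → ℂ} (ha : HasDensity w a) :
    ∑' n : ℕ, eLpNorm (op (P.phiS (-((n : ℤ) + 1))) w) 2 volume ^ 2 ≤
      eLpNorm (op (P.chiS 0) w) 2 volume ^ 2 := by
  rw [P.tsum_eLpNorm_low ha, eLpNorm_op_sq ha (P.hasCompactSupport_chiS 0)]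
  exact lintegral_mono fun ξ => mul_le_mul' le_rfl (P.tsum_enorm_phiS_sq_le ξ)

theorem low_le_tsum {w : 𝓢'(Space, ℂ)} {a : Space → ℂ} (ha : HasDensity w a) :
    eLpNorm (op (P.chiS 0) w) 2 volume ^ 2 ≤
      2 * ∑' n : ℕ, eLpNorm (op (P.phiS (-((n : ℤ) + 1))) w) 2 volume ^ 2 := by
  rw [P.tsum_eLpNorm_low ha, eLpNorm_op_sq ha (P.hasCompactSupport_chiS 0),
    ← lintegral_const_mul' _ _ (by norm_num)]
  have h0 : ∀ᵐ ξ : Space, ξ ≠ 0 := by simp [ae_iff, measure_singleton]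
  refine lintegral_mono_ae ?_
  filter_upwards [h0] with ξ hξ
  rw [mul_left_comm]
  exact mul_le_mul' le_rfl (P.enorm_chiS_sq_le hξ)

/-- The square of the norm of `H^σ`, with the low frequencies cut into dyadic shells. -/
def dyadicSum (σ : ℝ) {ι : Type*} [Fintype ι] (w : ι → 𝓢'(Space, ℂ)) : ℝ≥0∞ :=
  ∑' q : ℤ, ENNReal.ofReal ((2 : ℝ) ^ (2 * σ * q.toNat)) *
    ∑ i, eLpNorm (op (P.phiS q) (w i)) 2 volume ^ 2

section Comparison

variable {σ : ℝ} {ι : Type*} [Fintype ι] {w : ι → 𝓢'(Space, ℂ)}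

theorem dyadicSum_eq (σ : ℝ) (w : ι → 𝓢'(Space, ℂ)) :
    P.dyadicSum σ w = (∑' n : ℕ, ENNReal.ofReal ((2 : ℝ) ^ (2 * σ * n)) *
      ∑ i, eLpNorm (op (P.phiS n) (w i)) 2 volume ^ 2) +
      ∑ i, ∑' n : ℕ, eLpNorm (op (P.phiS (-((n : ℤ) + 1))) (w i)) 2 volume ^ 2 := by
  rw [dyadicSum, tsum_int_eq]
  congr 1
  rw [← Summable.tsum_finsetSum fun i _ => ENNReal.summable]
  refine tsum_congr fun n => ?_
  have : (-((n : ℤ) + 1)).toNat = 0 := by omega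
  rw [this]
  simp

theorem sobolevNorm_sq (σ : ℝ) (w : ι → 𝓢'(Space, ℂ)) :
    sobolevNorm P σ w ^ 2 = ENNReal.ofReal ((2 : ℝ) ^ (-(2 * σ))) *
      (∑ i, eLpNorm (op (P.chiS 0) (w i)) 2 volume ^ 2) +
      ∑' n : ℕ, ENNReal.ofReal ((2 : ℝ) ^ (2 * σ * n)) *
        ∑ i, eLpNorm (op (P.phiS n) (w i)) 2 volume ^ 2 := by
  have h : sobolevNorm P σ w ^ 2 = ∑' n : ℕ, ENNReal.ofReal ((2 : ℝ) ^ (2 * σ * ((n : ℝ) - 1))) *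
      ∑ i, eLpNorm (block P n (w i)) 2 volume ^ 2 := by
    rw [sobolevNorm, ← ENNReal.rpow_natCast, ← ENNReal.rpow_mul]
    simp
  rw [h, tsum_eq_zero_add' ENNReal.summable]
  simp only [block_zero, block_succ]
  congr 1
  · norm_num
  · refine tsum_congr fun n => ?_
    push_cast
    rw [add_sub_cancel_right]

theorem dyadicSum_le (hσ : σ ≤ 1) (hw : ∀ i, ∃ a, HasDensity (w i) a) :
    P.dyadicSum σ w ≤ 4 * sobolevNorm P σ w ^ 2 := by
  choose a ha using hw
  rw [dyadicSum_eq, sobolevNorm_sq, mul_add, add_comm]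
  refine add_le_add ?_ (le_mul_of_one_le_left' (by norm_num))
  refine (Finset.sum_le_sum fun i _ => P.tsum_low_le (ha i)).trans ?_
  rw [← mul_assoc]
  refine le_mul_of_one_le_left' ?_
  rw [← ENNReal.ofReal_ofNat, ← ENNReal.ofReal_mul (by norm_num), ← ENNReal.ofReal_one]
  refine ENNReal.ofReal_le_ofReal ?_
  -- `2 ^ (-2σ) ≥ 1 / 4` is the weight of the lowest block in the Sobolev norm.
  have h1 : (2 : ℝ) ^ (-2 : ℝ) ≤ (2 : ℝ) ^ (-(2 * σ)) :=
    Real.rpow_le_rpow_of_exponent_le (by norm_num) (by linarith)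
  have h2 : (2 : ℝ) ^ (-2 : ℝ) = 1 / 4 := by
    rw [Real.rpow_neg (by norm_num)]; norm_num
  rw [h2] at h1
  linarith

theorem sobolevNorm_sq_le (hσ : -(1 / 2) ≤ σ) (hw : ∀ i, ∃ a, HasDensity (w i) a) :
    sobolevNorm P σ w ^ 2 ≤ 4 * P.dyadicSum σ w := by
  choose a ha using hw
  rw [dyadicSum_eq, sobolevNorm_sq, mul_add, add_comm]
  refine add_le_add (le_mul_of_one_le_left' (by norm_num)) ?_
  -- `2 ^ (-2σ) ≤ 2`, and two shells at most meet at each low frequency.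
  have h1 : ENNReal.ofReal ((2 : ℝ) ^ (-(2 * σ))) ≤ 2 := by
    rw [← ENNReal.ofReal_ofNat]
    refine ENNReal.ofReal_le_ofReal ?_
    calc (2 : ℝ) ^ (-(2 * σ)) ≤ (2 : ℝ) ^ (1 : ℝ) :=
          Real.rpow_le_rpow_of_exponent_le (by norm_num) (by linarith)
      _ = 2 := by norm_num
  refine (mul_le_mul' h1 (Finset.sum_le_sum fun i _ => P.low_le_tsum (ha i))).trans_eq ?_
  rw [← Finset.mul_sum, ← mul_assoc]
  norm_num

end Comparison

theorem dyadicSum_energy {w : Fin 3 → 𝓢'(Space, ℂ)} (hw : ∀ l, ∃ a, HasDensity (w l) a) (σ : ℝ) :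
    P.dyadicSum σ w = ∑' q : ℤ, ENNReal.ofReal ((2 : ℝ) ^ (2 * σ * q.toNat) * P.energy w q) := by
  refine tsum_congr fun q => ?_
  rw [ENNReal.ofReal_mul (by positivity), P.ofReal_energy hw]

theorem dyadicSum_dissipation {w : Fin 3 → 𝓢'(Space, ℂ)} (hw : ∀ l, ∃ a, HasDensity (w l) a)
    (σ : ℝ) : P.dyadicSum σ (horizontalGradient w) =
      ∑' q : ℤ, ENNReal.ofReal ((2 : ℝ) ^ (2 * σ * q.toNat) * P.dissipation w q) := by
  refine tsum_congr fun q => ?_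
  choose a ha using hw
  rw [ENNReal.ofReal_mul (by positivity), dissipation,
    ENNReal.ofReal_sum_of_nonneg fun i _ => add_nonneg (integral_nonneg fun _ => sq_nonneg _)
      (integral_nonneg fun _ => sq_nonneg _), Fintype.sum_prod_type, Fin.sum_univ_two,
    ← Finset.sum_add_distrib]
  congr 1
  refine Finset.sum_congr rfl fun i _ => ?_
  have c1 := fun k => HasDensity.hasCompactSupport_mulI (P.hasCompactSupport_phiS q) k
  have h : ∀ k, op (P.phiS q) (∂_{e k} (w i)) = op (mulI k (P.phiS q)) (w i) := fun k =>
    funext fun x => op_lineDeriv k _ _ x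
  rw [ENNReal.ofReal_add (integral_nonneg fun _ => sq_nonneg _)
    (integral_nonneg fun _ => sq_nonneg _),
    ofReal_integral_normSq ((ha i).memLp_op (c1 0)),
      ofReal_integral_normSq ((ha i).memLp_op (c1 1)),
    ← h, ← h]
  rfl

end LittlewoodPaley

theorem hasDensity_horizontalGradient {w : Fin 3 → 𝓢'(Space, ℂ)}
    (hw : ∀ l, ∃ a, HasDensity (w l) a) (ki : Fin 2 × Fin 3) :
    ∃ a, HasDensity (horizontalGradient w ki) a := by
  obtain ⟨a, ha⟩ := hw ki.2
  exact ⟨_, ha.lineDeriv _⟩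

/-! ### The dyadic energies of a solution -/

theorem aemeasurable_sobolevNorm (P : LittlewoodPaley) (σ : ℝ) {ι : Type*} [Fintype ι]
    {μ : Measure ℝ} [SFinite μ] {w : ℝ → ι → 𝓢'(Space, ℂ)}
    (hw : ∀ i ψ, AEMeasurable (fun τ => w τ i ψ) μ) :
    AEMeasurable (fun τ => sobolevNorm P σ (w τ)) μ := by
  refine AEMeasurable.pow_const (AEMeasurable.tsum fun n => AEMeasurable.const_mul
    (Finset.aemeasurable_fun_sum _ fun i _ => AEMeasurable.pow_const ?_ _) _) _
  cases n with
  | zero => simp only [block_zero]; exact aemeasurable_eLpNorm_op (hw i) _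
  | succ j => simp only [block_succ]; exact aemeasurable_eLpNorm_op (hw i) _

/-- Blocks bounded as in `H^{-1/2}` give a bound in `H^{-9/16}`. -/
theorem exists_sobolevNorm_sq_le_of_block (P : LittlewoodPaley) : ∃ K : ℝ≥0∞, K ≠ ⊤ ∧
    ∀ (w : Fin 3 → 𝓢'(Space, ℂ)) (M : ℝ≥0∞), (∀ n i, eLpNorm (block P n (w i)) 2 volume ≤
      ENNReal.ofReal ((2 : ℝ) ^ (((n : ℝ) - 1) / 2)) * M) →
      sobolevNorm P (-(9 / 16)) w ^ 2 ≤ K * M ^ 2 := by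
  set r : ℝ := (2 : ℝ) ^ (-(1 / 8) : ℝ) with hr
  have hr0 : 0 < r := by positivity
  have hr1 : r < 1 := Real.rpow_lt_one_of_one_lt_of_neg (by norm_num) (by norm_num)
  have hs : ∑' n : ℕ, ENNReal.ofReal ((2 : ℝ) ^ (-(1 / 8) * ((n : ℝ) - 1))) ≠ ⊤ := by
    refine (Summable.congr (f := fun n : ℕ => r ^ n * (2 : ℝ) ^ (1 / 8 : ℝ))
      ((summable_geometric_of_lt_one hr0.le hr1).mul_right _) fun n => ?_).tsum_ofReal_ne_top
    rw [hr, ← Real.rpow_mul_natCast two_pos.le, ← Real.rpow_add two_pos]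
    congr 1
    ring
  refine ⟨_, ENNReal.mul_ne_top hs (by norm_num : (3 : ℝ≥0∞) ≠ ⊤), fun w M h => ?_⟩
  rw [sobolevNorm, ← ENNReal.rpow_natCast, ← ENNReal.rpow_mul]
  norm_num only
  rw [ENNReal.rpow_one, mul_assoc, ← ENNReal.tsum_mul_right]
  refine ENNReal.tsum_le_tsum fun n => ?_
  calc _ ≤ ENNReal.ofReal ((2 : ℝ) ^ (2 * (-(9 / 16)) * ((n : ℝ) - 1))) *
        ∑ i : Fin 3, (ENNReal.ofReal ((2 : ℝ) ^ (((n : ℝ) - 1) / 2)) * M) ^ 2 := by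
        norm_num only
        gcongr with i
        exact h n i
    _ = _ := by
        simp only [Finset.sum_const, Finset.card_univ, Fintype.card_fin, nsmul_eq_mul, mul_pow,
          ← ENNReal.ofReal_pow (Real.rpow_nonneg two_pos.le _), ← Real.rpow_mul_natCast two_pos.le]
        have he : (2 : ℝ) ^ (-(1 / 8) * ((n : ℝ) - 1)) =
            (2 : ℝ) ^ (2 * (-(9 / 16)) * ((n : ℝ) - 1)) *
              (2 : ℝ) ^ (((n : ℝ) - 1) / 2 * (2 : ℕ)) := by
          rw [← Real.rpow_add two_pos]
          congr 1
          push_cast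
          ring
        rw [he, ENNReal.ofReal_mul (by positivity)]
        push_cast
        ring

section Solution

variable {P : LittlewoodPaley} {T : ℝ} {u v f : ℝ → Fin 3 → 𝓢'(Space, ℂ)}
  {p g : ℝ → 𝓢'(Space, ℂ)} {v₀ : Fin 3 → 𝓢'(Space, ℂ)} {N : ℝ → Fin 3 → 𝓢'(Space, ℂ)} {h : ℝ → ℝ}

/-- The bound of the velocity in `H^{-1/2}`, known at almost every time, passes to the dyadic
blocks at all times by weak continuity. -/
theorem Momentum.eLpNorm_block_le {G : Fin 3 → ℝ → 𝓢'(Space, ℂ)} (hm : Momentum T v G) (hT : 0 < T)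
    {M : ℝ} (hM : ∀ᵐ τ ∂volume.restrict (Set.Icc 0 T),
      sobolevNorm P (-(1 / 2)) (v τ) ≤ ENNReal.ofReal M) {t : ℝ} (ht : t ∈ Set.Icc 0 T) (n : ℕ)
    (i : Fin 3) : eLpNorm (block P n (v t i)) 2 volume ≤
      ENNReal.ofReal ((2 : ℝ) ^ (((n : ℝ) - 1) / 2)) * ENNReal.ofReal M := by
  have hb : ∀ n : ℕ, ∃ m : 𝓢(Space, ℂ), ∀ S, block P n S = LosingEstimate.op m S := fun n => by
    cases n with
    | zero => exact ⟨_, block_zero P⟩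
    | succ j => exact ⟨_, block_succ P j⟩
  obtain ⟨m, hm'⟩ := hb n
  refine eLpNorm_le_of_ae hT (F := fun t => block P n (v t i)) (fun x => ?_) (fun t => ?_) ?_ ht
  · simp only [hm']
    exact hm.continuousOn hT.le i _
  · rw [hm']
    exact continuous_op _ _
  · filter_upwards [hM] with τ hτ
    refine (LosingEstimate.eLpNorm_block_le P (-(1 / 2)) (v τ) n i).trans ?_
    rw [show -(-(1 / 2) * ((n : ℝ) - 1)) = ((n : ℝ) - 1) / 2 by ring]
    gcongr

theorem lintegral_shell_lt_top {ι : Type} [Fintype ι] (σ : ℝ) {w : ℝ → ι → 𝓢'(Space, ℂ)}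
    (hw : ∫⁻ τ in Set.Icc 0 T, sobolevNorm P σ (w τ) < ⊤) (q : ℤ) (i : ι) :
    ∫⁻ τ in Set.Icc 0 T, eLpNorm (op (P.phiS q) (w τ i)) 2 volume < ⊤ := by
  obtain ⟨c, hc, -, hle⟩ := P.exists_shell_le_sobolevNorm σ q
  refine (lintegral_mono fun τ => hle (w τ) i).trans_lt ?_
  rw [lintegral_const_mul' _ _ hc]
  exact ENNReal.mul_lt_top hc.lt_top hw

theorem lintegral_lt_top_of_sq {F : ℝ → ℝ≥0∞} (hF : ∫⁻ τ in Set.Icc 0 T, F τ ^ 2 < ⊤) :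
    ∫⁻ τ in Set.Icc 0 T, F τ < ⊤ := by
  have h1 : ∀ τ, F τ ≤ 1 + F τ ^ 2 := by
    intro τ
    rcases le_total (F τ) 1 with h | h
    · exact h.trans le_self_add
    · exact (le_self_pow h two_ne_zero).trans le_add_self
  refine (lintegral_mono h1).trans_lt ?_
  rw [lintegral_add_left measurable_const]
  simp [hF]

/-- The a priori properties of a solution, at all times for the velocity and at almost all times for
the data. The exponent `-9/16 < -1/2` makes the sum of the bounds of the blocks finite. -/
theorem IsSolution.exists_flow (hT : 0 < T) (sol : IsSolution P T u v f p g v₀) {M σ : ℝ}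
    (hM : ∀ᵐ τ ∂volume.restrict (Set.Icc 0 T), sobolevNorm P (-(1 / 2)) (v τ) ≤ ENNReal.ofReal M)
    (hf : ∫⁻ τ in Set.Icc 0 T, sobolevNorm P σ (f τ) < ⊤)
    (hg : ∫⁻ τ in Set.Icc 0 T, sobolevNorm P (σ - 1) (fun _ : Unit => g τ) ^ 2 < ⊤)
    (hh : IntegrableOn h (Set.Icc 0 T) volume)
    (hu : ∀ᵐ τ ∂volume.restrict (Set.Icc 0 T), 0 ≤ h τ ∧ llNorm P (u τ) ≤ ENNReal.ofReal (h τ)) :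
    v 0 = v₀ ∧ (∃ K : ℝ≥0∞, K ≠ ⊤ ∧ ∀ t ∈ Set.Icc 0 T, sobolevNorm P (-(9 / 16)) (v t) ^ 2 ≤ K) ∧
      ∃ N, Flow P T u v f p g N h := by
  obtain ⟨h0, N, hm, hN, hc⟩ := sol.exists_momentum hT.le
  obtain ⟨K, hK, hle⟩ := exists_sobolevNorm_sq_le_of_block P
  have hb := fun t (ht : t ∈ Set.Icc 0 T) => hm.eLpNorm_block_le hT hM ht
  have hdens : ∀ t ∈ Set.Icc 0 T, ∀ l, ∃ a, HasDensity (v t l) a := fun t ht l =>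
    exists_density_of_block P fun n => (hb t ht n l).trans_lt
      (ENNReal.mul_lt_top ENNReal.ofReal_lt_top ENNReal.ofReal_lt_top)
  have hg' := lintegral_lt_top_of_sq hg
  refine ⟨h0, ⟨K * ENNReal.ofReal M ^ 2, ENNReal.mul_ne_top hK (by finiteness),
    fun t ht => hle _ _ (hb t ht)⟩, N,
      ⟨hT, hm, sol.u_integrable, sol.v_integrable, sol.f_integrable,
    sol.g_integrable, hh, fun t ht => hm.divergence_eq_zero hT sol.div_v ht, hdens,
    ⟨ENNReal.ofReal M, ENNReal.ofReal_ne_top, fun t ht j l => ?_⟩, ?_, ?_,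
    fun q l => lintegral_shell_lt_top σ hf q l,
    fun q => lintegral_shell_lt_top (σ - 1) hg' q (), ?_, hc⟩⟩
  -- The homogeneous shells `j < 0` are parts of the lowest block.
  · by_cases hj : j < 0
    · obtain ⟨a, ha⟩ := hdens t ht l
      have h1 := eLpNorm_op_le_of_norm_le ha (P.hasCompactSupport_phiS j)
        (P.hasCompactSupport_chiS 0) (c := 1) fun ξ => by
          rw [one_mul]; exact P.norm_phiS_le_chiS hj ξ
      rw [ENNReal.ofReal_one, one_mul, ← block_zero] at h1
      refine (h1.trans (hb t ht 0 l)).trans ?_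
      gcongr
      · norm_num
      · push_cast
        linarith [(Nat.cast_nonneg j.toNat : (0 : ℝ) ≤ j.toNat)]
    · obtain ⟨n, rfl⟩ := Int.eq_ofNat_of_zero_le (not_lt.1 hj)
      have h1 := hb t ht (n + 1) l
      rw [block_succ] at h1
      simpa using h1
  · filter_upwards [ae_lt_top' (aemeasurable_sobolevNorm P σ
      fun i ψ => (sol.f_integrable i).aemeasurable ψ) hf.ne] with τ hτ l
    exact exists_density_of_sobolevNorm P hτ l
  · filter_upwards [ae_lt_top' (aemeasurable_sobolevNorm P (σ - 1)
      fun (_ : Unit) ψ => sol.g_integrable.aemeasurable ψ) hg'.ne] with τ hτ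
    exact exists_density_of_sobolevNorm P hτ ()
  · filter_upwards [hu, sol.u_real, sol.div_u] with τ h1 h2 h3
    exact ⟨h1.1, h2, fun k => LLBound.of_llNorm h1.1 h1.2 k, h3⟩

/-- The energies of a solution form an `EnergyFamily`, where half of the dissipation has been given
to the work `Θ`. -/
theorem Flow.energyFamily (F : Flow P T u v f p g N h) {C : ℝ}
    (hC : ∀ (u v N : Fin 3 → 𝓢'(Space, ℂ)) (h : ℝ), IsTransport P u h → divergence v = 0 →
      (∀ l, ∃ a, HasDensity (v l) a) → (∀ l, IsConvection P u (v l) (N l)) → ∀ q i,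
      eLpNorm (P.remainder u v N q i) 2 volume ≤ ENNReal.ofReal (C * h) *
        LittlewoodPaley.decaySum (fun j => ∑ l, eLpNorm (op (P.phiS j) (v l)) 2 volume) q)
    {K : ℝ≥0∞} (hK : K ≠ ⊤) (hv : ∀ t ∈ Set.Icc 0 T, sobolevNorm P (-(9 / 16)) (v t) ^ 2 ≤ K) :
    EnergyFamily T (9 * C) h (fun q t => P.energy (v t) q) (fun q t => P.dissipation (v t) q)
      (fun q τ => (∑ i, ∫ x, inner ℝ (op (P.phiS q) (v τ i) x)
        (P.forcing (u τ) (v τ) (N τ) (f τ) (g τ) q i x)) + P.dissipation (v τ) q / 2)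
      (fun q τ => 3 * ∑ l, eLpNorm (op (P.phiS q) (f τ l)) 2 volume)
      (fun q τ => 3 * eLpNorm (op (P.phiS q) (g τ)) 2 volume) := by
  refine ⟨F.pos.le, fun q t => P.energy_nonneg _ q, fun q t => P.dissipation_nonneg _ q, ?_,
    F.h_int,
    F.integrableOn_dissipation, fun q => ?_, fun q => ?_, fun q => ?_, ?_, 4 * K,
    ENNReal.mul_ne_top (by norm_num) hK, fun t ht => ?_⟩
  · filter_upwards [F.transport] with τ hτ using hτ.nonneg
  · refine (F.hasPrim_energy q).congr F.pos.le (fun _ _ => rfl) fun τ _ => ?_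
    ring
  · exact (Finset.aemeasurable_fun_sum _ fun l _ =>
      aemeasurable_eLpNorm_op (F.f_int l).aemeasurable _).const_mul _
  · exact (aemeasurable_eLpNorm_op F.g_int.aemeasurable _).const_mul _
  · have hR : ∀ᵐ τ ∂volume.restrict (Set.Icc 0 T), ∀ q, ∃ K' : ℝ≥0∞, K' ≠ ⊤ ∧ ∀ i,
        eLpNorm (P.remainder (u τ) (v τ) (N τ) q i) 2 volume ≤ ENNReal.ofReal (C * h τ) *
          LittlewoodPaley.decaySum (fun j => ∑ l, eLpNorm (op (P.phiS j) (v τ l)) 2 volume) q ∧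
        LittlewoodPaley.decaySum
          (fun j => ∑ l, eLpNorm (op (P.phiS j) (v τ l)) 2 volume) q ≤ K' := by
      refine ae_all_iff.2 fun q => ?_
      obtain ⟨K', hK', h1⟩ := F.exists_remainder_le hC q
      filter_upwards [h1] with τ h2 using ⟨K', hK', h2⟩
    filter_upwards [hR, F.f_density, F.g_density, ae_restrict_mem measurableSet_Icc]
      with τ h1 h2 h3 hτ q
    obtain ⟨K', hK', h4⟩ := h1 q
    rw [mul_assoc]
    exact P.ofReal_work_le (F.density τ hτ) h2 h3 (fun i => ((h4 i).1.trans
      (mul_le_mul' le_rfl (h4 i).2)).trans_lt (ENNReal.mul_lt_top ENNReal.ofReal_lt_top hK'.lt_top))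
      fun i => (h4 i).1
  · refine le_trans (le_of_eq ?_) ((P.dyadicSum_le (by norm_num) (F.density t ht)).trans
      (mul_le_mul' le_rfl (hv t ht)))
    rw [P.dyadicSum_energy (F.density t ht)]
    norm_num only

end Solution

/-! ### The losing estimate -/

theorem accum_mono {T : ℝ} {h : ℝ → ℝ} (h0 : ∀ᵐ τ ∂volume.restrict (Set.Icc 0 T), 0 ≤ h τ)
    (hi : IntegrableOn h (Set.Icc 0 T)) {r t : ℝ} (hr : 0 ≤ r) (hrt : r ≤ t) (ht : t ≤ T) :
    accum h r ≤ accum h t := by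
  have hT : 0 ≤ T := hr.trans (hrt.trans ht)
  have hI : ∀ a b, 0 ≤ a → a ≤ b → b ≤ T → IntervalIntegrable h volume a b := by
    intro a b ha hab hb
    rw [intervalIntegrable_iff_integrableOn_Icc_of_le hab]
    exact hi.mono_set (Set.Icc_subset_Icc ha hb)
  have h1 := intervalIntegral.integral_add_adjacent_intervals (hI 0 r le_rfl hr (hrt.trans ht))
    (hI r t hr hrt ht)
  have h2 : 0 ≤ ∫ τ in r..t, h τ := intervalIntegral.integral_nonneg_of_ae_restrict hrt
    (ae_restrict_of_ae_restrict_of_subset (Set.Icc_subset_Icc hr ht) h0)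
  simp only [accum]
  linarith

theorem ennreal_sum_three_sq_le (x : Fin 3 → ℝ≥0∞) : (∑ l, x l) ^ 2 ≤ 3 * ∑ l, x l ^ 2 := by
  have h1 := ENNReal.inner_le_Lp_mul_Lq Finset.univ x (fun _ => 1) (p := 2) (q := 2)
    Real.HolderConjugate.two_two
  simp only [mul_one, ENNReal.one_rpow, Finset.sum_const, Finset.card_univ, Fintype.card_fin] at h1
  refine (pow_le_pow_left' h1 2).trans_eq ?_
  rw [mul_pow, ← ENNReal.rpow_natCast, ← ENNReal.rpow_natCast, ← ENNReal.rpow_mul,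
    ← ENNReal.rpow_mul]
  norm_num
  rw [mul_comm]

/-- The right-hand side of the estimate of the squares, in terms of the norms of the data. -/
theorem ennreal_data_le {X F G a b c : ℝ≥0∞} {t : ℝ} (ht : 0 ≤ t) (hX : X ≤ 4 * a ^ 2)
    (hF : F ≤ 11 * b) (hG : G ≤ 36 * c ^ 2) :
    16 * (X + F ^ 2 + ENNReal.ofReal t * G + G) ≤
      (44 * (ENNReal.ofReal (1 + √t) * (a + b + c))) ^ 2 := by
  set r := ENNReal.ofReal (1 + √t)
  have h1 : 1 ≤ r ^ 2 := by
    refine one_le_pow₀ ?_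
    rw [← ENNReal.ofReal_one]
    exact ENNReal.ofReal_le_ofReal (by linarith [Real.sqrt_nonneg t])
  have h2 : ENNReal.ofReal t + 1 ≤ r ^ 2 := by
    rw [← ENNReal.ofReal_pow (by positivity), ← ENNReal.ofReal_one,
      ← ENNReal.ofReal_add ht zero_le_one]
    refine ENNReal.ofReal_le_ofReal ?_
    nlinarith [Real.sq_sqrt ht, Real.sqrt_nonneg t]
  have h3 : a ^ 2 + b ^ 2 + c ^ 2 ≤ (a + b + c) ^ 2 := by
    have : (a + b + c) ^ 2 = a ^ 2 + b ^ 2 + c ^ 2 + 2 * (a * b + a * c + b * c) := by ring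
    rw [this]
    exact le_self_add
  -- `44 ^ 2 = 16 * 121`, and `121 = 11 ^ 2` bounds the constants `4`, `11 ^ 2` and `36`.
  calc 16 * (X + F ^ 2 + ENNReal.ofReal t * G + G)
      = 16 * (X + F ^ 2 + (ENNReal.ofReal t + 1) * G) := by ring
    _ ≤ 16 * (121 * (r ^ 2 * a ^ 2) + 121 * (r ^ 2 * b ^ 2) + r ^ 2 * (121 * c ^ 2)) := by
        refine mul_le_mul' le_rfl (add_le_add (add_le_add ?_ ?_) (mul_le_mul' h2 ?_))
        · refine hX.trans (mul_le_mul' (by norm_num) (le_mul_of_one_le_left' h1))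
        · refine (pow_le_pow_left' hF 2).trans ?_
          rw [mul_pow]
          exact mul_le_mul' (by norm_num) (le_mul_of_one_le_left' h1)
        · exact hG.trans (mul_le_mul' (by norm_num) le_rfl)
    _ = 44 ^ 2 * (r ^ 2 * (a ^ 2 + b ^ 2 + c ^ 2)) := by ring
    _ ≤ 44 ^ 2 * (r ^ 2 * (a + b + c) ^ 2) := by gcongr
    _ = _ := by ring

section Flow

variable {P : LittlewoodPaley} {T : ℝ} {u v f : ℝ → Fin 3 → 𝓢'(Space, ℂ)}
  {p g : ℝ → 𝓢'(Space, ℂ)} {N : ℝ → Fin 3 → 𝓢'(Space, ℂ)} {h : ℝ → ℝ}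

theorem Flow.tsum_initial_le (F : Flow P T u v f p g N h) {s : ℝ} (hs : s ≤ 1) :
    ∑' q : ℤ, ENNReal.ofReal ((2 : ℝ) ^ (2 * s * q.toNat) * P.energy (v 0) q) ≤
      4 * sobolevNorm P s (v 0) ^ 2 := by
  have hd := F.density 0 ⟨le_rfl, F.pos.le⟩
  rw [← P.dyadicSum_energy hd]
  exact P.dyadicSum_le hs hd

theorem Flow.lintegral_source_le (F : Flow P T u v f p g N h) {s t : ℝ} (hs : s ≤ 1)
    (ht : t ≤ T) :
    ∫⁻ τ in Set.Icc 0 t, (∑' q : ℤ, ENNReal.ofReal ((2 : ℝ) ^ (2 * s * q.toNat)) *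
      (3 * ∑ l, eLpNorm (op (P.phiS q) (f τ l)) 2 volume) ^ 2) ^ (1 / 2 : ℝ) ≤
      11 * ∫⁻ τ in Set.Icc 0 t, sobolevNorm P s (f τ) := by
  rw [← lintegral_const_mul' _ _ (by norm_num)]
  refine lintegral_mono_ae ?_
  filter_upwards [ae_restrict_of_ae_restrict_of_subset (Set.Icc_subset_Icc_right ht) F.f_density]
    with τ hτ
  have h1 : ∑' q : ℤ, ENNReal.ofReal ((2 : ℝ) ^ (2 * s * q.toNat)) *
      (3 * ∑ l, eLpNorm (op (P.phiS q) (f τ l)) 2 volume) ^ 2 ≤ (11 * sobolevNorm P s (f τ)) ^ 2 :=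
    calc _ ≤ 27 * P.dyadicSum s (f τ) := by
          rw [LittlewoodPaley.dyadicSum, ← ENNReal.tsum_mul_left]
          refine ENNReal.tsum_le_tsum fun q => ?_
          rw [mul_left_comm]
          refine mul_le_mul' le_rfl ?_
          rw [mul_pow]
          refine (mul_le_mul' le_rfl (ennreal_sum_three_sq_le _)).trans_eq ?_
          rw [← mul_assoc]
          norm_num
      _ ≤ 27 * (4 * sobolevNorm P s (f τ) ^ 2) := mul_le_mul' le_rfl (P.dyadicSum_le hs hτ)
      _ ≤ _ := by
          rw [← mul_assoc, mul_pow]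
          exact mul_le_mul' (by norm_num) le_rfl
  refine (ENNReal.rpow_le_rpow h1 (by norm_num)).trans_eq ?_
  rw [← ENNReal.rpow_natCast, ← ENNReal.rpow_mul]
  norm_num

theorem Flow.lintegral_vertical_le (F : Flow P T u v f p g N h) {s t : ℝ} (hs : s ≤ 1)
    (ht : t ≤ T) :
    ∫⁻ τ in Set.Icc 0 t, ∑' q : ℤ, ENNReal.ofReal ((2 : ℝ) ^ (2 * (s - 1) * q.toNat)) *
      (3 * eLpNorm (op (P.phiS q) (g τ)) 2 volume) ^ 2 ≤
      36 * ∫⁻ τ in Set.Icc 0 t, sobolevNorm P (s - 1) (fun _ : Unit => g τ) ^ 2 := by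
  rw [← lintegral_const_mul' _ _ (by norm_num)]
  refine lintegral_mono_ae ?_
  filter_upwards [ae_restrict_of_ae_restrict_of_subset (Set.Icc_subset_Icc_right ht) F.g_density]
    with τ hτ
  calc _ = 9 * P.dyadicSum (s - 1) (fun _ : Unit => g τ) := by
        rw [LittlewoodPaley.dyadicSum, ← ENNReal.tsum_mul_left]
        refine tsum_congr fun q => ?_
        simp only [Finset.univ_unique, Finset.sum_singleton]
        ring
    _ ≤ 9 * (4 * sobolevNorm P (s - 1) (fun _ : Unit => g τ) ^ 2) :=
        mul_le_mul' le_rfl (P.dyadicSum_le (by linarith) fun _ => hτ)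
    _ = _ := by rw [← mul_assoc]; norm_num

/-- The norms of the velocity and of its horizontal gradient, bounded by the dyadic energies. -/
theorem Flow.sobolevNorm_add_le (F : Flow P T u v f p g N h) {s s₁ lam t : ℝ} (hs₁ : -(1 / 2) ≤ s₁)
    (hlam : 0 ≤ lam) (ht : t ∈ Set.Icc 0 T) (hst : s₁ ≤ losingIndex s lam h t) {B : ℝ≥0∞}
    (hB : ∑' q : ℤ, (ENNReal.ofReal ((2 : ℝ) ^ (2 * (s - lam * accum h t) * q.toNat) *
        P.energy (v t) q) + ∫⁻ τ in Set.Icc 0 t,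
          ENNReal.ofReal ((2 : ℝ) ^ (2 * (s - lam * accum h τ) * q.toNat) *
            P.dissipation (v τ) q)) ≤ B ^ 2) :
    sobolevNorm P (losingIndex s lam h t) (v t) +
      (∫⁻ τ in Set.Icc 0 t, sobolevNorm P (losingIndex s lam h τ) (horizontalGradient (v τ)) ^ 2) ^
        (1 / 2 : ℝ) ≤ 4 * B := by
  have hsub : Set.Icc 0 t ⊆ Set.Icc 0 T := Set.Icc_subset_Icc_right ht.2
  have hB2 : 4 * B ^ 2 = (2 * B) ^ 2 := by rw [mul_pow]; norm_num
  rw [ENNReal.tsum_add] at hB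
  have h1 : sobolevNorm P (losingIndex s lam h t) (v t) ≤ 2 * B := by
    rw [← ENNReal.pow_le_pow_left_iff two_ne_zero, ← hB2]
    refine (P.sobolevNorm_sq_le (hs₁.trans hst) (F.density t ht)).trans (mul_le_mul' le_rfl ?_)
    rw [P.dyadicSum_energy (F.density t ht)]
    exact le_self_add.trans hB
  have hH : AEMeasurable (accum h) (volume.restrict (Set.Icc 0 t)) := by
    have hi : IntegrableOn h (Set.uIcc 0 t) := by
      rw [Set.uIcc_of_le ht.1]
      exact F.h_int.mono_set hsub
    have hc := intervalIntegral.continuousOn_primitive_interval hi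
    rw [Set.uIcc_of_le ht.1] at hc
    exact hc.aemeasurable measurableSet_Icc
  have h2 : ∫⁻ τ in Set.Icc 0 t,
      sobolevNorm P (losingIndex s lam h τ) (horizontalGradient (v τ)) ^ 2 ≤ (2 * B) ^ 2 := by
    have h0 : ∀ᵐ τ ∂volume.restrict (Set.Icc 0 T), 0 ≤ h τ := by
      filter_upwards [F.transport] with τ hτ using hτ.nonneg
    calc _ ≤ ∫⁻ τ in Set.Icc 0 t, 4 * ∑' q : ℤ,
          ENNReal.ofReal ((2 : ℝ) ^ (2 * (s - lam * accum h τ) * q.toNat) *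
            P.dissipation (v τ) q) := by
          refine setLIntegral_mono' measurableSet_Icc fun τ hτ => ?_
          have hd := F.density τ (hsub hτ)
          have hm := accum_mono h0 F.h_int hτ.1 hτ.2 ht.2
          have hle : losingIndex s lam h t ≤ losingIndex s lam h τ :=
            sub_le_sub_left (mul_le_mul_of_nonneg_left hm hlam) s
          refine (P.sobolevNorm_sq_le (hs₁.trans (hst.trans hle))
            (hasDensity_horizontalGradient hd)).trans_eq ?_
          rw [P.dyadicSum_dissipation hd]
          rfl
      _ ≤ 4 * B ^ 2 := by
          rw [lintegral_const_mul' _ _ (by norm_num), lintegral_tsum fun q => ?_]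
          · exact mul_le_mul' le_rfl (le_add_self.trans hB)
          · have hD : AEMeasurable (fun τ => P.dissipation (v τ) q)
                (volume.restrict (Set.Icc 0 t)) :=
              ((F.integrableOn_dissipation q).mono_set hsub).1.aemeasurable
            exact (((hH.const_mul lam).const_sub s).const_mul 2 |>.mul_const _ |>.const_pow 2
              |>.mul hD).ennreal_ofReal
      _ = _ := hB2
  refine (add_le_add h1 (ENNReal.rpow_le_rpow h2 (by norm_num))).trans_eq ?_
  rw [← ENNReal.rpow_natCast, ← ENNReal.rpow_mul]
  norm_num
  rw [← two_mul, ← mul_assoc]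
  norm_num

end Flow

end LosingEstimate

end

theorem propositionA5 (P : LittlewoodPaley) (s₁ s : ℝ) (hs₁ : s₁ ∈ Set.Ico (-(1 / 2) : ℝ) 1)
    (hs : s ∈ Set.Ioo s₁ 1) :
    ∃ C : ℝ, 0 < C ∧
      ∀ (T : ℝ) (_ : 0 < T) (lam : ℝ) (_ : C < lam)
        (u v f : ℝ → Fin 3 → 𝓢'(Space, ℂ)) (p g : ℝ → 𝓢'(Space, ℂ))
        (v₀ : Fin 3 → 𝓢'(Space, ℂ)) (h : ℝ → ℝ)
        (_ : IsSolution P T u v f p g v₀)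
        (_ : ∃ M : ℝ, ∀ᵐ τ ∂volume.restrict (Set.Icc 0 T),
          sobolevNorm P (-(1 / 2)) (v τ) ≤ ENNReal.ofReal M)
        (_ : sobolevNorm P s v₀ < ⊤)
        (_ : ∫⁻ τ in Set.Icc 0 T, sobolevNorm P s (f τ) < ⊤)
        (_ : ∫⁻ τ in Set.Icc 0 T, sobolevNorm P (s - 1) (fun _ : Unit => g τ) ^ 2 < ⊤)
        (_ : IntegrableOn h (Set.Icc 0 T) volume)
        (_ : ∀ᵐ τ ∂volume.restrict (Set.Icc 0 T),
          0 ≤ h τ ∧ llNorm P (u τ) ≤ ENNReal.ofReal (h τ)),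
        ∀ t ∈ Set.Icc 0 T, s₁ ≤ losingIndex s lam h t →
          sobolevNorm P (losingIndex s lam h t) (v t) +
              (∫⁻ τ in Set.Icc 0 t,
                sobolevNorm P (losingIndex s lam h τ) (horizontalGradient (v τ)) ^ 2) ^
                  (1 / 2 : ℝ) ≤
            ENNReal.ofReal (C * (1 + √t) * Real.exp (C / lam * ∫ τ in (0 : ℝ)..t, h τ)) *
              (sobolevNorm P s v₀ + (∫⁻ τ in Set.Icc 0 t, sobolevNorm P s (f τ)) +
                (∫⁻ τ in Set.Icc 0 t, sobolevNorm P (s - 1) (fun _ : Unit => g τ) ^ 2) ^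
                  (1 / 2 : ℝ)) := by
  obtain ⟨C₀, hC₀, hR⟩ := P.exists_remainder_bound
  obtain ⟨C₁, hC₁, hE⟩ :=
    EnergyFamily.exists_losing_estimate hs₁.1 hs.2 (mul_nonneg (by norm_num : (0 : ℝ) ≤ 9) hC₀)
  refine ⟨C₁ + 176, by linarith,
    fun T hT lam hlam u v f p g v₀ h sol ⟨M, hM⟩ _ hf hg hh hu t ht hst => ?_⟩
  obtain ⟨h0, ⟨K, hK, hv⟩, N, F⟩ := sol.exists_flow hT hM hf hg hh hu
  have hlam0 : 0 ≤ lam := by linarith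
  have hs1 := hs.2.le
  have hest := hE t lam h _ _ _ _ _ (by linarith) ((F.energyFamily hR hK hv).mono ht)
    (by simp only [losingIndex] at hst; simp only [accum]; linarith)
  set a := sobolevNorm P s v₀
  set b := ∫⁻ τ in Set.Icc 0 t, sobolevNorm P s (f τ)
  set c := (∫⁻ τ in Set.Icc 0 t, sobolevNorm P (s - 1) (fun _ : Unit => g τ) ^ 2) ^ (1 / 2 : ℝ)
    with hc
  have hc2 : c ^ 2 = ∫⁻ τ in Set.Icc 0 t, sobolevNorm P (s - 1) (fun _ : Unit => g τ) ^ 2 := by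
    rw [hc, ← ENNReal.rpow_natCast, ← ENNReal.rpow_mul]
    norm_num
  have hX := F.tsum_initial_le hs1
  rw [h0] at hX
  have hG := F.lintegral_vertical_le hs1 ht.2
  rw [← hc2] at hG
  rw [h0] at hest
  refine (F.sobolevNorm_add_le hs₁.1 hlam0 ht hst (hest.trans
    (ennreal_data_le ht.1 hX (F.lintegral_source_le hs1 ht.2) hG))).trans ?_
  rw [← mul_assoc, ← mul_assoc]
  refine mul_le_mul' ?_ le_rfl
  have hH : 0 ≤ ∫ τ in (0 : ℝ)..t, h τ := intervalIntegral.integral_nonneg_of_ae_restrict ht.1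
    (ae_restrict_of_ae_restrict_of_subset (Set.Icc_subset_Icc_right ht.2) (hu.mono fun _ h => h.1))
  -- The exponential factor is only used through being at least `1`: since `λ` exceeds the constant,
  -- the decrease of the regularity absorbs every contribution of `h`.
  have hexp : 1 ≤ Real.exp ((C₁ + 176) / lam * ∫ τ in (0 : ℝ)..t, h τ) :=
    Real.one_le_exp (mul_nonneg (div_nonneg (by linarith) hlam0) hH)
  have hr := Real.sqrt_nonneg t
  have e : (4 * 44 : ℝ≥0∞) * ENNReal.ofReal (1 + √t) = ENNReal.ofReal (176 * (1 + √t)) := by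
    rw [ENNReal.ofReal_mul (by norm_num), ENNReal.ofReal_ofNat]
    norm_num
  rw [e]
  refine ENNReal.ofReal_le_ofReal ?_
  refine le_trans ?_ (le_mul_of_one_le_right (by positivity) hexp)
  gcongr
  linarith
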